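/- Let $\mathcal C$ be a braided monoidal category with braiding $\Phi$ and unit $I$, and let $H$ be a Hopf algebra in $\mathcal C$ whose antipode $S$ is invertible. Assume that $H$ is finite, i.e. the inner hom-objects $H^*=[H,I]$ and $[H,H]$ exist and the canonical morphism $H\otimes H^*\to[H,H]$ is invertible, and that $H$ is transparent, i.e. $H$ lies in Müger's center $\mathcal Z_2(\mathcal C)=\{X \mid \Phi_{Y,X}\Phi_{X,Y}=\mathrm{id}_{X\otimes Y}\ \text{for all } Y\in\mathcal C\}$. Let $\mathrm{ev}:H^*\otimes H\to I$ be the evaluation, $d=\sum_i h_i\otimes h^i: I\to H\otimes H^*$ the dual basis morphism, $\mathrm{ev}'=\mathrm{ev}\,\Phi_{H,H^*}$ and $d'=\Phi_{H^*,H}^{-1}d$. The formulas below are in Sweedler notation; a crossing that is not specified is by $\Phi$ and has $H$ or $H^*$ as one of its strands, so that it is symmetric. Let $B=(H^{op})^*$, i.e. $H^*$ with product $(fg)(h)=f(h_1)g(h_2)$, unit $\varepsilon$, coproduct determined by $f_1(h)f_2(k)=f(kh)$ and counit $f\mapsto f(1)$. Let $D(H)=B\bowtie H$ be the Drinfel'd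 double: the object $B\otimes H$ with unit $\varepsilon\otimes 1$, the codiagonal coalgebra structure, and product $$(f\otimes h)(g\otimes k)=f\,(h_1\triangleright g_1)\otimes (h_2\triangleleft g_2)\,k,\qquad (h\triangleright f)(x)=f(S^{-1}(h_2)\,x\,h_1),\qquad h\triangleleft f=h_2\, f(S^{-1}(h_3)h_1).$$ Then $D(H)$ is a bialgebra in $\mathcal C$ and $\eta_B\otimes H: H\to D(H)$ is an algebra morphism. Moreover, with the usual monoidal structures on categories of modules over bialgebras and of Yetter-Drinfel'd modules (tensor product of $\mathcal C$ with diagonal action and codiagonal coaction): (1) The category ${}_H^H\mathcal{YD}(\mathcal C)$ of left-left Yetter-Drinfel'd modules, i.e. left $H$-modules and left $H$-comodules with $(h_1n)_{-1}h_2\otimes(h_1n)_0=h_1n_{-1}\otimes h_2n_0$, is braided by $$\Phi^L_{X,Y}:X\otimes Y\to Y\otimes X,\quad x\otimes y\mapsto x_{-1}y\otimes x_0\quad\text{(with $x_0$, $y$ crossed by $\Phi_{X,Y}$)}.$$ The category ${}_{D(H)}\mathcal C$ of left $D(H)$-modules is braided by the morphisms $M\otimes N\to N\otimes M$ inverse to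 $$N\otimes M\to M\otimes N,\quad n\otimes m\mapsto \sum_i (h^i\otimes 1)m\otimes(\varepsilon\otimes h_i)n\quad\text{(with $n$, $m$ crossed by $\Phi_{M,N}^{-1}$)}.$$ There is an isomorphism of braided monoidal categories ${}_H^H\mathcal{YD}(\mathcal C)\cong{}_{D(H)}\mathcal C$ that leaves the underlying $H$-modules and the morphisms unchanged, with $D(H)$-action $(f\otimes h)m=f(S^{-1}((hm)_{-1}))\,(hm)_0$. Furthermore, there is an embedding of braided monoidal categories (a fully faithful braided monoidal functor, injective on objects) $${}_{D(H)}\mathcal C\hookrightarrow\mathcal Z_{1,l}({}_H\mathcal C)$$ into the left center of ${}_H\mathcal C$ (objects $X$ of ${}_H\mathcal C$ with a monoidal natural isomorphism $X\otimes U\cong U\otimes X$). It restricts $D(H)$-modules to $H$ along $\eta_B\otimes H$, does not change morphisms, and sends the $D(H)$-module of a Yetter-Drinfel'd module $X$ to $(X,\ U\mapsto\Phi^L_{X,U})$, where $\Phi^L_{X,U}$ is given by the above formula for every $H$-module $U$. In particular, ${}_H^H\mathcal{YD}(\mathcal C)\cong{}_{D(H)}\mathcal C\hookrightarrow\mathcal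 Z_{1,l}({}_H\mathcal C)$. (2) The category $\mathcal{YD}(\mathcal C)_H^H$ of right-right Yetter-Drinfel'd modules, i.e. right $H$-modules and right $H$-comodules with $(nh_2)_0\otimes h_1(nh_2)_1=n_0h_1\otimes n_1h_2$, is braided by $$\Phi^R_{X,Y}:X\otimes Y\to Y\otimes X,\quad x\otimes y\mapsto y_0\otimes x y_1\quad\text{(with $x$, $y_0$ crossed by $\Phi_{X,Y}$)}.$$ The category $\mathcal C_{D(H)}$ of right $D(H)$-modules is braided by the morphisms $M\otimes N\to N\otimes M$ inverse to $$N\otimes M\to M\otimes N,\quad n\otimes m\mapsto \sum_i m(\varepsilon\otimes h_i)\otimes n(h^i\otimes 1)\quad\text{(with $n$, $m$ crossed by $\Phi_{M,N}^{-1}$)}.$$ There is an isomorphism of braided monoidal categories $\mathcal{YD}(\mathcal C)_H^H\cong\mathcal C_{D(H)}$ that leaves the underlying $H$-modules and the morphisms unchanged, with $D(H)$-action $m(f\otimes h)=f(S^{-1}(m_1))\,m_0h$. Furthermore, there is an embedding of braided monoidal categories $$\mathcal C_{D(H)}\hookrightarrow\mathcal Z_{1,r}(\mathcal C_H)$$ into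 the right center of $\mathcal C_H$ (objects $X$ of $\mathcal C_H$ with a monoidal natural isomorphism $U\otimes X\cong X\otimes U$). It restricts $D(H)$-modules to $H$ along $\eta_B\otimes H$, does not change morphisms, and sends the $D(H)$-module of a Yetter-Drinfel'd module $X$ to $(X,\ U\mapsto\Phi^R_{U,X})$. In particular, $\mathcal{YD}(\mathcal C)_H^H\cong\mathcal C_{D(H)}\hookrightarrow\mathcal Z_{1,r}(\mathcal C_H)$. -/

import Mathlib

open CategoryTheory MonoidalCategory BraidedCategory

universe v u

namespace BraidedHopf

noncomputable section

section Raw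

variable {C : Type u} [Category.{v} C] [MonoidalCategory C] [BraidedCategory C]

/-- The diagonal left action on a tensor product, `a (m ⊗ n) = a₁ m ⊗ a₂ n`. -/
def tensorAct {H M N : C} (dl : H ⟶ H ⊗ H) (aM : H ⊗ M ⟶ M) (aN : H ⊗ N ⟶ N) :
    H ⊗ (M ⊗ N) ⟶ M ⊗ N :=
  dl ▷ (M ⊗ N) ≫ tensorμ H H M N ≫ (aM ⊗ₘ aN)

/-- The codiagonal left coaction on a tensor product, `m ⊗ n ↦ m₋₁ n₋₁ ⊗ m₀ ⊗ n₀`. -/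
def tensorCoact {H M N : C} (mu : H ⊗ H ⟶ H) (cM : M ⟶ H ⊗ M) (cN : N ⟶ H ⊗ N) :
    M ⊗ N ⟶ H ⊗ (M ⊗ N) :=
  (cM ⊗ₘ cN) ≫ tensorμ H M H N ≫ mu ▷ (M ⊗ N)

/-- The diagonal right action on a tensor product, `(m ⊗ n) a = m a₁ ⊗ n a₂`. -/
def tensorActR {H M N : C} (dl : H ⟶ H ⊗ H) (aM : M ⊗ H ⟶ M) (aN : N ⊗ H ⟶ N) :
    (M ⊗ N) ⊗ H ⟶ M ⊗ N :=
  (M ⊗ N) ◁ dl ≫ tensorμ M N H H ≫ (aM ⊗ₘ aN)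

/-- The codiagonal right coaction on a tensor product, `m ⊗ n ↦ m₀ ⊗ n₀ ⊗ m₁ n₁`. -/
def tensorCoactR {H M N : C} (mu : H ⊗ H ⟶ H) (cM : M ⟶ M ⊗ H) (cN : N ⟶ N ⊗ H) :
    M ⊗ N ⟶ (M ⊗ N) ⊗ H :=
  (cM ⊗ₘ cN) ≫ tensorμ M H N H ≫ (M ⊗ N) ◁ mu

/-- The first side `(h₁ n)₋₁ h₂ ⊗ (h₁ n)₀` of the left-left Yetter-Drinfeld condition. -/
def ydL {H N : C} (dl : H ⟶ H ⊗ H) (mu : H ⊗ H ⟶ H) (a : H ⊗ N ⟶ N) (c : N ⟶ H ⊗ N) :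
    H ⊗ N ⟶ H ⊗ N :=
  dl ▷ N ≫ (α_ H H N).hom ≫ H ◁ (β_ H N).hom ≫ (α_ H N H).inv ≫ a ▷ H ≫ c ▷ H ≫
    (α_ H N H).hom ≫ H ◁ (β_ N H).hom ≫ (α_ H H N).inv ≫ mu ▷ N

/-- The second side `h₁ n₋₁ ⊗ h₂ n₀` of the left-left Yetter-Drinfeld condition. -/
def ydR {H N : C} (dl : H ⟶ H ⊗ H) (mu : H ⊗ H ⟶ H) (a : H ⊗ N ⟶ N) (c : N ⟶ H ⊗ N) :
    H ⊗ N ⟶ H ⊗ N :=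
  (dl ⊗ₘ c) ≫ tensorμ H H H N ≫ (mu ⊗ₘ a)

/-- The first side `(n h₂)₀ ⊗ h₁ (n h₂)₁` of the right-right Yetter-Drinfeld condition. -/
def ydL' {H N : C} (dl : H ⟶ H ⊗ H) (mu : H ⊗ H ⟶ H) (a : N ⊗ H ⟶ N) (c : N ⟶ N ⊗ H) :
    N ⊗ H ⟶ N ⊗ H :=
  N ◁ dl ≫ (α_ N H H).inv ≫ (β_ N H).hom ▷ H ≫ (α_ H N H).hom ≫ H ◁ a ≫ H ◁ c ≫
    (α_ H N H).inv ≫ (β_ H N).hom ▷ H ≫ (α_ N H H).hom ≫ N ◁ mu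

/-- The second side `n₀ h₁ ⊗ n₁ h₂` of the right-right Yetter-Drinfeld condition. -/
def ydR' {H N : C} (dl : H ⟶ H ⊗ H) (mu : H ⊗ H ⟶ H) (a : N ⊗ H ⟶ N) (c : N ⟶ N ⊗ H) :
    N ⊗ H ⟶ N ⊗ H :=
  (c ⊗ₘ dl) ≫ tensorμ N H H H ≫ (a ⊗ₘ mu)

section

variable {H M N : C} (Δ : H ⟶ H ⊗ H) (μ : H ⊗ H ⟶ H)
  (aM : H ⊗ M ⟶ M) (cM : M ⟶ H ⊗ M) (aN : H ⊗ N ⟶ N) (cN : N ⟶ H ⊗ N)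

theorem ydW (assoc : μ ▷ H ≫ μ = (α_ H H H).hom ≫ H ◁ μ ≫ μ) :
    (𝟙 _ ⊗≫ H ◁ (β_ M H).hom ▷ H ⊗≫ μ ▷ (M ⊗ H) ⊗≫ H ◁ (β_ M H).hom ⊗≫ μ ▷ M :
        H ⊗ M ⊗ H ⊗ H ⟶ H ⊗ M) =
      𝟙 _ ⊗≫ H ◁ M ◁ μ ⊗≫ H ◁ (β_ M H).hom ⊗≫ μ ▷ M := by
  calc
    _ = 𝟙 _ ⊗≫ H ◁ (β_ M H).hom ▷ H ⊗≫ (μ ▷ (M ⊗ H) ≫ H ◁ (β_ M H).hom) ⊗≫ μ ▷ M := by monoidal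
    _ = 𝟙 _ ⊗≫ H ◁ ((β_ M H).hom ▷ H ⊗≫ H ◁ (β_ M H).hom) ⊗≫ (μ ▷ H ≫ μ) ▷ M := by
      rw [← whisker_exchange]; monoidal
    _ = 𝟙 _ ⊗≫ H ◁ ((α_ _ _ _).inv ≫ ((α_ M H H).hom ≫ (β_ M (H ⊗ H)).hom ≫ μ ▷ M)) ⊗≫ μ ▷ M := by
      rw [assoc, braiding_tensor_right_hom]; monoidal
    _ = _ := by rw [← braiding_naturality_right]; monoidal

theorem ydA (assoc : μ ▷ H ≫ μ = (α_ H H H).hom ≫ H ◁ μ ≫ μ)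
    (coassoc : Δ ≫ Δ ▷ H = Δ ≫ H ◁ Δ ≫ (α_ H H H).inv) :
    ydL Δ μ (tensorAct Δ aM aN) (tensorCoact μ cM cN) =
      𝟙 _ ⊗≫ Δ ▷ (M ⊗ N) ⊗≫ H ◁ (β_ H M).hom ▷ N ⊗≫ (aM ≫ cM) ▷ (H ⊗ N) ⊗≫
        (H ⊗ M) ◁ ydL Δ μ aN cN ⊗≫ H ◁ (β_ M H).hom ▷ N ⊗≫ μ ▷ (M ⊗ N) := by
  calc
    _ = 𝟙 _ ⊗≫ Δ ▷ (M ⊗ N) ⊗≫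
        (H ◁ ((β_ H M).hom ▷ N ⊗≫ M ◁ (β_ H N).hom) ≫ Δ ▷ (M ⊗ N ⊗ H)) ⊗≫
        H ◁ (β_ H M).hom ▷ (N ⊗ H) ⊗≫ aM ▷ (H ⊗ N ⊗ H) ⊗≫ M ◁ aN ▷ H ⊗≫ cM ▷ (N ⊗ H) ⊗≫
        H ◁ M ◁ cN ▷ H ⊗≫ H ◁ (β_ M H).hom ▷ (N ⊗ H) ⊗≫ μ ▷ (M ⊗ N ⊗ H) ⊗≫
        H ◁ M ◁ (β_ N H).hom ⊗≫ H ◁ (β_ M H).hom ▷ N ⊗≫ μ ▷ (M ⊗ N) := by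
      rw [ydL, tensorAct, tensorCoact, MonoidalCategory.tensorHom_def aM aN,
        MonoidalCategory.tensorHom_def cM cN, braiding_tensor_right_hom, braiding_tensor_left_hom]
      simp only [tensorμ]
      monoidal
    _ = 𝟙 _ ⊗≫ (Δ ≫ Δ ▷ H) ▷ (M ⊗ N) ⊗≫ H ◁ H ◁ (β_ H M).hom ▷ N ⊗≫
        H ◁ ((H ⊗ M) ◁ (β_ H N).hom ≫ (β_ H M).hom ▷ (N ⊗ H)) ⊗≫ aM ▷ (H ⊗ N ⊗ H) ⊗≫ M ◁ aN ▷ H ⊗≫ cM ▷ (N ⊗ H) ⊗≫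
        H ◁ M ◁ cN ▷ H ⊗≫ ((H ◁ (β_ M H).hom ⊗≫ μ ▷ M) ▷ (N ⊗ H) ≫
        (H ⊗ M) ◁ (β_ N H).hom) ⊗≫ H ◁ (β_ M H).hom ▷ N ⊗≫ μ ▷ (M ⊗ N) := by
      rw [whisker_exchange]; monoidal
    _ = 𝟙 _ ⊗≫ Δ ▷ (M ⊗ N) ⊗≫ H ◁ (Δ ▷ M ≫ (β_ (H ⊗ H) M).hom) ▷ N ⊗≫
        ((H ⊗ M) ◁ H ◁ (β_ H N).hom ≫ aM ▷ (H ⊗ N ⊗ H)) ⊗≫ M ◁ aN ▷ H ⊗≫ cM ▷ (N ⊗ H) ⊗≫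
        H ◁ M ◁ cN ▷ H ⊗≫ H ◁ M ◁ H ◁ (β_ N H).hom ⊗≫
        (𝟙 (H ⊗ M ⊗ H ⊗ H) ⊗≫ H ◁ (β_ M H).hom ▷ H ⊗≫ μ ▷ (M ⊗ H) ⊗≫ H ◁ (β_ M H).hom ⊗≫ μ ▷ M) ▷ N ⊗≫ 𝟙 (H ⊗ M ⊗ N) := by
      rw [coassoc, whisker_exchange (β_ H M).hom (β_ H N).hom,
        ← whisker_exchange (H ◁ (β_ M H).hom ⊗≫ μ ▷ M) (β_ N H).hom, braiding_tensor_left_hom]; monoidal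
    _ = 𝟙 _ ⊗≫ Δ ▷ (M ⊗ N) ⊗≫ H ◁ (β_ H M).hom ▷ N ⊗≫
        ((H ⊗ M) ◁ Δ ▷ N ≫ aM ▷ ((H ⊗ H) ⊗ N)) ⊗≫
        (M ◁ (H ◁ (β_ H N).hom ⊗≫ aN ▷ H) ≫ cM ▷ (N ⊗ H)) ⊗≫
        H ◁ M ◁ cN ▷ H ⊗≫ H ◁ M ◁ H ◁ (β_ N H).hom ⊗≫
        (𝟙 (H ⊗ M ⊗ H ⊗ H) ⊗≫ H ◁ M ◁ μ ⊗≫ H ◁ (β_ M H).hom ⊗≫ μ ▷ M) ▷ N ⊗≫ 𝟙 (H ⊗ M ⊗ N) := by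
      rw [whisker_exchange, braiding_naturality_left, ydW μ assoc]; monoidal
    _ = 𝟙 _ ⊗≫ Δ ▷ (M ⊗ N) ⊗≫ H ◁ (β_ H M).hom ▷ N ⊗≫ aM ▷ (H ⊗ N) ⊗≫
        (M ◁ (Δ ▷ N) ≫ cM ▷ ((H ⊗ H) ⊗ N)) ⊗≫ (H ⊗ M) ◁ (H ◁ (β_ H N).hom ⊗≫ aN ▷ H) ⊗≫
        H ◁ M ◁ cN ▷ H ⊗≫ H ◁ M ◁ H ◁ (β_ N H).hom ⊗≫
        (𝟙 (H ⊗ M ⊗ H ⊗ H) ⊗≫ H ◁ M ◁ μ ⊗≫ H ◁ (β_ M H).hom ⊗≫ μ ▷ M) ▷ N ⊗≫ 𝟙 (H ⊗ M ⊗ N) := by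
      rw [whisker_exchange, whisker_exchange]; monoidal
    _ = _ := by rw [whisker_exchange, ydL]; monoidal


theorem ydB (assoc : μ ▷ H ≫ μ = (α_ H H H).hom ≫ H ◁ μ ≫ μ)
    (coassoc : Δ ≫ Δ ▷ H = Δ ≫ H ◁ Δ ≫ (α_ H H H).inv) :
    (𝟙 _ ⊗≫ Δ ▷ (M ⊗ N) ⊗≫ H ◁ (β_ H M).hom ▷ N ⊗≫ (aM ≫ cM) ▷ (H ⊗ N) ⊗≫
        (H ⊗ M) ◁ ydR Δ μ aN cN ⊗≫ H ◁ (β_ M H).hom ▷ N ⊗≫ μ ▷ (M ⊗ N) :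
          H ⊗ M ⊗ N ⟶ H ⊗ M ⊗ N) =
      𝟙 _ ⊗≫ Δ ▷ (M ⊗ N) ⊗≫ H ◁ (β_ H M).hom ▷ N ⊗≫ ydL Δ μ aM cM ▷ (H ⊗ N) ⊗≫
        (H ⊗ M) ◁ (H ◁ cN ⊗≫ (β_ H H).hom ▷ N) ⊗≫ H ◁ (β_ M H).hom ▷ (H ⊗ N) ⊗≫
        μ ▷ (M ⊗ H ⊗ N) ⊗≫ (H ⊗ M) ◁ aN ⊗≫ 𝟙 (H ⊗ M ⊗ N) := by
  calc
    _ = 𝟙 _ ⊗≫ Δ ▷ (M ⊗ N) ⊗≫ H ◁ (β_ H M).hom ▷ N ⊗≫ (aM ≫ cM) ▷ (H ⊗ N) ⊗≫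
        (H ⊗ M) ◁ (Δ ▷ N ⊗≫ H ◁ (H ◁ cN ⊗≫ (β_ H H).hom ▷ N) ⊗≫ μ ▷ (H ⊗ N)) ⊗≫
        H ◁ ((M ⊗ H) ◁ aN ≫ (β_ M H).hom ▷ N) ⊗≫ μ ▷ (M ⊗ N) := by
      rw [ydR, MonoidalCategory.tensorHom_def Δ cN, MonoidalCategory.tensorHom_def μ aN]
      simp only [tensorμ]
      monoidal
    _ = 𝟙 _ ⊗≫ Δ ▷ (M ⊗ N) ⊗≫ H ◁ (β_ H M).hom ▷ N ⊗≫
        ((aM ≫ cM) ▷ (H ⊗ N) ≫ (H ⊗ M) ◁ (Δ ▷ N)) ⊗≫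
        (H ⊗ M) ◁ H ◁ (H ◁ cN ⊗≫ (β_ H H).hom ▷ N) ⊗≫
        H ◁ (M ◁ μ ≫ (β_ M H).hom) ▷ (H ⊗ N) ⊗≫ ((H ⊗ H) ◁ (M ◁ aN) ≫ μ ▷ (M ⊗ N)) := by
      rw [whisker_exchange (β_ M H).hom aN]
      monoidal
    _ = 𝟙 _ ⊗≫ Δ ▷ (M ⊗ N) ⊗≫ H ◁ ((β_ H M).hom ≫ M ◁ Δ) ▷ N ⊗≫
        (aM ≫ cM) ▷ ((H ⊗ H) ⊗ N) ⊗≫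
        (H ⊗ M) ◁ H ◁ (H ◁ cN ⊗≫ (β_ H H).hom ▷ N) ⊗≫
        H ◁ ((β_ M (H ⊗ H)).hom ≫ μ ▷ M) ▷ (H ⊗ N) ⊗≫ μ ▷ (M ⊗ H ⊗ N) ⊗≫ (H ⊗ M) ◁ aN ⊗≫ 𝟙 (H ⊗ M ⊗ N) := by
      rw [← whisker_exchange (aM ≫ cM) (Δ ▷ N), braiding_naturality_right,
        whisker_exchange μ]
      monoidal
    _ = 𝟙 _ ⊗≫ (Δ ≫ H ◁ Δ) ▷ (M ⊗ N) ⊗≫ H ◁ (β_ (H ⊗ H) M).hom ▷ N ⊗≫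
        (aM ≫ cM) ▷ ((H ⊗ H) ⊗ N) ⊗≫
        (H ◁ ((M ⊗ H) ◁ (H ◁ cN ⊗≫ (β_ H H).hom ▷ N) ≫ (β_ M H).hom ▷ ((H ⊗ H) ⊗ N))) ⊗≫
        (H ⊗ H) ◁ (β_ M H).hom ▷ (H ⊗ N) ⊗≫ (H ◁ μ ≫ μ) ▷ (M ⊗ H ⊗ N) ⊗≫ (H ⊗ M) ◁ aN ⊗≫ 𝟙 (H ⊗ M ⊗ N) := by
      rw [← braiding_naturality_left, braiding_tensor_right_hom]
      monoidal
    _ = 𝟙 _ ⊗≫ (Δ ≫ H ◁ Δ ≫ (α_ H H H).inv) ▷ (M ⊗ N) ⊗≫ (H ⊗ H) ◁ (β_ H M).hom ▷ N ⊗≫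
        H ◁ (β_ H M).hom ▷ (H ⊗ N) ⊗≫
        (aM ≫ cM) ▷ ((H ⊗ H) ⊗ N) ⊗≫
        H ◁ (β_ M H).hom ▷ (H ⊗ N) ⊗≫
        (H ⊗ H ⊗ M) ◁ (H ◁ cN ⊗≫ (β_ H H).hom ▷ N) ⊗≫
        (H ⊗ H) ◁ (β_ M H).hom ▷ (H ⊗ N) ⊗≫
        (μ ▷ H ≫ μ) ▷ (M ⊗ H ⊗ N) ⊗≫ (H ⊗ M) ◁ aN ⊗≫ 𝟙 (H ⊗ M ⊗ N) := by
      rw [assoc, whisker_exchange (β_ M H).hom, braiding_tensor_left_hom]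
      monoidal
    _ = 𝟙 _ ⊗≫ Δ ▷ (M ⊗ N) ⊗≫ (Δ ▷ (H ⊗ M) ≫ (H ⊗ H) ◁ (β_ H M).hom) ▷ N ⊗≫
        H ◁ (β_ H M).hom ▷ (H ⊗ N) ⊗≫
        (aM ≫ cM) ▷ ((H ⊗ H) ⊗ N) ⊗≫
        H ◁ (β_ M H).hom ▷ (H ⊗ N) ⊗≫
        (H ⊗ H ⊗ M) ◁ (H ◁ cN ⊗≫ (β_ H H).hom ▷ N) ⊗≫
        ((H ⊗ H) ◁ (β_ M H).hom ≫ μ ▷ (H ⊗ M)) ▷ (H ⊗ N) ⊗≫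
        μ ▷ (M ⊗ H ⊗ N) ⊗≫ (H ⊗ M) ◁ aN ⊗≫ 𝟙 (H ⊗ M ⊗ N) := by
      rw [← coassoc]
      monoidal
    _ = 𝟙 _ ⊗≫ Δ ▷ (M ⊗ N) ⊗≫ H ◁ (β_ H M).hom ▷ N ⊗≫ Δ ▷ (M ⊗ H ⊗ N) ⊗≫
        H ◁ (β_ H M).hom ▷ (H ⊗ N) ⊗≫
        (aM ≫ cM) ▷ ((H ⊗ H) ⊗ N) ⊗≫
        H ◁ (β_ M H).hom ▷ (H ⊗ N) ⊗≫
        ((H ⊗ H) ◁ (M ◁ (H ◁ cN ⊗≫ (β_ H H).hom ▷ N)) ≫ μ ▷ (M ⊗ (H ⊗ H) ⊗ N)) ⊗≫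
        H ◁ (β_ M H).hom ▷ (H ⊗ N) ⊗≫
        μ ▷ (M ⊗ H ⊗ N) ⊗≫ (H ⊗ M) ◁ aN ⊗≫ 𝟙 (H ⊗ M ⊗ N) := by
      rw [← whisker_exchange Δ, whisker_exchange μ]
      monoidal
    _ = _ := by rw [whisker_exchange μ, ydL]; monoidal

theorem ydX :
    (𝟙 (H ⊗ M ⊗ N) ⊗≫ H ◁ cM ▷ N ⊗≫ (β_ H H).hom ▷ (M ⊗ N) ⊗≫
      H ◁ ((β_ H M).hom ▷ N ⊗≫ M ◁ H ◁ cN ⊗≫ (M ◁ (β_ H H).hom ⊗≫ (β_ M H).hom ▷ H) ▷ N) ⊗≫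
        𝟙 ((H ⊗ H) ⊗ M ⊗ H ⊗ N)) =
    𝟙 (H ⊗ M ⊗ N) ⊗≫ H ◁ ((cM ⊗ₘ cN) ⊗≫ H ◁ (β_ M H).hom ▷ N) ⊗≫
      (β_ H (H ⊗ H)).hom ▷ (M ⊗ N) ⊗≫ (H ⊗ H) ◁ (β_ H M).hom ▷ N ⊗≫
        𝟙 ((H ⊗ H) ⊗ M ⊗ H ⊗ N) := by
  calc
    _ = 𝟙 (H ⊗ M ⊗ N) ⊗≫ H ◁ cM ▷ N ⊗≫ (β_ H H).hom ▷ (M ⊗ N) ⊗≫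
      H ◁ (((β_ H M).hom ▷ N ≫ (M ⊗ H) ◁ cN) ⊗≫
        (M ◁ (β_ H H).hom ⊗≫ (β_ M H).hom ▷ H) ▷ N) ⊗≫
        𝟙 ((H ⊗ H) ⊗ M ⊗ H ⊗ N) := by monoidal
    _ = 𝟙 (H ⊗ M ⊗ N) ⊗≫ H ◁ cM ▷ N ⊗≫ (β_ H H).hom ▷ (M ⊗ N) ⊗≫
      H ◁ ((H ⊗ M) ◁ cN ⊗≫
        ((β_ H M).hom ▷ H ⊗≫ M ◁ (β_ H H).hom ⊗≫ (β_ M H).hom ▷ H) ▷ N) ⊗≫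
        𝟙 ((H ⊗ H) ⊗ M ⊗ H ⊗ N) := by
      rw [← whisker_exchange (β_ H M).hom cN]; monoidal
    _ = 𝟙 (H ⊗ M ⊗ N) ⊗≫ H ◁ cM ▷ N ⊗≫
      ((β_ H H).hom ▷ (M ⊗ N) ≫ (H ⊗ H) ◁ (M ◁ cN ⊗≫ (β_ M H).hom ▷ N)) ⊗≫
        (H ◁ (β_ H H).hom) ▷ (M ⊗ N) ⊗≫ (H ⊗ H) ◁ (β_ H M).hom ▷ N ⊗≫
        𝟙 ((H ⊗ H) ⊗ M ⊗ H ⊗ N) := by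
      rw [yang_baxter']; monoidal
    _ = _ := by
      rw [← whisker_exchange (β_ H H).hom, braiding_tensor_right_hom,
        MonoidalCategory.tensorHom_def cM cN]
      monoidal

theorem ydC (assoc : μ ▷ H ≫ μ = (α_ H H H).hom ≫ H ◁ μ ≫ μ)
    (coassoc : Δ ≫ Δ ▷ H = Δ ≫ H ◁ Δ ≫ (α_ H H H).inv) :
    (𝟙 _ ⊗≫ Δ ▷ (M ⊗ N) ⊗≫ H ◁ (β_ H M).hom ▷ N ⊗≫ ydR Δ μ aM cM ▷ (H ⊗ N) ⊗≫
        (H ⊗ M) ◁ (H ◁ cN ⊗≫ (β_ H H).hom ▷ N) ⊗≫ H ◁ (β_ M H).hom ▷ (H ⊗ N) ⊗≫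
        μ ▷ (M ⊗ H ⊗ N) ⊗≫ (H ⊗ M) ◁ aN ⊗≫ 𝟙 (H ⊗ M ⊗ N) :
          H ⊗ M ⊗ N ⟶ H ⊗ M ⊗ N) =
      ydR Δ μ (tensorAct Δ aM aN) (tensorCoact μ cM cN) := by
  calc
    _ = 𝟙 _ ⊗≫ Δ ▷ (M ⊗ N) ⊗≫ (H ◁ (β_ H M).hom ≫ Δ ▷ (M ⊗ H)) ▷ N ⊗≫
        ((H ⊗ H) ◁ cM) ▷ (H ⊗ N) ⊗≫ H ◁ (β_ H H).hom ▷ (M ⊗ H ⊗ N) ⊗≫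
        (μ ▷ (H ⊗ M) ≫ H ◁ aM) ▷ (H ⊗ N) ⊗≫
        (H ⊗ M) ◁ (H ◁ cN ⊗≫ (β_ H H).hom ▷ N) ⊗≫ H ◁ (β_ M H).hom ▷ (H ⊗ N) ⊗≫
        μ ▷ (M ⊗ H ⊗ N) ⊗≫ (H ⊗ M) ◁ aN ⊗≫ 𝟙 (H ⊗ M ⊗ N) := by
      rw [ydR, MonoidalCategory.tensorHom_def Δ cM, MonoidalCategory.tensorHom_def μ aM]
      simp only [tensorμ]
      monoidal
    _ = 𝟙 _ ⊗≫ (Δ ≫ Δ ▷ H) ▷ (M ⊗ N) ⊗≫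
        (H ⊗ H) ◁ ((β_ H M).hom ≫ cM ▷ H) ▷ N ⊗≫ H ◁ (β_ H H).hom ▷ (M ⊗ H ⊗ N) ⊗≫
        (μ ▷ (H ⊗ M) ▷ (H ⊗ N) ⊗≫ H ◁ (aM ▷ (H ⊗ N) ≫
        M ◁ (H ◁ cN ⊗≫ (β_ H H).hom ▷ N))) ⊗≫ H ◁ (β_ M H).hom ▷ (H ⊗ N) ⊗≫
        μ ▷ (M ⊗ H ⊗ N) ⊗≫ (H ⊗ M) ◁ aN ⊗≫ 𝟙 (H ⊗ M ⊗ N) := by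
      rw [whisker_exchange Δ]
      monoidal
    _ = 𝟙 _ ⊗≫ (Δ ≫ Δ ▷ H) ▷ (M ⊗ N) ⊗≫
        (H ⊗ H) ◁ (H ◁ cM ≫ (β_ H (H ⊗ M)).hom) ▷ N ⊗≫ H ◁ (β_ H H).hom ▷ (M ⊗ H ⊗ N) ⊗≫
        (μ ▷ ((H ⊗ M) ⊗ (H ⊗ N)) ≫ H ◁ ((H ⊗ M) ◁ (H ◁ cN ⊗≫ (β_ H H).hom ▷ N))) ⊗≫
        H ◁ (aM ▷ H ≫ (β_ M H).hom) ▷ (H ⊗ N) ⊗≫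
        μ ▷ (M ⊗ H ⊗ N) ⊗≫ (H ⊗ M) ◁ aN ⊗≫ 𝟙 (H ⊗ M ⊗ N) := by
      rw [braiding_naturality_right, ← whisker_exchange aM]
      monoidal
    _ = 𝟙 _ ⊗≫ (Δ ≫ Δ ▷ H) ▷ (M ⊗ N) ⊗≫
        (H ⊗ H) ◁ (H ◁ cM ≫ (β_ H (H ⊗ M)).hom) ▷ N ⊗≫
        (H ◁ ((β_ H H).hom ▷ (M ⊗ H ⊗ N) ≫ (H ⊗ H) ◁ (M ◁ (H ◁ cN ⊗≫ (β_ H H).hom ▷ N)))) ⊗≫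
        (μ ▷ (((H ⊗ M) ⊗ H) ⊗ (H ⊗ N)) ≫ H ◁ ((β_ (H ⊗ M) H).hom ▷ (H ⊗ N))) ⊗≫
        (H ◁ H ◁ aM ▷ (H ⊗ N)) ⊗≫
        μ ▷ (M ⊗ H ⊗ N) ⊗≫ (H ⊗ M) ◁ aN ⊗≫ 𝟙 (H ⊗ M ⊗ N) := by
      rw [braiding_naturality_left, ← whisker_exchange μ]
      monoidal
    _ = 𝟙 _ ⊗≫ (Δ ≫ Δ ▷ H) ▷ (M ⊗ N) ⊗≫
        (H ⊗ H) ◁ ((H ◁ cM ≫ (β_ H (H ⊗ M)).hom) ▷ N ⊗≫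
          (H ⊗ M) ◁ (H ◁ cN ⊗≫ (β_ H H).hom ▷ N)) ⊗≫
        H ◁ ((β_ H H).hom ▷ ((M ⊗ H) ⊗ H ⊗ N) ≫ (H ⊗ H) ◁ ((β_ M H).hom ▷ (H ⊗ N))) ⊗≫
        (H ⊗ H) ◁ (β_ H H).hom ▷ (M ⊗ H ⊗ N) ⊗≫
        μ ▷ (H ⊗ H ⊗ M ⊗ H ⊗ N) ⊗≫
        (H ◁ H ◁ aM ▷ (H ⊗ N)) ⊗≫
        μ ▷ (M ⊗ H ⊗ N) ⊗≫ (H ⊗ M) ◁ aN ⊗≫ 𝟙 (H ⊗ M ⊗ N) := by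
      rw [← whisker_exchange (β_ H H).hom, ← whisker_exchange μ, braiding_tensor_left_hom]
      monoidal
    _ = 𝟙 _ ⊗≫ (Δ ≫ Δ ▷ H) ▷ (M ⊗ N) ⊗≫
        (H ⊗ H) ◁ (𝟙 (H ⊗ M ⊗ N) ⊗≫ H ◁ cM ▷ N ⊗≫ (β_ H H).hom ▷ (M ⊗ N) ⊗≫
      H ◁ ((β_ H M).hom ▷ N ⊗≫ M ◁ H ◁ cN ⊗≫ (M ◁ (β_ H H).hom ⊗≫ (β_ M H).hom ▷ H) ▷ N) ⊗≫
        𝟙 ((H ⊗ H) ⊗ M ⊗ H ⊗ N)) ⊗≫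
        H ◁ ((β_ H H).hom ▷ H ⊗≫ H ◁ (β_ H H).hom) ▷ (M ⊗ H ⊗ N) ⊗≫
        μ ▷ (H ⊗ H ⊗ M ⊗ H ⊗ N) ⊗≫
        (H ◁ H ◁ aM ▷ (H ⊗ N)) ⊗≫
        μ ▷ (M ⊗ H ⊗ N) ⊗≫ (H ⊗ M) ◁ aN ⊗≫ 𝟙 (H ⊗ M ⊗ N) := by
      rw [← whisker_exchange (β_ H H).hom, braiding_tensor_right_hom]
      monoidal
    _ = 𝟙 _ ⊗≫ (Δ ≫ Δ ▷ H) ▷ (M ⊗ N) ⊗≫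
        ((H ⊗ H) ⊗ H) ◁ ((cM ⊗ₘ cN) ⊗≫ H ◁ (β_ M H).hom ▷ N) ⊗≫
        (H ⊗ H) ◁ (β_ H (H ⊗ H)).hom ▷ (M ⊗ N) ⊗≫
        H ◁ (H ◁ ((H ⊗ H) ◁ ((β_ H M).hom ▷ N)) ⊗≫ (β_ H (H ⊗ H)).hom ▷ (M ⊗ H ⊗ N)) ⊗≫
        μ ▷ (H ⊗ (H ⊗ M) ⊗ H ⊗ N) ⊗≫ ((H ⊗ H) ◁ (aM ▷ (H ⊗ N)) ≫
        μ ▷ (M ⊗ H ⊗ N)) ⊗≫ (H ⊗ M) ◁ aN ⊗≫ 𝟙 (H ⊗ M ⊗ N) := by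
      rw [ydX, braiding_tensor_right_hom H H H]
      monoidal
    _ = 𝟙 _ ⊗≫ (Δ ≫ H ◁ Δ ≫ (α_ H H H).inv) ▷ (M ⊗ N) ⊗≫
        ((H ⊗ H) ⊗ H) ◁ ((cM ⊗ₘ cN) ⊗≫ H ◁ (β_ M H).hom ▷ N) ⊗≫
        (H ⊗ H) ◁ (β_ H (H ⊗ H)).hom ▷ (M ⊗ N) ⊗≫
        H ◁ ((H ⊗ H ⊗ H) ◁ ((β_ H M).hom ▷ N) ≫ (β_ H (H ⊗ H)).hom ▷ ((M ⊗ H) ⊗ N)) ⊗≫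
        (μ ▷ H ≫ μ) ▷ (H ⊗ M ⊗ H ⊗ N) ⊗≫ (H ◁ (aM ▷ (H ⊗ N))) ⊗≫
        (H ⊗ M) ◁ aN ⊗≫ 𝟙 (H ⊗ M ⊗ N) := by
      rw [coassoc, whisker_exchange μ]
      monoidal
    _ = 𝟙 _ ⊗≫ Δ ▷ (M ⊗ N) ⊗≫
        H ◁ (Δ ▷ (M ⊗ N) ≫ (H ⊗ H) ◁ ((cM ⊗ₘ cN) ⊗≫ H ◁ (β_ M H).hom ▷ N)) ⊗≫
        H ◁ (β_ (H ⊗ H) (H ⊗ H)).hom ▷ (M ⊗ N) ⊗≫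
        ((H ⊗ (H ⊗ H)) ◁ (H ◁ (β_ H M).hom ▷ N) ≫ (H ◁ μ ≫ μ) ▷ (H ⊗ (M ⊗ H) ⊗ N)) ⊗≫ (H ◁ (aM ▷ (H ⊗ N))) ⊗≫
        (H ⊗ M) ◁ aN ⊗≫ 𝟙 (H ⊗ M ⊗ N) := by
      rw [whisker_exchange (β_ H (H ⊗ H)).hom, assoc, braiding_tensor_left_hom]
      monoidal
    _ = 𝟙 _ ⊗≫ Δ ▷ (M ⊗ N) ⊗≫ (H ⊗ H) ◁ ((cM ⊗ₘ cN) ⊗≫ H ◁ (β_ M H).hom ▷ N) ⊗≫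
        H ◁ (Δ ▷ (H ⊗ H) ≫ (β_ (H ⊗ H) (H ⊗ H)).hom) ▷ (M ⊗ N) ⊗≫
        (H ◁ μ ≫ μ) ▷ (H ⊗ H ⊗ M ⊗ N) ⊗≫ (H ⊗ H) ◁ (β_ H M).hom ▷ N ⊗≫ (H ◁ (aM ▷ (H ⊗ N))) ⊗≫
        (H ⊗ M) ◁ aN ⊗≫ 𝟙 (H ⊗ M ⊗ N) := by
      rw [whisker_exchange (H ◁ μ ≫ μ), ← whisker_exchange Δ]
      monoidal
    _ = 𝟙 _ ⊗≫ Δ ▷ (M ⊗ N) ⊗≫ (H ⊗ H) ◁ ((cM ⊗ₘ cN) ⊗≫ H ◁ (β_ M H).hom ▷ N) ⊗≫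
        H ◁ (β_ H (H ⊗ H)).hom ▷ (M ⊗ N) ⊗≫
        ((H ⊗ H ⊗ H) ◁ (Δ ▷ (M ⊗ N)) ≫ (H ◁ μ ≫ μ) ▷ ((H ⊗ H) ⊗ M ⊗ N)) ⊗≫ (H ⊗ H) ◁ (β_ H M).hom ▷ N ⊗≫ (H ◁ (aM ▷ (H ⊗ N))) ⊗≫
        (H ⊗ M) ◁ aN ⊗≫ 𝟙 (H ⊗ M ⊗ N) := by
      rw [braiding_naturality_left]
      monoidal
    _ = 𝟙 _ ⊗≫ Δ ▷ (M ⊗ N) ⊗≫ (H ⊗ H) ◁ ((cM ⊗ₘ cN) ⊗≫ H ◁ (β_ M H).hom ▷ N) ⊗≫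
        H ◁ ((β_ H (H ⊗ H)).hom ≫ μ ▷ H) ▷ (M ⊗ N) ⊗≫
        μ ▷ (H ⊗ M ⊗ N) ⊗≫ H ◁ (Δ ▷ (M ⊗ N)) ⊗≫ (H ⊗ H) ◁ (β_ H M).hom ▷ N ⊗≫ (H ◁ (aM ▷ (H ⊗ N))) ⊗≫
        (H ⊗ M) ◁ aN ⊗≫ 𝟙 (H ⊗ M ⊗ N) := by
      rw [whisker_exchange (H ◁ μ ≫ μ)]
      monoidal
    _ = _ := by
      rw [← braiding_naturality_right, ydR, MonoidalCategory.tensorHom_def Δ,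
        MonoidalCategory.tensorHom_def μ, tensorAct, tensorCoact,
        MonoidalCategory.tensorHom_def aM aN]
      simp only [tensorμ]
      monoidal

end

theorem ydT {H M N : C} (Δ : H ⟶ H ⊗ H) (μ : H ⊗ H ⟶ H)
  (aM : H ⊗ M ⟶ M) (cM : M ⟶ H ⊗ M) (aN : H ⊗ N ⟶ N) (cN : N ⟶ H ⊗ N)
    (assoc : μ ▷ H ≫ μ = (α_ H H H).hom ≫ H ◁ μ ≫ μ)
    (coassoc : Δ ≫ Δ ▷ H = Δ ≫ H ◁ Δ ≫ (α_ H H H).inv)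
    (hM : ydL Δ μ aM cM = ydR Δ μ aM cM) (hN : ydL Δ μ aN cN = ydR Δ μ aN cN) :
    ydL Δ μ (tensorAct Δ aM aN) (tensorCoact μ cM cN) =
      ydR Δ μ (tensorAct Δ aM aN) (tensorCoact μ cM cN) := by
  rw [ydA Δ μ aM cM aN cN assoc coassoc, hN, ydB Δ μ aM cM aN cN assoc coassoc, hM,
    ydC Δ μ aM cM aN cN assoc coassoc]

open MonoidalOpposite

theorem unmop_tensorμ (W X Y Z : C) :
    (tensorμ (mop W) (mop X) (mop Y) (mop Z)).unmop = tensorμ Z Y X W := by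
  simp only [tensorμ]
  simp

theorem ydT' {H M N : C} (Δ : H ⟶ H ⊗ H) (μ : H ⊗ H ⟶ H)
  (aM : M ⊗ H ⟶ M) (cM : M ⟶ M ⊗ H) (aN : N ⊗ H ⟶ N) (cN : N ⟶ N ⊗ H)
    (assoc : μ ▷ H ≫ μ = (α_ H H H).hom ≫ H ◁ μ ≫ μ)
    (coassoc : Δ ≫ Δ ▷ H = Δ ≫ H ◁ Δ ≫ (α_ H H H).inv)
    (hM : ydL' Δ μ aM cM = ydR' Δ μ aM cM) (hN : ydL' Δ μ aN cN = ydR' Δ μ aN cN) :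
    ydL' Δ μ (tensorActR Δ aM aN) (tensorCoactR μ cM cN) =
      ydR' Δ μ (tensorActR Δ aM aN) (tensorCoactR μ cM cN) := by
  have hl : ∀ {X : C} (a : X ⊗ H ⟶ X) (c : X ⟶ X ⊗ H),
      (ydL (H := mop H) (N := mop X) Δ.mop μ.mop a.mop c.mop).unmop = ydL' Δ μ a c := by
    intro X a c
    simp only [ydL, ydL', unmop_comp]
    rfl
  have hr : ∀ {X : C} (a : X ⊗ H ⟶ X) (c : X ⟶ X ⊗ H),
      (ydR (H := mop H) (N := mop X) Δ.mop μ.mop a.mop c.mop).unmop = ydR' Δ μ a c := by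
    intro X a c
    simp only [ydR, ydR', unmop_comp, unmop_tensorμ]
    rfl
  have ha : tensorAct (H := mop H) (M := mop N) (N := mop M) Δ.mop aN.mop aM.mop =
      (tensorActR Δ aM aN).mop := by
    apply Quiver.Hom.unmop_inj
    simp only [tensorAct, tensorActR, unmop_comp, unmop_tensorμ]
    rfl
  have hc : tensorCoact (H := mop H) (M := mop N) (N := mop M) μ.mop cN.mop cM.mop =
      (tensorCoactR μ cM cN).mop := by
    apply Quiver.Hom.unmop_inj
    simp only [tensorCoact, tensorCoactR, unmop_comp, unmop_tensorμ]
    rfl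
  have key := ydT (C := Cᴹᵒᵖ) (H := mop H) (M := mop N) (N := mop M) Δ.mop μ.mop aN.mop cN.mop
    aM.mop cM.mop
    (Quiver.Hom.unmop_inj (by
      change H ◁ μ ≫ μ = (α_ H H H).inv ≫ μ ▷ H ≫ μ
      rw [assoc]; simp))
    (Quiver.Hom.unmop_inj (by
      change Δ ≫ H ◁ Δ = Δ ≫ Δ ▷ H ≫ (α_ H H H).hom
      rw [reassoc_of% coassoc]; simp))
    (Quiver.Hom.unmop_inj (by rw [hl, hr, hN])) (Quiver.Hom.unmop_inj (by rw [hl, hr, hM]))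
  have key' := congrArg Quiver.Hom.unmop key
  rw [ha, hc] at key'
  exact (hl _ _).symm.trans (key'.trans (hr _ _))
end Raw

section Bialgebra

open scoped MonObj ComonObj

variable {C : Type u} [Category.{v} C] [MonoidalCategory C] [BraidedCategory C]
variable {A M N P : C} [BimonObj A]

theorem tensorAct_one (aM : A ⊗ M ⟶ M) (aN : A ⊗ N ⟶ N)
    (hM : η[A] ▷ M ≫ aM = (λ_ M).hom) (hN : η[A] ▷ N ≫ aN = (λ_ N).hom) :
    η[A] ▷ (M ⊗ N) ≫ tensorAct Δ[A] aM aN = (λ_ (M ⊗ N)).hom := by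
  rw [tensorAct, ← comp_whiskerRight_assoc, BimonObj.one_comul, MonObj.tensorObj.one_def,
    comp_whiskerRight_assoc, tensorμ_natural_left_assoc, tensorHom_comp_tensorHom, hM, hN,
    tensor_left_unitality]

theorem tensorActR_one (aM : M ⊗ A ⟶ M) (aN : N ⊗ A ⟶ N)
    (hM : M ◁ η[A] ≫ aM = (ρ_ M).hom) (hN : N ◁ η[A] ≫ aN = (ρ_ N).hom) :
    (M ⊗ N) ◁ η[A] ≫ tensorActR Δ[A] aM aN = (ρ_ (M ⊗ N)).hom := by
  rw [tensorActR, ← MonoidalCategory.whiskerLeft_comp_assoc, BimonObj.one_comul,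
    MonObj.tensorObj.one_def, MonoidalCategory.whiskerLeft_comp_assoc,
    tensorμ_natural_right_assoc, tensorHom_comp_tensorHom, hM, hN, tensor_right_unitality]

theorem tensorAct_mul (aM : A ⊗ M ⟶ M) (aN : A ⊗ N ⟶ N)
    (hM : μ[A] ▷ M ≫ aM = (α_ A A M).hom ≫ A ◁ aM ≫ aM)
    (hN : μ[A] ▷ N ≫ aN = (α_ A A N).hom ≫ A ◁ aN ≫ aN) :
    μ[A] ▷ (M ⊗ N) ≫ tensorAct Δ[A] aM aN =
      (α_ A A (M ⊗ N)).hom ≫ A ◁ tensorAct Δ[A] aM aN ≫ tensorAct Δ[A] aM aN := by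
  rw [tensorAct, ← comp_whiskerRight_assoc, BimonObj.mul_comul]
  simp only [comp_whiskerRight, Category.assoc]
  rw [tensorμ_natural_left_assoc, tensorHom_comp_tensorHom, hM, hN,
    ← tensorHom_comp_tensorHom, ← tensorHom_comp_tensorHom,
    tensor_associativity_assoc, ← tensorμ_natural_right_assoc]
  simp only [MonoidalCategory.whiskerLeft_comp, Category.assoc]
  simp only [whisker_exchange_assoc]
  simp only [Category.assoc, tensor_whiskerLeft]
  rw [MonoidalCategory.tensorHom_def Δ[A] Δ[A]]
  monoidal

theorem tensorActR_mul (aM : M ⊗ A ⟶ M) (aN : N ⊗ A ⟶ N)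
    (hM : M ◁ μ[A] ≫ aM = (α_ M A A).inv ≫ aM ▷ A ≫ aM)
    (hN : N ◁ μ[A] ≫ aN = (α_ N A A).inv ≫ aN ▷ A ≫ aN) :
    (M ⊗ N) ◁ μ[A] ≫ tensorActR Δ[A] aM aN =
      (α_ (M ⊗ N) A A).inv ≫ tensorActR Δ[A] aM aN ▷ A ≫ tensorActR Δ[A] aM aN := by
  have ta := tensor_associativity M N A A A A
  rw [← IsIso.inv_comp_eq, ← Category.assoc, ← Category.assoc, ← IsIso.eq_comp_inv] at ta
  rw [tensorActR, ← MonoidalCategory.whiskerLeft_comp_assoc, BimonObj.mul_comul]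
  simp only [MonoidalCategory.whiskerLeft_comp, Category.assoc]
  rw [tensorμ_natural_right_assoc, tensorHom_comp_tensorHom, hM, hN,
    ← tensorHom_comp_tensorHom, ← tensorHom_comp_tensorHom]
  have e : (M ⊗ N) ◁ tensorμ A A A A ≫ tensorμ M N (A ⊗ A) (A ⊗ A) ≫
      ((α_ M A A).inv ⊗ₘ (α_ N A A).inv) = (α_ (M ⊗ N) (A ⊗ A) (A ⊗ A)).inv ≫
        tensorμ M N A A ▷ (A ⊗ A) ≫ tensorμ (M ⊗ A) (N ⊗ A) A A := by
    rw [Iso.eq_inv_comp, ← tensor_associativity_assoc]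
    simp
  rw [reassoc_of% e, ← tensorμ_natural_left_assoc]
  simp only [comp_whiskerRight, Category.assoc]
  simp only [← whisker_exchange_assoc]
  simp only [Category.assoc, whiskerRight_tensor]
  rw [MonoidalCategory.tensorHom_def' Δ[A] Δ[A]]
  monoidal


theorem tensorCoact_counit (cM : M ⟶ A ⊗ M) (cN : N ⟶ A ⊗ N)
    (hM : cM ≫ ε[A] ▷ M = (λ_ M).inv) (hN : cN ≫ ε[A] ▷ N = (λ_ N).inv) :
    tensorCoact μ[A] cM cN ≫ ε[A] ▷ (M ⊗ N) = (λ_ (M ⊗ N)).inv := by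
  have e : tensorμ A M A N ≫ (ε[A] ⊗ₘ ε[A]) ▷ (M ⊗ N) =
      (ε[A] ▷ M ⊗ₘ ε[A] ▷ N) ≫ tensorμ (𝟙_ C) M (𝟙_ C) N := by
    have := tensorμ_natural ε[A] (𝟙 M) ε[A] (𝟙 N)
    simpa using this.symm
  rw [tensorCoact]
  simp only [Category.assoc]
  rw [← comp_whiskerRight, BimonObj.mul_counit, Comon.tensorObj_counit, comp_whiskerRight,
    reassoc_of% e, tensorHom_comp_tensorHom_assoc, hM, hN, ← cancel_mono (λ_ (M ⊗ N)).hom]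
  simp only [Category.assoc, ← leftUnitor_monoidal]
  simp

theorem tensorCoact_coassoc (cM : M ⟶ A ⊗ M) (cN : N ⟶ A ⊗ N)
    (hM : cM ≫ Δ[A] ▷ M = cM ≫ A ◁ cM ≫ (α_ A A M).inv)
    (hN : cN ≫ Δ[A] ▷ N = cN ≫ A ◁ cN ≫ (α_ A A N).inv) :
    tensorCoact μ[A] cM cN ≫ Δ[A] ▷ (M ⊗ N) =
      tensorCoact μ[A] cM cN ≫ A ◁ tensorCoact μ[A] cM cN ≫ (α_ A A (M ⊗ N)).inv := by
  have e : tensorμ A M A N ≫ (Δ[A] ⊗ₘ Δ[A]) ▷ (M ⊗ N) =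
      (Δ[A] ▷ M ⊗ₘ Δ[A] ▷ N) ≫ tensorμ (A ⊗ A) M (A ⊗ A) N := by
    have := tensorμ_natural Δ[A] (𝟙 M) Δ[A] (𝟙 N)
    simpa using this.symm
  have e2 : ((α_ A A M).inv ⊗ₘ (α_ A A N).inv) ≫ tensorμ (A ⊗ A) M (A ⊗ A) N ≫
      tensorμ A A A A ▷ (M ⊗ N) = tensorμ A (A ⊗ M) A (A ⊗ N) ≫ (A ⊗ A) ◁ tensorμ A M A N ≫
        (α_ (A ⊗ A) (A ⊗ A) (M ⊗ N)).inv := by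
    rw [← cancel_mono (α_ (A ⊗ A) (A ⊗ A) (M ⊗ N)).hom]
    simp only [Category.assoc, associator_monoidal]
    simp
  have e3 : tensorμ A M A N ≫ (A ⊗ A) ◁ (cM ⊗ₘ cN) =
      (A ◁ cM ⊗ₘ A ◁ cN) ≫ tensorμ A (A ⊗ M) A (A ⊗ N) := by
    have := tensorμ_natural (𝟙 A) cM (𝟙 A) cN
    simpa using this.symm
  rw [tensorCoact]
  simp only [Category.assoc]
  rw [← comp_whiskerRight, BimonObj.mul_comul]
  simp only [comp_whiskerRight]
  rw [reassoc_of% e, tensorHom_comp_tensorHom_assoc, hM, hN, ← tensorHom_comp_tensorHom_assoc,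
    ← tensorHom_comp_tensorHom_assoc, reassoc_of% e2, ← reassoc_of% e3]
  simp only [MonoidalCategory.whiskerLeft_comp, Category.assoc]
  simp only [← whisker_exchange_assoc]
  rw [MonoidalCategory.tensorHom_def' μ[A] μ[A]]
  monoidal

theorem tensorCoactR_counit (cM : M ⟶ M ⊗ A) (cN : N ⟶ N ⊗ A)
    (hM : cM ≫ M ◁ ε[A] = (ρ_ M).inv) (hN : cN ≫ N ◁ ε[A] = (ρ_ N).inv) :
    tensorCoactR μ[A] cM cN ≫ (M ⊗ N) ◁ ε[A] = (ρ_ (M ⊗ N)).inv := by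
  have e : tensorμ M A N A ≫ (M ⊗ N) ◁ (ε[A] ⊗ₘ ε[A]) =
      (M ◁ ε[A] ⊗ₘ N ◁ ε[A]) ≫ tensorμ M (𝟙_ C) N (𝟙_ C) := by
    have := tensorμ_natural (𝟙 M) ε[A] (𝟙 N) ε[A]
    simpa using this.symm
  rw [tensorCoactR]
  simp only [Category.assoc]
  rw [← MonoidalCategory.whiskerLeft_comp, BimonObj.mul_counit, Comon.tensorObj_counit,
    MonoidalCategory.whiskerLeft_comp, reassoc_of% e, tensorHom_comp_tensorHom_assoc, hM, hN,
    ← cancel_mono (ρ_ (M ⊗ N)).hom]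
  simp only [Category.assoc, ← rightUnitor_monoidal]
  simp

theorem tensorCoactR_coassoc (cM : M ⟶ M ⊗ A) (cN : N ⟶ N ⊗ A)
    (hM : cM ≫ M ◁ Δ[A] = cM ≫ cM ▷ A ≫ (α_ M A A).hom)
    (hN : cN ≫ N ◁ Δ[A] = cN ≫ cN ▷ A ≫ (α_ N A A).hom) :
    tensorCoactR μ[A] cM cN ≫ (M ⊗ N) ◁ Δ[A] =
      tensorCoactR μ[A] cM cN ≫ tensorCoactR μ[A] cM cN ▷ A ≫ (α_ (M ⊗ N) A A).hom := by
  have e : tensorμ M A N A ≫ (M ⊗ N) ◁ (Δ[A] ⊗ₘ Δ[A]) =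
      (M ◁ Δ[A] ⊗ₘ N ◁ Δ[A]) ≫ tensorμ M (A ⊗ A) N (A ⊗ A) := by
    have := tensorμ_natural (𝟙 M) Δ[A] (𝟙 N) Δ[A]
    simpa using this.symm
  have e3 : tensorμ M A N A ≫ (cM ⊗ₘ cN) ▷ (A ⊗ A) =
      (cM ▷ A ⊗ₘ cN ▷ A) ≫ tensorμ (M ⊗ A) A (N ⊗ A) A := by
    have := tensorμ_natural cM (𝟙 A) cN (𝟙 A)
    simpa using this.symm
  rw [tensorCoactR]
  simp only [Category.assoc]
  rw [← MonoidalCategory.whiskerLeft_comp, BimonObj.mul_comul]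
  simp only [MonoidalCategory.whiskerLeft_comp]
  rw [reassoc_of% e, tensorHom_comp_tensorHom_assoc, hM, hN, ← tensorHom_comp_tensorHom_assoc,
    ← tensorHom_comp_tensorHom_assoc, ← associator_monoidal_assoc, ← reassoc_of% e3]
  simp only [comp_whiskerRight, Category.assoc]
  simp only [whisker_exchange_assoc]
  rw [MonoidalCategory.tensorHom_def μ[A] μ[A]]
  monoidal

theorem tensorAct_natural {M' N' : C} (aM : A ⊗ M ⟶ M) (aN : A ⊗ N ⟶ N) (aM' : A ⊗ M' ⟶ M')
    (aN' : A ⊗ N' ⟶ N') (f : M ⟶ M') (g : N ⟶ N') (hf : aM ≫ f = A ◁ f ≫ aM')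
    (hg : aN ≫ g = A ◁ g ≫ aN') :
    tensorAct Δ[A] aM aN ≫ (f ⊗ₘ g) = A ◁ (f ⊗ₘ g) ≫ tensorAct Δ[A] aM' aN' := by
  simp only [tensorAct, Category.assoc]
  rw [tensorHom_comp_tensorHom, hf, hg, ← tensorHom_comp_tensorHom, ← tensorμ_natural_right_assoc,
    whisker_exchange_assoc]

theorem tensorActR_natural {M' N' : C} (aM : M ⊗ A ⟶ M) (aN : N ⊗ A ⟶ N) (aM' : M' ⊗ A ⟶ M')
    (aN' : N' ⊗ A ⟶ N') (f : M ⟶ M') (g : N ⟶ N') (hf : aM ≫ f = f ▷ A ≫ aM')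
    (hg : aN ≫ g = g ▷ A ≫ aN') :
    tensorActR Δ[A] aM aN ≫ (f ⊗ₘ g) = (f ⊗ₘ g) ▷ A ≫ tensorActR Δ[A] aM' aN' := by
  simp only [tensorActR, Category.assoc]
  rw [tensorHom_comp_tensorHom, hf, hg, ← tensorHom_comp_tensorHom, ← tensorμ_natural_left_assoc,
    whisker_exchange_assoc]

theorem tensorCoact_natural {M' N' : C} (cM : M ⟶ A ⊗ M) (cN : N ⟶ A ⊗ N) (cM' : M' ⟶ A ⊗ M')
    (cN' : N' ⟶ A ⊗ N') (f : M ⟶ M') (g : N ⟶ N') (hf : cM ≫ A ◁ f = f ≫ cM')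
    (hg : cN ≫ A ◁ g = g ≫ cN') :
    tensorCoact μ[A] cM cN ≫ A ◁ (f ⊗ₘ g) = (f ⊗ₘ g) ≫ tensorCoact μ[A] cM' cN' := by
  have e : tensorμ A M A N ≫ (A ⊗ A) ◁ (f ⊗ₘ g) =
      (A ◁ f ⊗ₘ A ◁ g) ≫ tensorμ A M' A N' := by
    have := tensorμ_natural (𝟙 A) f (𝟙 A) g
    simpa using this.symm
  simp only [tensorCoact, Category.assoc]
  rw [← whisker_exchange, reassoc_of% e, tensorHom_comp_tensorHom_assoc, hf, hg,
    ← tensorHom_comp_tensorHom_assoc]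

theorem tensorCoactR_natural {M' N' : C} (cM : M ⟶ M ⊗ A) (cN : N ⟶ N ⊗ A) (cM' : M' ⟶ M' ⊗ A)
    (cN' : N' ⟶ N' ⊗ A) (f : M ⟶ M') (g : N ⟶ N') (hf : cM ≫ f ▷ A = f ≫ cM')
    (hg : cN ≫ g ▷ A = g ≫ cN') :
    tensorCoactR μ[A] cM cN ≫ (f ⊗ₘ g) ▷ A = (f ⊗ₘ g) ≫ tensorCoactR μ[A] cM' cN' := by
  have e : tensorμ M A N A ≫ (f ⊗ₘ g) ▷ (A ⊗ A) =
      (f ▷ A ⊗ₘ g ▷ A) ≫ tensorμ M' A N' A := by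
    have := tensorμ_natural f (𝟙 A) g (𝟙 A)
    simpa using this.symm
  simp only [tensorCoactR, Category.assoc]
  rw [whisker_exchange, reassoc_of% e, tensorHom_comp_tensorHom_assoc, hf, hg,
    ← tensorHom_comp_tensorHom_assoc]

theorem tensorAct_assoc (aM : A ⊗ M ⟶ M) (aN : A ⊗ N ⟶ N) (aP : A ⊗ P ⟶ P) :
    tensorAct Δ[A] (tensorAct Δ[A] aM aN) aP ≫ (α_ M N P).hom =
      A ◁ (α_ M N P).hom ≫ tensorAct Δ[A] aM (tensorAct Δ[A] aN aP) := by
  have e := associator_monoidal A A A M N P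
  have e1 : tensorμ A A (M ⊗ N) P ≫ (Δ[A] ▷ (M ⊗ N) ⊗ₘ 𝟙 (A ⊗ P)) =
      (Δ[A] ▷ A) ▷ ((M ⊗ N) ⊗ P) ≫ tensorμ (A ⊗ A) A (M ⊗ N) P := by
    have := tensorμ_natural Δ[A] (𝟙 A) (𝟙 (M ⊗ N)) (𝟙 P)
    simpa using this.symm
  have e2 : tensorμ A A M (N ⊗ P) ≫ (𝟙 (A ⊗ M) ⊗ₘ Δ[A] ▷ (N ⊗ P)) =
      (A ◁ Δ[A]) ▷ (M ⊗ N ⊗ P) ≫ tensorμ A (A ⊗ A) M (N ⊗ P) := by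
    have := tensorμ_natural (𝟙 A) Δ[A] (𝟙 M) (𝟙 (N ⊗ P))
    simpa using this.symm
  have l : tensorAct Δ[A] (tensorAct Δ[A] aM aN) aP = Δ[A] ▷ _ ≫ (tensorμ A A (M ⊗ N) P ≫
      (Δ[A] ▷ (M ⊗ N) ⊗ₘ 𝟙 (A ⊗ P))) ≫ tensorμ A A M N ▷ (A ⊗ P) ≫ ((aM ⊗ₘ aN) ⊗ₘ aP) := by
    simp only [tensorAct, ← tensorHom_id (tensorμ A A M N), Category.assoc, tensorHom_comp_tensorHom,
      Category.id_comp]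
  have r : tensorAct Δ[A] aM (tensorAct Δ[A] aN aP) = Δ[A] ▷ _ ≫ (tensorμ A A M (N ⊗ P) ≫
      (𝟙 (A ⊗ M) ⊗ₘ Δ[A] ▷ (N ⊗ P))) ≫ (A ⊗ M) ◁ tensorμ A A N P ≫ (aM ⊗ₘ (aN ⊗ₘ aP)) := by
    simp only [tensorAct, ← id_tensorHom (A ⊗ M) (tensorμ A A N P), Category.assoc,
      tensorHom_comp_tensorHom, Category.id_comp]
  rw [l, r, e1, e2]
  simp only [Category.assoc]
  rw [associator_naturality, reassoc_of% e, whisker_exchange_assoc Δ[A], whisker_exchange_assoc (A ◁ Δ[A]),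
    MonoidalCategory.tensorHom_def (α_ A A A).hom, Category.assoc]
  simp only [← comp_whiskerRight_assoc]
  rw [ComonObj.comul_assoc]

theorem tensorActR_assoc (aM : M ⊗ A ⟶ M) (aN : N ⊗ A ⟶ N) (aP : P ⊗ A ⟶ P) :
    tensorActR Δ[A] (tensorActR Δ[A] aM aN) aP ≫ (α_ M N P).hom =
      (α_ M N P).hom ▷ A ≫ tensorActR Δ[A] aM (tensorActR Δ[A] aN aP) := by
  have e := associator_monoidal M N P A A A
  have e1 : tensorμ (M ⊗ N) P A A ≫ ((M ⊗ N) ◁ Δ[A] ⊗ₘ 𝟙 (P ⊗ A)) =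
      ((M ⊗ N) ⊗ P) ◁ (Δ[A] ▷ A) ≫ tensorμ (M ⊗ N) P (A ⊗ A) A := by
    have := tensorμ_natural (𝟙 (M ⊗ N)) (𝟙 P) Δ[A] (𝟙 A)
    simpa using this.symm
  have e2 : tensorμ M (N ⊗ P) A A ≫ (𝟙 (M ⊗ A) ⊗ₘ (N ⊗ P) ◁ Δ[A]) =
      (M ⊗ N ⊗ P) ◁ (A ◁ Δ[A]) ≫ tensorμ M (N ⊗ P) A (A ⊗ A) := by
    have := tensorμ_natural (𝟙 M) (𝟙 (N ⊗ P)) (𝟙 A) Δ[A]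
    simpa using this.symm
  have l : tensorActR Δ[A] (tensorActR Δ[A] aM aN) aP = _ ◁ Δ[A] ≫ (tensorμ (M ⊗ N) P A A ≫
      ((M ⊗ N) ◁ Δ[A] ⊗ₘ 𝟙 (P ⊗ A))) ≫ tensorμ M N A A ▷ (P ⊗ A) ≫ ((aM ⊗ₘ aN) ⊗ₘ aP) := by
    simp only [tensorActR, ← tensorHom_id (tensorμ M N A A), Category.assoc, tensorHom_comp_tensorHom,
      Category.id_comp]
  have r : tensorActR Δ[A] aM (tensorActR Δ[A] aN aP) = _ ◁ Δ[A] ≫ (tensorμ M (N ⊗ P) A A ≫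
      (𝟙 (M ⊗ A) ⊗ₘ (N ⊗ P) ◁ Δ[A])) ≫ (M ⊗ A) ◁ tensorμ N P A A ≫ (aM ⊗ₘ (aN ⊗ₘ aP)) := by
    simp only [tensorActR, ← id_tensorHom (M ⊗ A) (tensorμ N P A A), Category.assoc,
      tensorHom_comp_tensorHom, Category.id_comp]
  rw [l, r, e1, e2]
  simp only [Category.assoc]
  rw [associator_naturality, reassoc_of% e, ← whisker_exchange_assoc (α_ M N P).hom,
    ← whisker_exchange_assoc (α_ M N P).hom, MonoidalCategory.tensorHom_def' (α_ M N P).hom,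
    Category.assoc]
  simp only [← MonoidalCategory.whiskerLeft_comp_assoc]
  rw [ComonObj.comul_assoc]

theorem tensorCoact_assoc (cM : M ⟶ A ⊗ M) (cN : N ⟶ A ⊗ N) (cP : P ⟶ A ⊗ P) :
    tensorCoact μ[A] (tensorCoact μ[A] cM cN) cP ≫ A ◁ (α_ M N P).hom =
      (α_ M N P).hom ≫ tensorCoact μ[A] cM (tensorCoact μ[A] cN cP) := by
  have e := tensor_associativity A M A N A P
  have e1 : (μ[A] ▷ (M ⊗ N) ⊗ₘ 𝟙 (A ⊗ P)) ≫ tensorμ A (M ⊗ N) A P =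
      tensorμ (A ⊗ A) (M ⊗ N) A P ≫ (μ[A] ▷ A) ▷ ((M ⊗ N) ⊗ P) := by
    have := tensorμ_natural μ[A] (𝟙 (M ⊗ N)) (𝟙 A) (𝟙 P)
    simpa using this
  have e2 : (𝟙 (A ⊗ M) ⊗ₘ μ[A] ▷ (N ⊗ P)) ≫ tensorμ A M A (N ⊗ P) =
      tensorμ A M (A ⊗ A) (N ⊗ P) ≫ (A ◁ μ[A]) ▷ (M ⊗ N ⊗ P) := by
    have := tensorμ_natural (𝟙 A) (𝟙 M) μ[A] (𝟙 (N ⊗ P))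
    simpa using this
  have l : tensorCoact μ[A] (tensorCoact μ[A] cM cN) cP = ((cM ⊗ₘ cN) ⊗ₘ cP) ≫
      tensorμ A M A N ▷ (A ⊗ P) ≫ ((μ[A] ▷ (M ⊗ N) ⊗ₘ 𝟙 (A ⊗ P)) ≫ tensorμ A (M ⊗ N) A P) ≫
      μ[A] ▷ _ := by
    simp only [tensorCoact, ← tensorHom_id (tensorμ A M A N), Category.assoc,
      tensorHom_comp_tensorHom_assoc, Category.comp_id]
  have r : tensorCoact μ[A] cM (tensorCoact μ[A] cN cP) = (cM ⊗ₘ (cN ⊗ₘ cP)) ≫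
      (A ⊗ M) ◁ tensorμ A N A P ≫ ((𝟙 (A ⊗ M) ⊗ₘ μ[A] ▷ (N ⊗ P)) ≫ tensorμ A M A (N ⊗ P)) ≫
      μ[A] ▷ _ := by
    simp only [tensorCoact, ← id_tensorHom (A ⊗ M) (tensorμ A N A P), Category.assoc,
      tensorHom_comp_tensorHom_assoc, Category.comp_id]
  rw [l, r, e1, e2]
  simp only [Category.assoc]
  rw [← associator_naturality_assoc, ← reassoc_of% e]
  simp only [← comp_whiskerRight, ← comp_whiskerRight_assoc]
  rw [MonObj.mul_assoc, MonoidalCategory.tensorHom_def (α_ A A A).hom]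
  simp only [comp_whiskerRight, Category.assoc]
  simp only [whisker_exchange, whisker_exchange_assoc]

theorem tensorCoactR_assoc (cM : M ⟶ M ⊗ A) (cN : N ⟶ N ⊗ A) (cP : P ⟶ P ⊗ A) :
    tensorCoactR μ[A] (tensorCoactR μ[A] cM cN) cP ≫ (α_ M N P).hom ▷ A =
      (α_ M N P).hom ≫ tensorCoactR μ[A] cM (tensorCoactR μ[A] cN cP) := by
  have e := tensor_associativity M A N A P A
  have e1 : ((M ⊗ N) ◁ μ[A] ⊗ₘ 𝟙 (P ⊗ A)) ≫ tensorμ (M ⊗ N) A P A =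
      tensorμ (M ⊗ N) (A ⊗ A) P A ≫ ((M ⊗ N) ⊗ P) ◁ (μ[A] ▷ A) := by
    have := tensorμ_natural (𝟙 (M ⊗ N)) μ[A] (𝟙 P) (𝟙 A)
    simpa using this
  have e2 : (𝟙 (M ⊗ A) ⊗ₘ (N ⊗ P) ◁ μ[A]) ≫ tensorμ M A (N ⊗ P) A =
      tensorμ M A (N ⊗ P) (A ⊗ A) ≫ (M ⊗ N ⊗ P) ◁ (A ◁ μ[A]) := by
    have := tensorμ_natural (𝟙 M) (𝟙 A) (𝟙 (N ⊗ P)) μ[A]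
    simpa using this
  have l : tensorCoactR μ[A] (tensorCoactR μ[A] cM cN) cP = ((cM ⊗ₘ cN) ⊗ₘ cP) ≫
      tensorμ M A N A ▷ (P ⊗ A) ≫ (((M ⊗ N) ◁ μ[A] ⊗ₘ 𝟙 (P ⊗ A)) ≫ tensorμ (M ⊗ N) A P A) ≫
      _ ◁ μ[A] := by
    simp only [tensorCoactR, ← tensorHom_id (tensorμ M A N A), Category.assoc,
      tensorHom_comp_tensorHom_assoc, Category.comp_id]
  have r : tensorCoactR μ[A] cM (tensorCoactR μ[A] cN cP) = (cM ⊗ₘ (cN ⊗ₘ cP)) ≫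
      (M ⊗ A) ◁ tensorμ N A P A ≫ ((𝟙 (M ⊗ A) ⊗ₘ (N ⊗ P) ◁ μ[A]) ≫ tensorμ M A (N ⊗ P) A) ≫
      _ ◁ μ[A] := by
    simp only [tensorCoactR, ← id_tensorHom (M ⊗ A) (tensorμ N A P A), Category.assoc,
      tensorHom_comp_tensorHom_assoc, Category.comp_id]
  rw [l, r, e1, e2]
  simp only [Category.assoc]
  rw [← associator_naturality_assoc, ← reassoc_of% e]
  simp only [← MonoidalCategory.whiskerLeft_comp, ← MonoidalCategory.whiskerLeft_comp_assoc]
  rw [MonObj.mul_assoc, MonoidalCategory.tensorHom_def' (α_ M N P).hom]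
  simp only [MonoidalCategory.whiskerLeft_comp, Category.assoc]
  simp only [← whisker_exchange, ← whisker_exchange_assoc]

theorem tensorAct_left_unit (aN : A ⊗ N ⟶ N) :
    tensorAct Δ[A] ((ρ_ A).hom ≫ ε[A]) aN ≫ (λ_ N).hom = A ◁ (λ_ N).hom ≫ aN := by
  have h : Δ[A] ▷ N ≫ ε[A] ▷ A ▷ N = (λ_ A).inv ▷ N := by
    rw [← comp_whiskerRight, ComonObj.counit_comul]
  calc
    _ = A ◁ (λ_ N).hom ≫ (Δ[A] ▷ N ≫ ε[A] ▷ A ▷ N) ≫ (α_ _ _ _).hom ≫ (λ_ _).hom ≫ aN := by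
      simp only [tensorAct, tensorμ, braiding_tensorUnit_right, MonoidalCategory.tensorHom_def]
      rw [← cancel_epi (A ◁ (λ_ N).inv)]
      monoidal
    _ = _ := by rw [h]; monoidal

theorem tensorAct_right_unit (aM : A ⊗ M ⟶ M) :
    tensorAct Δ[A] aM ((ρ_ A).hom ≫ ε[A]) ≫ (ρ_ M).hom = A ◁ (ρ_ M).hom ≫ aM := by
  have h : Δ[A] ▷ M ≫ (A ◁ ε[A]) ▷ M = (ρ_ A).inv ▷ M := by
    rw [← comp_whiskerRight, ComonObj.comul_counit]
  have h2 : (β_ A M).hom ≫ M ◁ ε[A] = ε[A] ▷ M ≫ (λ_ M).hom ≫ (ρ_ M).inv := by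
    rw [← braiding_naturality_left, braiding_tensorUnit_left]
  calc
    _ = A ◁ (ρ_ M).hom ≫ Δ[A] ▷ M ⊗≫ A ◁ ((β_ A M).hom ≫ M ◁ ε[A]) ⊗≫ aM := by
      simp only [tensorAct, tensorμ, MonoidalCategory.tensorHom_def']
      rw [← cancel_epi (A ◁ (ρ_ M).inv)]
      monoidal
    _ = A ◁ (ρ_ M).hom ≫ (Δ[A] ▷ M ≫ (A ◁ ε[A]) ▷ M) ⊗≫ aM := by rw [h2]; monoidal
    _ = _ := by rw [h]; monoidal

theorem tensorActR_left_unit (aN : N ⊗ A ⟶ N) :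
    tensorActR Δ[A] ((λ_ A).hom ≫ ε[A]) aN ≫ (λ_ N).hom = (λ_ N).hom ▷ A ≫ aN := by
  have h : N ◁ Δ[A] ≫ N ◁ ε[A] ▷ A = N ◁ (λ_ A).inv := by
    rw [← MonoidalCategory.whiskerLeft_comp, ComonObj.counit_comul]
  have h2 : (β_ N A).hom ≫ ε[A] ▷ N = N ◁ ε[A] ≫ (ρ_ N).hom ≫ (λ_ N).inv := by
    rw [← braiding_naturality_right, braiding_tensorUnit_right]
  calc
    _ = (λ_ N).hom ▷ A ≫ N ◁ Δ[A] ⊗≫ ((β_ N A).hom ≫ ε[A] ▷ N) ▷ A ⊗≫ aN := by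
      simp only [tensorActR, tensorμ, MonoidalCategory.tensorHom_def]
      rw [← cancel_epi ((λ_ N).inv ▷ A)]
      monoidal
    _ = (λ_ N).hom ▷ A ≫ (N ◁ Δ[A] ≫ N ◁ ε[A] ▷ A) ⊗≫ aN := by rw [h2]; monoidal
    _ = _ := by rw [h]; monoidal

theorem tensorActR_right_unit (aM : M ⊗ A ⟶ M) :
    tensorActR Δ[A] aM ((λ_ A).hom ≫ ε[A]) ≫ (ρ_ M).hom = (ρ_ M).hom ▷ A ≫ aM := by
  have h : M ◁ Δ[A] ≫ M ◁ A ◁ ε[A] = M ◁ (ρ_ A).inv := by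
    rw [← MonoidalCategory.whiskerLeft_comp, ComonObj.comul_counit]
  calc
    _ = (ρ_ M).hom ▷ A ≫ (M ◁ Δ[A] ≫ M ◁ A ◁ ε[A]) ⊗≫ aM := by
      simp only [tensorActR, tensorμ, braiding_tensorUnit_left, MonoidalCategory.tensorHom_def']
      rw [← cancel_epi ((ρ_ M).inv ▷ A)]
      monoidal
    _ = _ := by rw [h]; monoidal

theorem tensorCoact_left_unit (cN : N ⟶ A ⊗ N) :
    tensorCoact μ[A] (η[A] ≫ (ρ_ A).inv) cN ≫ A ◁ (λ_ N).hom = (λ_ N).hom ≫ cN := by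
  have h : η[A] ▷ A ▷ N ≫ μ[A] ▷ N = (λ_ A).hom ▷ N := by
    rw [← comp_whiskerRight, MonObj.one_mul]
  calc
    _ = (λ_ N).hom ≫ cN ⊗≫ (η[A] ▷ A ▷ N ≫ μ[A] ▷ N) := by
      simp only [tensorCoact, tensorμ, braiding_tensorUnit_left, MonoidalCategory.tensorHom_def']
      rw [← cancel_epi (λ_ N).inv]
      monoidal
    _ = _ := by rw [h]; monoidal

theorem tensorCoact_right_unit (cM : M ⟶ A ⊗ M) :
    tensorCoact μ[A] cM (η[A] ≫ (ρ_ A).inv) ≫ A ◁ (ρ_ M).hom = (ρ_ M).hom ≫ cM := by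
  have h : (A ◁ η[A]) ▷ M ≫ μ[A] ▷ M = (ρ_ A).hom ▷ M := by
    rw [← comp_whiskerRight, MonObj.mul_one]
  have h2 : M ◁ η[A] ≫ (β_ M A).hom = (ρ_ M).hom ≫ (λ_ M).inv ≫ η[A] ▷ M := by
    rw [braiding_naturality_right, braiding_tensorUnit_right, Category.assoc]
  calc
    _ = (ρ_ M).hom ≫ cM ⊗≫ A ◁ (M ◁ η[A] ≫ (β_ M A).hom) ⊗≫ μ[A] ▷ M := by
      simp only [tensorCoact, tensorμ, MonoidalCategory.tensorHom_def]
      rw [← cancel_epi (ρ_ M).inv]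
      monoidal
    _ = (ρ_ M).hom ≫ cM ⊗≫ ((A ◁ η[A]) ▷ M ≫ μ[A] ▷ M) := by rw [h2]; monoidal
    _ = _ := by rw [h]; monoidal

theorem tensorCoactR_left_unit (cN : N ⟶ N ⊗ A) :
    tensorCoactR μ[A] (η[A] ≫ (λ_ A).inv) cN ≫ (λ_ N).hom ▷ A = (λ_ N).hom ≫ cN := by
  have h : N ◁ η[A] ▷ A ≫ N ◁ μ[A] = N ◁ (λ_ A).hom := by
    rw [← MonoidalCategory.whiskerLeft_comp, MonObj.one_mul]
  have h2 : η[A] ▷ N ≫ (β_ A N).hom = (λ_ N).hom ≫ (ρ_ N).inv ≫ N ◁ η[A] := by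
    rw [braiding_naturality_left, braiding_tensorUnit_left, Category.assoc]
  calc
    _ = (λ_ N).hom ≫ cN ⊗≫ (η[A] ▷ N ≫ (β_ A N).hom) ▷ A ⊗≫ N ◁ μ[A] := by
      simp only [tensorCoactR, tensorμ, MonoidalCategory.tensorHom_def']
      rw [← cancel_epi (λ_ N).inv]
      monoidal
    _ = (λ_ N).hom ≫ cN ⊗≫ (N ◁ η[A] ▷ A ≫ N ◁ μ[A]) := by rw [h2]; monoidal
    _ = _ := by rw [h]; monoidal

theorem tensorCoactR_right_unit (cM : M ⟶ M ⊗ A) :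
    tensorCoactR μ[A] cM (η[A] ≫ (λ_ A).inv) ≫ (ρ_ M).hom ▷ A = (ρ_ M).hom ≫ cM := by
  have h : M ◁ A ◁ η[A] ≫ M ◁ μ[A] = M ◁ (ρ_ A).hom := by
    rw [← MonoidalCategory.whiskerLeft_comp, MonObj.mul_one]
  calc
    _ = (ρ_ M).hom ≫ cM ⊗≫ (M ◁ A ◁ η[A] ≫ M ◁ μ[A]) := by
      simp only [tensorCoactR, tensorμ, braiding_tensorUnit_right, MonoidalCategory.tensorHom_def]
      rw [← cancel_epi (ρ_ M).inv]
      monoidal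
    _ = _ := by rw [h]; monoidal


theorem unitAct_one : η[A] ▷ 𝟙_ C ≫ (ρ_ A).hom ≫ ε[A] = (λ_ (𝟙_ C)).hom := by
  rw [rightUnitor_naturality_assoc, BimonObj.one_counit, Category.comp_id, unitors_equal]

theorem unitActR_one : 𝟙_ C ◁ η[A] ≫ (λ_ A).hom ≫ ε[A] = (ρ_ (𝟙_ C)).hom := by
  rw [leftUnitor_naturality_assoc, BimonObj.one_counit, Category.comp_id, unitors_equal]

theorem unitAct_mul : μ[A] ▷ 𝟙_ C ≫ (ρ_ A).hom ≫ ε[A] =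
    (α_ A A (𝟙_ C)).hom ≫ A ◁ ((ρ_ A).hom ≫ ε[A]) ≫ (ρ_ A).hom ≫ ε[A] := by
  rw [rightUnitor_naturality_assoc, BimonObj.mul_counit, Comon.tensorObj_counit,
    MonoidalCategory.tensorHom_def']
  monoidal

theorem unitActR_mul : 𝟙_ C ◁ μ[A] ≫ (λ_ A).hom ≫ ε[A] =
    (α_ (𝟙_ C) A A).inv ≫ ((λ_ A).hom ≫ ε[A]) ▷ A ≫ (λ_ A).hom ≫ ε[A] := by
  rw [leftUnitor_naturality_assoc, BimonObj.mul_counit, Comon.tensorObj_counit,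
    MonoidalCategory.tensorHom_def]
  monoidal

theorem unitCoact_counit : (η[A] ≫ (ρ_ A).inv) ≫ ε[A] ▷ 𝟙_ C = (λ_ (𝟙_ C)).inv := by
  rw [Category.assoc, ← rightUnitor_inv_naturality, BimonObj.one_counit_assoc, unitors_inv_equal]

theorem unitCoactR_counit : (η[A] ≫ (λ_ A).inv) ≫ 𝟙_ C ◁ ε[A] = (ρ_ (𝟙_ C)).inv := by
  rw [Category.assoc, ← leftUnitor_inv_naturality, BimonObj.one_counit_assoc, unitors_inv_equal]

theorem unitCoact_coassoc : (η[A] ≫ (ρ_ A).inv) ≫ Δ[A] ▷ 𝟙_ C =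
    (η[A] ≫ (ρ_ A).inv) ≫ A ◁ (η[A] ≫ (ρ_ A).inv) ≫ (α_ A A (𝟙_ C)).inv := by
  rw [Category.assoc, ← rightUnitor_inv_naturality, BimonObj.one_comul_assoc,
    MonObj.tensorObj.one_def, MonoidalCategory.tensorHom_def]
  monoidal

theorem unitCoactR_coassoc : (η[A] ≫ (λ_ A).inv) ≫ 𝟙_ C ◁ Δ[A] =
    (η[A] ≫ (λ_ A).inv) ≫ (η[A] ≫ (λ_ A).inv) ▷ A ≫ (α_ (𝟙_ C) A A).hom := by
  rw [Category.assoc, ← leftUnitor_inv_naturality, BimonObj.one_comul_assoc,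
    MonObj.tensorObj.one_def, MonoidalCategory.tensorHom_def']
  monoidal

theorem unit_yd : ydL Δ[A] μ[A] ((ρ_ A).hom ≫ ε[A]) (η[A] ≫ (ρ_ A).inv) =
    ydR Δ[A] μ[A] ((ρ_ A).hom ≫ ε[A]) (η[A] ≫ (ρ_ A).inv) := by
  have h1 : Δ[A] ≫ ε[A] ▷ A ≫ η[A] ▷ A ≫ μ[A] = 𝟙 A := by
    rw [ComonObj.counit_comul_assoc, MonObj.one_mul, Iso.inv_hom_id]
  have h2 : A ◁ η[A] ≫ (β_ A A).hom = (ρ_ A).hom ≫ (λ_ A).inv ≫ η[A] ▷ A := by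
    rw [braiding_naturality_right, braiding_tensorUnit_right, Category.assoc]
  have h3 : A ◁ η[A] ≫ μ[A] = (ρ_ A).hom := MonObj.mul_one A
  have h4 : Δ[A] ≫ A ◁ ε[A] = (ρ_ A).inv := ComonObj.comul_counit A
  trans 𝟙 (A ⊗ 𝟙_ C)
  · calc
      _ = (Δ[A] ≫ ε[A] ▷ A ≫ η[A] ▷ A ≫ μ[A]) ▷ 𝟙_ C := by
        simp only [ydL, braiding_tensorUnit_right, braiding_tensorUnit_left]
        monoidal
      _ = _ := by rw [h1, id_whiskerRight]
  · symm
    calc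
      _ = Δ[A] ▷ 𝟙_ C ⊗≫ A ◁ (A ◁ η[A] ≫ (β_ A A).hom) ▷ 𝟙_ C ⊗≫ μ[A] ▷ A ▷ 𝟙_ C ⊗≫
          A ◁ ε[A] ▷ 𝟙_ C ⊗≫ 𝟙 (A ⊗ 𝟙_ C) := by
        simp only [ydR, tensorμ, MonoidalCategory.tensorHom_def]
        monoidal
      _ = Δ[A] ▷ 𝟙_ C ⊗≫ ((A ◁ η[A] ≫ μ[A]) ▷ A) ▷ 𝟙_ C ⊗≫
          A ◁ ε[A] ▷ 𝟙_ C ⊗≫ 𝟙 (A ⊗ 𝟙_ C) := by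
        rw [h2]; monoidal
      _ = (Δ[A] ≫ A ◁ ε[A]) ▷ 𝟙_ C ⊗≫ 𝟙 (A ⊗ 𝟙_ C) := by rw [h3]; monoidal
      _ = _ := by rw [h4]; monoidal

theorem unit_yd' : ydL' Δ[A] μ[A] ((λ_ A).hom ≫ ε[A]) (η[A] ≫ (λ_ A).inv) =
    ydR' Δ[A] μ[A] ((λ_ A).hom ≫ ε[A]) (η[A] ≫ (λ_ A).inv) := by
  have h1 : Δ[A] ≫ A ◁ ε[A] ≫ A ◁ η[A] ≫ μ[A] = 𝟙 A := by
    rw [ComonObj.comul_counit_assoc, MonObj.mul_one, Iso.inv_hom_id]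
  have h2 : η[A] ▷ A ≫ (β_ A A).hom = (λ_ A).hom ≫ (ρ_ A).inv ≫ A ◁ η[A] := by
    rw [braiding_naturality_left, braiding_tensorUnit_left, Category.assoc]
  have h3 : η[A] ▷ A ≫ μ[A] = (λ_ A).hom := MonObj.one_mul A
  have h4 : Δ[A] ≫ ε[A] ▷ A = (λ_ A).inv := ComonObj.counit_comul A
  trans 𝟙 (𝟙_ C ⊗ A)
  · calc
      _ = 𝟙_ C ◁ (Δ[A] ≫ A ◁ ε[A] ≫ A ◁ η[A] ≫ μ[A]) := by
        simp only [ydL', braiding_tensorUnit_right, braiding_tensorUnit_left]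
        monoidal
      _ = _ := by rw [h1, MonoidalCategory.whiskerLeft_id]
  · symm
    calc
      _ = 𝟙_ C ◁ Δ[A] ⊗≫ 𝟙_ C ◁ (η[A] ▷ A ≫ (β_ A A).hom) ▷ A ⊗≫ 𝟙_ C ◁ A ◁ μ[A] ⊗≫
          𝟙_ C ◁ ε[A] ▷ A ⊗≫ 𝟙 (𝟙_ C ⊗ A) := by
        simp only [ydR', tensorμ, MonoidalCategory.tensorHom_def']
        monoidal
      _ = 𝟙_ C ◁ Δ[A] ⊗≫ 𝟙_ C ◁ A ◁ (η[A] ▷ A ≫ μ[A]) ⊗≫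
          𝟙_ C ◁ ε[A] ▷ A ⊗≫ 𝟙 (𝟙_ C ⊗ A) := by
        rw [h2]; monoidal
      _ = 𝟙_ C ◁ (Δ[A] ≫ ε[A] ▷ A) ⊗≫ 𝟙 (𝟙_ C ⊗ A) := by rw [h3]; monoidal
      _ = _ := by rw [h4]; monoidal

end Bialgebra

section Modules

open scoped MonObj ComonObj

variable {C : Type u} [Category.{v} C] [MonoidalCategory C] {A : C}

/-- The action `A ⊗ M ⟶ M` of a left module. -/
abbrev lact [MonObj A] (M : Mod C A) : A ⊗ M.X ⟶ M.X := ModObj.smul (M := A) (X := M.X)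

theorem one_lact [MonObj A] (M : Mod C A) : η[A] ▷ M.X ≫ lact M = (λ_ M.X).hom :=
  ModObj.one_smul (M := A) M.X

theorem mul_lact [MonObj A] (M : Mod C A) :
    μ[A] ▷ M.X ≫ lact M = (α_ A A M.X).hom ≫ A ◁ lact M ≫ lact M :=
  ModObj.mul_smul (M := A) M.X

theorem lact_hom [MonObj A] {M N : Mod C A} (f : M ⟶ N) :
    lact M ≫ f.hom = A ◁ f.hom ≫ lact N :=
  IsModHom.smul_hom (A := A) (f := f.hom)

/-- The left module with a given action. -/
abbrev lmk [MonObj A] (X : C) (a : A ⊗ X ⟶ X) (h₁ : η[A] ▷ X ≫ a = (λ_ X).hom)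
    (h₂ : μ[A] ▷ X ≫ a = (α_ A A X).hom ≫ A ◁ a ≫ a) : Mod C A :=
  { X := X
    mod := { smul := a, one_smul := h₁, mul_smul := h₂ } }

/-- An isomorphism of left modules from a linear isomorphism. -/
def lisoMk [MonObj A] {M N : Mod C A} (e : M.X ≅ N.X) (h : lact M ≫ e.hom = A ◁ e.hom ≫ lact N) :
    M ≅ N where
  hom := .mk' e.hom h
  inv := .mk' e.inv (by
    change lact N ≫ e.inv = A ◁ e.inv ≫ lact M
    rw [Iso.comp_inv_eq, Category.assoc, h, whiskerLeft_inv_hom_assoc])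
  hom_inv_id := Mod.hom_ext _ _ e.hom_inv_id
  inv_hom_id := Mod.hom_ext _ _ e.inv_hom_id

variable [BraidedCategory C] [BimonObj A]

instance : MonoidalCategoryStruct (Mod C A) where
  tensorObj M N := lmk (M.X ⊗ N.X) (tensorAct Δ[A] (lact M) (lact N))
    (tensorAct_one _ _ (one_lact M) (one_lact N)) (tensorAct_mul _ _ (mul_lact M) (mul_lact N))
  tensorUnit := lmk (𝟙_ C) ((ρ_ A).hom ≫ ε[A]) unitAct_one unitAct_mul
  tensorHom f g := .mk' (f.hom ⊗ₘ g.hom) (tensorAct_natural _ _ _ _ _ _ (lact_hom f) (lact_hom g))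
  whiskerLeft M _ _ g := .mk' (M.X ◁ g.hom) (by
    have := tensorAct_natural _ _ _ _ _ _ (lact_hom (𝟙 M)) (lact_hom g)
    rwa [Mod.id_hom', id_tensorHom] at this)
  whiskerRight f N := .mk' (f.hom ▷ N.X) (by
    have := tensorAct_natural _ _ _ _ _ _ (lact_hom f) (lact_hom (𝟙 N))
    rwa [Mod.id_hom', tensorHom_id] at this)
  associator M N P := lisoMk (α_ M.X N.X P.X) (tensorAct_assoc _ _ _)
  leftUnitor M := lisoMk (λ_ M.X) (tensorAct_left_unit _)
  rightUnitor M := lisoMk (ρ_ M.X) (tensorAct_right_unit _)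

/-- Left modules over a bialgebra form a monoidal category, with the tensor product, unit and
constraints of the ambient category. -/
instance : MonoidalCategory (Mod C A) where
  tensorHom_def f g := Mod.hom_ext _ _ (MonoidalCategory.tensorHom_def f.hom g.hom)
  id_tensorHom_id M N := Mod.hom_ext _ _ (id_tensorHom_id M.X N.X)
  tensorHom_comp_tensorHom f₁ f₂ g₁ g₂ :=
    Mod.hom_ext _ _ (tensorHom_comp_tensorHom f₁.hom f₂.hom g₁.hom g₂.hom)
  whiskerLeft_id M N := Mod.hom_ext _ _ (MonoidalCategory.whiskerLeft_id M.X N.X)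
  id_whiskerRight M N := Mod.hom_ext _ _ (id_whiskerRight M.X N.X)
  associator_naturality f g h :=
    Mod.hom_ext _ _ (associator_naturality f.hom g.hom h.hom)
  leftUnitor_naturality f := Mod.hom_ext _ _ (leftUnitor_naturality f.hom)
  rightUnitor_naturality f := Mod.hom_ext _ _ (rightUnitor_naturality f.hom)
  pentagon M N P Q := Mod.hom_ext _ _ (pentagon M.X N.X P.X Q.X)
  triangle M N := Mod.hom_ext _ _ (triangle M.X N.X)

end Modules

section RightModules

open scoped MonObj ComonObj

variable {C : Type u} [Category.{v} C] [MonoidalCategory C]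

variable (C) in
/-- A right module over a monoid object. -/
structure RMod (A : C) [MonObj A] where
  /-- The underlying object. -/
  X : C
  /-- The action. -/
  act : X ⊗ A ⟶ X
  act_one : X ◁ η[A] ≫ act = (ρ_ X).hom
  act_mul : X ◁ μ[A] ≫ act = (α_ X A A).inv ≫ act ▷ A ≫ act

namespace RMod

variable {A : C}

/-- A linear morphism of right modules. -/
@[ext]
structure Hom [MonObj A] (M N : RMod C A) where
  /-- The underlying morphism. -/
  hom : M.X ⟶ N.X
  act_hom : M.act ≫ hom = hom ▷ A ≫ N.act

instance [MonObj A] : Category (RMod C A) where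
  Hom M N := Hom M N
  id M := { hom := 𝟙 M.X, act_hom := by simp }
  comp f g :=
    { hom := f.hom ≫ g.hom
      act_hom := by
        rw [← Category.assoc, f.act_hom, Category.assoc, g.act_hom, comp_whiskerRight,
          Category.assoc] }
  id_comp f := Hom.ext (Category.id_comp f.hom)
  comp_id f := Hom.ext (Category.comp_id f.hom)
  assoc f g h := Hom.ext (Category.assoc f.hom g.hom h.hom)

/-- The forgetful functor to the ambient category. -/
def forget (A : C) [MonObj A] : RMod C A ⥤ C where
  obj M := M.X
  map f := f.hom

/-- Restriction of scalars along a morphism of monoid objects. -/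
def comap {A B : C} [MonObj A] [MonObj B] (f : A ⟶ B) [IsMonHom f] : RMod C B ⥤ RMod C A where
  obj M :=
    { X := M.X
      act := M.X ◁ f ≫ M.act
      act_one := by
        rw [← MonoidalCategory.whiskerLeft_comp_assoc, IsMonHom.one_hom, M.act_one]
      act_mul := by
        rw [← MonoidalCategory.whiskerLeft_comp_assoc, IsMonHom.mul_hom,
          MonoidalCategory.whiskerLeft_comp_assoc, M.act_mul, MonoidalCategory.tensorHom_def]
        rw [comp_whiskerRight, Category.assoc, ← whisker_exchange_assoc]
        simp }
  map {M N} g :=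
    { hom := g.hom
      act_hom := by
        change (M.X ◁ f ≫ M.act) ≫ g.hom = g.hom ▷ A ≫ N.X ◁ f ≫ N.act
        rw [Category.assoc, g.act_hom, whisker_exchange_assoc] }

/-- An isomorphism of right modules from a linear isomorphism. -/
def isoMk [MonObj A] {M N : RMod C A} (e : M.X ≅ N.X) (h : M.act ≫ e.hom = e.hom ▷ A ≫ N.act) :
    M ≅ N where
  hom := ⟨e.hom, h⟩
  inv := ⟨e.inv, by rw [Iso.comp_inv_eq, Category.assoc, h, inv_hom_whiskerRight_assoc]⟩
  hom_inv_id := Hom.ext e.hom_inv_id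
  inv_hom_id := Hom.ext e.inv_hom_id

variable [BraidedCategory C] [BimonObj A]

instance : MonoidalCategoryStruct (RMod C A) where
  tensorObj M N :=
    { X := M.X ⊗ N.X
      act := tensorActR Δ[A] M.act N.act
      act_one := tensorActR_one _ _ M.act_one N.act_one
      act_mul := tensorActR_mul _ _ M.act_mul N.act_mul }
  tensorUnit := ⟨𝟙_ C, (λ_ A).hom ≫ ε[A], unitActR_one, unitActR_mul⟩
  tensorHom f g := ⟨f.hom ⊗ₘ g.hom, tensorActR_natural _ _ _ _ _ _ f.act_hom g.act_hom⟩
  whiskerLeft M _ _ g := ⟨M.X ◁ g.hom, by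
    have := tensorActR_natural _ _ _ _ _ _ (Hom.act_hom (𝟙 M)) g.act_hom
    exact (id_tensorHom M.X g.hom) ▸ this⟩
  whiskerRight f N := ⟨f.hom ▷ N.X, by
    have := tensorActR_natural _ _ _ _ _ _ f.act_hom (Hom.act_hom (𝟙 N))
    exact (tensorHom_id f.hom N.X) ▸ this⟩
  associator M N P := isoMk (α_ M.X N.X P.X) (tensorActR_assoc _ _ _)
  leftUnitor M := isoMk (λ_ M.X) (tensorActR_left_unit _)
  rightUnitor M := isoMk (ρ_ M.X) (tensorActR_right_unit _)

/-- Right modules over a bialgebra form a monoidal category, with the tensor product, unit and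
constraints of the ambient category. -/
instance : MonoidalCategory (RMod C A) where
  tensorHom_def f g := Hom.ext (MonoidalCategory.tensorHom_def f.hom g.hom)
  id_tensorHom_id M N := Hom.ext (id_tensorHom_id M.X N.X)
  tensorHom_comp_tensorHom f₁ f₂ g₁ g₂ :=
    Hom.ext (tensorHom_comp_tensorHom f₁.hom f₂.hom g₁.hom g₂.hom)
  whiskerLeft_id M N := Hom.ext (MonoidalCategory.whiskerLeft_id M.X N.X)
  id_whiskerRight M N := Hom.ext (id_whiskerRight M.X N.X)
  associator_naturality f g h := Hom.ext (associator_naturality f.hom g.hom h.hom)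
  leftUnitor_naturality f := Hom.ext (leftUnitor_naturality f.hom)
  rightUnitor_naturality f := Hom.ext (rightUnitor_naturality f.hom)
  pentagon M N P Q := Hom.ext (pentagon M.X N.X P.X Q.X)
  triangle M N := Hom.ext (triangle M.X N.X)

end RMod

end RightModules

section YetterDrinfeld

open scoped MonObj ComonObj

variable {C : Type u} [Category.{v} C] [MonoidalCategory C] [BraidedCategory C]
variable (H : C) [BimonObj H]

/-- A left-left Yetter-Drinfeld module over `H`: a left module and left comodule such that
`(h₁ n)₋₁ h₂ ⊗ (h₁ n)₀ = h₁ n₋₁ ⊗ h₂ n₀`. -/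
structure LeftYD where
  /-- The underlying left module. -/
  toMod : Mod C H
  /-- The left coaction. -/
  coact : toMod.X ⟶ H ⊗ toMod.X
  coact_counit : coact ≫ ε[H] ▷ toMod.X = (λ_ toMod.X).inv
  coact_coassoc : coact ≫ Δ[H] ▷ toMod.X = coact ≫ H ◁ coact ≫ (α_ H H toMod.X).inv
  yd : ydL Δ[H] μ[H] (lact toMod) coact = ydR Δ[H] μ[H] (lact toMod) coact

/-- A right-right Yetter-Drinfeld module over `H`: a right module and right comodule such that
`(n h₂)₀ ⊗ h₁ (n h₂)₁ = n₀ h₁ ⊗ n₁ h₂`. -/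
structure RightYD where
  /-- The underlying right module. -/
  toRMod : RMod C H
  /-- The right coaction. -/
  coact : toRMod.X ⟶ toRMod.X ⊗ H
  coact_counit : coact ≫ toRMod.X ◁ ε[H] = (ρ_ toRMod.X).inv
  coact_coassoc : coact ≫ toRMod.X ◁ Δ[H] = coact ≫ coact ▷ H ≫ (α_ toRMod.X H H).hom
  yd : ydL' Δ[H] μ[H] toRMod.act coact = ydR' Δ[H] μ[H] toRMod.act coact

variable {H}

namespace LeftYD

/-- A linear and colinear morphism. -/
@[ext]
structure Hom (M N : LeftYD H) where
  /-- The underlying linear morphism. -/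
  hom : M.toMod ⟶ N.toMod
  coact_hom : M.coact ≫ H ◁ hom.hom = hom.hom ≫ N.coact

instance : Category (LeftYD H) where
  Hom M N := Hom M N
  id M := { hom := 𝟙 M.toMod, coact_hom := by simp }
  comp f g :=
    { hom := f.hom ≫ g.hom
      coact_hom := by
        rw [Mod.comp_hom', MonoidalCategory.whiskerLeft_comp, ← Category.assoc, f.coact_hom,
          Category.assoc, g.coact_hom, Category.assoc] }
  id_comp f := Hom.ext (Category.id_comp f.hom)
  comp_id f := Hom.ext (Category.comp_id f.hom)
  assoc f g h := Hom.ext (Category.assoc f.hom g.hom h.hom)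

variable (H) in
/-- The functor forgetting the coaction. -/
def forgetToMod : LeftYD H ⥤ Mod C H where
  obj M := M.toMod
  map f := f.hom

/-- An isomorphism of Yetter-Drinfeld modules from a colinear isomorphism of modules. -/
def isoMk {M N : LeftYD H} (e : M.toMod ≅ N.toMod)
    (h : M.coact ≫ H ◁ e.hom.hom = e.hom.hom ≫ N.coact) : M ≅ N where
  hom := ⟨e.hom, h⟩
  inv := ⟨e.inv, by
    have h₁ : e.inv.hom ≫ e.hom.hom = 𝟙 _ := congrArg Mod.Hom.hom e.inv_hom_id
    have h₂ : e.hom.hom ≫ e.inv.hom = 𝟙 _ := congrArg Mod.Hom.hom e.hom_inv_id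
    have h₃ := congrArg (fun t => e.inv.hom ≫ t ≫ H ◁ e.inv.hom) h
    simp only [Category.assoc] at h₃
    rw [← MonoidalCategory.whiskerLeft_comp, h₂, MonoidalCategory.whiskerLeft_id,
      Category.comp_id, reassoc_of% h₁] at h₃
    exact h₃.symm⟩
  hom_inv_id := Hom.ext e.hom_inv_id
  inv_hom_id := Hom.ext e.inv_hom_id

instance : MonoidalCategoryStruct (LeftYD H) where
  tensorObj M N :=
    { toMod := M.toMod ⊗ N.toMod
      coact := tensorCoact μ[H] M.coact N.coact
      coact_counit := tensorCoact_counit _ _ M.coact_counit N.coact_counit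
      coact_coassoc := tensorCoact_coassoc _ _ M.coact_coassoc N.coact_coassoc
      yd := ydT _ _ _ _ _ _ (MonObj.mul_assoc H) (by simp) M.yd N.yd }
  tensorUnit := ⟨𝟙_ (Mod C H), η[H] ≫ (ρ_ H).inv, unitCoact_counit, unitCoact_coassoc, unit_yd⟩
  tensorHom f g := ⟨f.hom ⊗ₘ g.hom, tensorCoact_natural _ _ _ _ _ _ f.coact_hom g.coact_hom⟩
  whiskerLeft M _ _ g := ⟨M.toMod ◁ g.hom, by
    have e := id_tensorHom M.toMod.X g.hom.hom
    have h : _ ≫ H ◁ (𝟙 M.toMod.X ⊗ₘ g.hom.hom) = (𝟙 M.toMod.X ⊗ₘ g.hom.hom) ≫ _ :=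
      tensorCoact_natural _ _ _ _ _ _ (Hom.coact_hom (𝟙 M)) g.coact_hom
    rw [e] at h
    exact h⟩
  whiskerRight f N := ⟨f.hom ▷ N.toMod, by
    have e := tensorHom_id f.hom.hom N.toMod.X
    have h : _ ≫ H ◁ (f.hom.hom ⊗ₘ 𝟙 N.toMod.X) = (f.hom.hom ⊗ₘ 𝟙 N.toMod.X) ≫ _ :=
      tensorCoact_natural _ _ _ _ _ _ f.coact_hom (Hom.coact_hom (𝟙 N))
    rw [e] at h
    exact h⟩
  associator M N P := isoMk (α_ M.toMod N.toMod P.toMod) (tensorCoact_assoc _ _ _)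
  leftUnitor M := isoMk (λ_ M.toMod) (tensorCoact_left_unit _)
  rightUnitor M := isoMk (ρ_ M.toMod) (tensorCoact_right_unit _)

/-- Left-left Yetter-Drinfeld modules form a monoidal category, with the diagonal action and the
codiagonal coaction on tensor products. -/
instance : MonoidalCategory (LeftYD H) where
  tensorHom_def f g := Hom.ext (MonoidalCategory.tensorHom_def f.hom g.hom)
  id_tensorHom_id M N := Hom.ext (id_tensorHom_id M.toMod N.toMod)
  tensorHom_comp_tensorHom f₁ f₂ g₁ g₂ :=
    Hom.ext (tensorHom_comp_tensorHom f₁.hom f₂.hom g₁.hom g₂.hom)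
  whiskerLeft_id M N := Hom.ext (MonoidalCategory.whiskerLeft_id M.toMod N.toMod)
  id_whiskerRight M N := Hom.ext (id_whiskerRight M.toMod N.toMod)
  associator_naturality f g h := Hom.ext (associator_naturality f.hom g.hom h.hom)
  leftUnitor_naturality f := Hom.ext (leftUnitor_naturality f.hom)
  rightUnitor_naturality f := Hom.ext (rightUnitor_naturality f.hom)
  pentagon M N P Q := Hom.ext (pentagon M.toMod N.toMod P.toMod Q.toMod)
  triangle M N := Hom.ext (triangle M.toMod N.toMod)

/-- The morphism `m ⊗ n ↦ m₋₁ n ⊗ m₀`, for a Yetter-Drinfeld module `M` and a module `N`. -/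
def braid (M : LeftYD H) (N : Mod C H) : M.toMod.X ⊗ N.X ⟶ N.X ⊗ M.toMod.X :=
  M.coact ▷ N.X ≫ (α_ H M.toMod.X N.X).hom ≫ H ◁ (β_ M.toMod.X N.X).hom ≫
    (α_ H N.X M.toMod.X).inv ≫ lact N ▷ M.toMod.X

end LeftYD

namespace RightYD

/-- A linear and colinear morphism. -/
@[ext]
structure Hom (M N : RightYD H) where
  /-- The underlying linear morphism. -/
  hom : M.toRMod ⟶ N.toRMod
  coact_hom : M.coact ≫ hom.hom ▷ H = hom.hom ≫ N.coact

instance : Category (RightYD H) where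
  Hom M N := Hom M N
  id M := { hom := 𝟙 M.toRMod, coact_hom := (by
    change M.coact ≫ 𝟙 M.toRMod.X ▷ H = 𝟙 M.toRMod.X ≫ M.coact
    simp) }
  comp f g :=
    { hom := f.hom ≫ g.hom
      coact_hom := by
        change _ ≫ (f.hom.hom ≫ g.hom.hom) ▷ H = (f.hom.hom ≫ g.hom.hom) ≫ _
        rw [comp_whiskerRight, ← Category.assoc, f.coact_hom,
          Category.assoc, g.coact_hom, Category.assoc] }
  id_comp f := Hom.ext (Category.id_comp f.hom)
  comp_id f := Hom.ext (Category.comp_id f.hom)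
  assoc f g h := Hom.ext (Category.assoc f.hom g.hom h.hom)

variable (H) in
/-- The functor forgetting the coaction. -/
def forgetToRMod : RightYD H ⥤ RMod C H where
  obj M := M.toRMod
  map f := f.hom

/-- An isomorphism of Yetter-Drinfeld modules from a colinear isomorphism of modules. -/
def isoMk {M N : RightYD H} (e : M.toRMod ≅ N.toRMod)
    (h : M.coact ≫ e.hom.hom ▷ H = e.hom.hom ≫ N.coact) : M ≅ N where
  hom := ⟨e.hom, h⟩
  inv := ⟨e.inv, by
    have h₁ : e.inv.hom ≫ e.hom.hom = 𝟙 _ := congrArg RMod.Hom.hom e.inv_hom_id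
    have h₂ : e.hom.hom ≫ e.inv.hom = 𝟙 _ := congrArg RMod.Hom.hom e.hom_inv_id
    have h₃ := congrArg (fun t => e.inv.hom ≫ t ≫ e.inv.hom ▷ H) h
    simp only [Category.assoc] at h₃
    rw [← comp_whiskerRight, h₂, id_whiskerRight, Category.comp_id, reassoc_of% h₁] at h₃
    exact h₃.symm⟩
  hom_inv_id := Hom.ext e.hom_inv_id
  inv_hom_id := Hom.ext e.inv_hom_id

instance : MonoidalCategoryStruct (RightYD H) where
  tensorObj M N :=
    { toRMod := M.toRMod ⊗ N.toRMod
      coact := tensorCoactR μ[H] M.coact N.coact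
      coact_counit := tensorCoactR_counit _ _ M.coact_counit N.coact_counit
      coact_coassoc := tensorCoactR_coassoc _ _ M.coact_coassoc N.coact_coassoc
      yd := ydT' _ _ _ _ _ _ (MonObj.mul_assoc H) (by simp) M.yd N.yd }
  tensorUnit :=
    ⟨𝟙_ (RMod C H), η[H] ≫ (λ_ H).inv, unitCoactR_counit, unitCoactR_coassoc, unit_yd'⟩
  tensorHom f g := ⟨f.hom ⊗ₘ g.hom, tensorCoactR_natural _ _ _ _ _ _ f.coact_hom g.coact_hom⟩
  whiskerLeft M _ _ g := ⟨M.toRMod ◁ g.hom, by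
    have e := id_tensorHom M.toRMod.X g.hom.hom
    have h : _ ≫ (𝟙 M.toRMod.X ⊗ₘ g.hom.hom) ▷ H = (𝟙 M.toRMod.X ⊗ₘ g.hom.hom) ≫ _ :=
      tensorCoactR_natural _ _ _ _ _ _ (Hom.coact_hom (𝟙 M)) g.coact_hom
    rw [e] at h
    exact h⟩
  whiskerRight f N := ⟨f.hom ▷ N.toRMod, by
    have e := tensorHom_id f.hom.hom N.toRMod.X
    have h : _ ≫ (f.hom.hom ⊗ₘ 𝟙 N.toRMod.X) ▷ H = (f.hom.hom ⊗ₘ 𝟙 N.toRMod.X) ≫ _ :=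
      tensorCoactR_natural _ _ _ _ _ _ f.coact_hom (Hom.coact_hom (𝟙 N))
    rw [e] at h
    exact h⟩
  associator M N P := isoMk (α_ M.toRMod N.toRMod P.toRMod) (tensorCoactR_assoc _ _ _)
  leftUnitor M := isoMk (λ_ M.toRMod) (tensorCoactR_left_unit _)
  rightUnitor M := isoMk (ρ_ M.toRMod) (tensorCoactR_right_unit _)

/-- Right-right Yetter-Drinfeld modules form a monoidal category, with the diagonal action and the
codiagonal coaction on tensor products. -/
instance : MonoidalCategory (RightYD H) where
  tensorHom_def f g := Hom.ext (MonoidalCategory.tensorHom_def f.hom g.hom)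
  id_tensorHom_id M N := Hom.ext (id_tensorHom_id M.toRMod N.toRMod)
  tensorHom_comp_tensorHom f₁ f₂ g₁ g₂ :=
    Hom.ext (tensorHom_comp_tensorHom f₁.hom f₂.hom g₁.hom g₂.hom)
  whiskerLeft_id M N := Hom.ext (MonoidalCategory.whiskerLeft_id M.toRMod N.toRMod)
  id_whiskerRight M N := Hom.ext (id_whiskerRight M.toRMod N.toRMod)
  associator_naturality f g h := Hom.ext (associator_naturality f.hom g.hom h.hom)
  leftUnitor_naturality f := Hom.ext (leftUnitor_naturality f.hom)
  rightUnitor_naturality f := Hom.ext (rightUnitor_naturality f.hom)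
  pentagon M N P Q := Hom.ext (pentagon M.toRMod N.toRMod P.toRMod Q.toRMod)
  triangle M N := Hom.ext (triangle M.toRMod N.toRMod)

/-- The morphism `m ⊗ n ↦ n₀ ⊗ m n₁`, for a module `M` and a Yetter-Drinfeld module `N`. -/
def braid (M : RMod C H) (N : RightYD H) : M.X ⊗ N.toRMod.X ⟶ N.toRMod.X ⊗ M.X :=
  M.X ◁ N.coact ≫ (α_ M.X N.toRMod.X H).inv ≫ (β_ M.X N.toRMod.X).hom ▷ H ≫
    (α_ N.toRMod.X M.X H).hom ≫ N.toRMod.X ◁ M.act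

end RightYD

end YetterDrinfeld
section RightCenter

variable (D : Type u) [Category.{v} D] [MonoidalCategory D]

variable {D} in
/-- A half-braiding `U ⊗ X ≅ X ⊗ U`, natural and monoidal in `U`. -/
structure RightHalfBraiding (X : D) where
  /-- The family of isomorphisms. -/
  β : ∀ U, U ⊗ X ≅ X ⊗ U
  monoidal : ∀ U V, (β (U ⊗ V)).hom =
    (α_ U V X).hom ≫ U ◁ (β V).hom ≫ (α_ U X V).inv ≫ (β U).hom ▷ V ≫ (α_ X U V).hom
  naturality : ∀ {U V} (f : U ⟶ V), f ▷ X ≫ (β V).hom = (β U).hom ≫ X ◁ f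

/-- The right center: objects `X` with a half-braiding `U ⊗ X ≅ X ⊗ U`. -/
structure RightCenter where
  /-- The underlying object. -/
  X : D
  /-- The half-braiding. -/
  half : RightHalfBraiding X

variable {D}

namespace RightCenter

/-- The half-braiding of an object of the right center. -/
abbrev β (X : RightCenter D) (U : D) : U ⊗ X.X ≅ X.X ⊗ U :=
  X.half.β U

/-- A morphism compatible with the half-braidings. -/
@[ext]
structure Hom (X Y : RightCenter D) where
  /-- The underlying morphism. -/
  hom : X.X ⟶ Y.X
  comm : ∀ U, U ◁ hom ≫ (Y.β U).hom = (X.β U).hom ≫ hom ▷ U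

instance : Category (RightCenter D) where
  Hom X Y := Hom X Y
  id X := { hom := 𝟙 X.X, comm := by simp }
  comp f g :=
    { hom := f.hom ≫ g.hom
      comm := fun U => by
        rw [MonoidalCategory.whiskerLeft_comp, Category.assoc, g.comm, ← Category.assoc, f.comm,
          Category.assoc, comp_whiskerRight] }
  id_comp f := Hom.ext (Category.id_comp f.hom)
  comp_id f := Hom.ext (Category.comp_id f.hom)
  assoc f g h := Hom.ext (Category.assoc f.hom g.hom h.hom)

variable (D) in
/-- The functor forgetting the half-braiding. -/
def forget : RightCenter D ⥤ D where
  obj X := X.X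
  map f := f.hom

/-- An isomorphism from an isomorphism compatible with the half-braidings. -/
def isoMk {X Y : RightCenter D} (e : X.X ≅ Y.X)
    (h : ∀ U, U ◁ e.hom ≫ (Y.β U).hom = (X.β U).hom ≫ e.hom ▷ U) : X ≅ Y where
  hom := ⟨e.hom, h⟩
  inv := ⟨e.inv, fun U => by
    rw [← cancel_epi (U ◁ e.hom), ← cancel_mono (e.hom ▷ U)]
    simp [h]⟩
  hom_inv_id := Hom.ext e.hom_inv_id
  inv_hom_id := Hom.ext e.inv_hom_id

theorem monoidal_tensor (X Y : RightCenter D) (U V : D) :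
    (𝟙 ((U ⊗ V) ⊗ X.X ⊗ Y.X) ⊗≫ (X.β (U ⊗ V)).hom ▷ Y.X ⊗≫ X.X ◁ (Y.β (U ⊗ V)).hom ⊗≫
      𝟙 ((X.X ⊗ Y.X) ⊗ U ⊗ V)) =
    𝟙 ((U ⊗ V) ⊗ X.X ⊗ Y.X) ⊗≫ U ◁ ((X.β V).hom ▷ Y.X ⊗≫ X.X ◁ (Y.β V).hom) ⊗≫
      ((X.β U).hom ▷ Y.X ⊗≫ X.X ◁ (Y.β U).hom) ▷ V ⊗≫ 𝟙 ((X.X ⊗ Y.X) ⊗ U ⊗ V) := by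
  rw [X.half.monoidal, Y.half.monoidal]
  calc
    _ = 𝟙 _ ⊗≫ U ◁ (X.β V).hom ▷ Y.X ⊗≫ ((X.β U).hom ▷ (V ⊗ Y.X) ≫
          (X.X ⊗ U) ◁ (Y.β V).hom) ⊗≫ X.X ◁ (Y.β U).hom ▷ V ⊗≫ 𝟙 _ := by monoidal
    _ = _ := by rw [← whisker_exchange]; monoidal

/-- The half-braiding of a tensor product. -/
def tensorβ (X Y : RightCenter D) (U : D) : U ⊗ (X.X ⊗ Y.X) ≅ (X.X ⊗ Y.X) ⊗ U :=
  (α_ U X.X Y.X).symm ≪≫ whiskerRightIso (X.β U) Y.X ≪≫ α_ X.X U Y.X ≪≫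
    whiskerLeftIso X.X (Y.β U) ≪≫ (α_ X.X Y.X U).symm

theorem tensorβ_hom (X Y : RightCenter D) (U : D) : (tensorβ X Y U).hom =
    (α_ U X.X Y.X).inv ≫ (X.β U).hom ▷ Y.X ≫ (α_ X.X U Y.X).hom ≫ X.X ◁ (Y.β U).hom ≫
      (α_ X.X Y.X U).inv := by
  simp [tensorβ]

/-- The tensor product of two objects of the right center. -/
def tensorObj (X Y : RightCenter D) : RightCenter D where
  X := X.X ⊗ Y.X
  half.β := tensorβ X Y
  half.monoidal U V := by
    have h := monoidal_tensor X Y U V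
    simp only [tensorβ_hom]
    calc
      _ = _ := by monoidal
      _ = _ := h
      _ = _ := by monoidal
  half.naturality {U V} f := by
    simp only [tensorβ_hom]
    calc
      _ = 𝟙 _ ⊗≫ (f ▷ X.X ≫ (X.β V).hom) ▷ Y.X ⊗≫ X.X ◁ (Y.β V).hom ⊗≫ 𝟙 _ := by monoidal
      _ = 𝟙 _ ⊗≫ (X.β U).hom ▷ Y.X ⊗≫ X.X ◁ (f ▷ Y.X ≫ (Y.β V).hom) ⊗≫ 𝟙 _ := by
        rw [X.half.naturality]; monoidal
      _ = _ := by rw [Y.half.naturality]; monoidal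

/-- The unit object of the right center. -/
def unit : RightCenter D where
  X := 𝟙_ D
  half.β U := ρ_ U ≪≫ (λ_ U).symm
  half.monoidal U V := by
    simp only [Iso.trans_hom, Iso.symm_hom]
    monoidal
  half.naturality f := by simp

theorem whiskerLeft_comm (X : RightCenter D) {Y₁ Y₂ : RightCenter D} (g : Y₁ ⟶ Y₂) (U : D) :
    U ◁ X.X ◁ g.hom ≫ (tensorβ X Y₂ U).hom =
      (tensorβ X Y₁ U).hom ≫ (X.X ◁ g.hom) ▷ U := by
  rw [tensorβ_hom, tensorβ_hom]
  calc
    _ = 𝟙 _ ⊗≫ ((U ⊗ X.X) ◁ g.hom ≫ (X.β U).hom ▷ Y₂.X) ⊗≫ X.X ◁ (Y₂.β U).hom ⊗≫ 𝟙 _ := by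
      monoidal
    _ = 𝟙 _ ⊗≫ (X.β U).hom ▷ Y₁.X ⊗≫ X.X ◁ (U ◁ g.hom ≫ (Y₂.β U).hom) ⊗≫ 𝟙 _ := by
      rw [whisker_exchange]; monoidal
    _ = _ := by rw [g.comm]; monoidal

theorem whiskerRight_comm {X₁ X₂ : RightCenter D} (f : X₁ ⟶ X₂) (Y : RightCenter D) (U : D) :
    U ◁ f.hom ▷ Y.X ≫ (tensorβ X₂ Y U).hom =
      (tensorβ X₁ Y U).hom ≫ (f.hom ▷ Y.X) ▷ U := by
  rw [tensorβ_hom, tensorβ_hom]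
  calc
    _ = 𝟙 _ ⊗≫ (U ◁ f.hom ≫ (X₂.β U).hom) ▷ Y.X ⊗≫ X₂.X ◁ (Y.β U).hom ⊗≫ 𝟙 _ := by monoidal
    _ = 𝟙 _ ⊗≫ (X₁.β U).hom ▷ Y.X ⊗≫ (f.hom ▷ (U ⊗ Y.X) ≫ X₂.X ◁ (Y.β U).hom) ⊗≫ 𝟙 _ := by
      rw [f.comm]; monoidal
    _ = _ := by rw [← whisker_exchange]; monoidal

instance : MonoidalCategoryStruct (RightCenter D) where
  tensorObj := tensorObj
  tensorUnit := unit
  tensorHom {X₁ Y₁ X₂ Y₂} f g := ⟨f.hom ⊗ₘ g.hom, fun U => by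
    change U ◁ (f.hom ⊗ₘ g.hom) ≫ (tensorβ Y₁ Y₂ U).hom =
      (tensorβ X₁ X₂ U).hom ≫ (f.hom ⊗ₘ g.hom) ▷ U
    rw [MonoidalCategory.tensorHom_def, MonoidalCategory.whiskerLeft_comp, Category.assoc,
      whiskerLeft_comm, ← Category.assoc, whiskerRight_comm, Category.assoc, comp_whiskerRight]⟩
  whiskerLeft X _ _ g := ⟨X.X ◁ g.hom, whiskerLeft_comm X g⟩
  whiskerRight f Y := ⟨f.hom ▷ Y.X, whiskerRight_comm f Y⟩
  associator X Y Z := isoMk (α_ X.X Y.X Z.X) fun U => by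
    change U ◁ (α_ X.X Y.X Z.X).hom ≫ (tensorβ X (tensorObj Y Z) U).hom =
      (tensorβ (tensorObj X Y) Z U).hom ≫ (α_ X.X Y.X Z.X).hom ▷ U
    simp only [tensorβ_hom, tensorObj, β]
    monoidal
  leftUnitor X := isoMk (λ_ X.X) fun U => by
    change U ◁ (λ_ X.X).hom ≫ _ = (tensorβ unit X U).hom ≫ (λ_ X.X).hom ▷ U
    simp only [tensorβ_hom, unit, β, Iso.trans_hom, Iso.symm_hom]
    monoidal
  rightUnitor X := isoMk (ρ_ X.X) fun U => by
    change U ◁ (ρ_ X.X).hom ≫ _ = (tensorβ X unit U).hom ≫ (ρ_ X.X).hom ▷ U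
    simp only [tensorβ_hom, unit, β, Iso.trans_hom, Iso.symm_hom]
    monoidal

/-- The monoidal structure of the right center. -/
instance : MonoidalCategory (RightCenter D) where
  tensorHom_def f g := Hom.ext (MonoidalCategory.tensorHom_def f.hom g.hom)
  id_tensorHom_id M N := Hom.ext (id_tensorHom_id M.X N.X)
  tensorHom_comp_tensorHom f₁ f₂ g₁ g₂ :=
    Hom.ext (tensorHom_comp_tensorHom f₁.hom f₂.hom g₁.hom g₂.hom)
  whiskerLeft_id M N := Hom.ext (MonoidalCategory.whiskerLeft_id M.X N.X)
  id_whiskerRight M N := Hom.ext (id_whiskerRight M.X N.X)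
  associator_naturality f g h := Hom.ext (associator_naturality f.hom g.hom h.hom)
  leftUnitor_naturality f := Hom.ext (leftUnitor_naturality f.hom)
  rightUnitor_naturality f := Hom.ext (rightUnitor_naturality f.hom)
  pentagon M N P Q := Hom.ext (pentagon M.X N.X P.X Q.X)
  triangle M N := Hom.ext (triangle M.X N.X)

/-- The braiding of the right center, `V ⊗ W ⟶ W ⊗ V` given by the half-braiding of `W`. -/
instance : BraidedCategory (RightCenter D) where
  braiding X Y := isoMk (X := X ⊗ Y) (Y := Y ⊗ X) (Y.β X.X) fun U => by
    change U ◁ (Y.β X.X).hom ≫ (tensorβ Y X U).hom =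
      (tensorβ X Y U).hom ≫ (Y.β X.X).hom ▷ U
    rw [tensorβ_hom, tensorβ_hom]
    have h := Y.half.naturality (X.β U).hom
    rw [Y.half.monoidal, Y.half.monoidal] at h
    simp only [Category.assoc] at h ⊢
    rw [← cancel_epi (α_ U X.X Y.X).hom, ← cancel_mono (α_ Y.X X.X U).hom]
    simpa using h.symm
  braiding_naturality_left f Y := Hom.ext (Y.half.naturality f.hom)
  braiding_naturality_right X _ _ f := Hom.ext (f.comm X.X)
  hexagon_forward X Y Z := Hom.ext (by
    change (α_ X.X Y.X Z.X).hom ≫ (tensorβ Y Z X.X).hom ≫ (α_ Y.X Z.X X.X).hom =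
      (Y.β X.X).hom ▷ Z.X ≫ (α_ Y.X X.X Z.X).hom ≫ Y.X ◁ (Z.β X.X).hom
    rw [tensorβ_hom]
    simp)
  hexagon_reverse X Y Z := Hom.ext (by
    change (α_ X.X Y.X Z.X).inv ≫ (Z.β (X.X ⊗ Y.X)).hom ≫ (α_ Z.X X.X Y.X).inv =
      X.X ◁ (Z.β Y.X).hom ≫ (α_ X.X Z.X Y.X).inv ≫ (Z.β X.X).hom ▷ Y.X
    rw [Z.half.monoidal]
    simp)

end RightCenter

end RightCenter
section Double

open scoped MonObj ComonObj

variable {C : Type u} [Category.{v} C] [MonoidalCategory C]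

/-- The morphism `ev : F ⊗ M ⟶ N` makes `F` an inner hom-object `[M, N]`. -/
def IsInnerHom {M N F : C} (ev : F ⊗ M ⟶ N) : Prop :=
  ∀ (T : C) (f : T ⊗ M ⟶ N), ∃! g : T ⟶ F, g ▷ M ≫ ev = f

/-- The data witnessing that `P` is finite: the inner hom-objects `P* = [P, 𝟙]` and `[P, P]` exist,
and the canonical morphism `db : P ⊗ P* ⟶ [P, P]`, corresponding to `P ⊗ ev`, is invertible. -/
structure FiniteObj (P : C) where
  /-- The dual object `[P, 𝟙]`. -/
  dual : C
  /-- The evaluation of `[P, 𝟙]`. -/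
  ev : dual ⊗ P ⟶ 𝟙_ C
  isInnerHom_ev : IsInnerHom ev
  /-- The object `[P, P]`. -/
  endo : C
  /-- The evaluation of `[P, P]`. -/
  evEndo : endo ⊗ P ⟶ P
  isInnerHom_evEndo : IsInnerHom evEndo
  /-- The canonical isomorphism `P ⊗ [P, 𝟙] ≅ [P, P]`. -/
  db : P ⊗ dual ≅ endo
  db_ev : db.hom ▷ P ≫ evEndo = (α_ P dual P).hom ≫ P ◁ ev ≫ (ρ_ P).hom

namespace FiniteObj

variable {P : C} (fin : FiniteObj P)

/-- The morphism to the dual corresponding to a pairing. -/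
def curry {T : C} (f : T ⊗ P ⟶ 𝟙_ C) : T ⟶ fin.dual :=
  (fin.isInnerHom_ev T f).choose

theorem curry_ev {T : C} (f : T ⊗ P ⟶ 𝟙_ C) : fin.curry f ▷ P ≫ fin.ev = f :=
  (fin.isInnerHom_ev T f).choose_spec.1

/-- The unit of `[P, P]`, corresponding to the identity of `P`. -/
def oneEndo : 𝟙_ C ⟶ fin.endo :=
  (fin.isInnerHom_evEndo (𝟙_ C) (λ_ P).hom).choose

/-- The dual basis morphism `d : 𝟙 ⟶ P ⊗ P*`, written `∑ pᵢ ⊗ pⁱ` below. -/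
def coev : 𝟙_ C ⟶ P ⊗ fin.dual :=
  fin.oneEndo ≫ fin.db.inv

variable [BraidedCategory C]

/-- The evaluation `P ⊗ P* ⟶ 𝟙` in the opposite order. -/
def ev' : P ⊗ fin.dual ⟶ 𝟙_ C :=
  (β_ P fin.dual).hom ≫ fin.ev

/-- The dual basis morphism `𝟙 ⟶ P* ⊗ P` in the opposite order. -/
def coev' : 𝟙_ C ⟶ fin.dual ⊗ P :=
  fin.coev ≫ (β_ fin.dual P).inv

end FiniteObj

variable [BraidedCategory C] {H : C} [HopfObj H] (fin : FiniteObj H)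

/-! The bialgebra `B = (Hᵒᵖ)*` on the dual object of `H`. -/

/-- The product `(f g)(h) = f(h₁) g(h₂)` of `B`. -/
def dualMul : fin.dual ⊗ fin.dual ⟶ fin.dual :=
  fin.curry ((fin.dual ⊗ fin.dual) ◁ Δ[H] ≫ tensorμ fin.dual fin.dual H H ≫
    (fin.ev ⊗ₘ fin.ev) ≫ (λ_ (𝟙_ C)).hom)

/-- The unit of `B`, which is the counit of `H`. -/
def dualOne : 𝟙_ C ⟶ fin.dual :=
  fin.curry ((λ_ H).hom ≫ ε[H])

/-- The coproduct of `B`, `f ↦ ∑ f(hⱼ hᵢ) hⁱ ⊗ hʲ`, so that `f₁(h) f₂(k) = f(k h)`. -/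
def dualComul : fin.dual ⟶ fin.dual ⊗ fin.dual :=
  (ρ_ fin.dual).inv ≫
    fin.dual ◁ ((λ_ (𝟙_ C)).inv ≫ (fin.coev ⊗ₘ fin.coev) ≫ tensorδ H H fin.dual fin.dual) ≫
      (α_ fin.dual (H ⊗ H) (fin.dual ⊗ fin.dual)).inv ≫
        (fin.dual ◁ ((β_ H H).hom ≫ μ[H]) ≫ fin.ev) ▷ (fin.dual ⊗ fin.dual) ≫
          (λ_ (fin.dual ⊗ fin.dual)).hom

/-- The counit `f ↦ f(1)` of `B`. -/
def dualCounit : fin.dual ⟶ 𝟙_ C :=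
  (ρ_ fin.dual).inv ≫ fin.dual ◁ η[H] ≫ fin.ev

/-! The Drinfel'd double `D(H) = B ⋈ H`. -/

/-- The underlying object `B ⊗ H` of the Drinfel'd double. -/
abbrev double : C := fin.dual ⊗ H

section

variable [IsIso (HopfObj.antipode (X := H))]

/-- The left action of `H` on `B`, `(h ▷ f)(x) = f(S⁻¹(h₂) x h₁)`. -/
def actB : H ⊗ fin.dual ⟶ fin.dual :=
  𝟙 _ ⊗≫ fin.coev' ▷ (H ⊗ fin.dual) ⊗≫ (fin.dual ⊗ H) ◁ Δ[H] ▷ fin.dual ⊗≫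
    fin.dual ◁ (μ[H] ⊗ₘ inv (HopfObj.antipode (X := H))) ▷ fin.dual ⊗≫
      fin.dual ◁ ((β_ H H).hom ≫ μ[H]) ▷ fin.dual ⊗≫ fin.dual ◁ fin.ev' ⊗≫ 𝟙 fin.dual

/-- The right action of `B` on `H`, `h ◁ f = f(S⁻¹(h₃) h₁) h₂`. -/
def actH : H ⊗ fin.dual ⟶ H :=
  𝟙 _ ⊗≫ (Δ[H] ≫ (Δ[H] ⊗ₘ inv (HopfObj.antipode (X := H)))) ▷ fin.dual ⊗≫
    (β_ H H).inv ▷ (H ⊗ fin.dual) ⊗≫ H ◁ ((β_ H H).hom ≫ μ[H]) ▷ fin.dual ⊗≫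
      H ◁ fin.ev' ⊗≫ 𝟙 H

/-- The product of the double, `(f ⊗ h)(g ⊗ k) = f (h₁ ▷ g₁) ⊗ (h₂ ◁ g₂) k`. -/
def doubleMul : double fin ⊗ double fin ⟶ double fin :=
  𝟙 _ ⊗≫ fin.dual ◁ (Δ[H] ⊗ₘ dualComul fin) ▷ H ⊗≫
    fin.dual ◁ tensorμ H H fin.dual fin.dual ▷ H ⊗≫
      fin.dual ◁ (actB fin ⊗ₘ actH fin) ▷ H ⊗≫ (dualMul fin ⊗ₘ μ[H])

end

/-- The unit of the double. -/
def doubleOne : 𝟙_ C ⟶ double fin :=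
  (λ_ (𝟙_ C)).inv ≫ (dualOne fin ⊗ₘ η[H])

/-- The codiagonal coproduct of the double. -/
def doubleComul : double fin ⟶ double fin ⊗ double fin :=
  (dualComul fin ⊗ₘ Δ[H]) ≫ tensorμ fin.dual fin.dual H H

/-- The counit of the double. -/
def doubleCounit : double fin ⟶ 𝟙_ C :=
  (dualCounit fin ⊗ₘ ε[H]) ≫ (λ_ (𝟙_ C)).hom

/-- The morphism `h ↦ 1 ⊗ h` from `H` to the double. -/
def inclH : H ⟶ double fin :=
  (λ_ H).inv ≫ dualOne fin ▷ H

/-- The morphism `f ↦ f ⊗ 1` from `B` to the double. -/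
def inclB : fin.dual ⟶ double fin :=
  (ρ_ fin.dual).inv ≫ fin.dual ◁ η[H]

/-- The morphism `m ⊗ n ↦ ∑ hⁱ n ⊗ hᵢ m` for left modules `M`, `N` over the double, in which `n`
crosses `m` by the inverse braiding: it is the action of the universal R-matrix
`∑ (1 ⊗ hᵢ) ⊗ (hⁱ ⊗ 1)` followed by `Φ_{N, M}⁻¹`. -/
def twistL {M N : C} (aM : double fin ⊗ M ⟶ M) (aN : double fin ⊗ N ⟶ N) : M ⊗ N ⟶ N ⊗ M :=
  (λ_ (M ⊗ N)).inv ≫ (fin.coev ≫ (inclH fin ⊗ₘ inclB fin)) ▷ (M ⊗ N) ≫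
    tensorμ (double fin) (double fin) M N ≫ (aM ⊗ₘ aN) ≫ (β_ N M).inv

/-- The morphism `m ⊗ n ↦ ∑ n hᵢ ⊗ m hⁱ` for right modules `M`, `N` over the double, in which `n`
crosses `m` by the inverse braiding: it is the action of `∑ (hⁱ ⊗ 1) ⊗ (1 ⊗ hᵢ)` followed by
`Φ_{N, M}⁻¹`. -/
def twistR {M N : C} (aM : M ⊗ double fin ⟶ M) (aN : N ⊗ double fin ⟶ N) : M ⊗ N ⟶ N ⊗ M :=
  (ρ_ (M ⊗ N)).inv ≫ (M ⊗ N) ◁ (fin.coev' ≫ (inclB fin ⊗ₘ inclH fin)) ≫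
    tensorμ M N (double fin) (double fin) ≫ (aM ⊗ₘ aN) ≫ (β_ N M).inv

end Double

section Centers

variable (C : Type u) [Category.{v} C] [MonoidalCategory C] [BraidedCategory C]

/-- The transparent objects of a braided category: those whose braiding with every object is
symmetric. -/
def mugerCenter : Set C :=
  {X | ∀ Y, (β_ X Y).hom ≫ (β_ Y X).hom = 𝟙 (X ⊗ Y)}

end Centers

section Functors

universe v₁ v₂ u₁ u₂

variable (A : Type u₁) [Category.{v₁} A] [MonoidalCategory A] [BraidedCategory A]
variable (B : Type u₂) [Category.{v₂} B] [MonoidalCategory B] [BraidedCategory B]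

/-- An isomorphism of braided monoidal categories. -/
structure BraidedIso where
  /-- The functor. -/
  functor : A ⥤ B
  /-- The inverse functor. -/
  inverse : B ⥤ A
  functor_inverse : functor ⋙ inverse = 𝟭 A
  inverse_functor : inverse ⋙ functor = 𝟭 B
  /-- The functor is braided monoidal. -/
  braided : functor.Braided
  /-- The inverse functor is braided monoidal. -/
  braided_inverse : inverse.Braided

/-- An embedding of braided monoidal categories: a braided monoidal functor that is fully faithful
and injective on objects. -/
structure BraidedEmbedding where
  /-- The functor. -/
  functor : A ⥤ B
  /-- The functor is braided monoidal. -/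
  braided : functor.Braided
  full : functor.Full
  faithful : functor.Faithful
  injective_obj : Function.Injective functor.obj

end Functors

section DoubleModules

open scoped MonObj ComonObj

variable {C : Type u} [Category.{v} C] [MonoidalCategory C] [BraidedCategory C]
variable {H : C} [HopfObj H] [IsIso (HopfObj.antipode (X := H))] (fin : FiniteObj H)

/-- The action of the double on a left-left Yetter-Drinfeld module, `(f ⊗ h) m = f · (h m)` where
`f · m = f(S⁻¹(m₋₁)) m₀`. -/
def LeftYD.doubleAct (M : LeftYD H) : double fin ⊗ M.toMod.X ⟶ M.toMod.X :=
  𝟙 _ ⊗≫ fin.dual ◁ (lact M.toMod ≫ M.coact) ⊗≫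
    fin.dual ◁ inv (HopfObj.antipode (X := H)) ▷ M.toMod.X ⊗≫ fin.ev ▷ M.toMod.X ⊗≫ 𝟙 M.toMod.X

/-- The action of the double on a right-right Yetter-Drinfeld module, `m (f ⊗ h) = (m · f) h` where
`m · f = m₀ f(S⁻¹(m₁))`. -/
def RightYD.doubleAct (M : RightYD H) : M.toRMod.X ⊗ double fin ⟶ M.toRMod.X :=
  𝟙 _ ⊗≫ M.coact ▷ (fin.dual ⊗ H) ⊗≫
    M.toRMod.X ◁ inv (HopfObj.antipode (X := H)) ▷ (fin.dual ⊗ H) ⊗≫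
      M.toRMod.X ◁ fin.ev' ▷ H ⊗≫ M.toRMod.act

end DoubleModules

end

end BraidedHopf

open CategoryTheory MonoidalCategory BraidedHopf
open scoped MonObj

/-!
Yetter-Drinfeld modules over a finite transparent Hopf algebra `H` and modules over its Drinfeld
double are the same thing because both consist of an action of `H`, an action of the dual algebra
`B`, and one compatibility between the two.

For the double this holds because its product is a smash product: `doubleMul_eq` rewrites it as
`f ⊗ h ⊗ g ⊗ k ↦ f x(h ⊗ g) k`, where the exchange morphism `x : H ⊗ B ⟶ B ⊗ H`, called `exchange`,
is `h ⊗ g ↦ g(S⁻¹(h₃) - h₁) ⊗ h₂`. It is composed of two commuting actions of `H` on its dual, by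
`g(- h)` and by `g(S⁻¹(h) -)`. As each of them is compatible with the products of `H` and of `B`, so
is `x` (`fuse_exch`, `exch_fuse`), and this gives associativity of the product of the double. A
module over a smash product is a module `M` over both factors such that `h (f m)` is the action of
`x(h ⊗ f)` on `m`.

For Yetter-Drinfeld modules, `dualAction` turns a coaction into `f m = f(S⁻¹(m₋₁)) m₀`. Since a
morphism `M ⟶ H ⊗ M` is the same as a morphism `B ⊗ M ⟶ M`, this is a bijection between coactions of
`H` and actions of `B`, and `isLeftYD_iff` says that the Yetter-Drinfeld condition corresponds to
the compatibility with `x`. Codiagonal coactions correspond to diagonal actions. Hence tensor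
products of modules over the double are modules over it, because they come from tensor products of
Yetter-Drinfeld modules; for the tensor square of the regular module, evaluated at `1 ⊗ 1`, this is
multiplicativity of the coproduct of the double (`doubleMul_doubleComul`).

The morphism `braidMap`, `x ⊗ n ↦ x₋₁ n ⊗ x₀`, is linear and colinear, it is invertible since `S`
is, and its inverse is the action of the universal R-matrix (`twist_eq`). For a fixed
Yetter-Drinfeld module it is a half-braiding on all `H`-modules, which gives the embedding into the
center. The coaction is recovered from the half-braiding with the regular module; therefore the
embedding is full and injective on objects.

The right-handed statements follow from the same lemmas in the category `Cᴹᵒᵖ` with reversed tensor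
product, in which `B` is dual to `H` by `ev' = ev Φ` and `d' = Φ⁻¹ d`. The structure of `B` does not
change under the reversal, but the exchange morphism becomes the inverse of `x`
(`exchange_unmop_exchange`), which is what right modules over the same double require
(`isRightYD_iff`).

Calculations with many tensor factors avoid associators: tensor products are nested to the right,
and an elementary morphism acts on the leftmost factors and leaves a *tail* `Z` alone. Further
factors on the left are kept by `V ◁ _`, so every equation of elementary morphisms can be used at
any position. Morphisms into `B ⊗ Z` are compared after evaluation by `pair`.
-/

namespace BraidedHopf

open CategoryTheory MonoidalCategory BraidedCategory
open scoped MonObj ComonObj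

/-! ### Morphisms applied to the leftmost factors -/

section Tail

variable {C : Type u} [Category.{v} C] [MonoidalCategory C]

/-! Commuting polygons stay commuting after whiskering; the digits of `whisk` count the edges of the
two sides. -/

section Whisk

variable {A A₁ A₂ A₃ A₁' A₂' A₃' A' : C} (V : C)

theorem whisk20 {f : A ⟶ A₁} {g : A₁ ⟶ A} (e : f ≫ g = 𝟙 A) : V ◁ f ≫ V ◁ g = 𝟙 (V ⊗ A) := by
  rw [← MonoidalCategory.whiskerLeft_comp, e, MonoidalCategory.whiskerLeft_id]

theorem whisk21 {f : A ⟶ A₁} {g : A₁ ⟶ A'} {k : A ⟶ A'} (e : f ≫ g = k) :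
    V ◁ f ≫ V ◁ g = V ◁ k := by
  rw [← MonoidalCategory.whiskerLeft_comp, e]

theorem whisk31 {f : A ⟶ A₁} {g : A₁ ⟶ A₂} {h : A₂ ⟶ A'} {k : A ⟶ A'} (e : f ≫ g ≫ h = k) :
    V ◁ f ≫ V ◁ g ≫ V ◁ h = V ◁ k := by
  simp only [← MonoidalCategory.whiskerLeft_comp, e]

theorem whisk22 {f : A ⟶ A₁} {g : A₁ ⟶ A'} {k : A ⟶ A₁'} {l : A₁' ⟶ A'} (e : f ≫ g = k ≫ l) :
    V ◁ f ≫ V ◁ g = V ◁ k ≫ V ◁ l := by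
  simp only [← MonoidalCategory.whiskerLeft_comp, e]

theorem whisk23 {f : A ⟶ A₁} {g : A₁ ⟶ A'} {k : A ⟶ A₁'} {l : A₁' ⟶ A₂'} {m : A₂' ⟶ A'}
    (e : f ≫ g = k ≫ l ≫ m) : V ◁ f ≫ V ◁ g = V ◁ k ≫ V ◁ l ≫ V ◁ m := by
  simp only [← MonoidalCategory.whiskerLeft_comp, e]

theorem whisk32 {f : A ⟶ A₁} {g : A₁ ⟶ A₂} {h : A₂ ⟶ A'} {k : A ⟶ A₁'} {l : A₁' ⟶ A'}
    (e : f ≫ g ≫ h = k ≫ l) : V ◁ f ≫ V ◁ g ≫ V ◁ h = V ◁ k ≫ V ◁ l := by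
  simp only [← MonoidalCategory.whiskerLeft_comp, e]

end Whisk

/-- A morphism `X ⊗ Y ⟶ W` applied to the two leftmost factors. -/
def fuse {X Y W : C} (g : X ⊗ Y ⟶ W) (Z : C) : X ⊗ Y ⊗ Z ⟶ W ⊗ Z :=
  (α_ X Y Z).inv ≫ g ▷ Z

/-- A morphism `W ⟶ X ⊗ Y` applied to the leftmost factor. -/
def split {X Y W : C} (g : W ⟶ X ⊗ Y) (Z : C) : W ⊗ Z ⟶ X ⊗ Y ⊗ Z :=
  g ▷ Z ≫ (α_ X Y Z).hom

/-- A pairing applied to the two leftmost factors. -/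
def cap {X Y : C} (g : X ⊗ Y ⟶ 𝟙_ C) (Z : C) : X ⊗ Y ⊗ Z ⟶ Z :=
  (α_ X Y Z).inv ≫ g ▷ Z ≫ (λ_ Z).hom

/-- A copairing inserted on the left. -/
def cup {X Y : C} (g : 𝟙_ C ⟶ X ⊗ Y) (Z : C) : Z ⟶ X ⊗ Y ⊗ Z :=
  (λ_ Z).inv ≫ g ▷ Z ≫ (α_ X Y Z).hom

/-- A global element inserted on the left. -/
def ins {X : C} (g : 𝟙_ C ⟶ X) (Z : C) : Z ⟶ X ⊗ Z :=
  (λ_ Z).inv ≫ g ▷ Z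

/-- A functional applied to the leftmost factor. -/
def del {X : C} (g : X ⟶ 𝟙_ C) (Z : C) : X ⊗ Z ⟶ Z :=
  g ▷ Z ≫ (λ_ Z).hom

section Naturality

variable {X Y W Z Z' : C}

theorem fuse_nat (g : X ⊗ Y ⟶ W) (f : Z ⟶ Z') :
    fuse g Z ≫ W ◁ f = X ◁ Y ◁ f ≫ fuse g Z' := by
  simp only [fuse, Category.assoc, ← whisker_exchange]
  simp

theorem split_nat (g : W ⟶ X ⊗ Y) (f : Z ⟶ Z') :
    split g Z ≫ X ◁ Y ◁ f = W ◁ f ≫ split g Z' := by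
  simp only [split, Category.assoc, whisker_exchange_assoc]
  simp

theorem cap_nat (g : X ⊗ Y ⟶ 𝟙_ C) (f : Z ⟶ Z') :
    cap g Z ≫ f = X ◁ Y ◁ f ≫ cap g Z' := by
  have h := leftUnitor_naturality f
  simp only [cap, Category.assoc, ← h, ← whisker_exchange_assoc]
  simp

theorem cup_nat (g : 𝟙_ C ⟶ X ⊗ Y) (f : Z ⟶ Z') :
    cup g Z ≫ X ◁ Y ◁ f = f ≫ cup g Z' := by
  simp only [cup, Category.assoc, leftUnitor_inv_naturality_assoc, whisker_exchange_assoc]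
  simp

theorem ins_nat (g : 𝟙_ C ⟶ X) (f : Z ⟶ Z') : ins g Z ≫ X ◁ f = f ≫ ins g Z' := by
  simp only [ins, Category.assoc, leftUnitor_inv_naturality_assoc, whisker_exchange]

theorem del_nat (g : X ⟶ 𝟙_ C) (f : Z ⟶ Z') : del g Z ≫ f = X ◁ f ≫ del g Z' := by
  have h := leftUnitor_naturality f
  simp only [del, Category.assoc, ← h, ← whisker_exchange_assoc]

end Naturality

variable [BraidedCategory C]

/-- The braiding of the two leftmost factors. -/
def cross (X Y Z : C) : X ⊗ Y ⊗ Z ⟶ Y ⊗ X ⊗ Z :=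
  (α_ X Y Z).inv ≫ (β_ X Y).hom ▷ Z ≫ (α_ Y X Z).hom

section Crossing

variable {X Y W X' Y' Z Z' : C} (V : C)

theorem cross_nat (f : Z ⟶ Z') :
    cross X Y Z ≫ Y ◁ X ◁ f = X ◁ Y ◁ f ≫ cross X Y Z' := by
  have h : cross X Y Z = fuse (β_ X Y).hom Z ≫ (α_ Y X Z).hom := by simp [cross, fuse]
  have h' : cross X Y Z' = fuse (β_ X Y).hom Z' ≫ (α_ Y X Z').hom := by simp [cross, fuse]
  rw [h, h', ← reassoc_of% (fuse_nat (β_ X Y).hom f)]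
  simp

theorem fuse_cross (g : X ⊗ Y ⟶ W) (Z : C) :
    fuse g (V ⊗ Z) ≫ cross W V Z =
      X ◁ cross Y V Z ≫ cross X V (Y ⊗ Z) ≫ V ◁ fuse g Z := by
  have h := braiding_naturality_left g V
  rw [braiding_tensor_left_hom] at h
  calc
    _ = 𝟙 _ ⊗≫ (g ▷ V ≫ (β_ W V).hom) ▷ Z ⊗≫ 𝟙 _ := by simp only [fuse, cross]; monoidal
    _ = _ := by rw [h]; simp only [fuse, cross]; monoidal

theorem cross_fuse (g : X ⊗ Y ⟶ W) (Z : C) :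
    V ◁ fuse g Z ≫ cross V W Z =
      cross V X (Y ⊗ Z) ≫ X ◁ cross V Y Z ≫ fuse g (V ⊗ Z) := by
  have h := braiding_naturality_right V g
  rw [braiding_tensor_right_hom] at h
  calc
    _ = 𝟙 _ ⊗≫ (V ◁ g ≫ (β_ V W).hom) ▷ Z ⊗≫ 𝟙 _ := by simp only [fuse, cross]; monoidal
    _ = _ := by rw [h]; simp only [fuse, cross]; monoidal

theorem split_cross (g : W ⟶ X ⊗ Y) (Z : C) :
    split g (V ⊗ Z) ≫ X ◁ cross Y V Z ≫ cross X V (Y ⊗ Z) =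
      cross W V Z ≫ V ◁ split g Z := by
  have h := braiding_naturality_left g V
  rw [braiding_tensor_left_hom] at h
  calc
    _ = 𝟙 _ ⊗≫ (g ▷ V ≫ (α_ X Y V).hom ≫ X ◁ (β_ Y V).hom ≫ (α_ X V Y).inv ≫
          (β_ X V).hom ▷ Y ≫ (α_ V X Y).hom) ▷ Z ⊗≫ 𝟙 _ := by
      simp only [split, cross]; monoidal
    _ = _ := by rw [h]; simp only [split, cross]; monoidal

theorem cross_split (g : W ⟶ X ⊗ Y) (Z : C) :
    V ◁ split g Z ≫ cross V X (Y ⊗ Z) ≫ X ◁ cross V Y Z =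
      cross V W Z ≫ split g (V ⊗ Z) := by
  have h := braiding_naturality_right V g
  rw [braiding_tensor_right_hom] at h
  calc
    _ = 𝟙 _ ⊗≫ (V ◁ g ≫ (α_ V X Y).inv ≫ (β_ V X).hom ▷ Y ≫ (α_ X V Y).hom ≫
          X ◁ (β_ V Y).hom ≫ (α_ X Y V).inv) ▷ Z ⊗≫ 𝟙 _ := by
      simp only [split, cross]; monoidal
    _ = _ := by rw [h]; simp only [split, cross]; monoidal

theorem cap_cross (g : X ⊗ Y ⟶ 𝟙_ C) (Z : C) :
    cross V X (Y ⊗ Z) ≫ X ◁ cross V Y Z ≫ cap g (V ⊗ Z) = V ◁ cap g Z := by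
  have h := braiding_naturality_right V g
  rw [braiding_tensor_right_hom, braiding_tensorUnit_right] at h
  calc
    _ = 𝟙 _ ⊗≫ (((α_ V X Y).inv ≫ (β_ V X).hom ▷ Y ≫ (α_ X V Y).hom ≫
          X ◁ (β_ V Y).hom ≫ (α_ X Y V).inv) ≫ g ▷ V) ▷ Z ⊗≫ 𝟙 _ := by
      simp only [cap, cross]; monoidal
    _ = _ := by rw [← h]; simp only [cap]; monoidal

theorem cross_cup (g : 𝟙_ C ⟶ X ⊗ Y) (Z : C) :
    cup g (V ⊗ Z) ≫ X ◁ cross Y V Z ≫ cross X V (Y ⊗ Z) = V ◁ cup g Z := by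
  have h := braiding_naturality_left g V
  rw [braiding_tensor_left_hom, braiding_tensorUnit_left] at h
  calc
    _ = 𝟙 _ ⊗≫ (g ▷ V ≫ (α_ X Y V).hom ≫ X ◁ (β_ Y V).hom ≫ (α_ X V Y).inv ≫
          (β_ X V).hom ▷ Y ≫ (α_ V X Y).hom) ▷ Z ⊗≫ 𝟙 _ := by
      simp only [cup, cross]; monoidal
    _ = _ := by rw [h]; simp only [cup]; monoidal

theorem ins_cross (g : 𝟙_ C ⟶ X) (Z : C) : ins g (V ⊗ Z) ≫ cross X V Z = V ◁ ins g Z := by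
  have h := braiding_naturality_left g V
  rw [braiding_tensorUnit_left] at h
  calc
    _ = 𝟙 _ ⊗≫ (g ▷ V ≫ (β_ X V).hom) ▷ Z ⊗≫ 𝟙 _ := by simp only [ins, cross]; monoidal
    _ = _ := by rw [h]; simp only [ins]; monoidal

theorem cross_ins (g : 𝟙_ C ⟶ X) (Z : C) : V ◁ ins g Z ≫ cross V X Z = ins g (V ⊗ Z) := by
  have h := braiding_naturality_right V g
  rw [braiding_tensorUnit_right] at h
  calc
    _ = 𝟙 _ ⊗≫ (V ◁ g ≫ (β_ V X).hom) ▷ Z ⊗≫ 𝟙 _ := by simp only [ins, cross]; monoidal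
    _ = _ := by rw [h]; simp only [ins]; monoidal

theorem del_cross (g : X ⟶ 𝟙_ C) (Z : C) : cross X V Z ≫ V ◁ del g Z = del g (V ⊗ Z) := by
  have h := braiding_naturality_left g V
  rw [braiding_tensorUnit_left] at h
  calc
    _ = 𝟙 _ ⊗≫ ((β_ X V).hom ≫ V ◁ g) ▷ Z ⊗≫ 𝟙 _ := by simp only [del, cross]; monoidal
    _ = _ := by rw [← h]; simp only [del]; monoidal

theorem cross_del (g : X ⟶ 𝟙_ C) (Z : C) : cross V X Z ≫ del g (V ⊗ Z) = V ◁ del g Z := by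
  have h := braiding_naturality_right V g
  rw [braiding_tensorUnit_right] at h
  calc
    _ = 𝟙 _ ⊗≫ ((β_ V X).hom ≫ g ▷ V) ▷ Z ⊗≫ 𝟙 _ := by simp only [del, cross]; monoidal
    _ = _ := by rw [← h]; simp only [del]; monoidal

theorem whisker_cross (f : X ⟶ X') (Z : C) :
    f ▷ (V ⊗ Z) ≫ cross X' V Z = cross X V Z ≫ V ◁ f ▷ Z := by
  have h := braiding_naturality_left f V
  calc
    _ = 𝟙 _ ⊗≫ (f ▷ V ≫ (β_ X' V).hom) ▷ Z ⊗≫ 𝟙 _ := by simp only [cross]; monoidal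
    _ = _ := by rw [h]; simp only [cross]; monoidal

theorem cross_whisker (f : X ⟶ X') (Z : C) :
    V ◁ f ▷ Z ≫ cross V X' Z = cross V X Z ≫ f ▷ (V ⊗ Z) := by
  have h := braiding_naturality_right V f
  calc
    _ = 𝟙 _ ⊗≫ (V ◁ f ≫ (β_ V X').hom) ▷ Z ⊗≫ 𝟙 _ := by simp only [cross]; monoidal
    _ = _ := by rw [h]; simp only [cross]; monoidal

theorem cross_yang_baxter (X Y V Z : C) :
    cross X Y (V ⊗ Z) ≫ Y ◁ cross X V Z ≫ cross Y V (X ⊗ Z) =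
      X ◁ cross Y V Z ≫ cross X V (Y ⊗ Z) ≫ V ◁ cross X Y Z := by
  have h := yang_baxter X Y V
  calc
    _ = 𝟙 _ ⊗≫ ((α_ X Y V).inv ≫ (β_ X Y).hom ▷ V ≫ (α_ Y X V).hom ≫ Y ◁ (β_ X V).hom ≫
          (α_ Y V X).inv ≫ (β_ Y V).hom ▷ X ≫ (α_ V Y X).hom) ▷ Z ⊗≫ 𝟙 _ := by
      simp only [cross]; monoidal
    _ = _ := by rw [h]; simp only [cross]; monoidal

end Crossing

/-- An object whose braiding with every object is symmetric. -/
class Transparent (X : C) : Prop where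
  symm : ∀ Y, (β_ X Y).hom ≫ (β_ Y X).hom = 𝟙 (X ⊗ Y)

section Transparent

variable (X Y Z : C) [Transparent X]

theorem braiding_symm_left : (β_ X Y).hom ≫ (β_ Y X).hom = 𝟙 (X ⊗ Y) :=
  Transparent.symm Y

theorem braiding_symm_right : (β_ Y X).hom ≫ (β_ X Y).hom = 𝟙 (Y ⊗ X) := by
  rw [← cancel_epi (β_ X Y).hom, reassoc_of% (braiding_symm_left X Y), Category.comp_id]

theorem braiding_inv_left : (β_ X Y).inv = (β_ Y X).hom := by
  rw [← cancel_epi (β_ X Y).hom, Iso.hom_inv_id, braiding_symm_left]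

theorem braiding_inv_right : (β_ Y X).inv = (β_ X Y).hom := by
  rw [← cancel_epi (β_ Y X).hom, Iso.hom_inv_id, braiding_symm_right]

theorem cross_cross_left : cross X Y Z ≫ cross Y X Z = 𝟙 (X ⊗ Y ⊗ Z) := by
  simp only [cross, Category.assoc, Iso.hom_inv_id_assoc]
  rw [← comp_whiskerRight_assoc, braiding_symm_left]
  simp

theorem cross_cross_right : cross Y X Z ≫ cross X Y Z = 𝟙 (Y ⊗ X ⊗ Z) := by
  simp only [cross, Category.assoc, Iso.hom_inv_id_assoc]
  rw [← comp_whiskerRight_assoc, braiding_symm_right]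
  simp

end Transparent

end Tail

/-! ### Hopf algebras and dual pairings -/

section Bimonoid

variable {C : Type u} [Category.{v} C] [MonoidalCategory C]

theorem fuse_one_left {A : C} [MonObj A] (Z : C) :
    ins η[A] (A ⊗ Z) ≫ fuse μ[A] Z = 𝟙 (A ⊗ Z) := by
  have h := MonObj.one_mul A
  calc
    _ = 𝟙 _ ⊗≫ (η[A] ▷ A ≫ μ[A]) ▷ Z ⊗≫ 𝟙 _ := by simp only [ins, fuse]; monoidal
    _ = _ := by rw [h]; monoidal

theorem fuse_one_right {A : C} [MonObj A] (Z : C) :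
    A ◁ ins η[A] Z ≫ fuse μ[A] Z = 𝟙 (A ⊗ Z) := by
  have h := MonObj.mul_one A
  calc
    _ = 𝟙 _ ⊗≫ (A ◁ η[A] ≫ μ[A]) ▷ Z ⊗≫ 𝟙 _ := by simp only [ins, fuse]; monoidal
    _ = _ := by rw [h]; monoidal

theorem fuse_assoc {A : C} [MonObj A] (Z : C) :
    A ◁ fuse μ[A] Z ≫ fuse μ[A] Z = fuse μ[A] (A ⊗ Z) ≫ fuse μ[A] Z := by
  have h := MonObj.mul_assoc A
  symm
  calc
    _ = 𝟙 _ ⊗≫ (μ[A] ▷ A ≫ μ[A]) ▷ Z ⊗≫ 𝟙 _ := by simp only [fuse]; monoidal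
    _ = _ := by rw [h]; simp only [fuse]; monoidal

theorem split_counit_left {A : C} [ComonObj A] (Z : C) :
    split Δ[A] Z ≫ del ε[A] (A ⊗ Z) = 𝟙 (A ⊗ Z) := by
  have h := ComonObj.counit_comul A
  calc
    _ = 𝟙 _ ⊗≫ (Δ[A] ≫ ε[A] ▷ A) ▷ Z ⊗≫ 𝟙 _ := by simp only [split, del]; monoidal
    _ = _ := by rw [h]; monoidal

theorem split_counit_right {A : C} [ComonObj A] (Z : C) :
    split Δ[A] Z ≫ A ◁ del ε[A] Z = 𝟙 (A ⊗ Z) := by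
  have h := ComonObj.comul_counit A
  calc
    _ = 𝟙 _ ⊗≫ (Δ[A] ≫ A ◁ ε[A]) ▷ Z ⊗≫ 𝟙 _ := by simp only [split, del]; monoidal
    _ = _ := by rw [h]; monoidal

theorem split_coassoc {A : C} [ComonObj A] (Z : C) :
    split Δ[A] Z ≫ A ◁ split Δ[A] Z = split Δ[A] Z ≫ split Δ[A] (A ⊗ Z) := by
  have h := ComonObj.comul_assoc A
  symm
  calc
    _ = 𝟙 _ ⊗≫ (Δ[A] ≫ Δ[A] ▷ A ≫ (α_ A A A).hom) ▷ Z ⊗≫ 𝟙 _ := by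
      simp only [split]; monoidal
    _ = _ := by rw [← h]; simp only [split]; monoidal

variable [BraidedCategory C]

theorem fuse_split {A : C} [BimonObj A] (Z : C) :
    fuse μ[A] Z ≫ split Δ[A] Z = split Δ[A] (A ⊗ Z) ≫ A ◁ A ◁ split Δ[A] Z ≫
      A ◁ cross A A (A ⊗ Z) ≫ fuse μ[A] (A ⊗ A ⊗ Z) ≫ A ◁ fuse μ[A] Z := by
  have h := BimonObj.mul_comul A
  calc
    _ = 𝟙 _ ⊗≫ (μ[A] ≫ Δ[A]) ▷ Z ⊗≫ 𝟙 _ := by simp only [fuse, split]; monoidal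
    _ = _ := by
      rw [h, MonoidalCategory.tensorHom_def Δ[A], MonoidalCategory.tensorHom_def μ[A]]
      simp only [tensorμ, fuse, split, cross]
      monoidal

theorem fuse_counit {A : C} [BimonObj A] (Z : C) :
    fuse μ[A] Z ≫ del ε[A] Z = del ε[A] (A ⊗ Z) ≫ del ε[A] Z := by
  have h := BimonObj.mul_counit A
  rw [Comon.tensorObj_counit] at h
  calc
    _ = 𝟙 _ ⊗≫ (μ[A] ≫ ε[A]) ▷ Z ⊗≫ 𝟙 _ := by simp only [fuse, del]; monoidal
    _ = _ := by rw [h, MonoidalCategory.tensorHom_def]; simp only [del]; monoidal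

theorem ins_split {A : C} [BimonObj A] (Z : C) :
    ins η[A] Z ≫ split Δ[A] Z = ins η[A] Z ≫ ins η[A] (A ⊗ Z) := by
  have h := BimonObj.one_comul A
  rw [MonObj.tensorObj.one_def] at h
  calc
    _ = 𝟙 _ ⊗≫ (η[A] ≫ Δ[A]) ▷ Z ⊗≫ 𝟙 _ := by simp only [ins, split]; monoidal
    _ = _ := by rw [h, MonoidalCategory.tensorHom_def']; simp only [ins]; monoidal

end Bimonoid

section Hopf

variable {C : Type u} [Category.{v} C] [MonoidalCategory C] [BraidedCategory C]
variable {H : C} [HopfObj H]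

theorem split_antipode_left (Z : C) :
    split Δ[H] Z ≫ HopfObj.antipode (X := H) ▷ (H ⊗ Z) ≫ fuse μ[H] Z =
      del ε[H] Z ≫ ins η[H] Z := by
  have h := HopfObj.antipode_left H
  calc
    _ = 𝟙 _ ⊗≫ (Δ[H] ≫ HopfObj.antipode (X := H) ▷ H ≫ μ[H]) ▷ Z ⊗≫ 𝟙 _ := by
      simp only [fuse, split]; monoidal
    _ = _ := by rw [h]; simp only [del, ins]; monoidal

theorem split_antipode_right (Z : C) :
    split Δ[H] Z ≫ H ◁ HopfObj.antipode (X := H) ▷ Z ≫ fuse μ[H] Z =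
      del ε[H] Z ≫ ins η[H] Z := by
  have h := HopfObj.antipode_right H
  calc
    _ = 𝟙 _ ⊗≫ (Δ[H] ≫ H ◁ HopfObj.antipode (X := H) ≫ μ[H]) ▷ Z ⊗≫ 𝟙 _ := by
      simp only [fuse, split]; monoidal
    _ = _ := by rw [h]; simp only [del, ins]; monoidal

theorem antipode_split (Z : C) :
    HopfObj.antipode (X := H) ▷ Z ≫ split Δ[H] Z =
      split Δ[H] Z ≫ cross H H Z ≫ HopfObj.antipode (X := H) ▷ (H ⊗ Z) ≫
        H ◁ HopfObj.antipode (X := H) ▷ Z := by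
  have h := HopfObj.antipode_comul H
  calc
    _ = 𝟙 _ ⊗≫ (HopfObj.antipode (X := H) ≫ Δ[H]) ▷ Z ⊗≫ 𝟙 _ := by
      simp only [split]; monoidal
    _ = _ := by rw [h, MonoidalCategory.tensorHom_def]; simp only [split, cross]; monoidal

variable [IsIso (HopfObj.antipode (X := H))]

variable (H) in
/-- The inverse of the antipode. -/
noncomputable abbrev antipodeInv : H ⟶ H := inv (HopfObj.antipode (X := H))

theorem antipode_antipodeInv (Z : C) :
    HopfObj.antipode (X := H) ▷ Z ≫ antipodeInv H ▷ Z = 𝟙 (H ⊗ Z) := by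
  rw [← comp_whiskerRight, IsIso.hom_inv_id, id_whiskerRight]

theorem antipodeInv_antipode (Z : C) :
    antipodeInv H ▷ Z ≫ HopfObj.antipode (X := H) ▷ Z = 𝟙 (H ⊗ Z) := by
  rw [← comp_whiskerRight, IsIso.inv_hom_id, id_whiskerRight]

theorem antipodeInv_del (Z : C) : antipodeInv H ▷ Z ≫ del ε[H] Z = del ε[H] Z := by
  rw [del, ← comp_whiskerRight_assoc]
  congr 2
  rw [IsIso.inv_comp_eq, HopfObj.antipode_counit]

theorem ins_antipodeInv (Z : C) : ins η[H] Z ≫ antipodeInv H ▷ Z = ins η[H] Z := by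
  rw [ins, Category.assoc, ← comp_whiskerRight]
  congr 2
  rw [IsIso.comp_inv_eq, HopfObj.one_antipode]

variable [Transparent H]

theorem fuse_antipodeInv (Z : C) :
    fuse μ[H] Z ≫ antipodeInv H ▷ Z =
      antipodeInv H ▷ (H ⊗ Z) ≫ H ◁ antipodeInv H ▷ Z ≫ cross H H Z ≫ fuse μ[H] Z := by
  have h : μ[H] ≫ antipodeInv H =
      antipodeInv H ▷ H ≫ H ◁ antipodeInv H ≫ (β_ H H).hom ≫ μ[H] := by
    rw [IsIso.comp_inv_eq]
    simp only [Category.assoc]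
    rw [HopfObj.mul_antipode, MonoidalCategory.tensorHom_def]
    simp only [Category.assoc]
    rw [← braiding_naturality_right_assoc, ← braiding_naturality_left_assoc,
      reassoc_of% (braiding_symm_left H H), ← MonoidalCategory.whiskerLeft_comp_assoc,
      IsIso.inv_hom_id, MonoidalCategory.whiskerLeft_id, Category.id_comp,
      ← comp_whiskerRight_assoc, IsIso.inv_hom_id, id_whiskerRight, Category.id_comp]
  calc
    _ = 𝟙 _ ⊗≫ (μ[H] ≫ antipodeInv H) ▷ Z ⊗≫ 𝟙 _ := by
      simp only [fuse]; monoidal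
    _ = _ := by rw [h]; simp only [fuse, cross]; monoidal

theorem antipodeInv_split (Z : C) :
    antipodeInv H ▷ Z ≫ split Δ[H] Z =
      split Δ[H] Z ≫ cross H H Z ≫ antipodeInv H ▷ (H ⊗ Z) ≫ H ◁ antipodeInv H ▷ Z := by
  rw [← cancel_epi (HopfObj.antipode (X := H) ▷ Z), ← Category.assoc, antipode_antipodeInv,
    Category.id_comp, reassoc_of% (antipode_split (H := H) Z)]
  rw [reassoc_of% (cross_whisker (Z := Z) H (HopfObj.antipode (X := H))),
    reassoc_of% (whisker_cross (Z := Z) H (HopfObj.antipode (X := H))),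
    reassoc_of% (cross_cross_left H H Z)]
  rw [reassoc_of% (antipode_antipodeInv (H := H) (H ⊗ Z)), ← MonoidalCategory.whiskerLeft_comp,
    antipode_antipodeInv]
  simp

/-- `h₂ S⁻¹(h₁) = ε(h)`. -/
theorem split_antipodeInv_left (Z : C) :
    split Δ[H] Z ≫ antipodeInv H ▷ (H ⊗ Z) ≫ cross H H Z ≫ fuse μ[H] Z =
      del ε[H] Z ≫ ins η[H] Z := by
  have h := congrArg (fun t => t ≫ antipodeInv H ▷ Z) (split_antipode_right (H := H) Z)
  simp only [Category.assoc] at h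
  rw [ins_antipodeInv, fuse_antipodeInv, ← whisker_exchange_assoc,
    ← MonoidalCategory.whiskerLeft_comp_assoc, antipode_antipodeInv] at h
  simpa using h

/-- `S⁻¹(h₂) h₁ = ε(h)`. -/
theorem split_antipodeInv_right (Z : C) :
    split Δ[H] Z ≫ cross H H Z ≫ antipodeInv H ▷ (H ⊗ Z) ≫ fuse μ[H] Z =
      del ε[H] Z ≫ ins η[H] Z := by
  have h := congrArg (fun t => t ≫ antipodeInv H ▷ Z) (split_antipode_left (H := H) Z)
  simp only [Category.assoc] at h
  rw [ins_antipodeInv, fuse_antipodeInv, reassoc_of% (antipode_antipodeInv (H := H) (H ⊗ Z)),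
    reassoc_of% (cross_whisker (Z := Z) H (antipodeInv H))] at h
  exact h

end Hopf

section Pairing

variable {C : Type u} [Category.{v} C] [MonoidalCategory C]
variable (H B : C) [ExactPairing H B]

/-- The evaluation of the dual `B` of `H`, with a tail. -/
abbrev evT (Z : C) : B ⊗ H ⊗ Z ⟶ Z := cap (ExactPairing.evaluation H B) Z

/-- The coevaluation of the dual `B` of `H`, with a tail. -/
abbrev coevT (Z : C) : Z ⟶ H ⊗ B ⊗ Z := cup (ExactPairing.coevaluation H B) Z

theorem coevT_evT_left (Z : C) : coevT H B (H ⊗ Z) ≫ H ◁ evT H B Z = 𝟙 (H ⊗ Z) := by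
  have h := ExactPairing.evaluation_coevaluation H B
  calc
    _ = 𝟙 _ ⊗≫ (ExactPairing.coevaluation H B ▷ H ≫ (α_ _ _ _).hom ≫
          H ◁ ExactPairing.evaluation H B) ▷ Z ⊗≫ 𝟙 _ := by
      simp only [cap, cup]; monoidal
    _ = _ := by rw [h]; monoidal

theorem coevT_evT_right (Z : C) : B ◁ coevT H B Z ≫ evT H B (B ⊗ Z) = 𝟙 (B ⊗ Z) := by
  have h := ExactPairing.coevaluation_evaluation H B
  calc
    _ = 𝟙 _ ⊗≫ (B ◁ ExactPairing.coevaluation H B ≫ (α_ _ _ _).inv ≫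
          ExactPairing.evaluation H B ▷ B) ▷ Z ⊗≫ 𝟙 _ := by
      simp only [cap, cup]; monoidal
    _ = _ := by rw [h]; monoidal

variable {H B} {Z W : C}

variable (B) in
/-- The morphism `f ⊗ z ↦ f(z₋₁) z₀` corresponding to `z ↦ z₋₁ ⊗ z₀`. -/
def pair (G : Z ⟶ H ⊗ W) : B ⊗ Z ⟶ W :=
  B ◁ G ≫ evT H B W

variable (H) in
/-- The morphism `z ↦ ∑ hᵢ ⊗ b(hⁱ ⊗ z)` corresponding to `b`. -/
def unpair (b : B ⊗ Z ⟶ W) : Z ⟶ H ⊗ W :=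
  coevT H B Z ≫ H ◁ b

theorem pair_unpair (b : B ⊗ Z ⟶ W) : pair B (unpair H b) = b := by
  rw [pair, unpair, MonoidalCategory.whiskerLeft_comp, Category.assoc, ← cap_nat,
    reassoc_of% (coevT_evT_right H B Z)]

theorem unpair_pair (G : Z ⟶ H ⊗ W) : unpair H (pair B G) = G := by
  rw [pair, unpair, MonoidalCategory.whiskerLeft_comp, reassoc_of% (cup_nat _ G),
    coevT_evT_left, Category.comp_id]

theorem pair_injective : Function.Injective (pair B : (Z ⟶ H ⊗ W) → (B ⊗ Z ⟶ W)) :=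
  Function.LeftInverse.injective (g := unpair H) unpair_pair

/-- Morphisms to `B ⊗ Z` agree if they agree after evaluation at every morphism `Z ⟶ H ⊗ W`. -/
theorem ext_pair {T : C} {f g : T ⟶ B ⊗ Z}
    (h : ∀ (W : C) (G : Z ⟶ H ⊗ W), f ≫ pair B G = g ≫ pair B G) : f = g := by
  have h' := h _ (coevT H B Z)
  simpa only [pair, coevT_evT_right, Category.comp_id] using h'

end Pairing

/-! ### The convolution product and dual actions -/

section Dual

variable {C : Type u} [Category.{v} C] [MonoidalCategory C]

section Pair

variable {H B : C} [ExactPairing H B] {Z Z' W W' : C}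

theorem pair_comp (G : Z ⟶ H ⊗ W) (k : W ⟶ W') : pair B G ≫ k = pair B (G ≫ H ◁ k) := by
  rw [pair, pair, Category.assoc, cap_nat, MonoidalCategory.whiskerLeft_comp, Category.assoc]

theorem comp_pair (f : Z' ⟶ Z) (G : Z ⟶ H ⊗ W) : B ◁ f ≫ pair B G = pair B (f ≫ G) := by
  rw [pair, pair, MonoidalCategory.whiskerLeft_comp, Category.assoc]

variable [BraidedCategory C]

theorem whiskerLeft_pair (V : C) (G : Z ⟶ H ⊗ W) :
    V ◁ pair B G = cross V B Z ≫ pair B (V ◁ G ≫ cross V H W) := by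
  rw [pair, MonoidalCategory.whiskerLeft_comp, ← cap_cross V _ W]
  rw [← reassoc_of% (cross_nat (X := V) (Y := B) G), pair, MonoidalCategory.whiskerLeft_comp,
    Category.assoc]

end Pair

variable [BraidedCategory C] (H B : C) [ExactPairing H B]

/-- The action `h · f` of `H` on its dual with `(h · f)(x) = f(ω(h, x))`. -/
def dualAct (ω : H ⊗ H ⟶ H) : H ⊗ B ⟶ B :=
  H ◁ (ρ_ B).inv ≫ cross H B (𝟙_ C) ≫
    pair B (H ◁ coevT H B (𝟙_ C) ≫ fuse ω (B ⊗ 𝟙_ C)) ≫ (ρ_ B).hom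

/-- The opposite coproduct. -/
abbrev comulOp (H : C) [ComonObj H] : H ⟶ H ⊗ H := Δ[H] ≫ (β_ H H).hom

theorem split_comulOp [ComonObj H] (Z : C) : split (comulOp H) Z = split Δ[H] Z ≫ cross H H Z := by
  simp [split, cross]

/-- The convolution product on the dual, `(f g)(h) = f(h₁) g(h₂)`. The opposite coproduct appears
since the inner `pair` evaluates the second factor `g` at the leftmost factor of `H ⊗ H`. -/
def convMul [ComonObj H] : B ⊗ B ⟶ B :=
  B ◁ (ρ_ B).inv ≫
    pair B (pair B (coevT H B (𝟙_ C) ≫ split (comulOp H) (B ⊗ 𝟙_ C))) ≫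
      (ρ_ B).hom

/-- The unit `ε` of the convolution product. -/
def convOne [ComonObj H] : 𝟙_ C ⟶ B :=
  ExactPairing.coevaluation H B ≫ ε[H] ▷ B ≫ (λ_ B).hom

variable {H B} {Z W : C}

/-- The defining property `(h · f)(x) = f(ω(h, x))` of the dual action. -/
theorem dualAct_pair (ω : H ⊗ H ⟶ H) (G : Z ⟶ H ⊗ W) :
    fuse (dualAct H B ω) Z ≫ pair B G = cross H B Z ≫ pair B (H ◁ G ≫ fuse ω W) := by
  have h : fuse (dualAct H B ω) Z =
      cross H B Z ≫ pair B (H ◁ coevT H B Z ≫ fuse ω (B ⊗ Z)) := by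
    simp only [dualAct, pair, fuse, cross, cap, cup]
    monoidal
  rw [h, Category.assoc, pair_comp, Category.assoc, fuse_nat,
    ← MonoidalCategory.whiskerLeft_comp_assoc]
  congr 4
  exact unpair_pair G

theorem convMul_pair [ComonObj H] (G : Z ⟶ H ⊗ W) :
    fuse (convMul H B) Z ≫ pair B G = pair B (pair B (G ≫ split (comulOp H) W)) := by
  have h : fuse (convMul H B) Z =
      pair B (pair B (coevT H B Z ≫ split (comulOp H) (B ⊗ Z))) := by
    simp only [convMul, pair, fuse, split, cap, cup]
    monoidal
  rw [h, pair_comp, pair_comp, Category.assoc, split_nat (comulOp H) (pair B G)]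
  congr 2
  rw [← Category.assoc]
  congr 1
  exact unpair_pair G

omit [BraidedCategory C] in
theorem convOne_pair [ComonObj H] (G : Z ⟶ H ⊗ W) :
    ins (convOne H B) Z ≫ pair B G = G ≫ del ε[H] W := by
  have h : ins (convOne H B) Z = coevT H B Z ≫ del ε[H] (B ⊗ Z) := by
    simp only [convOne, ins, del, cup]
    monoidal
  rw [h, Category.assoc, del_nat, ← Category.assoc]
  congr 1
  exact unpair_pair G

section ConvMonoid

variable [ComonObj H]

theorem convMul_one_left (Z : C) : ins (convOne H B) (B ⊗ Z) ≫ fuse (convMul H B) Z = 𝟙 _ := by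
  refine ext_pair (H := H) fun W G => ?_
  rw [Category.assoc, convMul_pair, convOne_pair, pair_comp, Category.assoc, split_comulOp,
    Category.assoc, del_cross, split_counit_left, Category.comp_id, Category.id_comp]

theorem convMul_one_right (Z : C) : B ◁ ins (convOne H B) Z ≫ fuse (convMul H B) Z = 𝟙 _ := by
  refine ext_pair (H := H) fun W G => ?_
  rw [Category.assoc, convMul_pair, comp_pair, convOne_pair, Category.assoc, split_comulOp,
    Category.assoc, cross_del, split_counit_right, Category.comp_id, Category.id_comp]

/-- Coassociativity of the opposite coproduct. -/
theorem split_comulOp_coassoc (Z : C) :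
    split (comulOp H) Z ≫ split (comulOp H) (H ⊗ Z) =
      split (comulOp H) Z ≫ H ◁ split (comulOp H) Z := by
  simp only [split_comulOp, Category.assoc, MonoidalCategory.whiskerLeft_comp]
  rw [← reassoc_of% (cross_split H Δ[H] Z), ← reassoc_of% (split_cross H Δ[H] Z),
    reassoc_of% (split_coassoc (A := H) Z), cross_yang_baxter]

theorem convMul_assoc (Z : C) :
    B ◁ fuse (convMul H B) Z ≫ fuse (convMul H B) Z =
      fuse (convMul H B) (B ⊗ Z) ≫ fuse (convMul H B) Z := by
  refine ext_pair (H := H) fun W G => ?_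
  simp only [Category.assoc, convMul_pair, comp_pair, pair_comp, split_comulOp_coassoc]

end ConvMonoid

section DualAct

theorem dualAct_dualAct_pair (ω ω' : H ⊗ H ⟶ H) (G : Z ⟶ H ⊗ W) :
    H ◁ fuse (dualAct H B ω') Z ≫ fuse (dualAct H B ω) Z ≫ pair B G =
      H ◁ cross H B Z ≫ cross H B (H ⊗ Z) ≫
        pair B (cross H H Z ≫ H ◁ H ◁ G ≫ H ◁ fuse ω W ≫ fuse ω' W) := by
  rw [dualAct_pair, reassoc_of% (cross_fuse H (dualAct H B ω') Z), dualAct_pair,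
    reassoc_of% (cross_yang_baxter H H B Z), comp_pair]
  simp only [MonoidalCategory.whiskerLeft_comp, Category.assoc]

theorem fuse_dualAct_pair (m : H ⊗ H ⟶ H) (ω : H ⊗ H ⟶ H) (G : Z ⟶ H ⊗ W) :
    fuse m (B ⊗ Z) ≫ fuse (dualAct H B ω) Z ≫ pair B G =
      H ◁ cross H B Z ≫ cross H B (H ⊗ Z) ≫ pair B (H ◁ H ◁ G ≫ fuse m (H ⊗ W) ≫ fuse ω W) := by
  rw [dualAct_pair, reassoc_of% (fuse_cross B m Z), comp_pair, reassoc_of% (fuse_nat m G)]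

/-- A dual action is an action as soon as `ω` is a contravariant action. -/
theorem dualAct_mul (m ω : H ⊗ H ⟶ H)
    (h : ∀ W, cross H H (H ⊗ W) ≫ H ◁ fuse ω W ≫ fuse ω W = fuse m (H ⊗ W) ≫ fuse ω W) (Z : C) :
    H ◁ fuse (dualAct H B ω) Z ≫ fuse (dualAct H B ω) Z =
      fuse m (B ⊗ Z) ≫ fuse (dualAct H B ω) Z := by
  refine ext_pair (H := H) fun W G => ?_
  rw [Category.assoc, Category.assoc, dualAct_dualAct_pair, fuse_dualAct_pair,
    reassoc_of% (cross_nat (X := H) (Y := H) G), h]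

theorem dualAct_one (e : 𝟙_ C ⟶ H) (ω : H ⊗ H ⟶ H)
    (h : ∀ W, ins e (H ⊗ W) ≫ fuse ω W = 𝟙 _) (Z : C) :
    ins e (B ⊗ Z) ≫ fuse (dualAct H B ω) Z = 𝟙 _ := by
  refine ext_pair (H := H) fun W G => ?_
  rw [Category.assoc, dualAct_pair, reassoc_of% (ins_cross B e Z), comp_pair,
    reassoc_of% (ins_nat e G), h, Category.comp_id, Category.id_comp]

/-- Dual actions by commuting operations commute. -/
theorem dualAct_comm [Transparent H] (ω ω' : H ⊗ H ⟶ H)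
    (h : ∀ W, cross H H (H ⊗ W) ≫ H ◁ fuse ω W ≫ fuse ω' W = H ◁ fuse ω' W ≫ fuse ω W) (Z : C) :
    H ◁ fuse (dualAct H B ω') Z ≫ fuse (dualAct H B ω) Z =
      cross H H (B ⊗ Z) ≫ H ◁ fuse (dualAct H B ω) Z ≫ fuse (dualAct H B ω') Z := by
  refine ext_pair (H := H) fun W G => ?_
  simp only [Category.assoc, dualAct_dualAct_pair]
  rw [reassoc_of% (cross_yang_baxter H H B Z), comp_pair,
    reassoc_of% (cross_cross_left H H Z), reassoc_of% (cross_nat (X := H) (Y := H) G), h]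

/-- A dual action is compatible with the convolution product as soon as `ω` is compatible with the
opposite coproduct. -/
theorem dualAct_convMul [ComonObj H] (δ : H ⟶ H ⊗ H) (ω : H ⊗ H ⟶ H)
    (h : ∀ W, fuse ω W ≫ split (comulOp H) W =
      split δ (H ⊗ W) ≫ H ◁ H ◁ split (comulOp H) W ≫ H ◁ fuse ω (H ⊗ W) ≫
        cross H H (H ⊗ W) ≫ H ◁ fuse ω W) (Z : C) :
    H ◁ fuse (convMul H B) Z ≫ fuse (dualAct H B ω) Z =
      split δ (B ⊗ B ⊗ Z) ≫ H ◁ cross H B (B ⊗ Z) ≫ fuse (dualAct H B ω) (H ⊗ B ⊗ Z) ≫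
        B ◁ fuse (dualAct H B ω) Z ≫ fuse (convMul H B) Z := by
  refine ext_pair (H := H) fun W G => ?_
  simp only [Category.assoc, convMul_pair, dualAct_pair, comp_pair, pair_comp,
    whiskerLeft_pair, MonoidalCategory.whiskerLeft_comp]
  rw [reassoc_of% (cross_fuse H (convMul H B) Z), convMul_pair, comp_pair,
    reassoc_of% (split_cross B δ (B ⊗ Z)), comp_pair, reassoc_of% (split_cross B δ Z), comp_pair,
    reassoc_of% (split_nat δ G)]
  simp only [Category.assoc, h]

/-- A dual action preserves the unit of the convolution product as soon as `ω` is compatible with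
the counit. -/
theorem dualAct_convOne [ComonObj H] (e : H ⟶ 𝟙_ C) (ω : H ⊗ H ⟶ H)
    (h : ∀ W, fuse ω W ≫ del ε[H] W = del e (H ⊗ W) ≫ del ε[H] W) (Z : C) :
    H ◁ ins (convOne H B) Z ≫ fuse (dualAct H B ω) Z = del e Z ≫ ins (convOne H B) Z := by
  refine ext_pair (H := H) fun W G => ?_
  rw [Category.assoc, Category.assoc, dualAct_pair, reassoc_of% (cross_ins H (convOne H B) Z),
    convOne_pair, convOne_pair, Category.assoc, h, ← Category.assoc, ← del_nat,
    Category.assoc]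

end DualAct

section Regular

variable [HopfObj H]

/-- The multiplication `h ⊗ x ↦ x h`, whose dual action is `(h · f)(x) = f(x h)`. -/
abbrev mulOp (H : C) [HopfObj H] : H ⊗ H ⟶ H := (β_ H H).hom ≫ μ[H]

theorem fuse_mulOp (Z : C) : fuse (mulOp H) Z = cross H H Z ≫ fuse μ[H] Z := by
  simp [fuse, cross]

/-- The multiplication `h ⊗ x ↦ S⁻¹(h) x`, whose dual action is `(h · f)(x) = f(S⁻¹(h) x)`. -/
noncomputable abbrev mulInv (H : C) [HopfObj H] [IsIso (HopfObj.antipode (X := H))] :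
    H ⊗ H ⟶ H :=
  antipodeInv H ▷ H ≫ μ[H]

theorem fuse_mulInv [IsIso (HopfObj.antipode (X := H))] (Z : C) :
    fuse (mulInv H) Z = antipodeInv H ▷ (H ⊗ Z) ≫ fuse μ[H] Z := by
  simp [fuse]

theorem fuse_split_comulOp [Transparent H] (Z : C) :
    fuse μ[H] Z ≫ split (comulOp H) Z = split (comulOp H) (H ⊗ Z) ≫ H ◁ H ◁ split (comulOp H) Z ≫
      H ◁ cross H H (H ⊗ Z) ≫ fuse μ[H] (H ⊗ H ⊗ Z) ≫ H ◁ fuse μ[H] Z := by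
  simp only [split_comulOp, Category.assoc, MonoidalCategory.whiskerLeft_comp]
  rw [reassoc_of% (fuse_split (A := H) Z), cross_fuse H μ[H] Z,
    reassoc_of% (fuse_cross H μ[H] (H ⊗ Z)),
    reassoc_of% (whisk20 H (cross_cross_left H H (H ⊗ Z))),
    ← reassoc_of% (cross_nat (X := H) (Y := H) (split Δ[H] Z)),
    reassoc_of% (whisk23 H (fuse_cross H μ[H] Z)), ← fuse_nat μ[H] (fuse μ[H] Z)]

theorem mulOp_one (W : C) : ins η[H] (H ⊗ W) ≫ fuse (mulOp H) W = 𝟙 _ := by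
  rw [fuse_mulOp, reassoc_of% (ins_cross H η[H] W), fuse_one_right]

theorem mulOp_mul [Transparent H] (W : C) :
    cross H H (H ⊗ W) ≫ H ◁ fuse (mulOp H) W ≫ fuse (mulOp H) W =
      fuse μ[H] (H ⊗ W) ≫ fuse (mulOp H) W := by
  simp only [fuse_mulOp, MonoidalCategory.whiskerLeft_comp, Category.assoc]
  rw [reassoc_of% (cross_fuse H μ[H] W), reassoc_of% (cross_yang_baxter H H H W),
    ← MonoidalCategory.whiskerLeft_comp_assoc, cross_cross_left, MonoidalCategory.whiskerLeft_id,
    Category.id_comp, reassoc_of% (fuse_cross H μ[H] W), fuse_assoc]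

theorem mulOp_counit (W : C) :
    fuse (mulOp H) W ≫ del ε[H] W = del ε[H] (H ⊗ W) ≫ del ε[H] W := by
  rw [fuse_mulOp, Category.assoc, fuse_counit, reassoc_of% (cross_del H ε[H] W), ← del_nat]

theorem mulOp_comulOp [Transparent H] (W : C) :
    fuse (mulOp H) W ≫ split (comulOp H) W =
      split Δ[H] (H ⊗ W) ≫ H ◁ H ◁ split (comulOp H) W ≫ H ◁ fuse (mulOp H) (H ⊗ W) ≫
        cross H H (H ⊗ W) ≫ H ◁ fuse (mulOp H) W := by
  simp only [fuse_mulOp, MonoidalCategory.whiskerLeft_comp, Category.assoc]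
  rw [fuse_split_comulOp, ← reassoc_of% (cross_split H (comulOp H) W),
    ← reassoc_of% (whisk32 H (split_cross H (comulOp H) W)),
    reassoc_of% (whisk20 H (cross_cross_right H H (H ⊗ W))),
    ← reassoc_of% (split_cross H (comulOp H) (H ⊗ W)), reassoc_of% (cross_fuse H μ[H] (H ⊗ W)),
    ← reassoc_of% (cross_yang_baxter H H H (H ⊗ W)),
    ← reassoc_of% (cross_nat (X := H) (Y := H) (split (comulOp H) W)),
    ← reassoc_of% (split_comulOp (H := H) (H ⊗ W)),
    reassoc_of% (split_nat (comulOp H) (split (comulOp H) W)),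
    reassoc_of% (fuse_nat μ[H] (cross H H W))]

variable [IsIso (HopfObj.antipode (X := H))]

theorem mulInv_one (W : C) : ins η[H] (H ⊗ W) ≫ fuse (mulInv H) W = 𝟙 _ := by
  rw [fuse_mulInv, reassoc_of% (ins_antipodeInv (H := H) (H ⊗ W)), fuse_one_left]

theorem mulInv_mul [Transparent H] (W : C) :
    cross H H (H ⊗ W) ≫ H ◁ fuse (mulInv H) W ≫ fuse (mulInv H) W =
      fuse μ[H] (H ⊗ W) ≫ fuse (mulInv H) W := by
  simp only [fuse_mulInv, MonoidalCategory.whiskerLeft_comp, Category.assoc]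
  rw [reassoc_of% (fuse_antipodeInv (H := H) (H ⊗ W)), whisker_exchange_assoc, fuse_assoc,
    reassoc_of% (cross_whisker (Z := H ⊗ W) H (antipodeInv H)),
    reassoc_of% (whisker_cross (Z := H ⊗ W) H (antipodeInv H)), whisker_exchange_assoc]

theorem mulOp_mulInv_comm [Transparent H] (W : C) :
    cross H H (H ⊗ W) ≫ H ◁ fuse (mulOp H) W ≫ fuse (mulInv H) W =
      H ◁ fuse (mulInv H) W ≫ fuse (mulOp H) W := by
  simp only [fuse_mulInv, fuse_mulOp, MonoidalCategory.whiskerLeft_comp, Category.assoc]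
  rw [reassoc_of% (cross_fuse H μ[H] W), whisker_exchange_assoc, fuse_assoc,
    whisker_exchange_assoc, reassoc_of% (cross_whisker (Z := H ⊗ W) H (antipodeInv H))]

theorem mulInv_counit (W : C) :
    fuse (mulInv H) W ≫ del ε[H] W = del ε[H] (H ⊗ W) ≫ del ε[H] W := by
  rw [fuse_mulInv, Category.assoc, fuse_counit,
    reassoc_of% (antipodeInv_del (H := H) (H ⊗ W))]

theorem antipodeInv_split_comulOp [Transparent H] (Z : C) :
    antipodeInv H ▷ Z ≫ split (comulOp H) Z =
      split Δ[H] Z ≫ antipodeInv H ▷ (H ⊗ Z) ≫ H ◁ antipodeInv H ▷ Z := by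
  rw [split_comulOp, reassoc_of% (antipodeInv_split (H := H) Z), cross_whisker,
    reassoc_of% (whisker_cross (Z := Z) H (antipodeInv H)),
    reassoc_of% (cross_cross_left H H Z), whisker_exchange]

theorem mulInv_comulOp [Transparent H] (W : C) :
    fuse (mulInv H) W ≫ split (comulOp H) W =
      split (comulOp H) (H ⊗ W) ≫ H ◁ H ◁ split (comulOp H) W ≫ H ◁ fuse (mulInv H) (H ⊗ W) ≫
        cross H H (H ⊗ W) ≫ H ◁ fuse (mulInv H) W := by
  simp only [fuse_mulInv, MonoidalCategory.whiskerLeft_comp, Category.assoc]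
  rw [fuse_split_comulOp, reassoc_of% (antipodeInv_split_comulOp (H := H) (H ⊗ W)),
    reassoc_of% (cross_fuse H μ[H] (H ⊗ W)),
    reassoc_of% (cross_whisker (Z := H ⊗ H ⊗ W) H (antipodeInv H)),
    ← reassoc_of% (cross_nat (X := H) (Y := H) (split (comulOp H) W)),
    split_comulOp (H := H) (H ⊗ W)]
  rw [Category.assoc, reassoc_of% (cross_cross_left H H (H ⊗ W)),
    reassoc_of% (fuse_nat μ[H] (antipodeInv H ▷ (H ⊗ W))),
    ← reassoc_of% (whisk22 H (whisker_cross (Z := H ⊗ W) H (antipodeInv H))),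
    whisker_exchange_assoc,
    reassoc_of% (whisk22 H (whisker_exchange (antipodeInv H) (split (comulOp H) W)))]

end Regular

end Dual

/-! ### Exchange morphisms given by actions -/

section Mix

variable {C : Type u} [Category.{v} C] [MonoidalCategory C] [BraidedCategory C]
variable {H B : C}

/-- The exchange morphism `h ⊗ f ↦ h₁ f ⊗ h₂` for an action `l` of `H` on `B` and a
coproduct `δ` of `H`. -/
def mix (δ : H ⟶ H ⊗ H) (l : H ⊗ B ⟶ B) (Z : C) : H ⊗ B ⊗ Z ⟶ B ⊗ H ⊗ Z :=
  split δ (B ⊗ Z) ≫ H ◁ cross H B Z ≫ fuse l (H ⊗ Z)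

variable (δ : H ⟶ H ⊗ H) (l : H ⊗ B ⟶ B) {Z Z' : C}

/-- Exchanging with a product in `H` amounts to exchanging with both factors. -/
theorem fuse_mix (m : H ⊗ H ⟶ H)
    (hδ : ∀ Z, fuse m Z ≫ split δ Z = split δ (H ⊗ Z) ≫ H ◁ H ◁ split δ Z ≫
      H ◁ cross H H (H ⊗ Z) ≫ fuse m (H ⊗ H ⊗ Z) ≫ H ◁ fuse m Z)
    (hl : ∀ Z, H ◁ fuse l Z ≫ fuse l Z = fuse m (B ⊗ Z) ≫ fuse l Z) (Z : C) :
    fuse m (B ⊗ Z) ≫ mix δ l Z = H ◁ mix δ l Z ≫ mix δ l (H ⊗ Z) ≫ B ◁ fuse m Z := by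
  simp only [mix, MonoidalCategory.whiskerLeft_comp, Category.assoc]
  rw [reassoc_of% (hδ (B ⊗ Z)), reassoc_of% (whisk23 H (fuse_cross B m Z)), ← fuse_nat l (fuse m Z),
    reassoc_of% (fuse_nat m (H ◁ cross H B Z)), reassoc_of% (fuse_nat m (cross H B (H ⊗ Z))),
    ← reassoc_of% (hl (H ⊗ H ⊗ Z)), ← reassoc_of% (split_nat δ (fuse l (H ⊗ Z))),
    reassoc_of% (whisk23 H (cross_fuse H l (H ⊗ Z))),
    ← reassoc_of% (split_nat δ (H ◁ cross H B Z)), ← reassoc_of% (split_nat δ (split δ (B ⊗ Z))),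
    reassoc_of% (whisk22 H (cross_nat (X := H) (Y := H) (cross H B Z))),
    fuse_nat l (fuse m Z)]

/-- Exchanging with a product in `B` amounts to exchanging with both factors. -/
theorem mix_fuse (m : B ⊗ B ⟶ B)
    (hδ : ∀ Z, split δ Z ≫ split δ (H ⊗ Z) = split δ Z ≫ H ◁ split δ Z)
    (hl : ∀ Z, H ◁ fuse m Z ≫ fuse l Z = split δ (B ⊗ B ⊗ Z) ≫ H ◁ cross H B (B ⊗ Z) ≫
      fuse l (H ⊗ B ⊗ Z) ≫ B ◁ fuse l Z ≫ fuse m Z) (Z : C) :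
    H ◁ fuse m Z ≫ mix δ l Z = mix δ l (B ⊗ Z) ≫ B ◁ mix δ l Z ≫ fuse m (H ⊗ Z) := by
  simp only [mix, MonoidalCategory.whiskerLeft_comp, Category.assoc]
  rw [← reassoc_of% (split_nat δ (fuse m Z)), reassoc_of% (whisk23 H (cross_fuse H m Z)),
    hl (H ⊗ Z), ← reassoc_of% (split_nat δ (B ◁ cross H B Z)),
    ← reassoc_of% (split_nat δ (cross H B (B ⊗ Z))), reassoc_of% (hδ (B ⊗ B ⊗ Z)),
    reassoc_of% (fuse_nat l (split δ (B ⊗ Z))), reassoc_of% (fuse_nat l (H ◁ cross H B Z)),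
    ← reassoc_of% (whisk32 H (split_cross B δ (B ⊗ Z))),
    reassoc_of% (whisk22 H (cross_nat (X := H) (Y := B) (cross H B Z)))]

theorem ins_mix (e : 𝟙_ C ⟶ H) (hδ : ∀ Z, ins e Z ≫ split δ Z = ins e Z ≫ ins e (H ⊗ Z))
    (hl : ∀ Z, ins e (B ⊗ Z) ≫ fuse l Z = 𝟙 _) (Z : C) :
    ins e (B ⊗ Z) ≫ mix δ l Z = B ◁ ins e Z := by
  rw [mix, reassoc_of% (hδ (B ⊗ Z)), reassoc_of% (ins_nat e (cross H B Z)), hl, Category.comp_id,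
    ins_cross]

theorem mix_ins (e : 𝟙_ C ⟶ B) (c : H ⟶ 𝟙_ C) (hδ : ∀ Z, split δ Z ≫ del c (H ⊗ Z) = 𝟙 _)
    (hl : ∀ Z, H ◁ ins e Z ≫ fuse l Z = del c Z ≫ ins e Z) (Z : C) :
    H ◁ ins e Z ≫ mix δ l Z = ins e (H ⊗ Z) := by
  rw [mix, ← reassoc_of% (split_nat δ (ins e Z)), reassoc_of% (whisk21 H (cross_ins H e Z)), hl,
    reassoc_of% (hδ Z)]

variable (l' : H ⊗ B ⟶ B)

/-- `h ⊗ f ↦ h₁ ⊗ h₂ f`, the other way to use an action of `H` on `B`. -/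
def shift (δ : H ⟶ H ⊗ H) (Z : C) : H ⊗ B ⊗ Z ⟶ H ⊗ B ⊗ Z :=
  split δ (B ⊗ Z) ≫ H ◁ fuse l' Z

/-- `f ⊗ h ↦ h₁ f ⊗ h₂`. -/
def slide (l : H ⊗ B ⟶ B) (δ : H ⟶ H ⊗ H) (Z : C) : B ⊗ H ⊗ Z ⟶ B ⊗ H ⊗ Z :=
  B ◁ split δ Z ≫ cross B H (H ⊗ Z) ≫ fuse l (H ⊗ Z)

theorem cross_slide [Transparent H] (Z : C) : cross H B Z ≫ slide l δ Z = mix δ l Z := by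
  rw [slide, mix, ← reassoc_of% (split_cross B δ Z), reassoc_of% (cross_cross_left H B (H ⊗ Z))]

theorem cross_mix [Transparent H] (Z : C) : cross B H Z ≫ mix δ l Z = slide l δ Z := by
  rw [← cross_slide, reassoc_of% (cross_cross_right H B Z)]

theorem mix_comulOp [ComonObj H] (Z : C) :
    mix (comulOp H) l' Z = shift l' Δ[H] Z ≫ cross H B Z := by
  rw [mix, shift, Category.assoc, cross_fuse, split_comulOp, Category.assoc]

theorem mix_comulOp_cross [Transparent H] [ComonObj H] (Z : C) :
    mix (comulOp H) l' Z ≫ cross B H Z = shift l' Δ[H] Z := by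
  rw [mix_comulOp, Category.assoc, cross_cross_left, Category.comp_id]

theorem shift_slide_comm [Transparent H] (hl : ∀ Z, H ◁ fuse l' Z ≫ fuse l Z =
      cross H H (B ⊗ Z) ≫ H ◁ fuse l Z ≫ fuse l' Z) (Z : C) :
    shift l' δ (H ⊗ Z) ≫ H ◁ slide l δ Z = H ◁ slide l δ Z ≫ shift l' δ (H ⊗ Z) := by
  simp only [shift, slide, MonoidalCategory.whiskerLeft_comp, Category.assoc]
  rw [reassoc_of% (whisk22 H (fuse_nat l' (split δ Z))),
    reassoc_of% (whisk23 H (fuse_cross H l' (H ⊗ Z))), whisk23 H (hl (H ⊗ Z)),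
    reassoc_of% (whisk20 H (cross_cross_left H H (B ⊗ H ⊗ Z)))]
  rw [← reassoc_of% (split_nat δ (fuse l (H ⊗ Z))),
    ← reassoc_of% (split_nat δ (cross B H (H ⊗ Z))),
    ← reassoc_of% (split_nat δ (B ◁ split δ Z))]

theorem slide_shift_comm
    (hδ : ∀ Z, split δ Z ≫ split δ (H ⊗ Z) = split δ Z ≫ H ◁ split δ Z) (Z : C) :
    B ◁ shift l' δ Z ≫ slide l δ (B ⊗ Z) = slide l δ (B ⊗ Z) ≫ B ◁ shift l' δ Z := by
  simp only [shift, slide, MonoidalCategory.whiskerLeft_comp, Category.assoc]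
  rw [← reassoc_of% (whisk22 B (split_nat δ (fuse l' Z))),
    reassoc_of% (whisk22 B (hδ (B ⊗ Z))), ← reassoc_of% (cross_nat (X := B) (Y := H)
      (H ◁ fuse l' Z)), ← fuse_nat l (H ◁ fuse l' Z), reassoc_of% (fuse_nat l (split δ (B ⊗ Z))),
    reassoc_of% (cross_nat (X := B) (Y := H) (split δ (B ⊗ Z)))]

end Mix

/-! ### The exchange morphism of the double and smash products -/

/-- A morphism `X ⊗ Y ⟶ X' ⊗ Y'` applied to the two leftmost factors. -/
def tailed {C : Type u} [Category.{v} C] [MonoidalCategory C] {X Y X' Y' : C}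
    (g : X ⊗ Y ⟶ X' ⊗ Y') (Z : C) : X ⊗ Y ⊗ Z ⟶ X' ⊗ Y' ⊗ Z :=
  (α_ X Y Z).inv ≫ g ▷ Z ≫ (α_ X' Y' Z).hom

theorem tailed_nat {C : Type u} [Category.{v} C] [MonoidalCategory C] {X Y X' Y' Z Z' : C}
    (g : X ⊗ Y ⟶ X' ⊗ Y') (f : Z ⟶ Z') :
    tailed g Z ≫ X' ◁ Y' ◁ f = X ◁ Y ◁ f ≫ tailed g Z' := by
  have h (Z) : tailed g Z = fuse g Z ≫ (α_ X' Y' Z).hom := by simp [tailed, fuse]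
  rw [h, h, ← reassoc_of% (fuse_nat g f)]
  simp

section Exchange

variable {C : Type u} [Category.{v} C] [MonoidalCategory C] [BraidedCategory C]
variable (H B : C) [HopfObj H] [ExactPairing H B]

/-- The action of `H` on its dual with `(h · f)(x) = f(x h)`. -/
def actMul : H ⊗ B ⟶ B := dualAct H B (mulOp H)

variable {H B} in
theorem actMul_mul [Transparent H] (Z : C) :
    H ◁ fuse (actMul H B) Z ≫ fuse (actMul H B) Z = fuse μ[H] (B ⊗ Z) ≫ fuse (actMul H B) Z :=
  dualAct_mul _ _ mulOp_mul Z

variable {H B} in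
theorem actMul_one (Z : C) : ins η[H] (B ⊗ Z) ≫ fuse (actMul H B) Z = 𝟙 _ :=
  dualAct_one _ _ mulOp_one Z

variable [IsIso (HopfObj.antipode (X := H))]

/-- The action of `H` on its dual with `(h · f)(x) = f(S⁻¹(h) x)`. -/
noncomputable def actInv : H ⊗ B ⟶ B := dualAct H B (mulInv H)

/-- The exchange morphism of the Drinfeld double, `h ⊗ f ↦ f(S⁻¹(h₃) - h₁) ⊗ h₂`, with a tail. -/
noncomputable def exch (Z : C) : H ⊗ B ⊗ Z ⟶ B ⊗ H ⊗ Z :=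
  shift (actInv H B) Δ[H] Z ≫ mix Δ[H] (actMul H B) Z

variable {H B}

theorem actInv_mul [Transparent H] (Z : C) :
    H ◁ fuse (actInv H B) Z ≫ fuse (actInv H B) Z = fuse μ[H] (B ⊗ Z) ≫ fuse (actInv H B) Z :=
  dualAct_mul _ _ mulInv_mul Z

theorem actInv_one (Z : C) : ins η[H] (B ⊗ Z) ≫ fuse (actInv H B) Z = 𝟙 _ :=
  dualAct_one _ _ mulInv_one Z

theorem actMul_actInv [Transparent H] (Z : C) :
    H ◁ fuse (actInv H B) Z ≫ fuse (actMul H B) Z =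
      cross H H (B ⊗ Z) ≫ H ◁ fuse (actMul H B) Z ≫ fuse (actInv H B) Z :=
  dualAct_comm _ _ mulOp_mulInv_comm Z

theorem exch_eq_mix [Transparent H] (Z : C) :
    exch H B Z = mix (comulOp H) (actInv H B) Z ≫ cross B H Z ≫ mix Δ[H] (actMul H B) Z := by
  rw [exch, ← mix_comulOp_cross, Category.assoc]

/-- Exchanging with a product in `H` amounts to exchanging with both factors, since this holds for
the two actions of which `exch` is composed and these commute. -/
theorem fuse_exch [Transparent H] (Z : C) :
    fuse μ[H] (B ⊗ Z) ≫ exch H B Z =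
      H ◁ exch H B Z ≫ exch H B (H ⊗ Z) ≫ B ◁ fuse μ[H] Z := by
  have h₁ := fuse_mix (comulOp H) (actInv H B) μ[H] fuse_split_comulOp actInv_mul Z
  have h₂ := fuse_mix Δ[H] (actMul H B) μ[H] fuse_split actMul_mul Z
  rw [exch_eq_mix, reassoc_of% h₁, reassoc_of% (cross_fuse B μ[H] Z), h₂,
    reassoc_of% (mix_comulOp_cross (actInv H B) (H ⊗ Z)),
    reassoc_of% (whisk21 H (cross_mix Δ[H] (actMul H B) Z)),
    reassoc_of% (shift_slide_comm Δ[H] (actMul H B) (actInv H B) actMul_actInv Z),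
    ← reassoc_of% (whisk21 H (cross_mix Δ[H] (actMul H B) Z)),
    ← mix_comulOp_cross]
  simp only [MonoidalCategory.whiskerLeft_comp, Category.assoc, exch_eq_mix]

/-- Exchanging with a product in `B` amounts to exchanging with both factors. -/
theorem exch_fuse [Transparent H] (Z : C) :
    H ◁ fuse (convMul H B) Z ≫ exch H B Z =
      exch H B (B ⊗ Z) ≫ B ◁ exch H B Z ≫ fuse (convMul H B) (H ⊗ Z) := by
  have h₁ := mix_fuse (comulOp H) (actInv H B) (convMul H B) split_comulOp_coassoc
    (dualAct_convMul _ _ mulInv_comulOp) Z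
  have h₂ := mix_fuse Δ[H] (actMul H B) (convMul H B) (fun Z => (split_coassoc Z).symm)
    (dualAct_convMul _ _ mulOp_comulOp) Z
  rw [exch_eq_mix, reassoc_of% h₁, reassoc_of% (fuse_cross H (convMul H B) Z), h₂,
    reassoc_of% (whisk21 B (mix_comulOp_cross (actInv H B) Z)),
    reassoc_of% (cross_mix Δ[H] (actMul H B) (B ⊗ Z)),
    reassoc_of% (slide_shift_comm Δ[H] (actMul H B) (actInv H B)
      (fun Z => (split_coassoc Z).symm) Z), ← cross_mix, ← mix_comulOp_cross]
  simp only [MonoidalCategory.whiskerLeft_comp, Category.assoc, exch_eq_mix]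

theorem ins_exch [Transparent H] (Z : C) : ins η[H] (B ⊗ Z) ≫ exch H B Z = B ◁ ins η[H] Z := by
  have h₁ := ins_mix (comulOp H) (actInv H B) η[H] (fun Z => by
    rw [split_comulOp, reassoc_of% (ins_split (A := H) Z), ins_cross, ins_nat]) actInv_one Z
  have h₂ := ins_mix Δ[H] (actMul H B) η[H] ins_split actMul_one Z
  rw [exch_eq_mix, reassoc_of% h₁, reassoc_of% (cross_ins B η[H] Z), h₂]

theorem exch_ins [Transparent H] (Z : C) :
    H ◁ ins (convOne H B) Z ≫ exch H B Z = ins (convOne H B) (H ⊗ Z) := by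
  have h₁ := mix_ins (comulOp H) (actInv H B) (convOne H B) ε[H] (fun Z => by
    rw [split_comulOp, Category.assoc, cross_del, split_counit_right])
    (dualAct_convOne _ _ mulInv_counit) Z
  have h₂ := mix_ins Δ[H] (actMul H B) (convOne H B) ε[H] split_counit_left
    (dualAct_convOne _ _ mulOp_counit) Z
  rw [exch_eq_mix, reassoc_of% h₁, reassoc_of% (ins_cross H (convOne H B) Z), h₂]

variable (H B) in
/-- The exchange morphism `h ⊗ f ↦ f(S⁻¹(h₃) - h₁) ⊗ h₂` of the Drinfeld double. -/
noncomputable def exchange : H ⊗ B ⟶ B ⊗ H :=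
  H ◁ (ρ_ B).inv ≫ exch H B (𝟙_ C) ≫ B ◁ (ρ_ H).hom

theorem tailed_exchange (Z : C) : tailed (exchange H B) Z = exch H B Z := by
  simp only [exchange, tailed, exch, shift, mix, fuse, split, cross]
  monoidal

end Exchange

section Smash

variable {C : Type u} [Category.{v} C] [MonoidalCategory C]
variable {H B : C}

/-- The product of `B ⊗ H` determined by products of `B` and `H` and an exchange morphism `x`. -/
def smashMul (mB : B ⊗ B ⟶ B) (mH : H ⊗ H ⟶ H) (x : H ⊗ B ⟶ B ⊗ H) :
    (B ⊗ H) ⊗ B ⊗ H ⟶ B ⊗ H :=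
  𝟙 _ ⊗≫ B ◁ x ▷ H ⊗≫ (mB ⊗ₘ mH)

/-- The product `smashMul` with a tail. -/
def smash (mB : B ⊗ B ⟶ B) (mH : H ⊗ H ⟶ H) (x : H ⊗ B ⟶ B ⊗ H) (Z : C) :
    B ⊗ H ⊗ B ⊗ H ⊗ Z ⟶ B ⊗ H ⊗ Z :=
  B ◁ tailed x (H ⊗ Z) ≫ fuse mB (H ⊗ H ⊗ Z) ≫ B ◁ fuse mH Z

/-- The product of `B ⊗ H` is associative if the exchange morphism is compatible with both products.
-/
theorem smash_assoc {mB : B ⊗ B ⟶ B} {mH : H ⊗ H ⟶ H} {x : H ⊗ B ⟶ B ⊗ H}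
    (hB : ∀ Z, B ◁ fuse mB Z ≫ fuse mB Z = fuse mB (B ⊗ Z) ≫ fuse mB Z)
    (hH : ∀ Z, H ◁ fuse mH Z ≫ fuse mH Z = fuse mH (H ⊗ Z) ≫ fuse mH Z)
    (hx : ∀ Z, fuse mH (B ⊗ Z) ≫ tailed x Z = H ◁ tailed x Z ≫ tailed x (H ⊗ Z) ≫ B ◁ fuse mH Z)
    (hx' : ∀ Z, H ◁ fuse mB Z ≫ tailed x Z = tailed x (B ⊗ Z) ≫ B ◁ tailed x Z ≫ fuse mB (H ⊗ Z))
    (Z : C) :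
    B ◁ H ◁ smash mB mH x Z ≫ smash mB mH x Z = smash mB mH x (B ⊗ H ⊗ Z) ≫ smash mB mH x Z := by
  simp only [smash, MonoidalCategory.whiskerLeft_comp, Category.assoc]
  rw [reassoc_of% (whisk23 B (hx (H ⊗ Z))), reassoc_of% (fuse_nat mB (H ◁ tailed x (H ⊗ Z))),
    reassoc_of% (fuse_nat mB (tailed x (H ⊗ H ⊗ Z))),
    reassoc_of% (fuse_nat mB (B ◁ fuse mH (H ⊗ Z))),
    ← reassoc_of% (whisk22 B (tailed_nat x (fuse mH Z))),
    reassoc_of% (whisk23 B (hx' (H ⊗ H ⊗ Z))),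
    ← reassoc_of% (fuse_nat mB (H ◁ fuse mH Z)), whisk22 B (hH Z),
    reassoc_of% (hB (H ⊗ H ⊗ H ⊗ Z)),
    reassoc_of% (whisk22 B (tailed_nat x (tailed x (H ⊗ Z)))),
    ← reassoc_of% (fuse_nat mB (B ◁ fuse mH (H ⊗ Z))),
    ← reassoc_of% (fuse_nat mB (fuse mH (H ⊗ Z)))]

theorem smashMul_assoc {mB : B ⊗ B ⟶ B} {mH : H ⊗ H ⟶ H} {x : H ⊗ B ⟶ B ⊗ H}
    (h : ∀ Z, B ◁ H ◁ smash mB mH x Z ≫ smash mB mH x Z =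
      smash mB mH x (B ⊗ H ⊗ Z) ≫ smash mB mH x Z) :
    smashMul mB mH x ▷ (B ⊗ H) ≫ smashMul mB mH x =
      (α_ _ _ _).hom ≫ (B ⊗ H) ◁ smashMul mB mH x ≫ smashMul mB mH x := by
  have e : smashMul mB mH x = 𝟙 _ ⊗≫ smash mB mH x (𝟙_ C) ⊗≫ 𝟙 _ := by
    simp only [smash, smashMul, fuse, tailed, MonoidalCategory.tensorHom_def]
    monoidal
  have e' : smashMul mB mH x ▷ (B ⊗ H) =
      𝟙 _ ⊗≫ smash mB mH x (B ⊗ H ⊗ 𝟙_ C) ⊗≫ 𝟙 _ := by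
    simp only [smash, smashMul, fuse, tailed, MonoidalCategory.tensorHom_def]
    monoidal
  calc
    _ = 𝟙 _ ⊗≫ (smash mB mH x (B ⊗ H ⊗ 𝟙_ C) ≫ smash mB mH x (𝟙_ C)) ⊗≫ 𝟙 _ := by
      rw [e', e]; monoidal
    _ = _ := by rw [← h, e]; monoidal

theorem one_smashMul {mB : B ⊗ B ⟶ B} {mH : H ⊗ H ⟶ H} {x : H ⊗ B ⟶ B ⊗ H} {eB : 𝟙_ C ⟶ B}
    {eH : 𝟙_ C ⟶ H} (hB : eB ▷ B ≫ mB = (λ_ B).hom) (hH : eH ▷ H ≫ mH = (λ_ H).hom)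
    (hx : eH ▷ B ≫ x = (λ_ B).hom ≫ (ρ_ B).inv ≫ B ◁ eH) :
    ((λ_ (𝟙_ C)).inv ≫ (eB ⊗ₘ eH)) ▷ (B ⊗ H) ≫ smashMul mB mH x = (λ_ (B ⊗ H)).hom := by
  simp only [smashMul, MonoidalCategory.tensorHom_def]
  calc
    _ = 𝟙 _ ⊗≫ eB ▷ (B ⊗ H) ⊗≫ B ◁ (eH ▷ B ≫ x) ▷ H ⊗≫ mB ▷ (H ⊗ H) ⊗≫ B ◁ mH := by monoidal
    _ = 𝟙 _ ⊗≫ eB ▷ (B ⊗ H) ⊗≫ (B ◁ B ◁ eH ≫ (α_ _ _ _).inv ≫ mB ▷ H) ▷ H ⊗≫ B ◁ mH := by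
      rw [hx]; monoidal
    _ = 𝟙 _ ⊗≫ (eB ▷ B ≫ mB) ▷ H ⊗≫ B ◁ (eH ▷ H ≫ mH) := by
      rw [associator_inv_naturality_right_assoc, whisker_exchange]; monoidal
    _ = _ := by rw [hB, hH]; monoidal

theorem smashMul_one {mB : B ⊗ B ⟶ B} {mH : H ⊗ H ⟶ H} {x : H ⊗ B ⟶ B ⊗ H} {eB : 𝟙_ C ⟶ B}
    {eH : 𝟙_ C ⟶ H} (hB : B ◁ eB ≫ mB = (ρ_ B).hom) (hH : H ◁ eH ≫ mH = (ρ_ H).hom)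
    (hx : H ◁ eB ≫ x = (ρ_ H).hom ≫ (λ_ H).inv ≫ eB ▷ H) :
    (B ⊗ H) ◁ ((λ_ (𝟙_ C)).inv ≫ (eB ⊗ₘ eH)) ≫ smashMul mB mH x = (ρ_ (B ⊗ H)).hom := by
  simp only [smashMul, MonoidalCategory.tensorHom_def']
  calc
    _ = 𝟙 _ ⊗≫ (B ⊗ H) ◁ eH ⊗≫ B ◁ (H ◁ eB ≫ x) ▷ H ⊗≫ B ◁ B ◁ mH ⊗≫ mB ▷ H := by monoidal
    _ = 𝟙 _ ⊗≫ (B ⊗ H) ◁ eH ⊗≫ B ◁ (eB ▷ (H ⊗ H) ≫ B ◁ mH) ⊗≫ mB ▷ H := by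
      rw [hx]; monoidal
    _ = 𝟙 _ ⊗≫ B ◁ (H ◁ eH ≫ mH) ⊗≫ (B ◁ eB ≫ mB) ▷ H := by
      rw [← whisker_exchange]; monoidal
    _ = _ := by rw [hB, hH]; monoidal

end Smash

/-! ### Finite objects and their duals -/

section Dual

variable {C : Type u} [Category.{v} C] [MonoidalCategory C] [BraidedCategory C]

/-- The dual of a transparent object is transparent. -/
theorem transparent_of_exactPairing (H B : C) [ExactPairing H B] [Transparent H] :
    Transparent B := by
  have h (Y Z : C) : cross Y B Z ≫ cross B Y Z = 𝟙 (Y ⊗ B ⊗ Z) := by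
    have e := whiskerLeft_pair (B := B) Y (coevT H B Z)
    rw [← cross_cup Y (ExactPairing.coevaluation H B) Z, Category.assoc, Category.assoc,
      cross_cross_left, Category.comp_id, ← pair_comp] at e
    have e' (Z : C) : pair B (coevT H B Z) = 𝟙 (B ⊗ Z) := coevT_evT_right H B Z
    rw [e', e', Category.id_comp, MonoidalCategory.whiskerLeft_id] at e
    exact e.symm
  have h' (Y : C) : (β_ Y B).hom ≫ (β_ B Y).hom = 𝟙 (Y ⊗ B) := by
    calc
      _ = 𝟙 _ ⊗≫ (cross Y B (𝟙_ C) ≫ cross B Y (𝟙_ C)) ⊗≫ 𝟙 _ := by simp only [cross]; monoidal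
      _ = _ := by rw [h]; monoidal
  refine ⟨fun Y => ?_⟩
  rw [← cancel_epi (β_ Y B).hom, reassoc_of% (h' Y), Category.comp_id]

variable (H B : C) [HopfObj H] [ExactPairing H B]

/-- The coproduct of the dual with `f₁(h) f₂(k) = f(k h)`. -/
def convComul : B ⟶ B ⊗ B :=
  (ρ_ B).inv ≫
    pair B (coevT H B (𝟙_ C) ≫ H ◁ coevT H B (B ⊗ 𝟙_ C) ≫ fuse μ[H] (B ⊗ B ⊗ 𝟙_ C)) ≫
      B ◁ (ρ_ B).hom

variable {H B} in
theorem convComul_pair {Z Z' W : C} (G : Z ⟶ H ⊗ Z') (G' : Z' ⟶ H ⊗ W) :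
    split (convComul H B) Z ≫ B ◁ pair B G ≫ pair B G' = pair B (G ≫ H ◁ G' ≫ fuse μ[H] W) := by
  have h : split (convComul H B) Z =
      pair B (coevT H B Z ≫ H ◁ coevT H B (B ⊗ Z) ≫ fuse μ[H] (B ⊗ B ⊗ Z)) := by
    simp only [convComul, pair, fuse, split, cap, cup]
    monoidal
  rw [h, comp_pair, pair_comp]
  simp only [Category.assoc]
  have e₁ : coevT H B (B ⊗ Z) ≫ H ◁ pair B (pair B G ≫ G') = pair B G ≫ G' :=
    unpair_pair _
  have e₂ : coevT H B Z ≫ H ◁ pair B G = G := unpair_pair _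
  rw [fuse_nat, ← MonoidalCategory.whiskerLeft_comp_assoc, e₁, MonoidalCategory.whiskerLeft_comp,
    Category.assoc, reassoc_of% e₂]

end Dual

section Finite

variable {C : Type u} [Category.{v} C] [MonoidalCategory C]

/-- A finite object is left dual to its dual. -/
noncomputable instance FiniteObj.exactPairing {P : C} (fin : FiniteObj P) :
    ExactPairing P fin.dual where
  evaluation' := fin.ev
  coevaluation' := fin.coev
  evaluation_coevaluation' := by
    -- The name of the identity of `P` in `[P, P]`, evaluated at `P`, is the identity.
    have h : fin.oneEndo ▷ P ≫ fin.evEndo = (λ_ P).hom :=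
      (fin.isInnerHom_evEndo (𝟙_ C) (λ_ P).hom).choose_spec.1
    rw [← cancel_mono (ρ_ P).hom]
    simp only [Category.assoc, ← fin.db_ev, FiniteObj.coev, comp_whiskerRight]
    rw [← comp_whiskerRight_assoc fin.db.inv, Iso.inv_hom_id, id_whiskerRight, Category.id_comp, h]
    simp
  coevaluation_evaluation' := by
    have h : fin.oneEndo ▷ P ≫ fin.evEndo = (λ_ P).hom :=
      (fin.isInnerHom_evEndo (𝟙_ C) (λ_ P).hom).choose_spec.1
    have h' : fin.coev ▷ P ≫ (α_ P fin.dual P).hom ≫ P ◁ fin.ev = (λ_ P).hom ≫ (ρ_ P).inv := by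
      rw [← cancel_mono (ρ_ P).hom]
      simp only [Category.assoc, ← fin.db_ev, FiniteObj.coev, comp_whiskerRight]
      rw [← comp_whiskerRight_assoc fin.db.inv, Iso.inv_hom_id, id_whiskerRight, Category.id_comp,
        h]
      simp
    rw [← cancel_mono (λ_ fin.dual).hom]
    -- Two morphisms to `[P, 𝟙_ C]` agree if they agree after evaluation.
    refine (fin.isInnerHom_ev _ ((ρ_ fin.dual).hom ▷ P ≫ fin.ev)).unique ?_ (by simp)
    calc
      _ = 𝟙 _ ⊗≫ fin.dual ◁ fin.coev ▷ P ⊗≫ (fin.ev ▷ (fin.dual ⊗ P) ≫ 𝟙_ C ◁ fin.ev) ⊗≫ 𝟙 _ := by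
        monoidal
      _ = 𝟙 _ ⊗≫ fin.dual ◁ (fin.coev ▷ P ≫ (α_ P fin.dual P).hom ≫ P ◁ fin.ev) ⊗≫ fin.ev ⊗≫
            𝟙 _ := by
        rw [← whisker_exchange]; monoidal
      _ = _ := by rw [h']; monoidal

variable [BraidedCategory C] {H : C} [HopfObj H] (fin : FiniteObj H)

omit [BraidedCategory C] [HopfObj H] in
theorem FiniteObj.curry_eq {T : C} (f : T ⊗ H ⟶ 𝟙_ C) (g : T ⟶ fin.dual)
    (h : g ▷ H ≫ fin.ev = f) : fin.curry f = g :=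
  (fin.isInnerHom_ev T f).unique (fin.curry_ev f) h

theorem dualOne_eq : dualOne fin = convOne H fin.dual := by
  apply fin.curry_eq
  have h := convOne_pair (B := fin.dual) (𝟙 (H ⊗ 𝟙_ C))
  calc
    _ = 𝟙 _ ⊗≫ (ins (convOne H fin.dual) (H ⊗ 𝟙_ C) ≫ pair fin.dual (𝟙 (H ⊗ 𝟙_ C))) ⊗≫ 𝟙 _ := by
      simp only [ins, pair, cap, ExactPairing.evaluation, ExactPairing.evaluation']
      monoidal
    _ = _ := by
      rw [h]
      simp only [del]
      monoidal

theorem dualMul_eq [Transparent H] :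
    dualMul fin = convMul H fin.dual := by
  apply fin.curry_eq
  have h := convMul_pair (B := fin.dual) (𝟙 (H ⊗ 𝟙_ C))
  have h' : pair fin.dual (pair fin.dual (split (comulOp H) (𝟙_ C))) =
      fin.dual ◁ fin.dual ◁ split Δ[H] (𝟙_ C) ≫ fin.dual ◁ cross fin.dual H (H ⊗ 𝟙_ C) ≫
        fin.dual ◁ H ◁ evT H fin.dual (𝟙_ C) ≫ evT H fin.dual (𝟙_ C) := by
    rw [← cap_cross H _ (𝟙_ C)]
    simp only [MonoidalCategory.whiskerLeft_comp, Category.assoc]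
    rw [reassoc_of% (whisk20 fin.dual (cross_cross_right H fin.dual (H ⊗ 𝟙_ C)))]
    simp only [pair, split_comulOp, MonoidalCategory.whiskerLeft_comp, Category.assoc]
  rw [Category.id_comp, h'] at h
  have e : ExactPairing.evaluation H fin.dual = fin.ev := rfl
  calc
    _ = 𝟙 _ ⊗≫ (fuse (convMul H fin.dual) (H ⊗ 𝟙_ C) ≫ pair fin.dual (𝟙 (H ⊗ 𝟙_ C))) ⊗≫
          𝟙 _ := by
      simp only [fuse, pair, cap, e]
      monoidal
    _ = _ := by
      rw [h]
      simp only [split, cross, cap, e, tensorμ, MonoidalCategory.tensorHom_def']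
      monoidal

theorem dualComul_eq [Transparent H] : dualComul fin = convComul H fin.dual := by
  have e : ExactPairing.evaluation H fin.dual = fin.ev := rfl
  have e' : ExactPairing.coevaluation H fin.dual = fin.coev := rfl
  have h : (λ_ (𝟙_ C)).inv ≫ (fin.coev ⊗ₘ fin.coev) ≫ tensorδ H H fin.dual fin.dual ≫
      ((β_ H H).hom ≫ μ[H]) ▷ (fin.dual ⊗ fin.dual) =
      𝟙 _ ⊗≫ (coevT H fin.dual (𝟙_ C) ≫ H ◁ coevT H fin.dual (fin.dual ⊗ 𝟙_ C) ≫
        fuse μ[H] (fin.dual ⊗ fin.dual ⊗ 𝟙_ C)) ⊗≫ 𝟙 _ := by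
    rw [← cross_cup H _ (fin.dual ⊗ 𝟙_ C), tensorδ, braiding_inv_left,
      MonoidalCategory.tensorHom_def']
    simp only [cup, cross, fuse, e']
    monoidal
  calc
    _ = 𝟙 _ ⊗≫ fin.dual ◁ ((λ_ (𝟙_ C)).inv ≫ (fin.coev ⊗ₘ fin.coev) ≫
          tensorδ H H fin.dual fin.dual ≫ ((β_ H H).hom ≫ μ[H]) ▷ (fin.dual ⊗ fin.dual)) ⊗≫
          fin.ev ▷ (fin.dual ⊗ fin.dual) ⊗≫ 𝟙 _ := by
      simp only [dualComul]; monoidal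
    _ = _ := by
      rw [h]
      simp only [convComul, pair, cap, e]
      monoidal

end Finite

/-! ### The product of the double -/

section Hopf

variable {C : Type u} [Category.{v} C] [MonoidalCategory C] [BraidedCategory C]
variable {H : C} [HopfObj H]

/-- `h₃ ⊗ h₁ ⊗ h₂`, obtained in two ways. -/
theorem split_split_comulOp_cross (Z : C) :
    split Δ[H] Z ≫ H ◁ split (comulOp H) Z ≫ cross H H (H ⊗ Z) =
      split (comulOp H) Z ≫ H ◁ split Δ[H] Z := by
  simp only [split_comulOp, MonoidalCategory.whiskerLeft_comp, Category.assoc]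
  rw [reassoc_of% (split_coassoc (A := H) Z), split_cross]

/-- `h₂ ⊗ h₃ ⊗ h₁ ⊗ h₄`, obtained in two ways. -/
theorem split_split_split_cross (Z : C) :
    split Δ[H] Z ≫ H ◁ split Δ[H] Z ≫ split (comulOp H) (H ⊗ H ⊗ Z) ≫ H ◁ cross H H (H ⊗ Z) =
      split Δ[H] Z ≫ H ◁ split Δ[H] Z ≫ cross H H (H ⊗ Z) ≫ split Δ[H] (H ⊗ H ⊗ Z) := by
  rw [split_comulOp, ← cross_split, Category.assoc, ← reassoc_of% (split_nat Δ[H] (split Δ[H] Z)),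
    ← reassoc_of% (split_coassoc (A := H) Z), reassoc_of% (whisk22 H (split_coassoc (A := H) Z))]

variable [Transparent H] [IsIso (HopfObj.antipode (X := H))]

/-- The cancellation `h₃ (S⁻¹(h₂) (x h₁)) ⊗ w = x h₁ ⊗ w`, where `x ⊗ w` stands for `G(h₄ ⊗ z)` on
the left and for `G(h₂ ⊗ z)` on the right. -/
theorem split_mulInv_cancel {Z W : C} (G : H ⊗ Z ⟶ H ⊗ W) :
    split Δ[H] Z ≫ H ◁ split Δ[H] Z ≫ H ◁ H ◁ G ≫ cross H H (H ⊗ W) ≫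
        H ◁ split (comulOp H) (H ⊗ W) ≫ H ◁ H ◁ fuse (mulOp H) W ≫ H ◁ fuse (mulInv H) W ≫
          fuse μ[H] W =
      split Δ[H] Z ≫ H ◁ G ≫ fuse (mulOp H) W := by
  rw [← reassoc_of% (split_cross H (comulOp H) (H ⊗ W)),
    ← reassoc_of% (split_nat (comulOp H) (H ◁ G)),
    ← reassoc_of% (whisk22 H (cross_nat (X := H) (Y := H) G)),
    reassoc_of% (split_split_split_cross (H := H) Z),
    ← reassoc_of% (cross_nat (X := H) (Y := H) (H ◁ G)), fuse_mulInv]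
  simp only [MonoidalCategory.whiskerLeft_comp, Category.assoc]
  rw [fuse_assoc, reassoc_of% (whisk22 H (whisker_exchange (antipodeInv H) (fuse (mulOp H) W))),
    reassoc_of% (whisk22 H (whisker_exchange (antipodeInv H) (H ◁ G))),
    ← reassoc_of% (fuse_nat μ[H] (fuse (mulOp H) W)), ← reassoc_of% (fuse_nat μ[H] (H ◁ G)),
    ← reassoc_of% (whisker_cross (Z := H ⊗ H ⊗ Z) H (antipodeInv H)),
    reassoc_of% (split_antipodeInv_left (H := H) (H ⊗ H ⊗ Z)),
    reassoc_of% (ins_nat η[H] (H ◁ G)), reassoc_of% (ins_nat η[H] (fuse (mulOp H) W)),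
    fuse_one_left, reassoc_of% (cross_del H ε[H] (H ⊗ Z)),
    reassoc_of% (whisk20 H (split_counit_left (A := H) Z)), Category.comp_id]

variable (H) in
/-- `h ⊗ x ↦ S⁻¹(h₂) (x h₁)`. -/
noncomputable def mulAd : H ⊗ H ⟶ H :=
  (β_ H H).hom ≫ H ◁ Δ[H] ≫ (α_ H H H).inv ≫ (μ[H] ⊗ₘ antipodeInv H) ≫ (β_ H H).hom ≫ μ[H]

theorem fuse_mulAd (Z : C) :
    fuse (mulAd H) Z =
      split (comulOp H) (H ⊗ Z) ≫ H ◁ fuse (mulOp H) Z ≫ fuse (mulInv H) Z := by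
  have h : fuse (mulAd H) Z = cross H H Z ≫ H ◁ split Δ[H] Z ≫ fuse μ[H] (H ⊗ Z) ≫
      H ◁ antipodeInv H ▷ Z ≫ cross H H Z ≫ fuse μ[H] Z := by
    simp only [mulAd, fuse, split, cross, MonoidalCategory.tensorHom_def]
    monoidal
  rw [h, ← reassoc_of% (split_cross H Δ[H] Z), reassoc_of% (fuse_nat μ[H] (antipodeInv H ▷ Z)),
    reassoc_of% (fuse_cross H μ[H] Z),
    reassoc_of% (whisk22 H (cross_whisker (Z := Z) H (antipodeInv H))),
    reassoc_of% (cross_whisker (Z := H ⊗ Z) H (antipodeInv H)),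
    ← reassoc_of% (cross_yang_baxter H H H Z), reassoc_of% (cross_cross_left H H (H ⊗ Z)),
    fuse_mulOp, fuse_mulInv, split_comulOp]
  simp only [MonoidalCategory.whiskerLeft_comp, Category.assoc]
  rw [whisker_exchange_assoc, whisker_exchange_assoc, whisker_exchange_assoc]

variable (H) in
/-- `h ↦ S⁻¹(h₃) h₁ ⊗ h₂`. -/
noncomputable def coAd (Z : C) : H ⊗ Z ⟶ H ⊗ H ⊗ Z :=
  split (comulOp H) Z ≫ antipodeInv H ▷ (H ⊗ Z) ≫ H ◁ split Δ[H] Z ≫ fuse μ[H] (H ⊗ Z)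

theorem coAd_eq (Z : C) :
    coAd H Z = split Δ[H] Z ≫ H ◁ antipodeInv H ▷ Z ≫ split Δ[H] (H ⊗ Z) ≫ cross H H (H ⊗ Z) ≫
      H ◁ fuse (mulOp H) Z ≫ cross H H Z := by
  rw [fuse_mulOp]
  simp only [MonoidalCategory.whiskerLeft_comp, Category.assoc]
  rw [cross_fuse H μ[H] Z, reassoc_of% (cross_yang_baxter H H H Z),
    reassoc_of% (whisk20 H (cross_cross_left H H Z)), reassoc_of% (split_cross H Δ[H] Z),
    reassoc_of% (cross_whisker (Z := Z) H (antipodeInv H)), coAd, split_comulOp, Category.assoc]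

/-- The adjoint action `mulAd` after the adjoint coaction `coAd`: the combination that computes the
product of the double on values. -/
theorem coAd_mulAd {Z W : C} (G : H ⊗ Z ⟶ H ⊗ W) :
    split Δ[H] Z ≫ H ◁ coAd H Z ≫ H ◁ H ◁ G ≫ cross H H (H ⊗ W) ≫ H ◁ fuse (mulAd H) W ≫
        fuse μ[H] W =
      split (comulOp H) Z ≫ H ◁ split Δ[H] Z ≫ H ◁ H ◁ G ≫ H ◁ fuse (mulOp H) W ≫
        fuse (mulInv H) W := by
  simp only [coAd, fuse_mulAd, MonoidalCategory.whiskerLeft_comp, Category.assoc]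
  have h := congrArg (fun t => H ◁ t) (split_mulInv_cancel G)
  simp only [MonoidalCategory.whiskerLeft_comp] at h
  conv_rhs => rw [fuse_mulInv, whisker_exchange_assoc, whisker_exchange_assoc,
    whisker_exchange_assoc, ← reassoc_of% h]
  rw [reassoc_of% (whisk22 H (fuse_nat μ[H] G)), reassoc_of% (cross_fuse H μ[H] (H ⊗ W)),
    reassoc_of% (fuse_nat μ[H] (split (comulOp H) (H ⊗ W))),
    reassoc_of% (fuse_nat μ[H] (H ◁ fuse (mulOp H) W)),
    reassoc_of% (fuse_nat μ[H] (fuse (mulInv H) W)), ← fuse_assoc,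
    ← reassoc_of% (cross_nat (X := H) (Y := H) (H ◁ G)),
    ← reassoc_of% (cross_nat (X := H) (Y := H) (split Δ[H] Z)),
    reassoc_of% (cross_whisker (Z := H ⊗ Z) H (antipodeInv H)),
    reassoc_of% (split_split_comulOp_cross (H := H) Z), whisker_exchange_assoc]

end Hopf

section Double

variable {C : Type u} [Category.{v} C] [MonoidalCategory C] [BraidedCategory C]
variable {H : C} [HopfObj H] [Transparent H] [IsIso (HopfObj.antipode (X := H))]
variable (fin : FiniteObj H)

/-- The action of `H` on its dual is the one with `(h f)(x) = f(S⁻¹(h₂) x h₁)`. -/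
theorem fuse_actB (Z : C) :
    fuse (actB fin) Z = cross H fin.dual Z ≫
      pair fin.dual (H ◁ coevT H fin.dual Z ≫ fuse (mulAd H) (fin.dual ⊗ Z)) := by
  have e' : ExactPairing.coevaluation H fin.dual = fin.coev := rfl
  have e : ExactPairing.evaluation H fin.dual = fin.ev := rfl
  let N : H ⊗ H ⟶ H := H ◁ Δ[H] ≫ (α_ H H H).inv ≫ (μ[H] ⊗ₘ antipodeInv H) ≫ (β_ H H).hom ≫ μ[H]
  have hN (Z : C) : fuse (mulAd H) Z = cross H H Z ≫ fuse N Z := by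
    simp [mulAd, N, fuse, cross]
  have h : fuse (actB fin) Z = coevT H fin.dual (H ⊗ fin.dual ⊗ Z) ≫
      cross H fin.dual (H ⊗ fin.dual ⊗ Z) ≫ fin.dual ◁ fuse N (fin.dual ⊗ Z) ≫
        fin.dual ◁ cross H fin.dual Z ≫ fin.dual ◁ evT H fin.dual Z := by
    simp only [actB, FiniteObj.coev', FiniteObj.ev', N, fuse, cross, cap, cup, e, e',
      braiding_inv_right]
    monoidal
  have h₁ (Z : C) : coevT H fin.dual (H ⊗ Z) ≫ H ◁ cross fin.dual H Z =
      H ◁ coevT H fin.dual Z ≫ cross H H (fin.dual ⊗ Z) := by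
    rw [← cross_cup H _ Z, Category.assoc, Category.assoc, cross_cross_left, Category.comp_id]
  have h₂ : coevT H fin.dual (fin.dual ⊗ Z) ≫ H ◁ cross fin.dual fin.dual Z =
      fin.dual ◁ coevT H fin.dual Z ≫ cross fin.dual H (fin.dual ⊗ Z) := by
    rw [← cross_cup fin.dual _ Z, Category.assoc, Category.assoc, cross_cross_left,
      Category.comp_id]
  rw [h, ← cap_cross fin.dual _ Z, ← reassoc_of% (cross_yang_baxter fin.dual H fin.dual Z),
    reassoc_of% (cross_fuse fin.dual N (fin.dual ⊗ Z)),
    reassoc_of% (cross_cross_left H fin.dual (H ⊗ fin.dual ⊗ Z)),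
    reassoc_of% (fuse_nat N (cross fin.dual fin.dual Z)),
    reassoc_of% (fuse_cross fin.dual N (fin.dual ⊗ Z)), reassoc_of% (h₁ (fin.dual ⊗ Z)),
    reassoc_of% (cross_nat (X := H) (Y := H) (cross fin.dual fin.dual Z)),
    reassoc_of% (whisk22 H h₂),
    reassoc_of% (cross_yang_baxter H H fin.dual (fin.dual ⊗ Z)),
    reassoc_of% (whisk20 H (cross_cross_right H fin.dual (fin.dual ⊗ Z))),
    ← reassoc_of% (cross_nat (X := H) (Y := fin.dual) (coevT H fin.dual Z)), hN]
  simp only [pair, MonoidalCategory.whiskerLeft_comp, Category.assoc]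

/-- The action of the dual on `H` evaluates at the adjoint coaction, `h ⊗ f ↦ f(S⁻¹(h₃) h₁) h₂`. -/
theorem fuse_actH (Z : C) :
    fuse (actH fin) Z = cross H fin.dual Z ≫ pair fin.dual (coAd H Z) := by
  have e : ExactPairing.evaluation H fin.dual = fin.ev := rfl
  have h : fuse (actH fin) Z = split Δ[H] (fin.dual ⊗ Z) ≫ H ◁ antipodeInv H ▷ (fin.dual ⊗ Z) ≫
      split Δ[H] (H ⊗ fin.dual ⊗ Z) ≫ cross H H (H ⊗ fin.dual ⊗ Z) ≫
        H ◁ fuse (mulOp H) (fin.dual ⊗ Z) ≫ H ◁ cross H fin.dual Z ≫ H ◁ evT H fin.dual Z := by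
    simp only [actH, FiniteObj.ev', fuse, split, cross, cap, e, mulOp, braiding_inv_left,
      MonoidalCategory.tensorHom_def']
    monoidal
  have h' : H ◁ cross H fin.dual Z ≫ H ◁ evT H fin.dual Z =
      H ◁ cross H fin.dual Z ≫ cross H fin.dual (H ⊗ Z) ≫ fin.dual ◁ cross H H Z ≫
        evT H fin.dual (H ⊗ Z) := by
    rw [← cap_cross H _ Z]
  rw [h, coAd_eq, h']
  have h₁ : fuse (mulOp H) (fin.dual ⊗ Z) ≫ cross H fin.dual Z =
      H ◁ cross H fin.dual Z ≫ cross H fin.dual (H ⊗ Z) ≫ fin.dual ◁ fuse (mulOp H) Z :=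
    fuse_cross fin.dual (mulOp H) Z
  rw [reassoc_of% (whisk23 H h₁),
    ← reassoc_of% (cross_nat (X := H) (Y := fin.dual) (fuse (mulOp H) Z)),
    reassoc_of% (cross_nat (X := H) (Y := H) (cross H fin.dual Z)),
    reassoc_of% (cross_yang_baxter H H fin.dual (H ⊗ Z)),
    reassoc_of% (split_nat Δ[H] (cross H fin.dual Z)),
    reassoc_of% (split_cross fin.dual Δ[H] (H ⊗ Z)),
    reassoc_of% (whisk22 H (whisker_cross (Z := Z) fin.dual (antipodeInv H))),
    ← reassoc_of% (cross_nat (X := H) (Y := fin.dual) (antipodeInv H ▷ Z)),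
    reassoc_of% (split_cross fin.dual Δ[H] Z)]
  simp only [pair, MonoidalCategory.whiskerLeft_comp, Category.assoc]

theorem fuse_actB_pair {Z W : C} (G : Z ⟶ H ⊗ W) :
    fuse (actB fin) Z ≫ pair fin.dual G =
      cross H fin.dual Z ≫ pair fin.dual (H ◁ G ≫ fuse (mulAd H) W) := by
  rw [fuse_actB, Category.assoc, pair_comp, Category.assoc, fuse_nat,
    ← MonoidalCategory.whiskerLeft_comp_assoc]
  congr 4
  exact unpair_pair G

/-- The product of the double is a smash product: the morphism `h ⊗ g ↦ (h₁ ▷ g₁) ⊗ (h₂ ◁ g₂)` in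
its definition is the exchange morphism `h ⊗ g ↦ g(S⁻¹(h₃) - h₁) ⊗ h₂`. -/
theorem doubleMul_eq : doubleMul fin = smashMul (dualMul fin) μ[H] (exchange H fin.dual) := by
  have h (Z : C) : tailed ((Δ[H] ⊗ₘ dualComul fin) ≫ tensorμ H H fin.dual fin.dual ≫
      (actB fin ⊗ₘ actH fin)) Z = exch H fin.dual Z := by
    have e : tailed ((Δ[H] ⊗ₘ dualComul fin) ≫ tensorμ H H fin.dual fin.dual ≫
        (actB fin ⊗ₘ actH fin)) Z = split Δ[H] (fin.dual ⊗ Z) ≫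
          H ◁ H ◁ split (convComul H fin.dual) Z ≫ H ◁ cross H fin.dual (fin.dual ⊗ Z) ≫
            fuse (actB fin) (H ⊗ fin.dual ⊗ Z) ≫ fin.dual ◁ fuse (actH fin) Z := by
      rw [dualComul_eq]
      simp only [tailed, split, cross, fuse, tensorμ, MonoidalCategory.tensorHom_def]
      monoidal
    refine ext_pair (H := H) fun W G => ?_
    rw [e]
    -- On values, the coproduct of the dual becomes the product of `H`.
    have h₁ : cross H fin.dual Z ≫ split (convComul H fin.dual) (H ⊗ Z) =
        H ◁ split (convComul H fin.dual) Z ≫ cross H fin.dual (fin.dual ⊗ Z) ≫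
          fin.dual ◁ cross H fin.dual Z := (cross_split H (convComul H fin.dual) Z).symm
    have h₂ (M : H ⊗ H ⊗ Z ⟶ H ⊗ H ⊗ W) :
        split (convComul H fin.dual) (H ⊗ H ⊗ Z) ≫ pair fin.dual (pair fin.dual M) =
          pair fin.dual (M ≫ fuse μ[H] W) := by
      have := convComul_pair (B := fin.dual) M (𝟙 (H ⊗ W))
      simpa only [comp_pair, Category.comp_id, MonoidalCategory.whiskerLeft_id,
        Category.id_comp] using this
    calc
      _ = split Δ[H] (fin.dual ⊗ Z) ≫ H ◁ (H ◁ split (convComul H fin.dual) Z ≫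
            cross H fin.dual (fin.dual ⊗ Z) ≫ fin.dual ◁ cross H fin.dual Z) ≫
              cross H fin.dual (fin.dual ⊗ H ⊗ Z) ≫ fin.dual ◁ cross H fin.dual (H ⊗ Z) ≫
                pair fin.dual (pair fin.dual (H ◁ coAd H Z ≫ H ◁ H ◁ G ≫ cross H H (H ⊗ W) ≫
                  H ◁ fuse (mulAd H) W)) := by
        simp only [Category.assoc]
        rw [comp_pair, fuse_actB_pair, fuse_actH, Category.assoc, pair_comp]
        simp only [MonoidalCategory.whiskerLeft_comp, whiskerLeft_pair, Category.assoc, pair_comp]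
        simp only [← comp_pair]
        rw [reassoc_of% (cross_nat (X := H) (Y := fin.dual) (cross H fin.dual Z))]
      _ = split Δ[H] (fin.dual ⊗ Z) ≫ H ◁ cross H fin.dual Z ≫ (H ◁ split (convComul H fin.dual)
            (H ⊗ Z) ≫ cross H fin.dual (fin.dual ⊗ H ⊗ Z) ≫
              fin.dual ◁ cross H fin.dual (H ⊗ Z)) ≫
                pair fin.dual (pair fin.dual (H ◁ coAd H Z ≫ H ◁ H ◁ G ≫ cross H H (H ⊗ W) ≫
                  H ◁ fuse (mulAd H) W)) := by
        rw [← h₁]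
        simp only [MonoidalCategory.whiskerLeft_comp, Category.assoc]
      _ = cross H fin.dual Z ≫ pair fin.dual (split Δ[H] Z ≫ H ◁ coAd H Z ≫ H ◁ H ◁ G ≫
            cross H H (H ⊗ W) ≫ H ◁ fuse (mulAd H) W ≫ fuse μ[H] W) := by
        rw [cross_split, Category.assoc, h₂, reassoc_of% (split_cross fin.dual Δ[H] Z), comp_pair]
        simp only [Category.assoc]
      _ = _ := by
        rw [coAd_mulAd]
        simp only [exch, shift, mix, Category.assoc, actMul, actInv, dualAct_pair]
        rw [reassoc_of% (split_cross fin.dual Δ[H] Z), comp_pair,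
          reassoc_of% (cross_fuse H (dualAct H fin.dual (mulInv H)) Z), dualAct_pair,
          ← reassoc_of% (split_comulOp (H := H) (fin.dual ⊗ Z)),
          reassoc_of% (split_cross fin.dual (comulOp H) Z), comp_pair]
        simp only [MonoidalCategory.whiskerLeft_comp, Category.assoc]
  have h' : (Δ[H] ⊗ₘ dualComul fin) ≫ tensorμ H H fin.dual fin.dual ≫
      (actB fin ⊗ₘ actH fin) = exchange H fin.dual := by
    have := h (𝟙_ C)
    rw [← tailed_exchange] at this
    have e {X Y X' Y' : C} (g : X ⊗ Y ⟶ X' ⊗ Y') :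
        g = X ◁ (ρ_ Y).inv ≫ tailed g (𝟙_ C) ≫ X' ◁ (ρ_ Y').hom := by
      simp only [tailed]
      monoidal
    rw [e ((Δ[H] ⊗ₘ dualComul fin) ≫ tensorμ H H fin.dual fin.dual ≫ (actB fin ⊗ₘ actH fin)),
      this, ← e]
  rw [smashMul, ← h']
  simp only [doubleMul]
  monoidal

end Double

/-! ### The Yetter-Drinfeld condition in terms of the dual -/

section YetterDrinfeld

variable {C : Type u} [Category.{v} C] [MonoidalCategory C] [BraidedCategory C]
variable {H B : C} [HopfObj H] [Transparent H] {M N : C}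

/-- As `H` is transparent, the double crossing in `ydL` reduces to a crossing of `H` with itself. -/
theorem ydL_eq (a : H ⊗ M ⟶ M) (c : M ⟶ H ⊗ M) :
    ydL Δ[H] μ[H] a c =
      split (comulOp H) M ≫ H ◁ (a ≫ c) ≫ cross H H M ≫ fuse μ[H] M := by
  have h := braiding_naturality_left (a ≫ c) H
  rw [braiding_tensor_left_hom] at h
  have h' : (a ≫ c) ▷ H ⊗≫ H ◁ (β_ M H).hom = 𝟙 ((H ⊗ M) ⊗ H) ⊗≫ H ◁ (β_ M H).hom ⊗≫
      (β_ H H).hom ▷ M ⊗≫ H ◁ (a ≫ c) ⊗≫ (β_ H H).hom ▷ M ⊗≫ 𝟙 (H ⊗ H ⊗ M) := by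
    have e : (β_ H H).hom ▷ M ≫ (β_ H H).hom ▷ M = 𝟙 ((H ⊗ H) ⊗ M) := by
      rw [← comp_whiskerRight, braiding_symm_left, id_whiskerRight]
    calc
      _ = (a ≫ c) ▷ H ⊗≫ H ◁ (β_ M H).hom ⊗≫ ((β_ H H).hom ▷ M ≫ (β_ H H).hom ▷ M) ⊗≫
            𝟙 (H ⊗ H ⊗ M) := by rw [e]; monoidal
      _ = 𝟙 _ ⊗≫ ((a ≫ c) ▷ H ≫ (α_ H M H).hom ≫ H ◁ (β_ M H).hom ≫ (α_ H H M).inv ≫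
            (β_ H H).hom ▷ M ≫ (α_ H H M).hom) ⊗≫ (β_ H H).hom ▷ M ⊗≫ 𝟙 (H ⊗ H ⊗ M) := by
        monoidal
      _ = _ := by rw [h]; monoidal
  calc
    _ = 𝟙 _ ⊗≫ Δ[H] ▷ M ⊗≫ H ◁ (β_ H M).hom ⊗≫ ((a ≫ c) ▷ H ⊗≫ H ◁ (β_ M H).hom) ⊗≫
          μ[H] ▷ M := by simp only [ydL]; monoidal
    _ = 𝟙 _ ⊗≫ Δ[H] ▷ M ⊗≫ H ◁ ((β_ H M).hom ≫ (β_ M H).hom) ⊗≫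
      (β_ H H).hom ▷ M ⊗≫ H ◁ (a ≫ c) ⊗≫ (β_ H H).hom ▷ M ⊗≫ μ[H] ▷ M := by rw [h']; monoidal
    _ = _ := by
      rw [braiding_symm_left, split_comulOp]; simp only [split, cross, fuse]; monoidal

instance (X Y Z : C) : IsIso (cross X Y Z) := by
  unfold cross; infer_instance

omit [Transparent H] in
theorem ydR_eq (a : H ⊗ M ⟶ M) (c : M ⟶ H ⊗ M) :
    ydR Δ[H] μ[H] a c =
      split Δ[H] M ≫ H ◁ H ◁ c ≫ H ◁ cross H H M ≫ fuse μ[H] (H ⊗ M) ≫ H ◁ a := by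
  simp only [ydR, split, cross, fuse, tensorμ, MonoidalCategory.tensorHom_def]
  monoidal

variable [IsIso (HopfObj.antipode (X := H))]

/-- The Yetter-Drinfeld condition in terms of the twisted coaction `F = (S⁻¹ ⊗ M) c`. -/
theorem yd_iff_twisted (a : H ⊗ M ⟶ M) (c : M ⟶ H ⊗ M) :
    ydL Δ[H] μ[H] a c = ydR Δ[H] μ[H] a c ↔
      split (comulOp H) M ≫ H ◁ a ≫ H ◁ (c ≫ antipodeInv H ▷ M) ≫ fuse (mulInv H) M =
        split (comulOp H) M ≫ H ◁ antipodeInv H ▷ M ≫ H ◁ H ◁ (c ≫ antipodeInv H ▷ M) ≫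
          H ◁ fuse (mulOp H) M ≫ cross H H M ≫ H ◁ a := by
  rw [← cancel_mono (antipodeInv H ▷ M), ydL_eq, ydR_eq]
  have h₁ : (split (comulOp H) M ≫ H ◁ (a ≫ c) ≫ cross H H M ≫ fuse μ[H] M) ≫
      antipodeInv H ▷ M = split (comulOp H) M ≫ H ◁ a ≫ H ◁ (c ≫ antipodeInv H ▷ M) ≫
        fuse (mulInv H) M := by
    simp only [Category.assoc, MonoidalCategory.whiskerLeft_comp]
    rw [fuse_antipodeInv, fuse_mulInv, ← reassoc_of% (cross_whisker H (antipodeInv H) M),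
      ← reassoc_of% (whisker_cross H (antipodeInv H) M), reassoc_of% (cross_cross_left H H M)]
  have h₂ : (split Δ[H] M ≫ H ◁ H ◁ c ≫ H ◁ cross H H M ≫ fuse μ[H] (H ⊗ M) ≫ H ◁ a) ≫
      antipodeInv H ▷ M = split (comulOp H) M ≫ H ◁ antipodeInv H ▷ M ≫
        H ◁ H ◁ (c ≫ antipodeInv H ▷ M) ≫ H ◁ fuse (mulOp H) M ≫ cross H H M ≫ H ◁ a := by
    simp only [Category.assoc, MonoidalCategory.whiskerLeft_comp, fuse_mulOp]
    rw [whisker_exchange, reassoc_of% (fuse_antipodeInv (H := H) (H ⊗ M)),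
      reassoc_of% (cross_fuse H μ[H] M), split_comulOp, Category.assoc,
      ← reassoc_of% (whisker_cross H (antipodeInv H) M),
      reassoc_of% (cross_nat (X := H) (Y := H) c),
      reassoc_of% (cross_nat (X := H) (Y := H) (antipodeInv H ▷ M)),
      reassoc_of% (cross_yang_baxter H H H M), reassoc_of% (whisk20 H (cross_cross_left H H M)),
      reassoc_of% (whisker_exchange (antipodeInv H) (cross H H M)),
      reassoc_of% (whisker_exchange (antipodeInv H) (H ◁ c)),
      reassoc_of% (whisk22 H (cross_whisker H (antipodeInv H) M))]
  rw [h₁, h₂]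

variable [ExactPairing H B]

/-- `h ⊗ f ↦ h₂ ⊗ S⁻¹(h₁) f` where `(h f)(x) = f(x h)`. -/
noncomputable def preExch (H B : C) [HopfObj H] [ExactPairing H B]
    [IsIso (HopfObj.antipode (X := H))] (Z : C) : H ⊗ B ⊗ Z ⟶ H ⊗ B ⊗ Z :=
  split (comulOp H) (B ⊗ Z) ≫ H ◁ antipodeInv H ▷ (B ⊗ Z) ≫ H ◁ fuse (actMul H B) Z

theorem actInv_actMul (Z : C) :
    H ◁ fuse (actMul H B) Z ≫ fuse (actInv H B) Z =
      cross H H (B ⊗ Z) ≫ H ◁ fuse (actInv H B) Z ≫ fuse (actMul H B) Z := by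
  rw [actMul_actInv, reassoc_of% (cross_cross_left H H (B ⊗ Z))]

/-- The identity `h₂ (S⁻¹(h₁) f) ⊗ h₃ = f ⊗ h`. -/
theorem preExch_mix (Z : C) : preExch H B Z ≫ mix Δ[H] (actMul H B) Z = cross H B Z := by
  have h := split_antipodeInv_left (H := H) (H ⊗ B ⊗ Z)
  simp only [preExch, mix, Category.assoc]
  rw [← reassoc_of% (split_nat Δ[H] (fuse (actMul H B) Z)),
    ← reassoc_of% (split_nat Δ[H] (antipodeInv H ▷ (B ⊗ Z))),
    split_comulOp, Category.assoc, ← reassoc_of% (cross_split H Δ[H] (B ⊗ Z)),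
    reassoc_of% (whisk23 H (cross_fuse H (actMul H B) Z)),
    ← reassoc_of% (whisk22 H (whisker_cross H (antipodeInv H) (B ⊗ Z))),
    reassoc_of% (whisk20 H (cross_cross_left H H (B ⊗ Z))),
    actMul_mul, ← reassoc_of% (fuse_nat μ[H] (cross H B Z)),
    ← reassoc_of% (whisker_cross H (antipodeInv H) (H ⊗ B ⊗ Z)),
    reassoc_of% (split_coassoc (A := H) (B ⊗ Z)), reassoc_of% h,
    reassoc_of% (split_counit_left (A := H) (B ⊗ Z)),
    reassoc_of% (ins_nat η[H] (cross H B Z)), actMul_one, Category.comp_id]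

theorem preExch_shift_comm (Z : C) :
    preExch H B Z ≫ shift (actInv H B) Δ[H] Z = shift (actInv H B) Δ[H] Z ≫ preExch H B Z := by
  simp only [preExch, shift, Category.assoc]
  rw [← reassoc_of% (split_nat Δ[H] (fuse (actMul H B) Z)),
    ← reassoc_of% (split_nat Δ[H] (antipodeInv H ▷ (B ⊗ Z))),
    split_comulOp, Category.assoc, ← reassoc_of% (cross_split H Δ[H] (B ⊗ Z)),
    whisk23 H (actInv_actMul Z), reassoc_of% (whisk22 H (cross_whisker H (antipodeInv H) (B ⊗ Z))),
    reassoc_of% (whisk20 H (cross_cross_left H H (B ⊗ Z))),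
    Category.assoc, reassoc_of% (split_coassoc (A := H) (B ⊗ Z)),
    ← reassoc_of% (split_nat Δ[H] (fuse (actInv H B) Z)),
    ← reassoc_of% (cross_nat (X := H) (Y := H) (fuse (actInv H B) Z)),
    reassoc_of% (whisk22 H (whisker_exchange (antipodeInv H) (fuse (actInv H B) Z)))]

/-- Precomposition with the invertible `preExch` cancels the part `h ⊗ f ↦ f(- h₁) ⊗ h₂` of the
exchange morphism. -/
theorem preExch_exch (Z : C) :
    preExch H B Z ≫ exch H B Z = mix (comulOp H) (actInv H B) Z := by
  rw [exch, reassoc_of% (preExch_shift_comm (H := H) (B := B) Z), preExch_mix, mix_comulOp]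

omit [IsIso (HopfObj.antipode (X := H))] in
theorem mix_eq_shift_comulOp (Z : C) :
    mix Δ[H] (actMul H B) Z = shift (actMul H B) (comulOp H) Z ≫ cross H B Z := by
  rw [mix, shift, Category.assoc, cross_fuse, split_comulOp, Category.assoc,
    reassoc_of% (cross_cross_left H H (B ⊗ Z))]

theorem preExch_shift (Z : C) :
    preExch H B Z ≫ shift (actMul H B) (comulOp H) Z = 𝟙 _ := by
  have h := preExch_mix (H := H) (B := B) Z
  rw [mix_eq_shift_comulOp, ← Category.assoc] at h
  have h' := congrArg (· ≫ cross B H Z) h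
  simpa only [Category.assoc, cross_cross_left, Category.comp_id] using h'

theorem shift_preExch (Z : C) :
    shift (actMul H B) (comulOp H) Z ≫ preExch H B Z = 𝟙 _ := by
  simp only [preExch, shift, Category.assoc]
  rw [← reassoc_of% (split_nat (comulOp H) (fuse (actMul H B) Z)),
    reassoc_of% (whisk22 H (whisker_exchange (antipodeInv H) (fuse (actMul H B) Z))),
    whisk22 H (actMul_mul Z), reassoc_of% (split_comulOp_coassoc (H := H) (B ⊗ Z)),
    split_comulOp]
  have e := congrArg (H ◁ ·) (split_antipodeInv_right (H := H) (B ⊗ Z))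
  simp only [MonoidalCategory.whiskerLeft_comp] at e
  simp only [MonoidalCategory.whiskerLeft_comp, Category.assoc]
  rw [reassoc_of% e, whisk20 H (actMul_one Z), Category.comp_id, del_cross, split_counit_left]

instance (Z : C) : IsIso (preExch H B Z) :=
  ⟨_, preExch_shift Z, shift_preExch Z⟩

/-- The Yetter-Drinfeld condition is the condition that the actions of `H` and `B` on `M` are
compatible with the exchange morphism, paired with `B` and twisted by an isomorphism. -/
theorem yd_iff_preExch (a : H ⊗ M ⟶ M) (c : M ⟶ H ⊗ M) :
    ydL Δ[H] μ[H] a c = ydR Δ[H] μ[H] a c ↔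
      preExch H B M ≫ H ◁ pair B (c ≫ antipodeInv H ▷ M) ≫ a =
        mix (comulOp H) (actInv H B) M ≫ B ◁ a ≫ pair B (c ≫ antipodeInv H ▷ M) := by
  have h₁ : preExch H B M ≫ H ◁ pair B (c ≫ antipodeInv H ▷ M) ≫ a =
      cross H B M ≫ pair B (split (comulOp H) M ≫ H ◁ antipodeInv H ▷ M ≫
        H ◁ H ◁ (c ≫ antipodeInv H ▷ M) ≫ H ◁ fuse (mulOp H) M ≫ cross H H M ≫ H ◁ a) := by
    have e : fuse (actMul H B) M ≫ pair B (c ≫ antipodeInv H ▷ M) = _ :=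
      dualAct_pair (mulOp H) (c ≫ antipodeInv H ▷ M)
    simp only [preExch, Category.assoc]
    rw [reassoc_of% (whisk22 H e), whiskerLeft_pair, Category.assoc, pair_comp,
      reassoc_of% (whisk22 H (whisker_cross B (antipodeInv H) M)),
      ← reassoc_of% (cross_nat (X := H) (Y := B) (antipodeInv H ▷ M)),
      reassoc_of% (split_cross B (comulOp H) M), comp_pair, comp_pair]
    simp only [MonoidalCategory.whiskerLeft_comp, Category.assoc]
  have h₂ : mix (comulOp H) (actInv H B) M ≫ B ◁ a ≫ pair B (c ≫ antipodeInv H ▷ M) =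
      cross H B M ≫ pair B (split (comulOp H) M ≫ H ◁ a ≫ H ◁ (c ≫ antipodeInv H ▷ M) ≫
        fuse (mulInv H) M) := by
    simp only [mix, Category.assoc]
    rw [comp_pair, actInv, dualAct_pair, reassoc_of% (split_cross B (comulOp H) M), comp_pair]
    simp only [MonoidalCategory.whiskerLeft_comp, Category.assoc]
  rw [yd_iff_twisted, h₁, h₂, cancel_epi (cross H B M), pair_injective.eq_iff, eq_comm]

/-- The Yetter-Drinfeld condition says that the actions of `H` and of its dual on `M` are compatible
with the exchange morphism of the double. -/
theorem yd_iff_exch (a : H ⊗ M ⟶ M) (c : M ⟶ H ⊗ M) :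
    ydL Δ[H] μ[H] a c = ydR Δ[H] μ[H] a c ↔
      H ◁ pair B (c ≫ antipodeInv H ▷ M) ≫ a =
        exch H B M ≫ B ◁ a ≫ pair B (c ≫ antipodeInv H ▷ M) := by
  rw [yd_iff_preExch (B := B), ← preExch_exch, Category.assoc, cancel_epi]

/-- A coaction of `H` is coassociative exactly if the corresponding action of the dual is
associative; `S⁻¹` reverses the coproduct, as it is needed for left actions. -/
theorem coassoc_iff_pair (c : M ⟶ H ⊗ M) :
    c ≫ split Δ[H] M = c ≫ H ◁ c ↔
      B ◁ pair B (c ≫ antipodeInv H ▷ M) ≫ pair B (c ≫ antipodeInv H ▷ M) =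
        fuse (convMul H B) M ≫ pair B (c ≫ antipodeInv H ▷ M) := by
  have h₁ : (c ≫ antipodeInv H ▷ M) ≫ split (comulOp H) M =
      (c ≫ split Δ[H] M) ≫ antipodeInv H ▷ (H ⊗ M) ≫ H ◁ antipodeInv H ▷ M := by
    rw [Category.assoc, antipodeInv_split_comulOp, Category.assoc]
  have h₂ : (c ≫ antipodeInv H ▷ M) ≫ H ◁ (c ≫ antipodeInv H ▷ M) =
      (c ≫ H ◁ c) ≫ antipodeInv H ▷ (H ⊗ M) ≫ H ◁ antipodeInv H ▷ M := by
    simp only [MonoidalCategory.whiskerLeft_comp, Category.assoc]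
    rw [reassoc_of% (whisker_exchange (antipodeInv H) c)]
  rw [comp_pair, pair_comp, convMul_pair, h₁, h₂, pair_injective.eq_iff, pair_injective.eq_iff,
    cancel_mono, eq_comm]

omit [Transparent H] in
/-- A coaction of `H` is counital exactly if the corresponding action of the dual is unital. -/
theorem counit_iff_pair (c : M ⟶ H ⊗ M) :
    c ≫ del ε[H] M = 𝟙 M ↔
      ins (convOne H B) M ≫ pair B (c ≫ antipodeInv H ▷ M) = 𝟙 M := by
  rw [convOne_pair, Category.assoc, antipodeInv_del]

/-- The codiagonal coaction corresponds to the diagonal action of the dual. -/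
theorem pair_tensorCoact (cM : M ⟶ H ⊗ M) (cN : N ⟶ H ⊗ N) :
    pair B (tensorCoact μ[H] cM cN ≫ antipodeInv H ▷ (M ⊗ N)) =
      tensorAct (convComul H B) (pair B (cM ≫ antipodeInv H ▷ M))
        (pair B (cN ≫ antipodeInv H ▷ N)) := by
  have := transparent_of_exactPairing H B
  have h₁ : tensorAct (convComul H B) (pair B (cM ≫ antipodeInv H ▷ M))
      (pair B (cN ≫ antipodeInv H ▷ N)) = split (convComul H B) (M ⊗ N) ≫
        B ◁ (cross B M N ≫ M ◁ pair B (cN ≫ antipodeInv H ▷ N)) ≫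
          pair B (split (cM ≫ antipodeInv H ▷ M) N) := by
    simp only [tensorAct, split, cross, pair, tensorμ, cap, MonoidalCategory.tensorHom_def']
    monoidal
  have h₂ : tensorCoact μ[H] cM cN = M ◁ cN ≫ split cM (H ⊗ N) ≫ H ◁ cross M H N ≫
      fuse μ[H] (M ⊗ N) := by
    simp only [tensorCoact, split, cross, fuse, tensorμ, MonoidalCategory.tensorHom_def']
    monoidal
  rw [h₁, h₂, whiskerLeft_pair, reassoc_of% (cross_cross_left B M N), convComul_pair]
  simp only [MonoidalCategory.whiskerLeft_comp, Category.assoc]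
  have h₃ : split (cM ≫ antipodeInv H ▷ M) N = split cM N ≫ antipodeInv H ▷ (M ⊗ N) := by
    simp [split]
  rw [fuse_antipodeInv, h₃,
    ← reassoc_of% (whisker_exchange (antipodeInv H) (antipodeInv H ▷ (M ⊗ N))),
    ← reassoc_of% (whisk22 H (cross_whisker M (antipodeInv H) N)),
    reassoc_of% (split_nat cM (antipodeInv H ▷ N)),
    reassoc_of% (whisker_cross H (antipodeInv H) (M ⊗ N)),
    reassoc_of% (split_cross H cM N)]
  simp only [MonoidalCategory.whiskerLeft_comp, Category.assoc]

end YetterDrinfeld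

/-! ### Modules over smash products -/

section SmashModules

variable {C : Type u} [Category.{v} C] [MonoidalCategory C] {B H M : C}

/-- The action `(f ⊗ h) m = f (h m)` of `B ⊗ H` determined by actions of `B` and `H`. -/
def smashAct (a : H ⊗ M ⟶ M) (b : B ⊗ M ⟶ M) : (B ⊗ H) ⊗ M ⟶ M :=
  (α_ B H M).hom ≫ B ◁ a ≫ b

/-- The action `m (f ⊗ h) = (m f) h` of `B ⊗ H` determined by actions of `B` and `H`. -/
def smashActR (a : M ⊗ H ⟶ M) (b : M ⊗ B ⟶ M) : M ⊗ B ⊗ H ⟶ M :=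
  (α_ M B H).inv ≫ b ▷ H ≫ a

theorem smashAct_comp {N : C} {a : H ⊗ M ⟶ M} {b : B ⊗ M ⟶ M} {a' : H ⊗ N ⟶ N}
    {b' : B ⊗ N ⟶ N} {f : M ⟶ N} (ha : a ≫ f = H ◁ f ≫ a')
    (hb : b ≫ f = B ◁ f ≫ b') :
    smashAct a b ≫ f = (B ⊗ H) ◁ f ≫ smashAct a' b' := by
  simp only [smashAct, Category.assoc, hb, ← MonoidalCategory.whiskerLeft_comp_assoc, ha]
  monoidal

section Construct

variable {mB : B ⊗ B ⟶ B} {mH : H ⊗ H ⟶ H} {x : H ⊗ B ⟶ B ⊗ H} {eB : 𝟙_ C ⟶ B} {eH : 𝟙_ C ⟶ H}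

theorem smashAct_mul {a : H ⊗ M ⟶ M} {b : B ⊗ M ⟶ M}
    (ha : mH ▷ M ≫ a = (α_ H H M).hom ≫ H ◁ a ≫ a)
    (hb : mB ▷ M ≫ b = (α_ B B M).hom ≫ B ◁ b ≫ b)
    (hx : H ◁ b ≫ a = tailed x M ≫ B ◁ a ≫ b) :
    smashMul mB mH x ▷ M ≫ smashAct a b =
      (α_ _ _ _).hom ≫ (B ⊗ H) ◁ smashAct a b ≫ smashAct a b := by
  simp only [smashMul, smashAct, MonoidalCategory.tensorHom_def]
  calc
    _ = 𝟙 _ ⊗≫ B ◁ x ▷ (H ⊗ M) ⊗≫ mB ▷ (H ⊗ H) ▷ M ⊗≫ B ◁ (mH ▷ M ≫ a) ≫ b := by monoidal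
    _ = 𝟙 _ ⊗≫ B ◁ x ▷ (H ⊗ M) ⊗≫ (mB ▷ (H ⊗ H ⊗ M) ≫ B ◁ (H ◁ a ≫ a)) ≫ b := by
      rw [ha]; monoidal
    _ = 𝟙 _ ⊗≫ B ◁ x ▷ (H ⊗ M) ⊗≫ B ◁ B ◁ (H ◁ a ≫ a) ⊗≫ (mB ▷ M ≫ b) := by
      rw [← whisker_exchange]; monoidal
    _ = 𝟙 _ ⊗≫ B ◁ (x ▷ (H ⊗ M) ≫ (B ⊗ H) ◁ a) ⊗≫ B ◁ B ◁ a ⊗≫ B ◁ b ≫ b := by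
      rw [hb]; monoidal
    _ = 𝟙 _ ⊗≫ B ◁ H ◁ B ◁ a ⊗≫ B ◁ (tailed x M ≫ B ◁ a ≫ b) ≫ b := by
      rw [← whisker_exchange]; simp only [tailed]; monoidal
    _ = _ := by rw [← hx]; monoidal

theorem smashAct_one {a : H ⊗ M ⟶ M} {b : B ⊗ M ⟶ M}
    (ha : eH ▷ M ≫ a = (λ_ M).hom) (hb : eB ▷ M ≫ b = (λ_ M).hom) :
    ((λ_ (𝟙_ C)).inv ≫ (eB ⊗ₘ eH)) ▷ M ≫ smashAct a b = (λ_ M).hom := by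
  simp only [smashAct, MonoidalCategory.tensorHom_def]
  calc
    _ = 𝟙 _ ⊗≫ eB ▷ (𝟙_ C ⊗ M) ⊗≫ B ◁ (eH ▷ M ≫ a) ≫ b := by monoidal
    _ = 𝟙 _ ⊗≫ (eB ▷ M ≫ b) ⊗≫ 𝟙 _ := by rw [ha]; monoidal
    _ = _ := by rw [hb]; monoidal

theorem smashActR_mul {a : M ⊗ H ⟶ M} {b : M ⊗ B ⟶ M}
    (ha : M ◁ mH ≫ a = (α_ M H H).inv ≫ a ▷ H ≫ a)
    (hb : M ◁ mB ≫ b = (α_ M B B).inv ≫ b ▷ B ≫ b)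
    (hx : a ▷ B ≫ b = (α_ M H B).hom ≫ M ◁ x ≫ (α_ M B H).inv ≫ b ▷ H ≫ a) :
    M ◁ smashMul mB mH x ≫ smashActR a b =
      (α_ _ _ _).inv ≫ smashActR a b ▷ (B ⊗ H) ≫ smashActR a b := by
  simp only [smashMul, smashActR, MonoidalCategory.tensorHom_def']
  calc
    _ = 𝟙 _ ⊗≫ (M ⊗ B) ◁ x ▷ H ⊗≫ (M ⊗ B ⊗ B) ◁ mH ⊗≫ (M ◁ mB ≫ b) ▷ H ≫ a := by monoidal
    _ = 𝟙 _ ⊗≫ (M ⊗ B) ◁ x ▷ H ⊗≫ (((M ⊗ B) ⊗ B) ◁ mH ≫ (b ▷ B ≫ b) ▷ H) ≫ a := by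
      rw [hb]; monoidal
    _ = 𝟙 _ ⊗≫ (M ⊗ B) ◁ x ▷ H ⊗≫ (b ▷ B ≫ b) ▷ (H ⊗ H) ⊗≫ (M ◁ mH ≫ a) := by
      rw [whisker_exchange]; monoidal
    _ = 𝟙 _ ⊗≫ ((M ⊗ B) ◁ x ≫ b ▷ (B ⊗ H)) ▷ H ⊗≫ (b ▷ H ≫ a) ▷ H ⊗≫ a := by
      rw [ha]; monoidal
    _ = 𝟙 _ ⊗≫ b ▷ (H ⊗ B ⊗ H) ⊗≫
        ((α_ M H B).hom ≫ M ◁ x ≫ (α_ M B H).inv ≫ b ▷ H ≫ a) ▷ H ⊗≫ a := by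
      rw [whisker_exchange]; monoidal
    _ = _ := by rw [← hx]; monoidal

theorem smashActR_one {a : M ⊗ H ⟶ M} {b : M ⊗ B ⟶ M}
    (ha : M ◁ eH ≫ a = (ρ_ M).hom) (hb : M ◁ eB ≫ b = (ρ_ M).hom) :
    M ◁ ((λ_ (𝟙_ C)).inv ≫ (eB ⊗ₘ eH)) ≫ smashActR a b = (ρ_ M).hom := by
  simp only [smashActR, MonoidalCategory.tensorHom_def']
  calc
    _ = 𝟙 _ ⊗≫ (M ⊗ 𝟙_ C) ◁ eH ⊗≫ (M ◁ eB ≫ b) ▷ H ≫ a := by monoidal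
    _ = 𝟙 _ ⊗≫ (M ◁ eH ≫ a) ⊗≫ 𝟙 _ := by rw [hb]; monoidal
    _ = _ := by rw [ha]; monoidal

variable (hB₁ : eB ▷ B ≫ mB = (λ_ B).hom) (hB₂ : B ◁ eB ≫ mB = (ρ_ B).hom)
  (hH₁ : eH ▷ H ≫ mH = (λ_ H).hom) (hH₂ : H ◁ eH ≫ mH = (ρ_ H).hom)
  (hx₁ : eH ▷ B ≫ x = (λ_ B).hom ≫ (ρ_ B).inv ≫ B ◁ eH)
  (hx₂ : H ◁ eB ≫ x = (ρ_ H).hom ≫ (λ_ H).inv ≫ eB ▷ H)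

include hB₁ hx₂ in
theorem inr_inr_smashMul :
    (((λ_ H).inv ≫ eB ▷ H) ⊗ₘ ((λ_ H).inv ≫ eB ▷ H)) ≫ smashMul mB mH x =
      mH ≫ (λ_ H).inv ≫ eB ▷ H := by
  simp only [smashMul, MonoidalCategory.tensorHom_def]
  calc
    _ = 𝟙 _ ⊗≫ eB ▷ (H ⊗ H) ⊗≫ B ◁ (H ◁ eB ≫ x) ▷ H ⊗≫ mB ▷ (H ⊗ H) ⊗≫ B ◁ mH := by monoidal
    _ = 𝟙 _ ⊗≫ eB ▷ (𝟙_ C ⊗ H ⊗ H) ⊗≫ (B ◁ eB ≫ mB) ▷ (H ⊗ H) ⊗≫ B ◁ mH := by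
      rw [hx₂]; monoidal
    _ = 𝟙 _ ⊗≫ 𝟙_ C ◁ eB ▷ (H ⊗ H) ⊗≫ (eB ▷ B ≫ mB) ▷ (H ⊗ H) ⊗≫ B ◁ mH := by
      have h := whisker_exchange eB eB
      calc
        _ = 𝟙 _ ⊗≫ (eB ▷ 𝟙_ C ≫ B ◁ eB) ▷ (H ⊗ H) ⊗≫ mB ▷ (H ⊗ H) ⊗≫ B ◁ mH := by monoidal
        _ = _ := by rw [← h]; monoidal
    _ = 𝟙 _ ⊗≫ (eB ▷ (H ⊗ H) ≫ B ◁ mH) := by rw [hB₁]; monoidal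
    _ = _ := by rw [← whisker_exchange]; monoidal

include hH₂ hx₁ in
theorem inl_inl_smashMul :
    (((ρ_ B).inv ≫ B ◁ eH) ⊗ₘ ((ρ_ B).inv ≫ B ◁ eH)) ≫ smashMul mB mH x =
      mB ≫ (ρ_ B).inv ≫ B ◁ eH := by
  simp only [smashMul, MonoidalCategory.tensorHom_def']
  calc
    _ = 𝟙 _ ⊗≫ (B ⊗ B) ◁ eH ⊗≫ B ◁ (eH ▷ B ≫ x) ▷ H ⊗≫ B ◁ B ◁ mH ⊗≫ mB ▷ H := by monoidal
    _ = 𝟙 _ ⊗≫ (B ⊗ B) ◁ (𝟙_ C ◁ eH ≫ eH ▷ H) ⊗≫ B ◁ B ◁ mH ⊗≫ mB ▷ H := by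
      rw [hx₁]; monoidal
    _ = 𝟙 _ ⊗≫ (B ⊗ B) ◁ eH ▷ 𝟙_ C ⊗≫ (B ⊗ B) ◁ (H ◁ eH ≫ mH) ⊗≫ mB ▷ H := by
      rw [whisker_exchange]; monoidal
    _ = 𝟙 _ ⊗≫ ((B ⊗ B) ◁ eH ≫ mB ▷ H) := by rw [hH₂]; monoidal
    _ = _ := by rw [whisker_exchange]; monoidal

include hB₂ hH₁ hx₁ in
theorem inl_inr_smashMul :
    (((ρ_ B).inv ≫ B ◁ eH) ⊗ₘ ((λ_ H).inv ≫ eB ▷ H)) ≫ smashMul mB mH x = 𝟙 (B ⊗ H) := by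
  simp only [smashMul, MonoidalCategory.tensorHom_def]
  calc
    _ = 𝟙 _ ⊗≫ B ◁ (eH ▷ 𝟙_ C ≫ H ◁ eB) ▷ H ⊗≫ B ◁ x ▷ H ⊗≫ mB ▷ (H ⊗ H) ⊗≫ B ◁ mH := by
      monoidal
    _ = 𝟙 _ ⊗≫ B ◁ eB ▷ H ⊗≫ B ◁ (eH ▷ B ≫ x) ▷ H ⊗≫ mB ▷ (H ⊗ H) ⊗≫ B ◁ mH := by
      rw [← whisker_exchange]; monoidal
    _ = 𝟙 _ ⊗≫ B ◁ eB ▷ H ⊗≫ ((B ⊗ B) ◁ (eH ▷ H) ≫ mB ▷ (H ⊗ H)) ⊗≫ B ◁ mH := by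
      rw [hx₁]; monoidal
    _ = 𝟙 _ ⊗≫ (B ◁ eB ≫ mB) ▷ H ⊗≫ B ◁ (eH ▷ H ≫ mH) := by
      rw [whisker_exchange]; monoidal
    _ = _ := by rw [hB₂, hH₁]; monoidal

include hB₁ hH₂ in
theorem inr_inl_smashMul :
    (((λ_ H).inv ≫ eB ▷ H) ⊗ₘ ((ρ_ B).inv ≫ B ◁ eH)) ≫ smashMul mB mH x = x := by
  simp only [smashMul, MonoidalCategory.tensorHom_def]
  calc
    _ = 𝟙 _ ⊗≫ eB ▷ (H ⊗ B) ⊗≫ B ◁ ((H ⊗ B) ◁ eH ≫ x ▷ H) ⊗≫ mB ▷ (H ⊗ H) ⊗≫ B ◁ mH := by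
      monoidal
    _ = 𝟙 _ ⊗≫ (eB ▷ (H ⊗ B) ≫ B ◁ x) ⊗≫ ((B ⊗ B) ◁ (H ◁ eH) ≫ mB ▷ (H ⊗ H)) ⊗≫ B ◁ mH := by
      rw [whisker_exchange]; monoidal
    _ = 𝟙 _ ⊗≫ x ⊗≫ (eB ▷ B ≫ mB) ▷ H ⊗≫ B ◁ (H ◁ eH ≫ mH) := by
      rw [whisker_exchange mB, ← whisker_exchange eB]; monoidal
    _ = _ := by rw [hB₁, hH₂]; monoidal

end Construct

section Restrict

variable {D : C} {m : D ⊗ D ⟶ D}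

/-- Acting by a product of elements of two objects mapping to an algebra. -/
theorem act_act {X Y : C} (i : X ⟶ D) (j : Y ⟶ D) {d : D ⊗ M ⟶ M}
    (hd : m ▷ M ≫ d = (α_ D D M).hom ≫ D ◁ d ≫ d) :
    X ◁ (j ▷ M ≫ d) ≫ i ▷ M ≫ d = (α_ X Y M).inv ≫ ((i ⊗ₘ j) ≫ m) ▷ M ≫ d := by
  rw [comp_whiskerRight, Category.assoc, hd, MonoidalCategory.tensorHom_def']
  calc
    _ = X ◁ j ▷ M ≫ (X ◁ d ≫ i ▷ M) ≫ d := by monoidal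
    _ = X ◁ j ▷ M ⊗≫ i ▷ (D ⊗ M) ⊗≫ D ◁ d ≫ d := by rw [whisker_exchange]; monoidal
    _ = _ := by monoidal

theorem act_actR {X Y : C} (i : X ⟶ D) (j : Y ⟶ D) {d : M ⊗ D ⟶ M}
    (hd : M ◁ m ≫ d = (α_ M D D).inv ≫ d ▷ D ≫ d) :
    (M ◁ i ≫ d) ▷ Y ≫ M ◁ j ≫ d = (α_ M X Y).hom ≫ M ◁ ((i ⊗ₘ j) ≫ m) ≫ d := by
  rw [MonoidalCategory.whiskerLeft_comp, Category.assoc, hd, MonoidalCategory.tensorHom_def]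
  calc
    _ = (M ◁ i) ▷ Y ≫ (d ▷ Y ≫ M ◁ j) ≫ d := by monoidal
    _ = (M ◁ i) ▷ Y ⊗≫ (M ⊗ D) ◁ j ⊗≫ d ▷ D ≫ d := by rw [← whisker_exchange]; monoidal
    _ = _ := by monoidal

end Restrict

end SmashModules

section TensorSmash

variable {C : Type u} [Category.{v} C] [MonoidalCategory C] [BraidedCategory C] {P Q M N : C}

/-- The diagonal action of `P ⊗ Q` with its codiagonal coproduct is determined by the diagonal
actions of `P` and `Q`. -/
theorem tensorAct_smashAct (δP : P ⟶ P ⊗ P) (δQ : Q ⟶ Q ⊗ Q) (qM : Q ⊗ M ⟶ M) (pM : P ⊗ M ⟶ M)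
    (qN : Q ⊗ N ⟶ N) (pN : P ⊗ N ⟶ N) :
    tensorAct ((δP ⊗ₘ δQ) ≫ tensorμ P P Q Q) (smashAct qM pM) (smashAct qN pN) =
      smashAct (tensorAct δQ qM qN) (tensorAct δP pM pN) := by
  calc
    _ = 𝟙 _ ⊗≫ δP ▷ (Q ⊗ M ⊗ N) ⊗≫ P ◁ (P ◁ δQ ⊗≫ (β_ P Q).hom ▷ Q) ▷ (M ⊗ N) ⊗≫
        P ◁ Q ◁ (P ◁ (β_ Q M).hom ⊗≫ (β_ P M).hom ▷ Q) ▷ N ⊗≫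
        P ◁ qM ▷ (P ⊗ Q ⊗ N) ⊗≫ pM ▷ (P ⊗ Q ⊗ N) ⊗≫ M ◁ P ◁ qN ⊗≫ M ◁ pN := by
      simp only [tensorAct, smashAct, tensorμ, MonoidalCategory.tensorHom_def,
        braiding_tensor_left_hom]
      monoidal
    _ = 𝟙 _ ⊗≫ δP ▷ (Q ⊗ M ⊗ N) ⊗≫ P ◁ (P ◁ δQ ▷ (M ⊗ N)) ⊗≫
        P ◁ ((β_ P Q).hom ▷ (Q ⊗ M) ≫ (Q ⊗ P) ◁ (β_ Q M).hom) ▷ N ⊗≫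
        P ◁ Q ◁ (β_ P M).hom ▷ (Q ⊗ N) ⊗≫
        P ◁ qM ▷ (P ⊗ Q ⊗ N) ⊗≫ pM ▷ (P ⊗ Q ⊗ N) ⊗≫ M ◁ P ◁ qN ⊗≫ M ◁ pN := by
      monoidal
    _ = 𝟙 _ ⊗≫ δP ▷ (Q ⊗ M ⊗ N) ⊗≫ P ◁ (P ◁ δQ ▷ (M ⊗ N)) ⊗≫
        P ◁ (P ⊗ Q) ◁ (β_ Q M).hom ▷ N ⊗≫
        P ◁ ((β_ P (Q ⊗ M)).hom ≫ qM ▷ P) ▷ (Q ⊗ N) ⊗≫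
        ((pM ▷ P) ▷ (Q ⊗ N) ≫ (M ⊗ P) ◁ qN) ⊗≫ M ◁ pN := by
      rw [← whisker_exchange, braiding_tensor_right_hom]
      monoidal
    _ = 𝟙 _ ⊗≫ δP ▷ (Q ⊗ M ⊗ N) ⊗≫ P ◁ (P ◁ δQ ▷ (M ⊗ N)) ⊗≫
        P ◁ (P ⊗ Q) ◁ (β_ Q M).hom ▷ N ⊗≫ P ◁ P ◁ qM ▷ (Q ⊗ N) ⊗≫
        P ◁ ((β_ P M).hom ▷ (Q ⊗ N) ≫ (M ⊗ P) ◁ qN) ⊗≫ (pM ▷ P) ▷ N ⊗≫ M ◁ pN := by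
      rw [← braiding_naturality_right, ← whisker_exchange (pM ▷ P) qN]
      monoidal
    _ = 𝟙 _ ⊗≫ (δP ▷ (Q ⊗ M ⊗ N) ≫ (P ⊗ P) ◁ tensorAct δQ qM qN) ⊗≫
        P ◁ (β_ P M).hom ▷ N ⊗≫ pM ▷ (P ⊗ N) ⊗≫ M ◁ pN := by
      rw [← whisker_exchange]
      simp only [tensorAct, tensorμ, MonoidalCategory.tensorHom_def]
      monoidal
    _ = _ := by
      rw [← whisker_exchange]
      simp only [tensorAct, smashAct, tensorμ, MonoidalCategory.tensorHom_def]
      monoidal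

end TensorSmash

/-! ### Yetter-Drinfeld modules and modules over the double -/

section Laws

variable {C : Type u} [Category.{v} C] [MonoidalCategory C] {X M : C}

theorem ins_act_iff {e : 𝟙_ C ⟶ X} {a : X ⊗ M ⟶ M} :
    ins e M ≫ a = 𝟙 M ↔ e ▷ M ≫ a = (λ_ M).hom := by
  rw [ins, Category.assoc, Iso.inv_comp_eq, Category.comp_id]

theorem fuse_act_iff {m : X ⊗ X ⟶ X} {a : X ⊗ M ⟶ M} :
    X ◁ a ≫ a = fuse m M ≫ a ↔ m ▷ M ≫ a = (α_ X X M).hom ≫ X ◁ a ≫ a := by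
  rw [fuse, Category.assoc, Iso.eq_inv_comp, eq_comm]

theorem del_coact_iff {e : X ⟶ 𝟙_ C} {c : M ⟶ X ⊗ M} :
    c ≫ del e M = 𝟙 M ↔ c ≫ e ▷ M = (λ_ M).inv := by
  rw [del, ← Category.assoc, ← Iso.eq_comp_inv, Category.id_comp]

theorem split_coact_iff {δ : X ⟶ X ⊗ X} {c : M ⟶ X ⊗ M} :
    c ≫ split δ M = c ≫ X ◁ c ↔ c ≫ δ ▷ M = c ≫ X ◁ c ≫ (α_ X X M).inv := by
  rw [split, ← Category.assoc, ← Iso.eq_comp_inv, Category.assoc]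

end Laws

section LeftDouble

variable {C : Type u} [Category.{v} C] [MonoidalCategory C] [BraidedCategory C]
variable {H B : C} [HopfObj H]

/-- The laws of a left-left Yetter-Drinfeld module with action `a` and coaction `c`. -/
structure IsLeftYD {M : C} (a : H ⊗ M ⟶ M) (c : M ⟶ H ⊗ M) : Prop where
  one : η[H] ▷ M ≫ a = (λ_ M).hom
  mul : μ[H] ▷ M ≫ a = (α_ H H M).hom ≫ H ◁ a ≫ a
  counit : c ≫ ε[H] ▷ M = (λ_ M).inv
  coassoc : c ≫ Δ[H] ▷ M = c ≫ H ◁ c ≫ (α_ H H M).inv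
  yd : ydL Δ[H] μ[H] a c = ydR Δ[H] μ[H] a c

theorem IsLeftYD.tensor {M N : C} {aM : H ⊗ M ⟶ M} {cM : M ⟶ H ⊗ M} {aN : H ⊗ N ⟶ N}
    {cN : N ⟶ H ⊗ N} (hM : IsLeftYD aM cM) (hN : IsLeftYD aN cN) :
    IsLeftYD (tensorAct Δ[H] aM aN) (tensorCoact μ[H] cM cN) where
  one := tensorAct_one aM aN hM.one hN.one
  mul := tensorAct_mul aM aN hM.mul hN.mul
  counit := tensorCoact_counit cM cN hM.counit hN.counit
  coassoc := tensorCoact_coassoc cM cN hM.coassoc hN.coassoc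
  yd := ydT _ _ aM cM aN cN (MonObj.mul_assoc H)
    (by rw [ComonObj.comul_assoc_assoc, Iso.hom_inv_id, Category.comp_id]) hM.yd hN.yd

theorem isLeftYD_unit : IsLeftYD (M := 𝟙_ C) ((ρ_ H).hom ≫ ε[H]) (η[H] ≫ (ρ_ H).inv) where
  one := unitAct_one
  mul := unitAct_mul
  counit := unitCoact_counit
  coassoc := unitCoact_coassoc
  yd := unit_yd

variable [IsIso (HopfObj.antipode (X := H))] [ExactPairing H B] {M N : C}

variable (B) in
/-- The action `f m = f(S⁻¹(m₋₁)) m₀` of the dual of `H` given by a coaction of `H`. -/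
noncomputable def dualAction (c : M ⟶ H ⊗ M) : B ⊗ M ⟶ M :=
  pair B (c ≫ antipodeInv H ▷ M)

variable (H) in
/-- The coaction of `H` given by an action of its dual. -/
def coactionOf (b : B ⊗ M ⟶ M) : M ⟶ H ⊗ M :=
  unpair H b ≫ HopfObj.antipode (X := H) ▷ M

theorem dualAction_coactionOf (b : B ⊗ M ⟶ M) : dualAction B (coactionOf H b) = b := by
  rw [dualAction, coactionOf, Category.assoc, antipode_antipodeInv, Category.comp_id, pair_unpair]

theorem coactionOf_dualAction (c : M ⟶ H ⊗ M) : coactionOf H (dualAction B c) = c := by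
  rw [dualAction, coactionOf, unpair_pair, Category.assoc, antipodeInv_antipode, Category.comp_id]

/-- A morphism is compatible with coactions of `H` exactly if it is so with the corresponding
actions of the dual. -/
theorem dualAction_comp_iff (cM : M ⟶ H ⊗ M) (cN : N ⟶ H ⊗ N) (f : M ⟶ N) :
    dualAction B cM ≫ f = B ◁ f ≫ dualAction B cN ↔ cM ≫ H ◁ f = f ≫ cN := by
  rw [dualAction, dualAction, pair_comp, comp_pair, pair_injective.eq_iff, Category.assoc,
    ← whisker_exchange, ← Category.assoc, ← Category.assoc, cancel_mono]

variable [Transparent H]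

/-- Yetter-Drinfeld modules are modules over `H` and over its dual whose actions are compatible with
the exchange morphism of the double. -/
theorem isLeftYD_iff (a : H ⊗ M ⟶ M) (c : M ⟶ H ⊗ M) :
    IsLeftYD a c ↔ (η[H] ▷ M ≫ a = (λ_ M).hom ∧ μ[H] ▷ M ≫ a = (α_ H H M).hom ≫ H ◁ a ≫ a) ∧
      (convOne H B ▷ M ≫ dualAction B c = (λ_ M).hom ∧
        convMul H B ▷ M ≫ dualAction B c =
          (α_ B B M).hom ≫ B ◁ dualAction B c ≫ dualAction B c) ∧
      H ◁ dualAction B c ≫ a = tailed (exchange H B) M ≫ B ◁ a ≫ dualAction B c := by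
  rw [tailed_exchange, ← ins_act_iff (X := B), ← fuse_act_iff (X := B)]
  constructor
  · rintro ⟨h₁, h₂, h₃, h₄, h₅⟩
    exact ⟨⟨h₁, h₂⟩, ⟨(counit_iff_pair c).1 (del_coact_iff.2 h₃),
      (coassoc_iff_pair c).1 (split_coact_iff.2 h₄)⟩, (yd_iff_exch a c).1 h₅⟩
  · rintro ⟨⟨h₁, h₂⟩, ⟨h₃, h₄⟩, h₅⟩
    exact ⟨h₁, h₂, del_coact_iff.1 ((counit_iff_pair (B := B) c).2 h₃),
      split_coact_iff.1 ((coassoc_iff_pair (B := B) c).2 h₄), (yd_iff_exch (B := B) a c).2 h₅⟩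

theorem dualAction_tensorCoact (cM : M ⟶ H ⊗ M) (cN : N ⟶ H ⊗ N) :
    dualAction B (tensorCoact μ[H] cM cN) =
      tensorAct (convComul H B) (dualAction B cM) (dualAction B cN) :=
  pair_tensorCoact cM cN

end LeftDouble

section DoubleMonoid

variable {C : Type u} [Category.{v} C] [MonoidalCategory C] [BraidedCategory C]
variable {H : C} [HopfObj H] [Transparent H] (fin : FiniteObj H)

theorem dualOne_mul : dualOne fin ▷ fin.dual ≫ dualMul fin = (λ_ fin.dual).hom := by
  have h := convMul_one_left (H := H) (B := fin.dual) (𝟙_ C)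
  calc
    _ = 𝟙 _ ⊗≫ (ins (convOne H fin.dual) (fin.dual ⊗ 𝟙_ C) ≫ fuse (convMul H fin.dual) (𝟙_ C)) ⊗≫
          𝟙 _ := by
      rw [dualMul_eq, dualOne_eq]; simp only [ins, fuse]; monoidal
    _ = _ := by rw [h]; monoidal

theorem dualMul_one : fin.dual ◁ dualOne fin ≫ dualMul fin = (ρ_ fin.dual).hom := by
  have h := convMul_one_right (H := H) (B := fin.dual) (𝟙_ C)
  calc
    _ = 𝟙 _ ⊗≫ (fin.dual ◁ ins (convOne H fin.dual) (𝟙_ C) ≫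
          fuse (convMul H fin.dual) (𝟙_ C)) ⊗≫ 𝟙 _ := by
      rw [dualMul_eq, dualOne_eq]; simp only [ins, fuse]; monoidal
    _ = _ := by rw [h]; monoidal

variable [IsIso (HopfObj.antipode (X := H))]

theorem one_exchange : η[H] ▷ fin.dual ≫ exchange H fin.dual =
    (λ_ fin.dual).hom ≫ (ρ_ fin.dual).inv ≫ fin.dual ◁ η[H] := by
  have h := ins_exch (H := H) (B := fin.dual) (𝟙_ C)
  rw [← tailed_exchange] at h
  calc
    _ = 𝟙 _ ⊗≫ (ins η[H] (fin.dual ⊗ 𝟙_ C) ≫ tailed (exchange H fin.dual) (𝟙_ C)) ⊗≫ 𝟙 _ := by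
      simp only [ins, tailed]; monoidal
    _ = _ := by rw [h]; simp only [ins]; monoidal

theorem exchange_one : H ◁ dualOne fin ≫ exchange H fin.dual =
    (ρ_ H).hom ≫ (λ_ H).inv ≫ dualOne fin ▷ H := by
  have h := exch_ins (H := H) (B := fin.dual) (𝟙_ C)
  rw [← tailed_exchange] at h
  rw [dualOne_eq]
  calc
    _ = 𝟙 _ ⊗≫ (H ◁ ins (convOne H fin.dual) (𝟙_ C) ≫
          tailed (exchange H fin.dual) (𝟙_ C)) ⊗≫ 𝟙 _ := by
      simp only [ins, tailed]; monoidal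
    _ = _ := by rw [h]; simp only [ins]; monoidal

/-- The algebra structure of the Drinfeld double. -/
@[reducible]
noncomputable def doubleMonObj : MonObj (double fin) where
  one := doubleOne fin
  mul := doubleMul fin
  one_mul := by
    rw [doubleMul_eq]
    exact one_smashMul (dualOne_mul fin) (MonObj.one_mul H) (one_exchange fin)
  mul_one := by
    rw [doubleMul_eq]
    exact smashMul_one (dualMul_one fin) (MonObj.mul_one H) (exchange_one fin)
  mul_assoc := by
    rw [doubleMul_eq]
    refine smashMul_assoc (smash_assoc ?_ fuse_assoc ?_ ?_)
    · rw [dualMul_eq]; exact convMul_assoc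
    · simp only [tailed_exchange]; exact fuse_exch
    · rw [dualMul_eq]; simp only [tailed_exchange]; exact exch_fuse

theorem inclH_mul : (inclH fin ⊗ₘ inclH fin) ≫ doubleMul fin = μ[H] ≫ inclH fin := by
  rw [doubleMul_eq]
  exact inr_inr_smashMul (dualOne_mul fin) (exchange_one fin)

theorem inclB_mul : (inclB fin ⊗ₘ inclB fin) ≫ doubleMul fin = dualMul fin ≫ inclB fin := by
  rw [doubleMul_eq]
  exact inl_inl_smashMul (MonObj.mul_one H) (one_exchange fin)

theorem inclB_inclH_mul : (inclB fin ⊗ₘ inclH fin) ≫ doubleMul fin = 𝟙 (double fin) := by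
  rw [doubleMul_eq]
  exact inl_inr_smashMul (dualMul_one fin) (MonObj.one_mul H) (one_exchange fin)

theorem inclH_inclB_mul :
    (inclH fin ⊗ₘ inclB fin) ≫ doubleMul fin = exchange H fin.dual := by
  rw [doubleMul_eq]
  exact inr_inl_smashMul (dualOne_mul fin) (MonObj.mul_one H)

omit [Transparent H] [IsIso (HopfObj.antipode (X := H))] in
theorem one_inclH : η[H] ≫ inclH fin = doubleOne fin := by
  rw [inclH, doubleOne, MonoidalCategory.tensorHom_def']
  monoidal

omit [Transparent H] [IsIso (HopfObj.antipode (X := H))] in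
theorem one_inclB : dualOne fin ≫ inclB fin = doubleOne fin := by
  rw [inclB, doubleOne, MonoidalCategory.tensorHom_def]
  monoidal

variable {fin} {M N : C}

/-- A Yetter-Drinfeld module is a module over the double. -/
theorem IsLeftYD.double {a : H ⊗ M ⟶ M} {c : M ⟶ H ⊗ M} (h : IsLeftYD a c) :
    doubleOne fin ▷ M ≫ smashAct a (dualAction fin.dual c) = (λ_ M).hom ∧
      doubleMul fin ▷ M ≫ smashAct a (dualAction fin.dual c) =
        (α_ _ _ _).hom ≫ double fin ◁ smashAct a (dualAction fin.dual c) ≫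
          smashAct a (dualAction fin.dual c) := by
  obtain ⟨⟨h₁, h₂⟩, ⟨h₃, h₄⟩, h₅⟩ := (isLeftYD_iff (B := fin.dual) a c).1 h
  rw [doubleMul_eq, dualMul_eq]
  refine ⟨smashAct_one h₁ ?_, smashAct_mul h₂ h₄ h₅⟩
  rw [dualOne_eq, h₃]

/-- A module over the double comes from a Yetter-Drinfeld module. -/
theorem isLeftYD_of_double {d : double fin ⊗ M ⟶ M} (h₁ : doubleOne fin ▷ M ≫ d = (λ_ M).hom)
    (h₂ : doubleMul fin ▷ M ≫ d = (α_ _ _ _).hom ≫ double fin ◁ d ≫ d) :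
    IsLeftYD (inclH fin ▷ M ≫ d) (coactionOf H (inclB fin ▷ M ≫ d)) ∧
      smashAct (inclH fin ▷ M ≫ d) (inclB fin ▷ M ≫ d) = d := by
  have e : smashAct (inclH fin ▷ M ≫ d) (inclB fin ▷ M ≫ d) = d := by
    rw [smashAct, act_act (inclB fin) (inclH fin) h₂, inclB_inclH_mul, id_whiskerRight,
      Category.id_comp, Iso.hom_inv_id_assoc]
  refine ⟨?_, e⟩
  rw [isLeftYD_iff (B := fin.dual), dualAction_coactionOf]
  refine ⟨⟨?_, ?_⟩, ⟨?_, ?_⟩, ?_⟩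
  · rw [← comp_whiskerRight_assoc, one_inclH, h₁]
  · rw [act_act (inclH fin) (inclH fin) h₂, inclH_mul]; simp
  · rw [← dualOne_eq, ← comp_whiskerRight_assoc, one_inclB, h₁]
  · rw [act_act (inclB fin) (inclB fin) h₂, inclB_mul, dualMul_eq]; simp
  · rw [act_act (inclH fin) (inclB fin) h₂, inclH_inclB_mul]
    conv_lhs => rw [← e]
    simp only [tailed, smashAct, Category.assoc]

omit [Transparent H] [IsIso (HopfObj.antipode (X := H))] in
theorem inclH_smashAct {a : H ⊗ M ⟶ M} {b : fin.dual ⊗ M ⟶ M}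
    (h : dualOne fin ▷ M ≫ b = (λ_ M).hom) : inclH fin ▷ M ≫ smashAct a b = a := by
  calc
    _ = 𝟙 _ ⊗≫ (dualOne fin ▷ (H ⊗ M) ≫ fin.dual ◁ a) ≫ b := by
      simp only [inclH, smashAct]; monoidal
    _ = 𝟙 _ ⊗≫ a ⊗≫ dualOne fin ▷ M ≫ b := by rw [← whisker_exchange]; monoidal
    _ = _ := by rw [h]; monoidal

omit [Transparent H] [IsIso (HopfObj.antipode (X := H))] in
theorem inclB_smashAct {a : H ⊗ M ⟶ M} {b : fin.dual ⊗ M ⟶ M}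
    (h : η[H] ▷ M ≫ a = (λ_ M).hom) : inclB fin ▷ M ≫ smashAct a b = b := by
  calc
    _ = 𝟙 _ ⊗≫ fin.dual ◁ (η[H] ▷ M ≫ a) ≫ b := by
      simp only [inclB, smashAct]; monoidal
    _ = _ := by rw [h]; monoidal

/-- The tensor product of Yetter-Drinfeld modules corresponds to the tensor product of modules over
the double. -/
theorem tensorAct_double {aM : H ⊗ M ⟶ M} {cM : M ⟶ H ⊗ M} {aN : H ⊗ N ⟶ N} {cN : N ⟶ H ⊗ N} :
    tensorAct (doubleComul fin) (smashAct aM (dualAction fin.dual cM))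
        (smashAct aN (dualAction fin.dual cN)) =
      smashAct (tensorAct Δ[H] aM aN) (dualAction fin.dual (tensorCoact μ[H] cM cN)) := by
  rw [doubleComul, tensorAct_smashAct, dualAction_tensorCoact, dualComul_eq]

end DoubleMonoid

/-! ### The bialgebra structure of the double -/

section DoubleBimonoid

variable {C : Type u} [Category.{v} C] [MonoidalCategory C] [BraidedCategory C]
variable {H : C} [HopfObj H] (fin : FiniteObj H)

theorem pair_ins_one (Z : C) : pair fin.dual (ins η[H] Z) = del (dualCounit fin) Z := by
  change fin.dual ◁ ins η[H] Z ≫ cap fin.ev Z = _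
  simp only [dualCounit, ins, cap, del]
  monoidal

variable [Transparent H]

theorem split_dualComul_counit_left (Z : C) :
    split (dualComul fin) Z ≫ del (dualCounit fin) (fin.dual ⊗ Z) = 𝟙 _ := by
  refine ext_pair (H := H) fun W G => ?_
  rw [Category.assoc, del_nat, ← pair_ins_one, dualComul_eq, convComul_pair, fuse_one_right,
    Category.comp_id, Category.id_comp]

theorem split_dualComul_counit_right (Z : C) :
    split (dualComul fin) Z ≫ fin.dual ◁ del (dualCounit fin) Z = 𝟙 _ := by
  refine ext_pair (H := H) fun W G => ?_
  rw [Category.assoc, ← pair_ins_one, dualComul_eq, convComul_pair,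
    reassoc_of% (ins_nat η[H] G), fuse_one_left, Category.comp_id, Category.id_comp]

theorem split_dualComul_coassoc (Z : C) :
    split (dualComul fin) Z ≫ split (dualComul fin) (fin.dual ⊗ Z) =
      split (dualComul fin) Z ≫ fin.dual ◁ split (dualComul fin) Z := by
  have key {Z₁ Z₂ W : C} (G₁ : Z ⟶ H ⊗ Z₁) (G₂ : Z₁ ⟶ H ⊗ Z₂) (G₃ : Z₂ ⟶ H ⊗ W) :
      (split (dualComul fin) Z ≫ split (dualComul fin) (fin.dual ⊗ Z)) ≫
        fin.dual ◁ fin.dual ◁ pair fin.dual G₁ ≫ fin.dual ◁ pair fin.dual G₂ ≫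
          pair fin.dual G₃ =
      (split (dualComul fin) Z ≫ fin.dual ◁ split (dualComul fin) Z) ≫
        fin.dual ◁ fin.dual ◁ pair fin.dual G₁ ≫ fin.dual ◁ pair fin.dual G₂ ≫
          pair fin.dual G₃ := by
    simp only [dualComul_eq, Category.assoc]
    rw [reassoc_of% (split_nat (convComul H fin.dual) (pair fin.dual G₁)), convComul_pair,
      convComul_pair, reassoc_of% (whisk31 fin.dual (convComul_pair (B := fin.dual) G₁ G₂)),
      convComul_pair]
    simp only [MonoidalCategory.whiskerLeft_comp, Category.assoc]
    rw [fuse_assoc, reassoc_of% (fuse_nat μ[H] G₃)]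
  have e (Z : C) : pair fin.dual (coevT H fin.dual Z) = 𝟙 _ := by
    have h := pair_unpair (H := H) (𝟙 (fin.dual ⊗ Z))
    rwa [unpair, MonoidalCategory.whiskerLeft_id, Category.comp_id] at h
  have h := key (coevT H fin.dual Z) (coevT H fin.dual (fin.dual ⊗ Z))
    (coevT H fin.dual (fin.dual ⊗ fin.dual ⊗ Z))
  simpa only [e, MonoidalCategory.whiskerLeft_id, Category.comp_id] using h

/-- The coalgebra structure of the dual of `H`. -/
@[reducible]
noncomputable def dualComonObj : ComonObj fin.dual where
  comul := dualComul fin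
  counit := dualCounit fin
  counit_comul := by
    have h := split_dualComul_counit_left fin (𝟙_ C)
    calc
      _ = 𝟙 _ ⊗≫ (split (dualComul fin) (𝟙_ C) ≫ del (dualCounit fin) (fin.dual ⊗ 𝟙_ C)) ⊗≫
            𝟙 _ := by
        simp only [split, del]; monoidal
      _ = _ := by rw [h]; monoidal
  comul_counit := by
    have h := split_dualComul_counit_right fin (𝟙_ C)
    calc
      _ = 𝟙 _ ⊗≫ (split (dualComul fin) (𝟙_ C) ≫ fin.dual ◁ del (dualCounit fin) (𝟙_ C)) ⊗≫
            𝟙 _ := by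
        simp only [split, del]; monoidal
      _ = _ := by rw [h]; monoidal
  comul_assoc := by
    have h := split_dualComul_coassoc fin (𝟙_ C)
    calc
      _ = 𝟙 _ ⊗≫ (split (dualComul fin) (𝟙_ C) ≫ fin.dual ◁ split (dualComul fin) (𝟙_ C)) ⊗≫
            𝟙 _ := by
        simp only [split]; monoidal
      _ = _ := by rw [← h]; simp only [split]; monoidal

/-- The coalgebra structure of the double. -/
@[reducible]
noncomputable def doubleComonObj : ComonObj (double fin) where
  comul := doubleComul fin
  counit := doubleCounit fin
  counit_comul := by
    let := dualComonObj fin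
    have h := ComonObj.counit_comul (fin.dual ⊗ H)
    rwa [Comon.tensorObj_comul, Comon.tensorObj_counit] at h
  comul_counit := by
    let := dualComonObj fin
    have h := ComonObj.comul_counit (fin.dual ⊗ H)
    rwa [Comon.tensorObj_comul, Comon.tensorObj_counit] at h
  comul_assoc := by
    let := dualComonObj fin
    have h := ComonObj.comul_assoc (fin.dual ⊗ H)
    rwa [Comon.tensorObj_comul] at h

variable [IsIso (HopfObj.antipode (X := H))]

/-- The diagonal action on a tensor product of modules over the double is an action, because it
comes from a tensor product of Yetter-Drinfeld modules. -/
theorem tensorAct_doubleComul {M N : C} {dM : double fin ⊗ M ⟶ M} {dN : double fin ⊗ N ⟶ N}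
    (hM₁ : doubleOne fin ▷ M ≫ dM = (λ_ M).hom)
    (hM₂ : doubleMul fin ▷ M ≫ dM = (α_ _ _ _).hom ≫ double fin ◁ dM ≫ dM)
    (hN₁ : doubleOne fin ▷ N ≫ dN = (λ_ N).hom)
    (hN₂ : doubleMul fin ▷ N ≫ dN = (α_ _ _ _).hom ≫ double fin ◁ dN ≫ dN) :
    doubleOne fin ▷ (M ⊗ N) ≫ tensorAct (doubleComul fin) dM dN = (λ_ _).hom ∧
      doubleMul fin ▷ (M ⊗ N) ≫ tensorAct (doubleComul fin) dM dN =
        (α_ _ _ _).hom ≫ double fin ◁ tensorAct (doubleComul fin) dM dN ≫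
          tensorAct (doubleComul fin) dM dN := by
  obtain ⟨hM, eM⟩ := isLeftYD_of_double hM₁ hM₂
  obtain ⟨hN, eN⟩ := isLeftYD_of_double hN₁ hN₂
  have h := (hM.tensor hN).double (fin := fin)
  rwa [← tensorAct_double, dualAction_coactionOf, dualAction_coactionOf, eM, eN] at h

omit [Transparent H] in
theorem smashAct_unit :
    smashAct ((ρ_ H).hom ≫ ε[H]) (dualAction fin.dual (η[H] ≫ (ρ_ H).inv)) =
      (ρ_ (double fin)).hom ≫ doubleCounit fin := by
  have h : (η[H] ≫ (ρ_ H).inv) ≫ antipodeInv H ▷ 𝟙_ C = ins η[H] (𝟙_ C) := by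
    have := ins_antipodeInv (H := H) (𝟙_ C)
    rw [← this, ins]
    monoidal
  rw [dualAction, h, pair_ins_one, smashAct, doubleCounit, MonoidalCategory.tensorHom_def', del]
  monoidal

/-- The counit of the double is multiplicative, because it is the action on the trivial
Yetter-Drinfeld module. -/
theorem doubleMul_doubleCounit : doubleMul fin ≫ doubleCounit fin =
    (doubleCounit fin ⊗ₘ doubleCounit fin) ≫ (λ_ (𝟙_ C)).hom := by
  have h := (isLeftYD_unit (H := H)).double (fin := fin) |>.2
  rw [smashAct_unit] at h
  calc
    _ = 𝟙 _ ⊗≫ (doubleMul fin ▷ 𝟙_ C ≫ (ρ_ (double fin)).hom ≫ doubleCounit fin) := by monoidal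
    _ = _ := by rw [h, MonoidalCategory.tensorHom_def']; monoidal

theorem doubleOne_doubleCounit : doubleOne fin ≫ doubleCounit fin = 𝟙 _ := by
  have h := (isLeftYD_unit (H := H)).double (fin := fin) |>.1
  rw [smashAct_unit] at h
  calc
    _ = 𝟙 _ ⊗≫ (doubleOne fin ▷ 𝟙_ C ≫ (ρ_ (double fin)).hom ≫ doubleCounit fin) := by monoidal
    _ = _ := by rw [h]; monoidal

/-- The diagonal action on `D ⊗ D`, evaluated at `1 ⊗ 1`, is the coproduct. -/
theorem tensorAct_doubleMul_one :
    double fin ◁ ((λ_ (𝟙_ C)).inv ≫ (doubleOne fin ⊗ₘ doubleOne fin)) ≫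
      tensorAct (doubleComul fin) (doubleMul fin) (doubleMul fin) =
      (ρ_ _).hom ≫ doubleComul fin := by
  have h : double fin ◁ doubleOne fin ≫ doubleMul fin = (ρ_ _).hom :=
    (doubleMonObj fin).mul_one
  rw [tensorAct, reassoc_of% (whisker_exchange (doubleComul fin)),
    MonoidalCategory.whiskerLeft_comp, Category.assoc, tensorμ_natural_right_assoc,
    tensorHom_comp_tensorHom, h, ← tensor_right_unitality, rightUnitor_naturality]

/-- The coproduct of the double is multiplicative, because the tensor square of the regular module
is a module and its action at `1 ⊗ 1` is the coproduct. -/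
theorem doubleMul_doubleComul : doubleMul fin ≫ doubleComul fin =
    (doubleComul fin ⊗ₘ doubleComul fin) ≫ tensorμ _ _ _ _ ≫
      (doubleMul fin ⊗ₘ doubleMul fin) := by
  have h₁ : doubleOne fin ▷ double fin ≫ doubleMul fin = (λ_ _).hom := (doubleMonObj fin).one_mul
  have h₂ := (doubleMonObj fin).mul_assoc
  have h := (tensorAct_doubleComul fin h₁ h₂ h₁ h₂).2
  have e := tensorAct_doubleMul_one fin
  calc
    _ = (ρ_ _).inv ≫ doubleMul fin ▷ 𝟙_ C ≫ (ρ_ _).hom ≫ doubleComul fin := by monoidal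
    _ = (ρ_ _).inv ≫ (double fin ⊗ double fin) ◁ ((λ_ (𝟙_ C)).inv ≫
          (doubleOne fin ⊗ₘ doubleOne fin)) ≫ doubleMul fin ▷ _ ≫
            tensorAct (doubleComul fin) (doubleMul fin) (doubleMul fin) := by
      rw [← e, reassoc_of% (whisker_exchange (doubleMul fin))]
    _ = 𝟙 _ ⊗≫ double fin ◁ (double fin ◁ ((λ_ (𝟙_ C)).inv ≫
          (doubleOne fin ⊗ₘ doubleOne fin)) ≫
            tensorAct (doubleComul fin) (doubleMul fin) (doubleMul fin)) ⊗≫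
              tensorAct (doubleComul fin) (doubleMul fin) (doubleMul fin) := by
      rw [h]; monoidal
    _ = _ := by rw [e, MonoidalCategory.tensorHom_def' (doubleComul fin), tensorAct]; monoidal

theorem doubleOne_doubleComul : doubleOne fin ≫ doubleComul fin =
    (λ_ (𝟙_ C)).inv ≫ (doubleOne fin ⊗ₘ doubleOne fin) := by
  have h₁ : doubleOne fin ▷ double fin ≫ doubleMul fin = (λ_ _).hom := (doubleMonObj fin).one_mul
  have h₂ := (doubleMonObj fin).mul_assoc
  have h := (tensorAct_doubleComul fin h₁ h₂ h₁ h₂).1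
  have e := tensorAct_doubleMul_one fin
  calc
    _ = (ρ_ _).inv ≫ doubleOne fin ▷ 𝟙_ C ≫ (ρ_ _).hom ≫ doubleComul fin := by monoidal
    _ = (ρ_ _).inv ≫ 𝟙_ C ◁ ((λ_ (𝟙_ C)).inv ≫
          (doubleOne fin ⊗ₘ doubleOne fin)) ≫ doubleOne fin ▷ _ ≫
            tensorAct (doubleComul fin) (doubleMul fin) (doubleMul fin) := by
      rw [← e, reassoc_of% (whisker_exchange (doubleOne fin))]
    _ = _ := by rw [h]; monoidal

/-- The bialgebra structure of the Drinfeld double. -/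
@[reducible]
noncomputable def doubleBimonObj : BimonObj (double fin) where
  toMonObj := doubleMonObj fin
  toComonObj := doubleComonObj fin
  mul_comul := doubleMul_doubleComul fin
  one_comul := doubleOne_doubleComul fin
  mul_counit := doubleMul_doubleCounit fin
  one_counit := doubleOne_doubleCounit fin

end DoubleBimonoid

/-! ### Braidings of Yetter-Drinfeld modules with modules -/

section Braiding

variable {C : Type u} [Category.{v} C] [MonoidalCategory C] [BraidedCategory C]
variable {H : C} {X X' Y N P : C}

/-- The morphism `x ⊗ n ↦ x₋₁ n ⊗ x₀`. -/
def braidMap (c : X ⟶ H ⊗ X) (a : H ⊗ N ⟶ N) : X ⊗ N ⟶ N ⊗ X :=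
  c ▷ N ≫ (α_ H X N).hom ≫ H ◁ (β_ X N).hom ≫ (α_ H N X).inv ≫ a ▷ X

theorem braidMap_natural_left {c : X ⟶ H ⊗ X} {c' : X' ⟶ H ⊗ X'} {f : X ⟶ X'}
    (h : c ≫ H ◁ f = f ≫ c') (a : H ⊗ N ⟶ N) :
    f ▷ N ≫ braidMap c' a = braidMap c a ≫ N ◁ f := by
  simp only [braidMap]
  calc
    _ = (f ≫ c') ▷ N ≫ (α_ H X' N).hom ≫ H ◁ (β_ X' N).hom ≫ (α_ H N X').inv ≫ a ▷ X' := by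
      monoidal
    _ = c ▷ N ⊗≫ H ◁ (f ▷ N ≫ (β_ X' N).hom) ⊗≫ a ▷ X' := by rw [← h]; monoidal
    _ = c ▷ N ⊗≫ H ◁ (β_ X N).hom ⊗≫ ((H ⊗ N) ◁ f ≫ a ▷ X') := by
      rw [braiding_naturality_left]; monoidal
    _ = _ := by rw [whisker_exchange]; monoidal

theorem braidMap_natural_right (c : X ⟶ H ⊗ X) {a : H ⊗ N ⟶ N} {a' : H ⊗ P ⟶ P} {g : N ⟶ P}
    (h : a ≫ g = H ◁ g ≫ a') : X ◁ g ≫ braidMap c a' = braidMap c a ≫ g ▷ X := by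
  simp only [braidMap]
  calc
    _ = (X ◁ g ≫ c ▷ P) ≫ (α_ H X P).hom ≫ H ◁ (β_ X P).hom ≫ (α_ H P X).inv ≫ a' ▷ X := by
      monoidal
    _ = c ▷ N ⊗≫ H ◁ (X ◁ g ≫ (β_ X P).hom) ⊗≫ a' ▷ X := by rw [whisker_exchange]; monoidal
    _ = c ▷ N ⊗≫ H ◁ (β_ X N).hom ⊗≫ (H ◁ g ≫ a') ▷ X := by
      rw [braiding_naturality_right]; monoidal
    _ = _ := by rw [← h]; monoidal

theorem braidMap_tensor_right [BimonObj H] {c : X ⟶ H ⊗ X} (aN : H ⊗ N ⟶ N) (aP : H ⊗ P ⟶ P)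
    (h : c ≫ Δ[H] ▷ X = c ≫ H ◁ c ≫ (α_ H H X).inv) :
    braidMap c (tensorAct Δ[H] aN aP) = (α_ X N P).inv ≫ braidMap c aN ▷ P ≫ (α_ N X P).hom ≫
      N ◁ braidMap c aP ≫ (α_ N P X).inv := by
  calc
    _ = c ▷ (N ⊗ P) ⊗≫ (H ◁ ((β_ X N).hom ▷ P ⊗≫ N ◁ (β_ X P).hom) ≫ Δ[H] ▷ (N ⊗ P ⊗ X)) ⊗≫
          H ◁ (β_ H N).hom ▷ (P ⊗ X) ⊗≫ aN ▷ (H ⊗ P ⊗ X) ⊗≫ N ◁ aP ▷ X ⊗≫ 𝟙 _ := by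
      simp only [braidMap, tensorAct, tensorμ, MonoidalCategory.tensorHom_def,
        braiding_tensor_right_hom]
      monoidal
    _ = (c ≫ Δ[H] ▷ X) ▷ (N ⊗ P) ⊗≫ H ◁ H ◁ (β_ X N).hom ▷ P ⊗≫
          H ◁ ((H ⊗ N) ◁ (β_ X P).hom ≫ (β_ H N).hom ▷ (P ⊗ X)) ⊗≫
            aN ▷ (H ⊗ P ⊗ X) ⊗≫ N ◁ aP ▷ X ⊗≫ 𝟙 _ := by
      rw [whisker_exchange]; monoidal
    _ = (c ≫ H ◁ c ≫ (α_ H H X).inv) ▷ (N ⊗ P) ⊗≫ H ◁ H ◁ (β_ X N).hom ▷ P ⊗≫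
          H ◁ (β_ H N).hom ▷ (X ⊗ P) ⊗≫ ((H ⊗ N) ◁ (H ◁ (β_ X P).hom) ≫
            aN ▷ (H ⊗ P ⊗ X)) ⊗≫ N ◁ aP ▷ X ⊗≫ 𝟙 _ := by
      rw [h, whisker_exchange (β_ H N).hom]; monoidal
    _ = c ▷ (N ⊗ P) ⊗≫ H ◁ (c ▷ N ≫ (β_ (H ⊗ X) N).hom) ▷ P ⊗≫ aN ▷ (H ⊗ X ⊗ P) ⊗≫
          N ◁ H ◁ (β_ X P).hom ⊗≫ N ◁ aP ▷ X ⊗≫ 𝟙 _ := by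
      rw [whisker_exchange aN, braiding_tensor_left_hom]; monoidal
    _ = c ▷ (N ⊗ P) ⊗≫ H ◁ (β_ X N).hom ▷ P ⊗≫ ((H ⊗ N) ◁ (c ▷ P) ≫
          aN ▷ ((H ⊗ X) ⊗ P)) ⊗≫ N ◁ H ◁ (β_ X P).hom ⊗≫ N ◁ aP ▷ X ⊗≫ 𝟙 _ := by
      rw [braiding_naturality_left]; monoidal
    _ = _ := by rw [whisker_exchange]; simp only [braidMap]; monoidal

theorem braidMap_tensor_left [BimonObj H] (cX : X ⟶ H ⊗ X) (cY : Y ⟶ H ⊗ Y) {a : H ⊗ N ⟶ N}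
    (h : μ[H] ▷ N ≫ a = (α_ H H N).hom ≫ H ◁ a ≫ a) :
    braidMap (tensorCoact μ[H] cX cY) a = (α_ X Y N).hom ≫ X ◁ braidMap cY a ≫
      (α_ X N Y).inv ≫ braidMap cX a ▷ Y ≫ (α_ N X Y).hom := by
  calc
    _ = 𝟙 _ ⊗≫ X ◁ cY ▷ N ⊗≫ cX ▷ (H ⊗ Y ⊗ N) ⊗≫ H ◁ (β_ X H).hom ▷ (Y ⊗ N) ⊗≫
          (μ[H] ▷ (X ⊗ Y ⊗ N) ≫ H ◁ (X ◁ (β_ Y N).hom ⊗≫ (β_ X N).hom ▷ Y)) ⊗≫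
            a ▷ (X ⊗ Y) := by
      simp only [braidMap, tensorCoact, tensorμ, MonoidalCategory.tensorHom_def',
        braiding_tensor_left_hom]
      monoidal
    _ = 𝟙 _ ⊗≫ X ◁ cY ▷ N ⊗≫ cX ▷ (H ⊗ Y ⊗ N) ⊗≫ H ◁ ((β_ X H).hom ▷ (Y ⊗ N) ≫
          (H ⊗ X) ◁ (β_ Y N).hom) ⊗≫ H ◁ H ◁ (β_ X N).hom ▷ Y ⊗≫
            (μ[H] ▷ N ≫ a) ▷ (X ⊗ Y) := by
      rw [← whisker_exchange]; monoidal
    _ = 𝟙 _ ⊗≫ X ◁ cY ▷ N ⊗≫ (cX ▷ (H ⊗ Y ⊗ N) ≫ (H ⊗ X) ◁ (H ◁ (β_ Y N).hom)) ⊗≫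
          H ◁ ((β_ X (H ⊗ N)).hom ≫ a ▷ X) ▷ Y ⊗≫ a ▷ (X ⊗ Y) := by
      rw [← whisker_exchange (β_ X H).hom, h, braiding_tensor_right_hom]; monoidal
    _ = 𝟙 _ ⊗≫ X ◁ (cY ▷ N ⊗≫ H ◁ (β_ Y N).hom) ⊗≫ (cX ▷ ((H ⊗ N) ⊗ Y) ≫
          (H ⊗ X) ◁ (a ▷ Y)) ⊗≫ H ◁ (β_ X N).hom ▷ Y ⊗≫ a ▷ (X ⊗ Y) := by
      rw [← whisker_exchange cX, ← braiding_naturality_right]; monoidal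
    _ = _ := by rw [← whisker_exchange]; simp only [braidMap]; monoidal

theorem braidMap_unit_left [BimonObj H] {a : H ⊗ N ⟶ N} (h : η[H] ▷ N ≫ a = (λ_ N).hom) :
    braidMap (η[H] ≫ (ρ_ H).inv) a = (λ_ N).hom ≫ (ρ_ N).inv := by
  simp only [braidMap, braiding_tensorUnit_left]
  calc
    _ = 𝟙 _ ⊗≫ (η[H] ▷ N ≫ a) ⊗≫ 𝟙 _ := by monoidal
    _ = _ := by rw [h]; monoidal

/-- The morphism `x ⊗ n ↦ x₋₁ n ⊗ x₀` is linear if `X` is a Yetter-Drinfeld module. -/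
theorem braidMap_linear [BimonObj H] {aX : H ⊗ X ⟶ X} {c : X ⟶ H ⊗ X} {a : H ⊗ N ⟶ N}
    (hX : ydL Δ[H] μ[H] aX c = ydR Δ[H] μ[H] aX c)
    (h : μ[H] ▷ N ≫ a = (α_ H H N).hom ≫ H ◁ a ≫ a) :
    tensorAct Δ[H] aX a ≫ braidMap c a = H ◁ braidMap c a ≫ tensorAct Δ[H] a aX := by
  have h₁ : tensorAct Δ[H] aX a ≫ braidMap c a = 𝟙 _ ⊗≫ ydL Δ[H] μ[H] aX c ▷ N ⊗≫
      H ◁ (β_ X N).hom ⊗≫ a ▷ X := by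
    have h' : H ◁ a ≫ a = (α_ H H N).inv ≫ μ[H] ▷ N ≫ a := by rw [h, Iso.inv_hom_id_assoc]
    calc
      _ = 𝟙 _ ⊗≫ Δ[H] ▷ (X ⊗ N) ⊗≫ H ◁ (β_ H X).hom ▷ N ⊗≫ aX ▷ (H ⊗ N) ⊗≫
            (X ◁ a ≫ c ▷ N) ⊗≫ H ◁ (β_ X N).hom ⊗≫ a ▷ X := by
        simp only [braidMap, tensorAct, tensorμ, MonoidalCategory.tensorHom_def]
        monoidal
      _ = 𝟙 _ ⊗≫ Δ[H] ▷ (X ⊗ N) ⊗≫ H ◁ (β_ H X).hom ▷ N ⊗≫ aX ▷ (H ⊗ N) ⊗≫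
            c ▷ (H ⊗ N) ⊗≫ H ◁ (X ◁ a ≫ (β_ X N).hom) ⊗≫ a ▷ X := by
        rw [whisker_exchange]; monoidal
      _ = 𝟙 _ ⊗≫ Δ[H] ▷ (X ⊗ N) ⊗≫ H ◁ (β_ H X).hom ▷ N ⊗≫ aX ▷ (H ⊗ N) ⊗≫
            c ▷ (H ⊗ N) ⊗≫ H ◁ (β_ X H).hom ▷ N ⊗≫ H ◁ H ◁ (β_ X N).hom ⊗≫
              (H ◁ a ≫ a) ▷ X := by
        rw [braiding_naturality_right, braiding_tensor_right_hom]; monoidal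
      _ = 𝟙 _ ⊗≫ Δ[H] ▷ (X ⊗ N) ⊗≫ H ◁ (β_ H X).hom ▷ N ⊗≫ aX ▷ (H ⊗ N) ⊗≫
            c ▷ (H ⊗ N) ⊗≫ H ◁ (β_ X H).hom ▷ N ⊗≫ ((H ⊗ H) ◁ (β_ X N).hom ≫
              μ[H] ▷ (N ⊗ X)) ⊗≫ a ▷ X := by
        rw [h']; monoidal
      _ = _ := by rw [whisker_exchange, ydL]; monoidal
  have h₂ : H ◁ braidMap c a ≫ tensorAct Δ[H] a aX = 𝟙 _ ⊗≫ ydR Δ[H] μ[H] aX c ▷ N ⊗≫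
      H ◁ (β_ X N).hom ⊗≫ a ▷ X := by
    have h' : H ◁ a ≫ a = (α_ H H N).inv ≫ μ[H] ▷ N ≫ a := by rw [h, Iso.inv_hom_id_assoc]
    calc
      _ = 𝟙 _ ⊗≫ (H ◁ braidMap c a ≫ Δ[H] ▷ (N ⊗ X)) ⊗≫ H ◁ (β_ H N).hom ▷ X ⊗≫
            a ▷ (H ⊗ X) ⊗≫ N ◁ aX := by
        simp only [tensorAct, tensorμ, MonoidalCategory.tensorHom_def]
        monoidal
      _ = 𝟙 _ ⊗≫ Δ[H] ▷ (X ⊗ N) ⊗≫ H ◁ H ◁ (c ▷ N ⊗≫ H ◁ (β_ X N).hom) ⊗≫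
            H ◁ (H ◁ a ≫ (β_ H N).hom) ▷ X ⊗≫ a ▷ (H ⊗ X) ⊗≫ N ◁ aX := by
        rw [whisker_exchange]; simp only [braidMap]; monoidal
      _ = 𝟙 _ ⊗≫ Δ[H] ▷ (X ⊗ N) ⊗≫ H ◁ H ◁ c ▷ N ⊗≫ H ◁ ((H ⊗ H) ◁ (β_ X N).hom ≫
            (β_ H H).hom ▷ (N ⊗ X)) ⊗≫ H ◁ H ◁ (β_ H N).hom ▷ X ⊗≫
              (H ◁ a ≫ a) ▷ (H ⊗ X) ⊗≫ N ◁ aX := by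
        rw [braiding_naturality_right, braiding_tensor_right_hom]; monoidal
      _ = 𝟙 _ ⊗≫ Δ[H] ▷ (X ⊗ N) ⊗≫ H ◁ H ◁ c ▷ N ⊗≫ H ◁ (β_ H H).hom ▷ (X ⊗ N) ⊗≫
            ((H ⊗ H) ◁ (H ◁ (β_ X N).hom ⊗≫ (β_ H N).hom ▷ X) ≫ μ[H] ▷ ((N ⊗ H) ⊗ X)) ⊗≫
              (a ▷ (H ⊗ X) ≫ N ◁ aX) := by
        rw [whisker_exchange (β_ H H).hom, h']; monoidal
      _ = 𝟙 _ ⊗≫ Δ[H] ▷ (X ⊗ N) ⊗≫ H ◁ H ◁ c ▷ N ⊗≫ H ◁ (β_ H H).hom ▷ (X ⊗ N) ⊗≫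
            μ[H] ▷ (H ⊗ X ⊗ N) ⊗≫ H ◁ ((β_ (H ⊗ X) N).hom ≫ N ◁ aX) ⊗≫ a ▷ X := by
        rw [whisker_exchange μ[H], ← whisker_exchange a, braiding_tensor_left_hom]; monoidal
      _ = _ := by
        rw [← braiding_naturality_left, ydR, tensorμ, MonoidalCategory.tensorHom_def,
          MonoidalCategory.tensorHom_def]
        monoidal
  rw [h₁, h₂, hX]

/-- The morphism `x ⊗ y ↦ x₋₁ y ⊗ x₀` is colinear if `Y` is a Yetter-Drinfeld module. -/
theorem braidMap_colinear [BimonObj H] {c : X ⟶ H ⊗ X} {aY : H ⊗ Y ⟶ Y} {cY : Y ⟶ H ⊗ Y}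
    (hY : ydL Δ[H] μ[H] aY cY = ydR Δ[H] μ[H] aY cY)
    (h : c ≫ Δ[H] ▷ X = c ≫ H ◁ c ≫ (α_ H H X).inv) :
    tensorCoact μ[H] c cY ≫ H ◁ braidMap c aY = braidMap c aY ≫ tensorCoact μ[H] cY c := by
  have h₁ : braidMap c aY ≫ tensorCoact μ[H] cY c = c ▷ Y ⊗≫ H ◁ (β_ X Y).hom ⊗≫
      ydL Δ[H] μ[H] aY cY ▷ X ⊗≫ 𝟙 _ := by
    calc
      _ = c ▷ Y ⊗≫ H ◁ (β_ X Y).hom ⊗≫ (aY ≫ cY) ▷ X ⊗≫ H ◁ Y ◁ c ⊗≫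
            H ◁ (β_ Y H).hom ▷ X ⊗≫ μ[H] ▷ (Y ⊗ X) := by
        simp only [braidMap, tensorCoact, tensorμ, MonoidalCategory.tensorHom_def]
        monoidal
      _ = c ▷ Y ⊗≫ H ◁ (β_ X Y).hom ⊗≫ ((aY ≫ cY) ▷ X ≫ (H ⊗ Y) ◁ c) ⊗≫
            H ◁ (β_ Y H).hom ▷ X ⊗≫ μ[H] ▷ (Y ⊗ X) := by monoidal
      _ = c ▷ Y ⊗≫ H ◁ ((β_ X Y).hom ≫ Y ◁ c) ⊗≫ (aY ≫ cY) ▷ (H ⊗ X) ⊗≫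
            H ◁ (β_ Y H).hom ▷ X ⊗≫ μ[H] ▷ (Y ⊗ X) := by
        rw [← whisker_exchange]; monoidal
      _ = (c ≫ H ◁ c ≫ (α_ H H X).inv) ▷ Y ⊗≫ H ◁ H ◁ (β_ X Y).hom ⊗≫
            H ◁ (β_ H Y).hom ▷ X ⊗≫ (aY ≫ cY) ▷ (H ⊗ X) ⊗≫
              H ◁ (β_ Y H).hom ▷ X ⊗≫ μ[H] ▷ (Y ⊗ X) := by
        rw [← braiding_naturality_left, braiding_tensor_left_hom]; monoidal
      _ = c ▷ Y ⊗≫ (Δ[H] ▷ (X ⊗ Y) ≫ (H ⊗ H) ◁ (β_ X Y).hom) ⊗≫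
            H ◁ (β_ H Y).hom ▷ X ⊗≫ (aY ≫ cY) ▷ (H ⊗ X) ⊗≫
              H ◁ (β_ Y H).hom ▷ X ⊗≫ μ[H] ▷ (Y ⊗ X) := by
        rw [← h]; monoidal
      _ = _ := by rw [← whisker_exchange, ydL]; monoidal
  have h₂ : tensorCoact μ[H] c cY ≫ H ◁ braidMap c aY = c ▷ Y ⊗≫ H ◁ (β_ X Y).hom ⊗≫
      ydR Δ[H] μ[H] aY cY ▷ X ⊗≫ 𝟙 _ := by
    calc
      _ = X ◁ cY ⊗≫ c ▷ (H ⊗ Y) ⊗≫ H ◁ (β_ X H).hom ▷ Y ⊗≫ (μ[H] ▷ (X ⊗ Y) ≫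
            H ◁ (c ▷ Y)) ⊗≫ H ◁ H ◁ (β_ X Y).hom ⊗≫ H ◁ aY ▷ X := by
        simp only [braidMap, tensorCoact, tensorμ, MonoidalCategory.tensorHom_def']
        monoidal
      _ = X ◁ cY ⊗≫ c ▷ (H ⊗ Y) ⊗≫ H ◁ ((β_ X H).hom ≫ H ◁ c) ▷ Y ⊗≫
            μ[H] ▷ ((H ⊗ X) ⊗ Y) ⊗≫ H ◁ H ◁ (β_ X Y).hom ⊗≫ H ◁ aY ▷ X := by
        rw [← whisker_exchange]; monoidal
      _ = (X ◁ cY ≫ (c ≫ H ◁ c ≫ (α_ H H X).inv) ▷ (H ⊗ Y)) ⊗≫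
            H ◁ H ◁ (β_ X H).hom ▷ Y ⊗≫ H ◁ (β_ H H).hom ▷ (X ⊗ Y) ⊗≫
            (μ[H] ▷ (H ⊗ X ⊗ Y) ≫ H ◁ H ◁ (β_ X Y).hom) ⊗≫ H ◁ aY ▷ X := by
        rw [← braiding_naturality_left, braiding_tensor_left_hom]; monoidal
      _ = c ▷ Y ⊗≫ Δ[H] ▷ (X ⊗ Y) ⊗≫ H ◁ H ◁ X ◁ cY ⊗≫ H ◁ H ◁ (β_ X H).hom ▷ Y ⊗≫
            H ◁ ((β_ H H).hom ▷ (X ⊗ Y) ≫ (H ⊗ H) ◁ (β_ X Y).hom) ⊗≫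
              μ[H] ▷ (H ⊗ Y ⊗ X) ⊗≫ H ◁ aY ▷ X := by
        rw [whisker_exchange, ← whisker_exchange μ[H], ← h]; monoidal
      _ = c ▷ Y ⊗≫ Δ[H] ▷ (X ⊗ Y) ⊗≫ H ◁ H ◁ (X ◁ cY ≫ (β_ X (H ⊗ Y)).hom) ⊗≫
            H ◁ (β_ H H).hom ▷ (Y ⊗ X) ⊗≫ μ[H] ▷ (H ⊗ Y ⊗ X) ⊗≫ H ◁ aY ▷ X := by
        rw [← whisker_exchange (β_ H H).hom, braiding_tensor_right_hom]; monoidal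
      _ = c ▷ Y ⊗≫ (Δ[H] ▷ (X ⊗ Y) ≫ (H ⊗ H) ◁ (β_ X Y).hom) ⊗≫ H ◁ H ◁ cY ▷ X ⊗≫
            H ◁ (β_ H H).hom ▷ (Y ⊗ X) ⊗≫ μ[H] ▷ (H ⊗ Y ⊗ X) ⊗≫ H ◁ aY ▷ X := by
        rw [braiding_naturality_right]; monoidal
      _ = _ := by
        rw [← whisker_exchange, ydR, tensorμ, MonoidalCategory.tensorHom_def,
          MonoidalCategory.tensorHom_def]
        monoidal
  rw [h₁, h₂, hY]

/-- A morphism compatible with the braidings with the regular module is colinear. -/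
theorem colinear_of_braidMap_mul [MonObj H] {c : X ⟶ H ⊗ X} {c' : X' ⟶ H ⊗ X'} {f : X ⟶ X'}
    (h : f ▷ H ≫ braidMap c' μ[H] = braidMap c μ[H] ≫ H ◁ f) : c ≫ H ◁ f = f ≫ c' := by
  have e {X : C} (c : X ⟶ H ⊗ X) : (ρ_ X).inv ≫ X ◁ η[H] ≫ braidMap c μ[H] = c := by
    simp only [braidMap]
    calc
      _ = 𝟙 _ ⊗≫ (X ◁ η[H] ≫ c ▷ H) ⊗≫ H ◁ (β_ X H).hom ⊗≫ μ[H] ▷ X := by monoidal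
      _ = 𝟙 _ ⊗≫ c ▷ 𝟙_ C ⊗≫ H ◁ (X ◁ η[H] ≫ (β_ X H).hom) ⊗≫ μ[H] ▷ X := by
        rw [whisker_exchange]; monoidal
      _ = c ⊗≫ (H ◁ η[H] ≫ μ[H]) ▷ X := by
        rw [braiding_naturality_right, braiding_tensorUnit_right]; monoidal
      _ = _ := by rw [MonObj.mul_one]; monoidal
  calc
    _ = (ρ_ X).inv ≫ X ◁ η[H] ≫ f ▷ H ≫ braidMap c' μ[H] := by rw [h, reassoc_of% (e c)]
    _ = f ≫ (ρ_ X').inv ≫ X' ◁ η[H] ≫ braidMap c' μ[H] := by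
      rw [reassoc_of% (whisker_exchange f), rightUnitor_inv_naturality_assoc]
    _ = _ := by rw [e]

variable [Transparent H]

/-- `x ⊗ n ↦ x₀ ⊗ x₋₁ n` -/
def tw (c : X ⟶ H ⊗ X) (a : H ⊗ N ⟶ N) : X ⊗ N ⟶ X ⊗ N :=
  split c N ≫ cross H X N ≫ X ◁ a

theorem braidMap_eq (c : X ⟶ H ⊗ X) (a : H ⊗ N ⟶ N) :
    braidMap c a = tw c a ≫ (β_ X N).hom := by
  have e : (β_ H X).hom ▷ N ≫ (β_ X H).hom ▷ N = 𝟙 _ := by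
    rw [← comp_whiskerRight, braiding_symm_left, id_whiskerRight]
  calc
    _ = c ▷ N ⊗≫ ((β_ H X).hom ▷ N ≫ (β_ X H).hom ▷ N) ⊗≫ H ◁ (β_ X N).hom ⊗≫ a ▷ X := by
      rw [e, braidMap]; monoidal
    _ = c ▷ N ⊗≫ (β_ H X).hom ▷ N ⊗≫ (β_ X (H ⊗ N)).hom ⊗≫ a ▷ X := by
      rw [braiding_tensor_right_hom]; monoidal
    _ = c ▷ N ⊗≫ (β_ H X).hom ▷ N ⊗≫ ((β_ X (H ⊗ N)).hom ≫ a ▷ X) := by monoidal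
    _ = _ := by rw [← braiding_naturality_right, tw, split, cross]; monoidal

theorem braidMap_eq' (c : X ⟶ H ⊗ X) (a : H ⊗ N ⟶ N) :
    braidMap c a = (β_ X N).hom ≫ N ◁ c ≫ cross N H X ≫ fuse a X := by
  have e : (β_ H N).hom ▷ X ≫ (β_ N H).hom ▷ X = 𝟙 _ := by
    rw [← comp_whiskerRight, braiding_symm_left, id_whiskerRight]
  rw [← braiding_naturality_left_assoc, braiding_tensor_left_hom]
  calc
    _ = c ▷ N ⊗≫ H ◁ (β_ X N).hom ⊗≫ ((β_ H N).hom ▷ X ≫ (β_ N H).hom ▷ X) ⊗≫ a ▷ X := by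
      rw [e, braidMap]; monoidal
    _ = _ := by rw [cross, fuse]; monoidal

end Braiding

section Inverse

variable {C : Type u} [Category.{v} C] [MonoidalCategory C] [BraidedCategory C]
variable {H B : C} [HopfObj H] [IsIso (HopfObj.antipode (X := H))] [Transparent H] {X N : C}

omit [IsIso (HopfObj.antipode (X := H))] [Transparent H] in
/-- The morphisms `x ⊗ n ↦ x₀ ⊗ T(x₋₁) n` and `x ⊗ n ↦ x₀ ⊗ T'(x₋₁) n` compose to the identity if
`T'(h₂) T(h₁) = ε(h)`. -/
theorem tw_tw (T T' : H ⟶ H) {c : X ⟶ H ⊗ X} {a : H ⊗ N ⟶ N}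
    (h₁ : c ≫ split Δ[H] X = c ≫ H ◁ c) (h₂ : c ≫ del ε[H] X = 𝟙 X)
    (h₃ : H ◁ a ≫ a = fuse μ[H] N ≫ a) (h₄ : ins η[H] N ≫ a = 𝟙 N)
    (hT : ∀ Z, split Δ[H] Z ≫ T ▷ (H ⊗ Z) ≫ cross H H Z ≫ T' ▷ (H ⊗ Z) ≫ fuse μ[H] Z =
      del ε[H] Z ≫ ins η[H] Z) :
    tw (c ≫ T ▷ X) a ≫ tw (c ≫ T' ▷ X) a = 𝟙 _ := by
  have e (T : H ⟶ H) : split (c ≫ T ▷ X) N = split c N ≫ T ▷ (X ⊗ N) := by simp [split]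
  have e₁ : split c N ≫ split Δ[H] (X ⊗ N) = split c N ≫ H ◁ split c N := by
    calc
      _ = (c ≫ split Δ[H] X) ▷ N ⊗≫ 𝟙 _ := by simp only [split]; monoidal
      _ = _ := by rw [h₁]; simp only [split]; monoidal
  have e₂ : split c N ≫ del ε[H] (X ⊗ N) = 𝟙 _ := by
    calc
      _ = (c ≫ del ε[H] X) ▷ N := by simp only [split, del]; monoidal
      _ = _ := by rw [h₂, id_whiskerRight]
  simp only [tw, e, Category.assoc]
  rw [← reassoc_of% (split_nat c a), reassoc_of% (whisker_exchange T' (X ◁ a)),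
    ← reassoc_of% (cross_nat (X := H) (Y := X) a), whisk22 X h₃,
    ← reassoc_of% (cross_split H c N), ← reassoc_of% (whisker_exchange T (split c N)),
    reassoc_of% (whisker_exchange T' (cross H X N)), ← reassoc_of% (fuse_cross X μ[H] N),
    ← reassoc_of% e₁, reassoc_of% (hT (X ⊗ N)), reassoc_of% e₂,
    reassoc_of% (ins_cross (X := H) X η[H] N), whisk20 X h₄]

theorem tw_tw_antipodeInv {c : X ⟶ H ⊗ X} {a : H ⊗ N ⟶ N}
    (h₁ : c ≫ split Δ[H] X = c ≫ H ◁ c) (h₂ : c ≫ del ε[H] X = 𝟙 X)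
    (h₃ : H ◁ a ≫ a = fuse μ[H] N ≫ a) (h₄ : ins η[H] N ≫ a = 𝟙 N) :
    tw c a ≫ tw (c ≫ antipodeInv H ▷ X) a = 𝟙 _ := by
  have h := tw_tw (𝟙 H) (antipodeInv H) h₁ h₂ h₃ h₄ fun Z => by
    rw [id_whiskerRight, Category.id_comp, split_antipodeInv_right]
  rwa [id_whiskerRight, Category.comp_id] at h

theorem tw_antipodeInv_tw {c : X ⟶ H ⊗ X} {a : H ⊗ N ⟶ N}
    (h₁ : c ≫ split Δ[H] X = c ≫ H ◁ c) (h₂ : c ≫ del ε[H] X = 𝟙 X)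
    (h₃ : H ◁ a ≫ a = fuse μ[H] N ≫ a) (h₄ : ins η[H] N ≫ a = 𝟙 N) :
    tw (c ≫ antipodeInv H ▷ X) a ≫ tw c a = 𝟙 _ := by
  have h := tw_tw (antipodeInv H) (𝟙 H) h₁ h₂ h₃ h₄ fun Z => by
    rw [id_whiskerRight, Category.id_comp, split_antipodeInv_left]
  rwa [id_whiskerRight, Category.comp_id] at h

/-- The braiding of a Yetter-Drinfeld module `X` with a module `N`. -/
noncomputable def braidIso {aX : H ⊗ X ⟶ X} {c : X ⟶ H ⊗ X} (hX : IsLeftYD aX c) {a : H ⊗ N ⟶ N}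
    (h₁ : η[H] ▷ N ≫ a = (λ_ N).hom) (h₂ : μ[H] ▷ N ≫ a = (α_ H H N).hom ≫ H ◁ a ≫ a) :
    X ⊗ N ≅ N ⊗ X where
  hom := braidMap c a
  inv := (β_ X N).inv ≫ tw (c ≫ antipodeInv H ▷ X) a
  hom_inv_id := by
    rw [braidMap_eq, Category.assoc, Iso.hom_inv_id_assoc]
    exact tw_tw_antipodeInv (split_coact_iff.2 hX.coassoc) (del_coact_iff.2 hX.counit)
      (fuse_act_iff.2 h₂) (ins_act_iff.2 h₁)
  inv_hom_id := by
    rw [braidMap_eq, Category.assoc, reassoc_of% (tw_antipodeInv_tw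
      (split_coact_iff.2 hX.coassoc) (del_coact_iff.2 hX.counit) (fuse_act_iff.2 h₂)
      (ins_act_iff.2 h₁)), Iso.inv_hom_id]

/-- The inverse of the braiding is the action of the universal R-matrix. -/
theorem twist_eq [ExactPairing H B] (c : X ⟶ H ⊗ X) (a : H ⊗ N ⟶ N) :
    coevT H B (N ⊗ X) ≫ H ◁ cross B N X ≫ H ◁ N ◁ dualAction B c ≫ fuse a X ≫ (β_ X N).inv =
      (β_ X N).inv ≫ tw (c ≫ antipodeInv H ▷ X) a := by
  have := transparent_of_exactPairing H B
  have e : N ◁ dualAction B c = cross N B X ≫ pair B (N ◁ (c ≫ antipodeInv H ▷ X) ≫ cross N H X) :=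
    whiskerLeft_pair N _
  have e' : coevT H B (N ⊗ X) ≫ H ◁ pair B (N ◁ (c ≫ antipodeInv H ▷ X) ≫ cross N H X) = _ :=
    unpair_pair _
  rw [← cancel_epi (β_ X N).hom, ← cancel_mono (β_ X N).hom]
  simp only [Category.assoc, Iso.hom_inv_id_assoc, Iso.inv_hom_id, Category.comp_id]
  rw [← braidMap_eq, braidMap_eq', e, ← MonoidalCategory.whiskerLeft_comp_assoc,
    reassoc_of% (cross_cross_left B N X), reassoc_of% e']

end Inverse

/-! ### Left Yetter-Drinfeld modules and the center -/

section FunctorEquality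

universe v₁ v₂ v₃ u₁ u₂ u₃

/-- Two functors that agree on objects are equal if they agree after composition with a faithful
functor. -/
theorem functor_eq_of_faithful {A : Type u₁} [Category.{v₁} A] {B : Type u₂} [Category.{v₂} B]
    {E : Type u₃} [Category.{v₃} E] (U : B ⥤ E) [U.Faithful] {F G : A ⥤ B}
    (h : ∀ X, F.obj X = G.obj X)
    (h' : ∀ {X Y : A} (f : X ⟶ Y), HEq (U.map (F.map f)) (U.map (G.map f))) : F = G := by
  have e {X Y X' Y' : B} (hX : X = X') (hY : Y = Y') (f : X ⟶ Y) (g : X' ⟶ Y')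
      (hfg : HEq (U.map f) (U.map g)) : HEq f g := by
    subst hX hY
    exact heq_of_eq (U.map_injective (eq_of_heq hfg))
  exact CategoryTheory.Functor.hext h fun X Y f => e (h X) (h Y) _ _ (h' f)

end FunctorEquality

noncomputable section LeftCategories

/-- An isomorphism in the center from an isomorphism compatible with the half-braidings. -/
def centerIsoMk {D : Type u} [Category.{v} D] [MonoidalCategory D] {X Y : Center D} (e : X.1 ≅ Y.1)
    (h : ∀ U, e.hom ▷ U ≫ (Y.2.β U).hom = (X.2.β U).hom ≫ U ◁ e.hom) : X ≅ Y :=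
  have : IsIso (Center.Hom.mk (X := X) (Y := Y) e.hom h).f := inferInstanceAs (IsIso e.hom)
  Center.isoMk ⟨e.hom, h⟩

variable {C : Type u} [Category.{v} C] [MonoidalCategory C] [BraidedCategory C]

instance {A : C} [MonObj A] : (Mod.forget (D := C) A).Faithful where
  map_injective h := Mod.hom_ext _ _ h

instance {H : C} [BimonObj H] : (LeftYD.forgetToMod H).Faithful where
  map_injective h := LeftYD.Hom.ext h

theorem LeftYD.hom_ext {H : C} [BimonObj H] {M N : LeftYD H} {f g : M ⟶ N}
    (h : f.hom.hom = g.hom.hom) : f = g :=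
  LeftYD.Hom.ext (Mod.hom_ext _ _ h)

omit [BraidedCategory C] in
theorem mod_ext_act {A : C} [MonObj A] {M N : Mod C A} (hX : M.X = N.X)
    (h : HEq (lact M) (lact N)) : M = N := by
  obtain @⟨X, aX⟩ := M
  obtain @⟨Y, aY⟩ := N
  obtain rfl : X = Y := hX
  obtain rfl : aX = aY := ModObj.ext _ _ (eq_of_heq h)
  rfl

theorem LeftYD.ext_coact {H : C} [BimonObj H] {M N : LeftYD H} (h : M.toMod = N.toMod)
    (h' : HEq M.coact N.coact) : M = N := by
  obtain ⟨X, a, _, _⟩ := M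
  obtain ⟨Y, b, _, _⟩ := N
  obtain rfl : X = Y := h
  obtain rfl : a = b := eq_of_heq h'
  rfl

variable {H : C} [HopfObj H]

theorem LeftYD.isLeftYD (M : LeftYD H) : IsLeftYD (lact M.toMod) M.coact :=
  ⟨one_lact M.toMod, mul_lact M.toMod, M.coact_counit, M.coact_coassoc, M.yd⟩

variable [Transparent H] [IsIso (HopfObj.antipode (X := H))]

namespace LeftYD

/-- The braiding of a Yetter-Drinfeld module with a module. -/
def braidModIso (M : LeftYD H) (N : Mod C H) : M.toMod ⊗ N ≅ N ⊗ M.toMod :=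
  lisoMk (M := M.toMod ⊗ N) (N := N ⊗ M.toMod) (braidIso M.isLeftYD (one_lact N) (mul_lact N))
    (braidMap_linear M.yd (mul_lact N))

/-- The half-braiding of the underlying module of a Yetter-Drinfeld module. -/
def halfBraiding (M : LeftYD H) : HalfBraiding M.toMod where
  β := M.braidModIso
  monoidal _ _ := Mod.hom_ext _ _ (braidMap_tensor_right _ _ M.coact_coassoc)
  naturality f := Mod.hom_ext _ _ (braidMap_natural_right _ (lact_hom f))

/-- The braiding of the category of Yetter-Drinfeld modules. -/
instance : BraidedCategory (LeftYD H) where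
  braiding M N := isoMk (M := M ⊗ N) (N := N ⊗ M) (M.braidModIso N.toMod)
    (braidMap_colinear N.yd M.coact_coassoc)
  braiding_naturality_right M _ _ f :=
    hom_ext (braidMap_natural_right M.coact (lact_hom f.hom))
  braiding_naturality_left f N := hom_ext (braidMap_natural_left f.coact_hom (lact N.toMod))
  hexagon_forward M N P := hom_ext (by
    change (α_ M.toMod.X N.toMod.X P.toMod.X).hom ≫
      braidMap M.coact (tensorAct Δ[H] (lact N.toMod) (lact P.toMod)) ≫
        (α_ N.toMod.X P.toMod.X M.toMod.X).hom =
      braidMap M.coact (lact N.toMod) ▷ P.toMod.X ≫ (α_ _ _ _).hom ≫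
        N.toMod.X ◁ braidMap M.coact (lact P.toMod)
    rw [braidMap_tensor_right _ _ M.coact_coassoc]
    simp)
  hexagon_reverse M N P := hom_ext (by
    change (α_ M.toMod.X N.toMod.X P.toMod.X).inv ≫
      braidMap (tensorCoact μ[H] M.coact N.coact) (lact P.toMod) ≫
        (α_ P.toMod.X M.toMod.X N.toMod.X).inv =
      M.toMod.X ◁ braidMap N.coact (lact P.toMod) ≫ (α_ _ _ _).inv ≫
        braidMap M.coact (lact P.toMod) ▷ N.toMod.X
    rw [braidMap_tensor_left _ _ (mul_lact P.toMod)]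
    simp)

/-- The functor from Yetter-Drinfeld modules to the center of the category of modules. -/
def toCenter : LeftYD H ⥤ Center (Mod C H) where
  obj M := ⟨M.toMod, M.halfBraiding⟩
  map f := ⟨f.hom, fun U => Mod.hom_ext _ _ (braidMap_natural_left f.coact_hom (lact U))⟩

variable (H) in
/-- The regular module. -/
abbrev regular : Mod C H := lmk H μ[H] (MonObj.one_mul H) (MonObj.mul_assoc H)

/-- A linear morphism that is compatible with the half-braidings is colinear: it suffices to look at
the half-braidings with the regular module. -/
theorem coact_hom_of_comm {M N : LeftYD H} (f : M.toMod ⟶ N.toMod)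
    (h : f ▷ regular H ≫ (N.halfBraiding.β (regular H)).hom =
      (M.halfBraiding.β (regular H)).hom ≫ regular H ◁ f) :
    M.coact ≫ H ◁ f.hom = f.hom ≫ N.coact :=
  colinear_of_braidMap_mul (congrArg Mod.Hom.hom h)

instance : (toCenter (H := H)).Full where
  map_surjective f := ⟨⟨f.f, coact_hom_of_comm f.f (f.comm _)⟩, rfl⟩

instance : (toCenter (H := H)).Faithful where
  map_injective h := Hom.ext (congrArg Center.Hom.f h)

theorem toCenter_injective : Function.Injective (toCenter (H := H)).obj := by
  intro M N h
  obtain ⟨X, c, _, _, _⟩ := M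
  obtain ⟨Y, c', _, _, _⟩ := N
  obtain ⟨h₁, h₂⟩ := Sigma.mk.inj h
  change X = Y at h₁
  subst h₁
  have h₃ := congrArg (fun t : HalfBraiding X => (t.β (regular H)).hom) (eq_of_heq h₂)
  refine ext_coact rfl (heq_of_eq ?_)
  -- As the half-braidings agree, the identity is colinear, so the coactions are equal.
  have := coact_hom_of_comm (M := ⟨X, c, ‹_›, ‹_›, ‹_›⟩) (N := ⟨X, c', ‹_›, ‹_›, ‹_›⟩) (𝟙 X) (by
    rw [id_whiskerRight, MonoidalCategory.whiskerLeft_id, Category.id_comp, Category.comp_id]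
    exact h₃.symm)
  rw [Mod.id_hom', MonoidalCategory.whiskerLeft_id, Category.id_comp, Category.comp_id] at this
  exact this

/-- The functor to the center is strictly monoidal on underlying objects. -/
def toCenterCoreMonoidal : (toCenter (H := H)).CoreMonoidal where
  εIso := centerIsoMk (Iso.refl (𝟙_ (Mod C H))) fun U => Mod.hom_ext _ _ (by
    change 𝟙 (𝟙_ C) ▷ U.X ≫ braidMap (η[H] ≫ (ρ_ H).inv) (lact U) =
      ((λ_ U.X).hom ≫ (ρ_ U.X).inv) ≫ U.X ◁ 𝟙 (𝟙_ C)
    rw [braidMap_unit_left (one_lact U)]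
    simp)
  μIso M N := centerIsoMk (Iso.refl (M.toMod ⊗ N.toMod)) fun U => Mod.hom_ext _ _ (by
    change 𝟙 (M.toMod.X ⊗ N.toMod.X) ▷ U.X ≫
        braidMap (tensorCoact μ[H] M.coact N.coact) (lact U) =
      ((α_ _ _ _).hom ≫ M.toMod.X ◁ braidMap N.coact (lact U) ≫ (α_ _ _ _).inv ≫
        braidMap M.coact (lact U) ▷ N.toMod.X ≫ (α_ _ _ _).hom) ≫
          U.X ◁ 𝟙 (M.toMod.X ⊗ N.toMod.X)
    rw [braidMap_tensor_left _ _ (mul_lact U)]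
    simp)
  μIso_hom_natural_left f N := by
    refine Center.ext _ _ ?_
    change f.hom ▷ N.toMod ≫ 𝟙 _ = 𝟙 _ ≫ f.hom ▷ N.toMod
    rw [Category.id_comp, Category.comp_id]
  μIso_hom_natural_right M f := by
    refine Center.ext _ _ ?_
    change M.toMod ◁ f.hom ≫ 𝟙 _ = 𝟙 _ ≫ M.toMod ◁ f.hom
    rw [Category.id_comp, Category.comp_id]
  associativity M N P := Center.ext _ _ (by
    change 𝟙 (M.toMod ⊗ N.toMod) ▷ P.toMod ≫
        𝟙 ((M.toMod ⊗ N.toMod) ⊗ P.toMod) ≫ (α_ M.toMod N.toMod P.toMod).hom =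
      (α_ M.toMod N.toMod P.toMod).hom ≫ M.toMod ◁ 𝟙 (N.toMod ⊗ P.toMod) ≫
        𝟙 (M.toMod ⊗ N.toMod ⊗ P.toMod)
    simp)
  left_unitality M := Center.ext _ _ (by
    change (λ_ M.toMod).hom = 𝟙 (𝟙_ (Mod C H)) ▷ M.toMod ≫ 𝟙 _ ≫ (λ_ M.toMod).hom
    simp)
  right_unitality M := Center.ext _ _ (by
    change (ρ_ M.toMod).hom = M.toMod ◁ 𝟙 (𝟙_ (Mod C H)) ≫ 𝟙 _ ≫ (ρ_ M.toMod).hom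
    simp)

instance : (toCenter (H := H)).Braided where
  __ := toCenterCoreMonoidal.toMonoidal
  braided M N := by
    refine Center.ext _ _ ?_
    change 𝟙 (M.toMod ⊗ N.toMod) ≫ (M.braidModIso N.toMod).hom =
      (M.braidModIso N.toMod).hom ≫ 𝟙 (N.toMod ⊗ M.toMod)
    rw [Category.id_comp, Category.comp_id]

end LeftYD

end LeftCategories

/-! ### Left modules over the double -/

noncomputable section LeftDoubleModules

variable {C : Type u} [Category.{v} C] [MonoidalCategory C] [BraidedCategory C]
variable {H : C} [HopfObj H] [Transparent H] [IsIso (HopfObj.antipode (X := H))] (fin : FiniteObj H)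

instance : BimonObj (double fin) := doubleBimonObj fin

instance : IsMonHom (inclH fin) where
  one_hom := one_inclH fin
  mul_hom := (inclH_mul fin).symm

omit [Transparent H] in
theorem LeftYD.doubleAct_eq (M : LeftYD H) :
    M.doubleAct fin = smashAct (lact M.toMod) (dualAction fin.dual M.coact) := by
  have e : (ε_ H fin.dual : fin.dual ⊗ H ⟶ 𝟙_ C) = fin.ev := rfl
  simp only [LeftYD.doubleAct, smashAct, dualAction, pair, evT, cap, e, antipodeInv]
  monoidal

/-- The module over the double given by a Yetter-Drinfeld module. -/
def LeftYD.toDoubleMod : LeftYD H ⥤ Mod C (double fin) where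
  obj M := lmk M.toMod.X (M.doubleAct fin)
    (by rw [M.doubleAct_eq]; exact M.isLeftYD.double.1)
    (by rw [M.doubleAct_eq]; exact M.isLeftYD.double.2)
  map {M N} f := .mk' f.hom.hom (by
    change M.doubleAct fin ≫ f.hom.hom = double fin ◁ f.hom.hom ≫ N.doubleAct fin
    rw [M.doubleAct_eq, N.doubleAct_eq]
    exact smashAct_comp (lact_hom f.hom) ((dualAction_comp_iff _ _ _).2 f.coact_hom))

theorem isLeftYD_of_mod (M : Mod C (double fin)) :
    IsLeftYD (inclH fin ▷ M.X ≫ lact M) (coactionOf H (inclB fin ▷ M.X ≫ lact M)) ∧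
      smashAct (inclH fin ▷ M.X ≫ lact M) (inclB fin ▷ M.X ≫ lact M) = lact M :=
  isLeftYD_of_double (one_lact M) (mul_lact M)

/-- The Yetter-Drinfeld module given by a module over the double. -/
def LeftYD.ofDoubleMod : Mod C (double fin) ⥤ LeftYD H where
  obj M :=
    { toMod := (Mod.comap (inclH fin)).obj M
      coact := coactionOf H (inclB fin ▷ M.X ≫ lact M)
      coact_counit := (isLeftYD_of_mod fin M).1.counit
      coact_coassoc := (isLeftYD_of_mod fin M).1.coassoc
      yd := (isLeftYD_of_mod fin M).1.yd }
  map {M N} f := ⟨(Mod.comap (inclH fin)).map f, by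
    refine (dualAction_comp_iff (B := fin.dual) _ _ _).1 ?_
    rw [dualAction_coactionOf, dualAction_coactionOf]
    change (inclB fin ▷ M.X ≫ lact M) ≫ f.hom = fin.dual ◁ f.hom ≫ inclB fin ▷ N.X ≫ lact N
    rw [Category.assoc, lact_hom, whisker_exchange_assoc]⟩

theorem LeftYD.toDoubleMod_comp_ofDoubleMod :
    LeftYD.toDoubleMod fin ⋙ LeftYD.ofDoubleMod fin = 𝟭 (LeftYD H) := by
  refine functor_eq_of_faithful (LeftYD.forgetToMod H ⋙ Mod.forget H) (fun M => ?_)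
    fun _ => HEq.rfl
  have h := M.isLeftYD
  obtain ⟨⟨h₁, h₂⟩, ⟨h₃, h₄⟩, h₅⟩ := (isLeftYD_iff (B := fin.dual) _ _).1 h
  rw [← dualOne_eq] at h₃
  refine LeftYD.ext_coact (mod_ext_act rfl (heq_of_eq ?_)) (heq_of_eq ?_)
  · change inclH fin ▷ M.toMod.X ≫ M.doubleAct fin = lact M.toMod
    rw [M.doubleAct_eq, inclH_smashAct h₃]
  · change coactionOf H (inclB fin ▷ M.toMod.X ≫ M.doubleAct fin) = M.coact
    rw [M.doubleAct_eq, inclB_smashAct h₁, coactionOf_dualAction]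

theorem LeftYD.ofDoubleMod_comp_toDoubleMod :
    LeftYD.ofDoubleMod fin ⋙ LeftYD.toDoubleMod fin = 𝟭 (Mod C (double fin)) := by
  refine functor_eq_of_faithful (Mod.forget (double fin)) (fun M => ?_) fun _ => HEq.rfl
  refine mod_ext_act rfl (heq_of_eq ?_)
  change ((LeftYD.ofDoubleMod fin).obj M).doubleAct fin = lact M
  rw [LeftYD.doubleAct_eq]
  change smashAct (inclH fin ▷ M.X ≫ lact M)
    (dualAction fin.dual (coactionOf H (inclB fin ▷ M.X ≫ lact M))) = lact M
  rw [dualAction_coactionOf, (isLeftYD_of_mod fin M).2]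

/-- The functor from Yetter-Drinfeld modules to modules over the double is strictly monoidal on
underlying objects. -/
def LeftYD.toDoubleModCoreMonoidal : (LeftYD.toDoubleMod fin).CoreMonoidal where
  εIso := lisoMk (M := 𝟙_ (Mod C (double fin))) (N := (LeftYD.toDoubleMod fin).obj (𝟙_ (LeftYD H)))
    (Iso.refl (𝟙_ C)) (by
      change ((ρ_ (double fin)).hom ≫ doubleCounit fin) ≫ 𝟙 (𝟙_ C) =
        double fin ◁ 𝟙 (𝟙_ C) ≫ (𝟙_ (LeftYD H)).doubleAct fin
      rw [LeftYD.doubleAct_eq, Category.comp_id, MonoidalCategory.whiskerLeft_id, Category.id_comp]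
      exact (smashAct_unit fin).symm)
  μIso M N := lisoMk (M := (LeftYD.toDoubleMod fin).obj M ⊗ (LeftYD.toDoubleMod fin).obj N)
    (N := (LeftYD.toDoubleMod fin).obj (M ⊗ N)) (Iso.refl (M.toMod.X ⊗ N.toMod.X)) (by
      change tensorAct (doubleComul fin) (M.doubleAct fin) (N.doubleAct fin) ≫ 𝟙 _ =
        double fin ◁ 𝟙 _ ≫ (M ⊗ N).doubleAct fin
      rw [M.doubleAct_eq, N.doubleAct_eq, (M ⊗ N).doubleAct_eq, tensorAct_double, Category.comp_id,
        MonoidalCategory.whiskerLeft_id, Category.id_comp]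
      rfl)
  μIso_hom_natural_left {M M'} f N := Mod.hom_ext _ _ (by
    change f.hom.hom ▷ N.toMod.X ≫ 𝟙 _ = 𝟙 _ ≫ f.hom.hom ▷ N.toMod.X
    rw [Category.id_comp, Category.comp_id])
  μIso_hom_natural_right M f := Mod.hom_ext _ _ (by
    change M.toMod.X ◁ f.hom.hom ≫ 𝟙 _ = 𝟙 _ ≫ M.toMod.X ◁ f.hom.hom
    rw [Category.id_comp, Category.comp_id])
  associativity M N P := Mod.hom_ext _ _ (by
    change 𝟙 (M.toMod.X ⊗ N.toMod.X) ▷ P.toMod.X ≫ 𝟙 _ ≫ (α_ _ _ _).hom =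
      (α_ _ _ _).hom ≫ M.toMod.X ◁ 𝟙 (N.toMod.X ⊗ P.toMod.X) ≫ 𝟙 _
    simp)
  left_unitality M := Mod.hom_ext _ _ (by
    change (λ_ M.toMod.X).hom = 𝟙 (𝟙_ C) ▷ M.toMod.X ≫ 𝟙 _ ≫ (λ_ M.toMod.X).hom
    simp)
  right_unitality M := Mod.hom_ext _ _ (by
    change (ρ_ M.toMod.X).hom = M.toMod.X ◁ 𝟙 (𝟙_ C) ≫ 𝟙 _ ≫ (ρ_ M.toMod.X).hom
    simp)

/-- The tensor product of modules over the double has the diagonal action of `H` and the codiagonal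
coaction. -/
theorem inclH_double (M N : Mod C (double fin)) :
    inclH fin ▷ (M.X ⊗ N.X) ≫ lact (M ⊗ N) =
      tensorAct Δ[H] (inclH fin ▷ M.X ≫ lact M) (inclH fin ▷ N.X ≫ lact N) ∧
    coactionOf H (inclB fin ▷ (M.X ⊗ N.X) ≫ lact (M ⊗ N)) =
      tensorCoact μ[H] (coactionOf H (inclB fin ▷ M.X ≫ lact M))
        (coactionOf H (inclB fin ▷ N.X ≫ lact N)) := by
  obtain ⟨hM, eM⟩ := isLeftYD_of_mod fin M
  obtain ⟨hN, eN⟩ := isLeftYD_of_mod fin N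
  have h := hM.tensor hN
  obtain ⟨⟨h₁, h₂⟩, ⟨h₃, h₄⟩, h₅⟩ := (isLeftYD_iff (B := fin.dual) _ _).1 h
  rw [← dualOne_eq] at h₃
  have e : lact (M ⊗ N) = tensorAct (doubleComul fin) (lact M) (lact N) := rfl
  rw [← eM, ← eN, ← dualAction_coactionOf (H := H) (inclB fin ▷ M.X ≫ lact M),
    ← dualAction_coactionOf (H := H) (inclB fin ▷ N.X ≫ lact N), tensorAct_double] at e
  rw [e, inclH_smashAct h₃, inclB_smashAct h₁, coactionOf_dualAction]
  exact ⟨rfl, rfl⟩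

theorem inclH_double_unit :
    inclH fin ▷ 𝟙_ C ≫ lact (𝟙_ (Mod C (double fin))) = (ρ_ H).hom ≫ ε[H] ∧
      coactionOf H (inclB fin ▷ 𝟙_ C ≫ lact (𝟙_ (Mod C (double fin)))) = η[H] ≫ (ρ_ H).inv := by
  obtain ⟨⟨h₁, h₂⟩, ⟨h₃, h₄⟩, h₅⟩ :=
    (isLeftYD_iff (B := fin.dual) _ _).1 (isLeftYD_unit (H := H))
  rw [← dualOne_eq] at h₃
  have e : lact (𝟙_ (Mod C (double fin))) = (ρ_ (double fin)).hom ≫ doubleCounit fin := rfl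
  rw [← smashAct_unit] at e
  rw [e, inclH_smashAct h₃, inclB_smashAct h₁, coactionOf_dualAction]
  exact ⟨rfl, rfl⟩

/-- The functor from modules over the double to Yetter-Drinfeld modules is strictly monoidal on
underlying objects. -/
def LeftYD.ofDoubleModCoreMonoidal : (LeftYD.ofDoubleMod fin).CoreMonoidal where
  εIso := LeftYD.isoMk (M := 𝟙_ (LeftYD H)) (N := (LeftYD.ofDoubleMod fin).obj (𝟙_ _))
    (lisoMk (M := 𝟙_ (Mod C H)) (N := (Mod.comap (inclH fin)).obj (𝟙_ _)) (Iso.refl (𝟙_ C)) (by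
      change ((ρ_ H).hom ≫ ε[H]) ≫ 𝟙 (𝟙_ C) =
        H ◁ 𝟙 (𝟙_ C) ≫ inclH fin ▷ 𝟙_ C ≫ lact (𝟙_ (Mod C (double fin)))
      rw [(inclH_double_unit fin).1]
      simp))
    (by
      change (η[H] ≫ (ρ_ H).inv) ≫ H ◁ 𝟙 (𝟙_ C) =
        𝟙 (𝟙_ C) ≫ coactionOf H (inclB fin ▷ 𝟙_ C ≫ lact (𝟙_ (Mod C (double fin))))
      rw [(inclH_double_unit fin).2]
      simp)
  μIso M N := LeftYD.isoMk
    (M := (LeftYD.ofDoubleMod fin).obj M ⊗ (LeftYD.ofDoubleMod fin).obj N)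
    (N := (LeftYD.ofDoubleMod fin).obj (M ⊗ N))
    (lisoMk (M := (Mod.comap (inclH fin)).obj M ⊗ (Mod.comap (inclH fin)).obj N)
      (N := (Mod.comap (inclH fin)).obj (M ⊗ N)) (Iso.refl (M.X ⊗ N.X)) (by
      change tensorAct Δ[H] (inclH fin ▷ M.X ≫ lact M) (inclH fin ▷ N.X ≫ lact N) ≫
          𝟙 (M.X ⊗ N.X) = H ◁ 𝟙 (M.X ⊗ N.X) ≫ inclH fin ▷ (M.X ⊗ N.X) ≫ lact (M ⊗ N)
      rw [(inclH_double fin M N).1]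
      simp))
    (by
      change tensorCoact μ[H] (coactionOf H (inclB fin ▷ M.X ≫ lact M))
        (coactionOf H (inclB fin ▷ N.X ≫ lact N)) ≫ H ◁ 𝟙 (M.X ⊗ N.X) =
          𝟙 (M.X ⊗ N.X) ≫ coactionOf H (inclB fin ▷ (M.X ⊗ N.X) ≫ lact (M ⊗ N))
      rw [(inclH_double fin M N).2]
      simp)
  μIso_hom_natural_left {M M'} f N := LeftYD.hom_ext (by
    change f.hom ▷ N.X ≫ 𝟙 _ = 𝟙 _ ≫ f.hom ▷ N.X
    rw [Category.id_comp, Category.comp_id])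
  μIso_hom_natural_right M f := LeftYD.hom_ext (by
    change M.X ◁ f.hom ≫ 𝟙 _ = 𝟙 _ ≫ M.X ◁ f.hom
    rw [Category.id_comp, Category.comp_id])
  associativity M N P := LeftYD.hom_ext (by
    change 𝟙 (M.X ⊗ N.X) ▷ P.X ≫ 𝟙 _ ≫ (α_ _ _ _).hom =
      (α_ _ _ _).hom ≫ M.X ◁ 𝟙 (N.X ⊗ P.X) ≫ 𝟙 _
    simp)
  left_unitality M := LeftYD.hom_ext (by
    change (λ_ M.X).hom = 𝟙 (𝟙_ C) ▷ M.X ≫ 𝟙 _ ≫ (λ_ M.X).hom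
    simp)
  right_unitality M := LeftYD.hom_ext (by
    change (ρ_ M.X).hom = M.X ◁ 𝟙 (𝟙_ C) ≫ 𝟙 _ ≫ (ρ_ M.X).hom
    simp)

theorem lact_tensor (M N : Mod C (double fin)) :
    lact (M ⊗ N) = smashAct
      (tensorAct Δ[H] (inclH fin ▷ M.X ≫ lact M) (inclH fin ▷ N.X ≫ lact N))
      (dualAction fin.dual (tensorCoact μ[H] (coactionOf H (inclB fin ▷ M.X ≫ lact M))
        (coactionOf H (inclB fin ▷ N.X ≫ lact N)))) := by
  rw [← (inclH_double fin M N).1, ← (inclH_double fin M N).2, dualAction_coactionOf]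
  exact (isLeftYD_of_mod fin (M ⊗ N)).2.symm

/-- The braiding of modules over the double: the braiding of the corresponding Yetter-Drinfeld
modules, which is linear over the double since it is linear and colinear over `H`. -/
def doubleBraidIso (M N : Mod C (double fin)) : M ⊗ N ≅ N ⊗ M :=
  lisoMk (M := M ⊗ N) (N := N ⊗ M)
    (braidIso (isLeftYD_of_mod fin M).1 (isLeftYD_of_mod fin N).1.one
      (isLeftYD_of_mod fin N).1.mul) (by
    rw [lact_tensor, lact_tensor]
    exact smashAct_comp (braidMap_linear (isLeftYD_of_mod fin M).1.yd (isLeftYD_of_mod fin N).1.mul)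
      ((dualAction_comp_iff _ _ _).2 (braidMap_colinear (isLeftYD_of_mod fin N).1.yd
        (isLeftYD_of_mod fin M).1.coassoc)))

instance : (LeftYD.ofDoubleMod fin).Faithful where
  map_injective h := Mod.hom_ext _ _ (congrArg (fun t => t.hom.hom) h)

/-- The braiding of the category of modules over the double. -/
instance : BraidedCategory (Mod C (double fin)) :=
  letI := (LeftYD.ofDoubleModCoreMonoidal fin).toMonoidal
  .ofFaithful (LeftYD.ofDoubleMod fin) (doubleBraidIso fin) fun _ _ => LeftYD.hom_ext
    ((Category.id_comp _).trans (Category.comp_id _).symm)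

instance : (LeftYD.ofDoubleMod fin).Braided where
  __ := (LeftYD.ofDoubleModCoreMonoidal fin).toMonoidal
  braided _ _ := LeftYD.hom_ext
    ((Category.id_comp _).trans (Category.comp_id _).symm)

theorem doubleBraidIso_toDoubleMod (M N : LeftYD H) :
    (doubleBraidIso fin ((LeftYD.toDoubleMod fin).obj M) ((LeftYD.toDoubleMod fin).obj N)).hom.hom =
      M.braid N.toMod := by
  obtain ⟨⟨h₁, h₂⟩, ⟨h₃, h₄⟩, h₅⟩ := (isLeftYD_iff (B := fin.dual) _ _).1 M.isLeftYD
  obtain ⟨⟨k₁, k₂⟩, ⟨k₃, k₄⟩, k₅⟩ := (isLeftYD_iff (B := fin.dual) _ _).1 N.isLeftYD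
  rw [← dualOne_eq] at h₃ k₃
  change braidMap (coactionOf H (inclB fin ▷ M.toMod.X ≫ M.doubleAct fin))
    (inclH fin ▷ N.toMod.X ≫ N.doubleAct fin) = braidMap M.coact (lact N.toMod)
  rw [M.doubleAct_eq, N.doubleAct_eq, inclB_smashAct h₁, inclH_smashAct k₃, coactionOf_dualAction]

instance : (LeftYD.toDoubleMod fin).Braided where
  __ := (LeftYD.toDoubleModCoreMonoidal fin).toMonoidal
  braided M N := Mod.hom_ext _ _ ((Category.id_comp _).trans
    ((doubleBraidIso_toDoubleMod fin M N).symm.trans (Category.comp_id _).symm))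

/-- The inverse of the braiding is the action of the universal R-matrix `∑ (ε ⊗ hᵢ) ⊗ (hⁱ ⊗ 1)`,
followed by the inverse braiding of the base category. -/
theorem doubleBraidIso_inv (M N : Mod C (double fin)) :
    (doubleBraidIso fin M N).inv.hom = twistL fin (lact N) (lact M) := by
  have h := twist_eq (B := fin.dual) (coactionOf H (inclB fin ▷ M.X ≫ lact M))
    (inclH fin ▷ N.X ≫ lact N)
  refine h.symm.trans ?_
  rw [dualAction_coactionOf]
  have e : (η_ H fin.dual : 𝟙_ C ⟶ H ⊗ fin.dual) = fin.coev := rfl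
  simp only [twistL, comp_whiskerRight, Category.assoc]
  rw [tensorμ_natural_left_assoc, tensorHom_comp_tensorHom_assoc]
  simp only [coevT, cross, fuse, cup, e, tensorμ, MonoidalCategory.tensorHom_def']
  monoidal

/-- Yetter-Drinfeld modules and modules over the double form isomorphic braided monoidal
categories. -/
def LeftYD.doubleModIso : BraidedIso (LeftYD H) (Mod C (double fin)) where
  functor := LeftYD.toDoubleMod fin
  inverse := LeftYD.ofDoubleMod fin
  functor_inverse := LeftYD.toDoubleMod_comp_ofDoubleMod fin
  inverse_functor := LeftYD.ofDoubleMod_comp_toDoubleMod fin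
  braided := inferInstance
  braided_inverse := inferInstance

instance : (LeftYD.ofDoubleMod fin).Full where
  map_surjective {M N} f := by
    refine ⟨.mk' f.hom.hom ?_, rfl⟩
    change lact M ≫ f.hom.hom = double fin ◁ f.hom.hom ≫ lact N
    rw [← (isLeftYD_of_mod fin M).2, ← (isLeftYD_of_mod fin N).2,
      ← dualAction_coactionOf (H := H) (inclB fin ▷ M.X ≫ lact M),
      ← dualAction_coactionOf (H := H) (inclB fin ▷ N.X ≫ lact N)]
    exact smashAct_comp (lact_hom f.hom) ((dualAction_comp_iff _ _ _).2 f.coact_hom)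

theorem LeftYD.ofDoubleMod_injective : Function.Injective (LeftYD.ofDoubleMod fin).obj :=
  fun M N h => by
    have e (M) := CategoryTheory.Functor.congr_obj (LeftYD.ofDoubleMod_comp_toDoubleMod fin) M
    exact (e M).symm.trans ((congrArg (LeftYD.toDoubleMod fin).obj h).trans (e N))

/-- The embedding of the category of modules over the double into the center of the category of
modules over `H`. -/
def doubleModEmbedding : BraidedEmbedding (Mod C (double fin)) (Center (Mod C H)) where
  functor := LeftYD.ofDoubleMod fin ⋙ LeftYD.toCenter
  braided := inferInstance
  full := inferInstance
  faithful := inferInstance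
  injective_obj := LeftYD.toCenter_injective.comp (LeftYD.ofDoubleMod_injective fin)

/-- The left-handed half of the theorem: the isomorphism and the embedding of braided monoidal
categories, with the formulas that describe them. -/
theorem exists_left_double_iso :
    ∃ (_ : BraidedCategory (LeftYD H)) (_ : BraidedCategory (Mod C (double fin)))
      (F : BraidedIso (LeftYD H) (Mod C (double fin)))
      (J : BraidedEmbedding (Mod C (double fin)) (Center (Mod C H)))
      (h₁ : ∀ X : LeftYD H, η[double fin] ▷ X.toMod.X ≫ X.doubleAct fin = (λ_ _).hom)
      (h₂ : ∀ X : LeftYD H, μ[double fin] ▷ X.toMod.X ≫ X.doubleAct fin =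
        (α_ _ _ _).hom ≫ double fin ◁ X.doubleAct fin ≫ X.doubleAct fin)
      (c : ∀ X : LeftYD H, HalfBraiding X.toMod),
      (∀ X Y : LeftYD H, (β_ X Y).hom.hom.hom = X.braid Y.toMod) ∧
      (∀ M N : Mod C (double fin), (β_ M N).inv.hom = twistL fin (lact N) (lact M)) ∧
      (∀ X, F.functor.obj X = lmk X.toMod.X (X.doubleAct fin) (h₁ X) (h₂ X)) ∧
      F.functor ⋙ Mod.comap (inclH fin) = LeftYD.forgetToMod H ∧
      (∀ X Y, ((c X).β Y).hom.hom = X.braid Y) ∧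
      (∀ X, J.functor.obj (F.functor.obj X) = ⟨X.toMod, c X⟩) ∧
      J.functor ⋙ Center.forget (Mod C H) = Mod.comap (inclH fin) := by
  refine ⟨inferInstance, inferInstance, LeftYD.doubleModIso fin, doubleModEmbedding fin,
    fun X => one_lact ((LeftYD.toDoubleMod fin).obj X),
    fun X => mul_lact ((LeftYD.toDoubleMod fin).obj X), fun X => X.halfBraiding,
    fun _ _ => rfl, doubleBraidIso_inv fin, fun _ => rfl, ?_, fun _ _ => rfl, fun X => ?_, rfl⟩
  · exact congrArg (· ⋙ LeftYD.forgetToMod H) (LeftYD.toDoubleMod_comp_ofDoubleMod fin)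
  · exact congrArg LeftYD.toCenter.obj
      (CategoryTheory.Functor.congr_obj (LeftYD.toDoubleMod_comp_ofDoubleMod fin) X)

end LeftDoubleModules

/-! ### The category with reversed tensor product -/

section Mirror

open MonoidalOpposite

variable {C : Type u} [Category.{v} C] [MonoidalCategory C]

instance {H : C} [ComonObj H] : ComonObj (mop H) where
  counit := ε[H].mop
  comul := Δ[H].mop
  counit_comul := Quiver.Hom.unmop_inj (ComonObj.comul_counit H)
  comul_counit := Quiver.Hom.unmop_inj (ComonObj.counit_comul H)
  comul_assoc := Quiver.Hom.unmop_inj (by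
    change Δ[H] ≫ Δ[H] ▷ H = Δ[H] ≫ H ◁ Δ[H] ≫ (α_ H H H).inv
    rw [ComonObj.comul_assoc_flip])

variable [BraidedCategory C]

instance {H : C} [BimonObj H] : BimonObj (mop H) where
  mul_comul := Quiver.Hom.unmop_inj (by
    change μ[H] ≫ Δ[H] = (Δ[H] ⊗ₘ Δ[H]) ≫ (tensorμ (mop H) (mop H) (mop H) (mop H)).unmop ≫
      (μ[H] ⊗ₘ μ[H])
    rw [unmop_tensorμ]
    exact BimonObj.mul_comul H)
  one_comul := Quiver.Hom.unmop_inj (by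
    change η[H] ≫ Δ[H] = (ρ_ (𝟙_ C)).inv ≫ (η[H] ⊗ₘ η[H])
    rw [BimonObj.one_comul, MonObj.tensorObj.one_def, unitors_inv_equal])
  mul_counit := Quiver.Hom.unmop_inj (by
    change μ[H] ≫ ε[H] = (ε[H] ⊗ₘ ε[H]) ≫ (ρ_ (𝟙_ C)).hom
    rw [BimonObj.mul_counit, Comon.tensorObj_counit, unitors_equal])
  one_counit := Quiver.Hom.unmop_inj (BimonObj.one_counit H)

instance {H : C} [HopfObj H] : HopfObj (mop H) where
  antipode := (HopfObj.antipode (X := H)).mop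
  antipode_left := Quiver.Hom.unmop_inj (HopfObj.antipode_right H)
  antipode_right := Quiver.Hom.unmop_inj (HopfObj.antipode_left H)

instance {H : C} [HopfObj H] [IsIso (HopfObj.antipode (X := H))] :
    IsIso (HopfObj.antipode (X := mop H)) :=
  inferInstanceAs (IsIso (HopfObj.antipode (X := H)).mop)

instance {H : C} [Transparent H] : Transparent (mop H) :=
  ⟨fun Y => Quiver.Hom.unmop_inj (braiding_symm_right H Y.unmop)⟩

/-- The duality of `H` and `B` in the reversed category, given by `ev' = ev Φ` and `d' = Φ⁻¹ d`. -/
instance {H B : C} [ExactPairing H B] : ExactPairing (mop H) (mop B) :=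
  letI := exactPairing_swap H B
  { coevaluation' := (ExactPairing.coevaluation B H).mop
    evaluation' := (ExactPairing.evaluation B H).mop
    coevaluation_evaluation' := Quiver.Hom.unmop_inj (ExactPairing.evaluation_coevaluation B H)
    evaluation_coevaluation' := Quiver.Hom.unmop_inj (ExactPairing.coevaluation_evaluation B H) }

theorem unmop_antipodeInv {H : C} [HopfObj H] [IsIso (HopfObj.antipode (X := H))] :
    (antipodeInv (mop H)).unmop = antipodeInv H := by
  have h : (HopfObj.antipode (X := H)) ≫ (antipodeInv (mop H)).unmop = 𝟙 H :=
    congrArg Quiver.Hom.unmop (IsIso.hom_inv_id (HopfObj.antipode (X := mop H)))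
  rw [← cancel_epi (HopfObj.antipode (X := H)), h, antipodeInv, IsIso.hom_inv_id]

end Mirror

section MirrorDual

open MonoidalOpposite

variable {C : Type u} [Category.{v} C] [MonoidalCategory C]
variable {H B : C} [ExactPairing H B] {T : C}

/-- A morphism to the dual is determined by its values. -/
theorem eq_of_ev {f g : T ⟶ B}
    (h : f ▷ H ≫ ExactPairing.evaluation H B = g ▷ H ≫ ExactPairing.evaluation H B) : f = g := by
  have e (f : T ⟶ B) : f = 𝟙 _ ⊗≫ T ◁ ExactPairing.coevaluation H B ⊗≫
      (f ▷ H ≫ ExactPairing.evaluation H B) ▷ B ⊗≫ 𝟙 _ := by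
    symm
    calc
      _ = 𝟙 _ ⊗≫ (T ◁ ExactPairing.coevaluation H B ≫ f ▷ (H ⊗ B)) ⊗≫
            ExactPairing.evaluation H B ▷ B ⊗≫ 𝟙 _ := by monoidal
      _ = 𝟙 _ ⊗≫ f ⊗≫ (B ◁ ExactPairing.coevaluation H B ≫ (α_ _ _ _).inv ≫
            ExactPairing.evaluation H B ▷ B) ⊗≫ 𝟙 _ := by rw [whisker_exchange]; monoidal
      _ = _ := by rw [ExactPairing.coevaluation_evaluation]; monoidal
  rw [e f, e g, h]

variable [BraidedCategory C]

theorem unmop_eq_of_ev {f : T ⟶ B} {g : mop T ⟶ mop B}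
    (h : (g ▷ mop H ≫ ExactPairing.evaluation (mop H) (mop B)).unmop =
      (β_ H T).hom ≫ f ▷ H ≫ ExactPairing.evaluation H B) : g.unmop = f := by
  refine eq_of_ev (H := H) ?_
  rw [← cancel_epi (β_ H T).hom, ← h, ← braiding_naturality_right_assoc]
  rfl

theorem dualAct_ev (ω : H ⊗ H ⟶ H) :
    dualAct H B ω ▷ H ≫ ExactPairing.evaluation H B = (β_ H B).hom ▷ H ≫ (α_ B H H).hom ≫
      B ◁ ω ≫ ExactPairing.evaluation H B := by
  have h := dualAct_pair (B := B) ω (𝟙 (H ⊗ 𝟙_ C))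
  calc
    _ = 𝟙 _ ⊗≫ (fuse (dualAct H B ω) (H ⊗ 𝟙_ C) ≫ pair B (𝟙 (H ⊗ 𝟙_ C))) ⊗≫ 𝟙 _ := by
      simp only [fuse, pair, cap]; monoidal
    _ = _ := by rw [h]; simp only [fuse, cross, pair, cap]; monoidal

omit [BraidedCategory C] in
theorem convOne_ev [ComonObj H] :
    convOne H B ▷ H ≫ ExactPairing.evaluation H B = (λ_ H).hom ≫ ε[H] := by
  have h := convOne_pair (B := B) (𝟙 (H ⊗ 𝟙_ C))
  calc
    _ = 𝟙 _ ⊗≫ (ins (convOne H B) (H ⊗ 𝟙_ C) ≫ pair B (𝟙 (H ⊗ 𝟙_ C))) ⊗≫ 𝟙 _ := by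
      simp only [ins, pair, cap]; monoidal
    _ = _ := by rw [h]; simp only [del]; monoidal

variable (H B) in
/-- The pairing `f ⊗ g ⊗ x ⊗ y ↦ f(y) g(x)`. -/
def evTwo : (B ⊗ B) ⊗ H ⊗ H ⟶ 𝟙_ C :=
  (α_ B B (H ⊗ H)).hom ≫ B ◁ ((α_ B H H).inv ≫ ExactPairing.evaluation H B ▷ H ≫ (λ_ H).hom) ≫
    ExactPairing.evaluation H B

theorem convMul_ev [ComonObj H] :
    convMul H B ▷ H ≫ ExactPairing.evaluation H B = (B ⊗ B) ◁ comulOp H ≫ evTwo H B := by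
  have h := convMul_pair (B := B) (𝟙 (H ⊗ 𝟙_ C))
  calc
    _ = 𝟙 _ ⊗≫ (fuse (convMul H B) (H ⊗ 𝟙_ C) ≫ pair B (𝟙 (H ⊗ 𝟙_ C))) ⊗≫ 𝟙 _ := by
      simp only [fuse, pair, cap]; monoidal
    _ = _ := by rw [h]; simp only [split, pair, cap, evTwo]; monoidal

theorem convComul_ev [HopfObj H] :
    convComul H B ▷ (H ⊗ H) ≫ evTwo H B = B ◁ μ[H] ≫ ExactPairing.evaluation H B := by
  have h := convComul_pair (B := B) (𝟙 (H ⊗ H ⊗ 𝟙_ C)) (𝟙 (H ⊗ 𝟙_ C))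
  calc
    _ = 𝟙 _ ⊗≫ (split (convComul H B) (H ⊗ H ⊗ 𝟙_ C) ≫ B ◁ pair B (𝟙 (H ⊗ H ⊗ 𝟙_ C)) ≫
          pair B (𝟙 (H ⊗ 𝟙_ C))) ⊗≫ 𝟙 _ := by
      simp only [split, pair, cap, evTwo]; monoidal
    _ = _ := by rw [h]; simp only [fuse, pair, cap]; monoidal

omit [BraidedCategory C] in
theorem eq_of_evTwo {f g : T ⟶ B ⊗ B}
    (h : f ▷ (H ⊗ H) ≫ evTwo H B = g ▷ (H ⊗ H) ≫ evTwo H B) : f = g := by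
  have e (f : T ⟶ B ⊗ B) :
      f = 𝟙 _ ⊗≫ T ◁ (ExactPairing.coevaluation H B ⊗≫
        H ◁ ExactPairing.coevaluation H B ▷ B) ⊗≫
        (f ▷ (H ⊗ H) ≫ evTwo H B) ▷ (B ⊗ B) ⊗≫ 𝟙 _ := by
    symm
    have h := ExactPairing.coevaluation_evaluation H B
    calc
      _ = 𝟙 _ ⊗≫ (T ◁ (ExactPairing.coevaluation H B ⊗≫
            H ◁ ExactPairing.coevaluation H B ▷ B) ≫ f ▷ (H ⊗ (H ⊗ B) ⊗ B)) ⊗≫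
              B ◁ ExactPairing.evaluation H B ▷ (H ⊗ B ⊗ B) ⊗≫
                ExactPairing.evaluation H B ▷ (B ⊗ B) ⊗≫ 𝟙 _ := by simp only [evTwo]; monoidal
      _ = 𝟙 _ ⊗≫ f ⊗≫ B ◁ B ◁ ExactPairing.coevaluation H B ⊗≫
            B ◁ ((B ⊗ H) ◁ ExactPairing.coevaluation H B ≫
              ExactPairing.evaluation H B ▷ (H ⊗ B)) ▷ B ⊗≫
                ExactPairing.evaluation H B ▷ (B ⊗ B) ⊗≫ 𝟙 _ := by
        rw [whisker_exchange]; monoidal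
      _ = 𝟙 _ ⊗≫ f ⊗≫ B ◁ (B ◁ ExactPairing.coevaluation H B ≫ (α_ _ _ _).inv ≫
            ExactPairing.evaluation H B ▷ B) ⊗≫ (B ◁ ExactPairing.coevaluation H B ≫
              (α_ _ _ _).inv ≫ ExactPairing.evaluation H B ▷ B) ▷ B ⊗≫ 𝟙 _ := by
        rw [whisker_exchange]; monoidal
      _ = _ := by rw [h]; monoidal
  rw [e f, e g, h]

/-- The pairing of `B ⊗ B` with `H ⊗ H` is the same in the reversed category. -/
theorem unmop_evTwo [Transparent H] :
    (evTwo (mop H) (mop B)).unmop = (β_ (H ⊗ H) (B ⊗ B)).hom ≫ evTwo H B := by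
  have e : (β_ H B).hom ≫ (β_ B H).hom = 𝟙 _ := braiding_symm_left H B
  have e₁ : (β_ (H ⊗ B) H).hom ≫ H ◁ ((β_ H B).hom ≫ ExactPairing.evaluation H B) =
      ((β_ H B).hom ≫ ExactPairing.evaluation H B) ▷ H ≫ (λ_ H).hom ≫ (ρ_ H).inv := by
    rw [← braiding_naturality_left, braiding_tensorUnit_left]
  have e₂ : (β_ H (B ⊗ H)).hom ≫ ExactPairing.evaluation H B ▷ H =
      H ◁ ExactPairing.evaluation H B ≫ (ρ_ H).hom ≫ (λ_ H).inv := by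
    rw [← braiding_naturality_right, braiding_tensorUnit_right]
  change (α_ (H ⊗ H) B B).inv ≫ ((α_ H H B).hom ≫ H ◁ ((β_ H B).hom ≫
    ExactPairing.evaluation H B) ≫ (ρ_ H).hom) ▷ B ≫ (β_ H B).hom ≫
      ExactPairing.evaluation H B = _
  symm
  calc
    _ = 𝟙 _ ⊗≫ H ◁ (β_ H B).hom ▷ B ⊗≫ H ◁ B ◁ (β_ H B).hom ⊗≫ (β_ H B).hom ▷ (B ⊗ H) ⊗≫
          B ◁ (((β_ H B).hom ≫ ExactPairing.evaluation H B) ▷ H ≫ (λ_ H).hom ≫ (ρ_ H).inv) ⊗≫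
            ExactPairing.evaluation H B := by
      rw [evTwo, braiding_tensor_left_hom, braiding_tensor_right_hom]
      monoidal
    _ = 𝟙 _ ⊗≫ H ◁ (β_ H B).hom ▷ B ⊗≫ (H ◁ (B ◁ (β_ H B).hom) ≫ H ◁ 𝟙 (B ⊗ B ⊗ H)) ⊗≫
          ((β_ H B).hom ▷ (B ⊗ H) ≫ (B ⊗ H) ◁ (β_ B H).hom) ⊗≫ B ◁ (β_ H H).hom ▷ B ⊗≫
            B ◁ H ◁ ((β_ H B).hom ≫ ExactPairing.evaluation H B) ⊗≫
              ExactPairing.evaluation H B := by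
      rw [← e₁, braiding_tensor_left_hom]
      monoidal
    _ = 𝟙 _ ⊗≫ H ◁ (β_ H B).hom ▷ B ⊗≫ H ◁ B ◁ ((β_ H B).hom ≫ (β_ B H).hom) ⊗≫
          (β_ H B).hom ▷ (H ⊗ B) ⊗≫ B ◁ (β_ H H).hom ▷ B ⊗≫
            ((B ⊗ H) ◁ ((β_ H B).hom ≫ ExactPairing.evaluation H B) ≫
              ExactPairing.evaluation H B ▷ 𝟙_ C) ⊗≫ 𝟙 _ := by
      rw [← whisker_exchange]; monoidal
    _ = 𝟙 _ ⊗≫ H ◁ (β_ H B).hom ▷ B ⊗≫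
          ((β_ H (B ⊗ H)).hom ≫ ExactPairing.evaluation H B ▷ H) ▷ B ⊗≫
            ((β_ H B).hom ≫ ExactPairing.evaluation H B) ⊗≫ 𝟙 _ := by
      rw [e, whisker_exchange, braiding_tensor_right_hom]; monoidal
    _ = _ := by rw [e₂]; monoidal

end MirrorDual

/-! ### The exchange morphism in the reversed category -/

section MirrorConv

open MonoidalOpposite

variable {C : Type u} [Category.{v} C] [MonoidalCategory C] [BraidedCategory C]
variable {H B : C} [HopfObj H] [ExactPairing H B]

theorem unmop_convOne : (convOne (mop H) (mop B)).unmop = convOne H B := by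
  refine unmop_eq_of_ev (H := H) (T := 𝟙_ C) ?_
  have h := congrArg Quiver.Hom.unmop (convOne_ev (H := mop H) (B := mop B))
  refine h.trans ?_
  rw [convOne_ev, braiding_tensorUnit_right, Category.assoc, Iso.inv_hom_id_assoc]
  rfl

variable [Transparent H]

omit [HopfObj H] in
theorem unmop_dualAct (ω : H ⊗ H ⟶ H) :
    (dualAct (mop H) (mop B) ω.mop).unmop =
      (β_ B H).hom ≫ dualAct H B ((β_ H H).hom ≫ ω) := by
  refine unmop_eq_of_ev (H := H) (T := B ⊗ H) ?_
  have h := congrArg Quiver.Hom.unmop (dualAct_ev (H := mop H) (B := mop B) ω.mop)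
  refine h.trans ?_
  change H ◁ (β_ B H).hom ≫ (α_ H H B).inv ≫ ω ▷ B ≫ (β_ H B).hom ≫
    ExactPairing.evaluation H B = _
  have e : (β_ B H).hom ▷ H ≫ (β_ H B).hom ▷ H = 𝟙 _ := by
    rw [← comp_whiskerRight, braiding_symm_right, id_whiskerRight]
  have e' : H ◁ (β_ B H).hom ≫ H ◁ (β_ H B).hom = 𝟙 _ := by
    rw [← MonoidalCategory.whiskerLeft_comp, braiding_symm_right, MonoidalCategory.whiskerLeft_id]
  have e'' : B ◁ (β_ H H).hom ≫ B ◁ (β_ H H).hom = 𝟙 _ := by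
    rw [← MonoidalCategory.whiskerLeft_comp, braiding_symm_right, MonoidalCategory.whiskerLeft_id]
  rw [comp_whiskerRight, Category.assoc, dualAct_ev, reassoc_of% e, braiding_tensor_right_hom,
    braiding_naturality_left_assoc, braiding_tensor_left_hom]
  simp only [Category.assoc, MonoidalCategory.whiskerLeft_comp]
  rw [Iso.inv_hom_id_assoc, reassoc_of% e', Iso.inv_hom_id_assoc, reassoc_of% e'']

theorem unmop_convMul : (convMul (mop H) (mop B)).unmop = convMul H B := by
  refine unmop_eq_of_ev (H := H) (T := B ⊗ B) ?_
  have h := congrArg Quiver.Hom.unmop (convMul_ev (H := mop H) (B := mop B))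
  refine h.trans ?_
  rw [convMul_ev, ← braiding_naturality_left_assoc, ← unmop_evTwo]
  rfl

theorem unmop_convComul : (convComul (mop H) (mop B)).unmop = convComul H B := by
  refine eq_of_evTwo (H := H) ?_
  rw [convComul_ev, ← cancel_epi (β_ (H ⊗ H) B).hom, ← braiding_naturality_right_assoc,
    ← unmop_evTwo, ← braiding_naturality_left_assoc]
  exact congrArg Quiver.Hom.unmop (convComul_ev (H := mop H) (B := mop B))

theorem unmop_actMul : (actMul (mop H) (mop B)).unmop = (β_ B H).hom ≫ dualAct H B μ[H] := by
  have h := unmop_dualAct (B := B) (mulOp H)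
  rw [← Category.assoc (β_ H H).hom, braiding_symm_left, Category.id_comp] at h
  exact h

variable [IsIso (HopfObj.antipode (X := H))]

omit [Transparent H] in
theorem antipodeInv_dualAct (ω : H ⊗ H ⟶ H) :
    antipodeInv H ▷ B ≫ dualAct H B ω = dualAct H B (antipodeInv H ▷ H ≫ ω) := by
  refine eq_of_ev (H := H) ?_
  rw [comp_whiskerRight, Category.assoc, dualAct_ev, dualAct_ev, MonoidalCategory.whiskerLeft_comp,
    Category.assoc, ← comp_whiskerRight_assoc, braiding_naturality_left, comp_whiskerRight_assoc]
  monoidal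

theorem unmop_actInv :
    (actInv (mop H) (mop B)).unmop = (β_ B H).hom ≫ antipodeInv H ▷ B ≫ actMul H B := by
  have h := unmop_dualAct (B := B) (H ◁ antipodeInv H ≫ μ[H])
  rw [← braiding_naturality_left_assoc, ← antipodeInv_dualAct] at h
  refine Eq.trans ?_ h
  have e : mulInv (mop H) = (H ◁ antipodeInv H ≫ μ[H]).mop := Quiver.Hom.unmop_inj (by
    change H ◁ (antipodeInv (mop H)).unmop ≫ μ[H] = _
    rw [unmop_antipodeInv]
    rfl)
  rw [actInv, e]

variable (H B) in
/-- The morphism `h ⊗ f ↦ h₂ ⊗ f(- S⁻¹(h₁))`. -/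
noncomputable def preExchange : H ⊗ B ⟶ H ⊗ B :=
  comulOp H ▷ B ≫ (α_ H H B).hom ≫ H ◁ (antipodeInv H ▷ B ≫ actMul H B)

variable (H B) in
/-- The morphism `h ⊗ f ↦ f(S⁻¹(h₂) -) ⊗ h₁`. -/
noncomputable def postExchange : H ⊗ B ⟶ B ⊗ H :=
  comulOp H ▷ B ≫ (α_ H H B).hom ≫ H ◁ (β_ H B).hom ≫ (α_ H B H).inv ≫ actInv H B ▷ H

theorem preExchange_exchange : preExchange H B ≫ exchange H B = postExchange H B := by
  have h := preExch_exch (H := H) (B := B) (𝟙_ C)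
  have e : preExchange H B = H ◁ (ρ_ B).inv ≫ preExch H B (𝟙_ C) ≫ H ◁ (ρ_ B).hom := by
    simp only [preExchange, preExch, fuse, split]; monoidal
  rw [e, exchange]
  simp only [Category.assoc]
  rw [← MonoidalCategory.whiskerLeft_comp_assoc, Iso.hom_inv_id, MonoidalCategory.whiskerLeft_id,
    Category.id_comp, reassoc_of% h]
  simp only [mix, fuse, split, cross, postExchange]; monoidal

instance : IsIso (preExchange H B) := by
  have e : preExchange H B = H ◁ (ρ_ B).inv ≫ preExch H B (𝟙_ C) ≫ H ◁ (ρ_ B).hom := by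
    simp only [preExchange, preExch, fuse, split]; monoidal
  rw [e]
  infer_instance

/-- Reversal of the tensor product interchanges the morphisms `preExchange` and `postExchange`, of
which `exchange` is the quotient. -/
theorem unmop_preExchange :
    (preExchange (mop H) (mop B)).unmop = (β_ B H).hom ≫ postExchange H B := by
  have e : (preExchange (mop H) (mop B)).unmop = B ◁ comulOp H ≫ (α_ B H H).inv ≫
      (B ◁ (antipodeInv (mop H)).unmop ≫ (actMul (mop H) (mop B)).unmop) ▷ H := rfl
  have e' : H ◁ (β_ B H).hom ≫ H ◁ (β_ H B).hom = 𝟙 _ := by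
    rw [← MonoidalCategory.whiskerLeft_comp, braiding_symm_right, MonoidalCategory.whiskerLeft_id]
  rw [e, unmop_antipodeInv, unmop_actMul, braiding_naturality_right_assoc, antipodeInv_dualAct,
    postExchange, ← braiding_naturality_right_assoc, braiding_tensor_right_hom]
  simp only [Category.assoc]
  rw [Iso.inv_hom_id_assoc, reassoc_of% e', Iso.hom_inv_id_assoc, comp_whiskerRight]
  rfl

theorem unmop_postExchange :
    (postExchange (mop H) (mop B)).unmop = (β_ B H).hom ≫ preExchange H B := by
  have e : (postExchange (mop H) (mop B)).unmop = B ◁ comulOp H ≫ (α_ B H H).inv ≫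
      (β_ B H).hom ▷ H ≫ (α_ H B H).hom ≫ H ◁ (actInv (mop H) (mop B)).unmop := rfl
  have e' := braiding_naturality_right B (comulOp H)
  rw [e, unmop_actInv, preExchange, ← reassoc_of% e', braiding_tensor_right_hom]
  simp

instance : IsIso (postExchange H B) := by
  have h := unmop_preExchange (H := H) (B := B)
  have : IsIso ((β_ B H).hom ≫ postExchange H B) := by rw [← h]; infer_instance
  exact IsIso.of_isIso_comp_left (β_ B H).hom _

/-- The exchange morphisms of `H` and of `H` in the reversed category are inverse to each other. -/
theorem exchange_unmop_exchange :
    exchange H B ≫ (exchange (mop H) (mop B)).unmop = 𝟙 (H ⊗ B) ∧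
      (exchange (mop H) (mop B)).unmop ≫ exchange H B = 𝟙 (B ⊗ H) := by
  have h := congrArg Quiver.Hom.unmop (preExchange_exchange (H := mop H) (B := mop B))
  have h' : (preExchange (mop H) (mop B)).unmop ≫ (exchange (mop H) (mop B)).unmop =
    (postExchange (mop H) (mop B)).unmop := h
  rw [unmop_preExchange, unmop_postExchange, Category.assoc, cancel_epi] at h'
  constructor
  · rw [← cancel_epi (preExchange H B), reassoc_of% (preExchange_exchange (H := H) (B := B)), h']
    exact (Category.comp_id _).symm
  · rw [← cancel_epi (postExchange H B), reassoc_of% h', preExchange_exchange]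
    exact (Category.comp_id _).symm

end MirrorConv

/-! ### Right Yetter-Drinfeld modules -/

section RightYetterDrinfeld

open MonoidalOpposite

variable {C : Type u} [Category.{v} C] [MonoidalCategory C] [BraidedCategory C]
variable {H B : C} [HopfObj H] {M N : C}

theorem unmop_ydL (a : M ⊗ H ⟶ M) (c : M ⟶ M ⊗ H) :
    (ydL (H := mop H) (N := mop M) Δ[H].mop μ[H].mop a.mop c.mop).unmop =
      ydL' Δ[H] μ[H] a c := by
  simp only [ydL, ydL', unmop_comp]
  rfl

theorem unmop_ydR (a : M ⊗ H ⟶ M) (c : M ⟶ M ⊗ H) :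
    (ydR (H := mop H) (N := mop M) Δ[H].mop μ[H].mop a.mop c.mop).unmop =
      ydR' Δ[H] μ[H] a c := by
  simp only [ydR, ydR', unmop_comp, unmop_tensorμ]
  rfl

theorem tensorAct_mop {A : C} (δ : A ⟶ A ⊗ A) (aM : M ⊗ A ⟶ M) (aN : N ⊗ A ⟶ N) :
    tensorAct (H := mop A) (M := mop N) (N := mop M) δ.mop aN.mop aM.mop =
      (tensorActR δ aM aN).mop := by
  apply Quiver.Hom.unmop_inj
  simp only [tensorAct, tensorActR, unmop_comp, unmop_tensorμ]
  rfl

theorem tensorCoact_mop (cM : M ⟶ M ⊗ H) (cN : N ⟶ N ⊗ H) :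
    tensorCoact (H := mop H) (M := mop N) (N := mop M) μ[H].mop cN.mop cM.mop =
      (tensorCoactR μ[H] cM cN).mop := by
  apply Quiver.Hom.unmop_inj
  simp only [tensorCoact, tensorCoactR, unmop_comp, unmop_tensorμ]
  rfl

/-- The laws of a right-right Yetter-Drinfeld module with action `a` and coaction `c`. -/
structure IsRightYD (a : M ⊗ H ⟶ M) (c : M ⟶ M ⊗ H) : Prop where
  one : M ◁ η[H] ≫ a = (ρ_ M).hom
  mul : M ◁ μ[H] ≫ a = (α_ M H H).inv ≫ a ▷ H ≫ a
  counit : c ≫ M ◁ ε[H] = (ρ_ M).inv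
  coassoc : c ≫ M ◁ Δ[H] = c ≫ c ▷ H ≫ (α_ M H H).hom
  yd : ydL' Δ[H] μ[H] a c = ydR' Δ[H] μ[H] a c

/-- Right-right Yetter-Drinfeld modules are left-left Yetter-Drinfeld modules in the reversed
category. -/
theorem isLeftYD_mop_iff {a : M ⊗ H ⟶ M} {c : M ⟶ M ⊗ H} :
    IsLeftYD (H := mop H) (M := mop M) a.mop c.mop ↔ IsRightYD a c := by
  constructor
  · rintro ⟨h₁, h₂, h₃, h₄, h₅⟩
    exact ⟨congrArg Quiver.Hom.unmop h₁, congrArg Quiver.Hom.unmop h₂,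
      congrArg Quiver.Hom.unmop h₃, congrArg Quiver.Hom.unmop h₄,
      (unmop_ydL a c).symm.trans ((congrArg Quiver.Hom.unmop h₅).trans (unmop_ydR a c))⟩
  · rintro ⟨h₁, h₂, h₃, h₄, h₅⟩
    exact ⟨Quiver.Hom.unmop_inj h₁, Quiver.Hom.unmop_inj h₂, Quiver.Hom.unmop_inj h₃,
      Quiver.Hom.unmop_inj h₄,
      Quiver.Hom.unmop_inj ((unmop_ydL a c).trans (h₅.trans (unmop_ydR a c).symm))⟩

theorem IsRightYD.tensor {aM : M ⊗ H ⟶ M} {cM : M ⟶ M ⊗ H} {aN : N ⊗ H ⟶ N}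
    {cN : N ⟶ N ⊗ H} (hM : IsRightYD aM cM) (hN : IsRightYD aN cN) :
    IsRightYD (tensorActR Δ[H] aM aN) (tensorCoactR μ[H] cM cN) where
  one := tensorActR_one aM aN hM.one hN.one
  mul := tensorActR_mul aM aN hM.mul hN.mul
  counit := tensorCoactR_counit cM cN hM.counit hN.counit
  coassoc := tensorCoactR_coassoc cM cN hM.coassoc hN.coassoc
  yd := ydT' _ _ aM cM aN cN (MonObj.mul_assoc H)
    (by rw [ComonObj.comul_assoc_assoc, Iso.hom_inv_id, Category.comp_id]) hM.yd hN.yd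

theorem isRightYD_unit :
    IsRightYD (M := 𝟙_ C) ((λ_ H).hom ≫ ε[H]) (η[H] ≫ (λ_ H).inv) where
  one := unitActR_one
  mul := unitActR_mul
  counit := unitCoactR_counit
  coassoc := unitCoactR_coassoc
  yd := unit_yd'

variable [IsIso (HopfObj.antipode (X := H))] [ExactPairing H B]

variable (B) in
/-- The right action `m f = f(S⁻¹(m₁)) m₀` of the dual of `H` given by a right coaction of `H`. -/
noncomputable def dualActionR (c : M ⟶ M ⊗ H) : M ⊗ B ⟶ M :=
  (dualAction (H := mop H) (M := mop M) (mop B) c.mop).unmop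

variable (H) in
/-- The right coaction of `H` given by a right action of its dual. -/
def coactionOfR (b : M ⊗ B ⟶ M) : M ⟶ M ⊗ H :=
  (coactionOf (mop H) (B := mop B) (M := mop M) b.mop).unmop

theorem dualActionR_eq (c : M ⟶ M ⊗ H) : dualActionR B c =
    c ▷ B ≫ (α_ M H B).hom ≫ M ◁ antipodeInv H ▷ B ≫
      M ◁ ((β_ H B).hom ≫ ExactPairing.evaluation H B) ≫ (ρ_ M).hom := by
  have e : dualActionR B c = (c ≫ M ◁ (antipodeInv (mop H)).unmop) ▷ B ≫
      (evT (mop H) (mop B) (mop M)).unmop := rfl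
  have e' : (evT (mop H) (mop B) (mop M)).unmop = (α_ M H B).hom ≫
      M ◁ ((β_ H B).hom ≫ ExactPairing.evaluation H B) ≫ (ρ_ M).hom := by
    simp only [evT, cap, unmop_comp]
    rfl
  rw [e, e', unmop_antipodeInv]
  monoidal

theorem dualActionR_coactionOfR (b : M ⊗ B ⟶ M) : dualActionR B (coactionOfR H b) = b :=
  congrArg Quiver.Hom.unmop (dualAction_coactionOf (H := mop H) (B := mop B) (M := mop M) b.mop)

theorem coactionOfR_dualActionR (c : M ⟶ M ⊗ H) : coactionOfR H (dualActionR B c) = c :=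
  congrArg Quiver.Hom.unmop (coactionOf_dualAction (H := mop H) (B := mop B) (M := mop M) c.mop)

theorem dualActionR_comp_iff (cM : M ⟶ M ⊗ H) (cN : N ⟶ N ⊗ H) (f : M ⟶ N) :
    dualActionR B cM ≫ f = f ▷ B ≫ dualActionR B cN ↔ cM ≫ f ▷ H = f ≫ cN := by
  have h := dualAction_comp_iff (H := mop H) (B := mop B) (M := mop M) cM.mop cN.mop f.mop
  constructor
  · exact fun k => congrArg Quiver.Hom.unmop (h.1 (Quiver.Hom.unmop_inj k))
  · exact fun k => congrArg Quiver.Hom.unmop (h.2 (Quiver.Hom.unmop_inj k))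

variable [Transparent H]

/-- The compatibility of left modules with the exchange morphism in the reversed category is that of
right modules with the exchange morphism, as the two exchange morphisms are inverse to each other.
-/
theorem exchange_compat_iff (a : M ⊗ H ⟶ M) (b : M ⊗ B ⟶ M) :
    mop H ◁ b.mop ≫ a.mop = tailed (exchange (mop H) (mop B)) (mop M) ≫ mop B ◁ a.mop ≫ b.mop ↔
      a ▷ B ≫ b = (α_ M H B).hom ≫ M ◁ exchange H B ≫ (α_ M B H).inv ≫ b ▷ H ≫ a := by
  obtain ⟨e₁, e₂⟩ := exchange_unmop_exchange (H := H) (B := B)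
  have h : mop H ◁ b.mop ≫ a.mop =
      tailed (exchange (mop H) (mop B)) (mop M) ≫ mop B ◁ a.mop ≫ b.mop ↔
      b ▷ H ≫ a = (α_ M B H).hom ≫ M ◁ (exchange (mop H) (mop B)).unmop ≫ (α_ M H B).inv ≫
        a ▷ B ≫ b := by
    constructor
    · intro k
      refine (congrArg Quiver.Hom.unmop k).trans ?_
      simp only [tailed, Category.assoc]
      rfl
    · intro k
      refine Quiver.Hom.unmop_inj (Eq.trans k ?_)
      simp only [tailed, Category.assoc]
      rfl
  rw [h]
  constructor
  · intro k
    rw [k, Iso.inv_hom_id_assoc, ← MonoidalCategory.whiskerLeft_comp_assoc, e₁]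
    simp
  · intro k
    rw [k, Iso.inv_hom_id_assoc, ← MonoidalCategory.whiskerLeft_comp_assoc, e₂]
    simp

/-- Right-right Yetter-Drinfeld modules are right modules over `H` and over its dual whose actions
are compatible with the exchange morphism of the double. -/
theorem isRightYD_iff (a : M ⊗ H ⟶ M) (c : M ⟶ M ⊗ H) :
    IsRightYD a c ↔
      (M ◁ η[H] ≫ a = (ρ_ M).hom ∧ M ◁ μ[H] ≫ a = (α_ M H H).inv ≫ a ▷ H ≫ a) ∧
      (M ◁ convOne H B ≫ dualActionR B c = (ρ_ M).hom ∧
        M ◁ convMul H B ≫ dualActionR B c =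
          (α_ M B B).inv ≫ dualActionR B c ▷ B ≫ dualActionR B c) ∧
      a ▷ B ≫ dualActionR B c = (α_ M H B).hom ≫ M ◁ exchange H B ≫ (α_ M B H).inv ≫
        dualActionR B c ▷ H ≫ a := by
  rw [← isLeftYD_mop_iff, isLeftYD_iff (B := mop B), ← exchange_compat_iff,
    ← unmop_convOne (H := H) (B := B), ← unmop_convMul (H := H) (B := B)]
  constructor
  · rintro ⟨⟨h₁, h₂⟩, ⟨h₃, h₄⟩, h₅⟩
    exact ⟨⟨congrArg Quiver.Hom.unmop h₁, congrArg Quiver.Hom.unmop h₂⟩,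
      ⟨congrArg Quiver.Hom.unmop h₃, congrArg Quiver.Hom.unmop h₄⟩, h₅⟩
  · rintro ⟨⟨h₁, h₂⟩, ⟨h₃, h₄⟩, h₅⟩
    exact ⟨⟨Quiver.Hom.unmop_inj h₁, Quiver.Hom.unmop_inj h₂⟩,
      ⟨Quiver.Hom.unmop_inj h₃, Quiver.Hom.unmop_inj h₄⟩, h₅⟩

theorem dualActionR_tensorCoactR (cM : M ⟶ M ⊗ H) (cN : N ⟶ N ⊗ H) :
    dualActionR B (tensorCoactR μ[H] cM cN) =
      tensorActR (convComul H B) (dualActionR B cM) (dualActionR B cN) := by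
  have h := dualAction_tensorCoact (H := mop H) (B := mop B) (M := mop N) (N := mop M)
    cN.mop cM.mop
  rw [← unmop_convComul]
  have h' := tensorAct_mop (convComul (mop H) (mop B)).unmop (dualActionR B cM) (dualActionR B cN)
  have h'' := tensorCoact_mop cM cN
  refine congrArg Quiver.Hom.unmop (Eq.trans ?_ (h.trans h'))
  exact congrArg (dualAction (H := mop H) (mop B)) h''.symm

theorem tensorActR_smashActR {P Q : C} (δP : P ⟶ P ⊗ P) (δQ : Q ⟶ Q ⊗ Q) (pM : M ⊗ P ⟶ M)
    (qM : M ⊗ Q ⟶ M) (pN : N ⊗ P ⟶ N) (qN : N ⊗ Q ⟶ N) :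
    tensorActR ((δP ⊗ₘ δQ) ≫ tensorμ P P Q Q) (smashActR qM pM) (smashActR qN pN) =
      smashActR (tensorActR δQ qM qN) (tensorActR δP pM pN) := by
  apply Quiver.Hom.mop_inj
  rw [← tensorAct_mop]
  have h := tensorAct_smashAct δQ.mop δP.mop pN.mop qN.mop pM.mop qM.mop
  refine Eq.trans ?_ (h.trans ?_)
  · congr 1
    apply Quiver.Hom.unmop_inj
    simp only [unmop_comp, unmop_tensorμ]
    rfl
  · rw [tensorAct_mop, tensorAct_mop]
    rfl

end RightYetterDrinfeld

/-! ### Right actions of the double and their braidings -/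

section RightDoubleActions

variable {C : Type u} [Category.{v} C] [MonoidalCategory C] [BraidedCategory C]

omit [BraidedCategory C] in
theorem smashActR_comp {H B M N : C} {a : M ⊗ H ⟶ M} {b : M ⊗ B ⟶ M} {a' : N ⊗ H ⟶ N}
    {b' : N ⊗ B ⟶ N} {f : M ⟶ N} (ha : a ≫ f = f ▷ H ≫ a') (hb : b ≫ f = f ▷ B ≫ b') :
    smashActR a b ≫ f = f ▷ (B ⊗ H) ≫ smashActR a' b' := by
  simp only [smashActR, Category.assoc, ha, ← comp_whiskerRight_assoc, hb]
  monoidal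

variable {H : C} [HopfObj H] [Transparent H] [IsIso (HopfObj.antipode (X := H))]
variable {fin : FiniteObj H} {M N : C}

/-- A right-right Yetter-Drinfeld module is a right module over the double. -/
theorem IsRightYD.double {a : M ⊗ H ⟶ M} {c : M ⟶ M ⊗ H} (h : IsRightYD a c) :
    M ◁ doubleOne fin ≫ smashActR a (dualActionR fin.dual c) = (ρ_ M).hom ∧
      M ◁ doubleMul fin ≫ smashActR a (dualActionR fin.dual c) =
        (α_ _ _ _).inv ≫ smashActR a (dualActionR fin.dual c) ▷ double fin ≫
          smashActR a (dualActionR fin.dual c) := by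
  obtain ⟨⟨h₁, h₂⟩, ⟨h₃, h₄⟩, h₅⟩ := (isRightYD_iff (B := fin.dual) a c).1 h
  rw [doubleMul_eq, dualMul_eq]
  refine ⟨smashActR_one h₁ ?_, smashActR_mul h₂ h₄ h₅⟩
  rw [dualOne_eq, h₃]

/-- A right module over the double comes from a right-right Yetter-Drinfeld module. -/
theorem isRightYD_of_double {d : M ⊗ double fin ⟶ M} (h₁ : M ◁ doubleOne fin ≫ d = (ρ_ M).hom)
    (h₂ : M ◁ doubleMul fin ≫ d = (α_ _ _ _).inv ≫ d ▷ double fin ≫ d) :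
    IsRightYD (M ◁ inclH fin ≫ d) (coactionOfR H (M ◁ inclB fin ≫ d)) ∧
      smashActR (M ◁ inclH fin ≫ d) (M ◁ inclB fin ≫ d) = d := by
  have e : smashActR (M ◁ inclH fin ≫ d) (M ◁ inclB fin ≫ d) = d := by
    rw [smashActR, act_actR (inclB fin) (inclH fin) h₂, inclB_inclH_mul,
      MonoidalCategory.whiskerLeft_id, Category.id_comp, Iso.inv_hom_id_assoc]
  refine ⟨?_, e⟩
  rw [isRightYD_iff (B := fin.dual), dualActionR_coactionOfR]
  refine ⟨⟨?_, ?_⟩, ⟨?_, ?_⟩, ?_⟩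
  · rw [← MonoidalCategory.whiskerLeft_comp_assoc, one_inclH, h₁]
  · rw [act_actR (inclH fin) (inclH fin) h₂, inclH_mul, Iso.inv_hom_id_assoc,
      MonoidalCategory.whiskerLeft_comp, Category.assoc]
  · rw [← dualOne_eq, ← MonoidalCategory.whiskerLeft_comp_assoc, one_inclB, h₁]
  · rw [act_actR (inclB fin) (inclB fin) h₂, inclB_mul, dualMul_eq]; simp
  · rw [act_actR (inclH fin) (inclB fin) h₂, inclH_inclB_mul]
    conv_lhs => rw [← e]
    simp only [smashActR]

omit [Transparent H] [IsIso (HopfObj.antipode (X := H))] in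
theorem inclH_smashActR {a : M ⊗ H ⟶ M} {b : M ⊗ fin.dual ⟶ M}
    (h : M ◁ dualOne fin ≫ b = (ρ_ M).hom) : M ◁ inclH fin ≫ smashActR a b = a := by
  calc
    _ = 𝟙 _ ⊗≫ (M ◁ dualOne fin ≫ b) ▷ H ≫ a := by
      simp only [inclH, smashActR]; monoidal
    _ = _ := by rw [h]; monoidal

omit [Transparent H] [IsIso (HopfObj.antipode (X := H))] in
theorem inclB_smashActR {a : M ⊗ H ⟶ M} {b : M ⊗ fin.dual ⟶ M}
    (h : M ◁ η[H] ≫ a = (ρ_ M).hom) : M ◁ inclB fin ≫ smashActR a b = b := by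
  calc
    _ = 𝟙 _ ⊗≫ ((M ⊗ fin.dual) ◁ η[H] ≫ b ▷ H) ≫ a := by
      simp only [inclB, smashActR]; monoidal
    _ = 𝟙 _ ⊗≫ b ⊗≫ M ◁ η[H] ≫ a := by rw [whisker_exchange]; monoidal
    _ = _ := by rw [h]; monoidal

theorem tensorActR_double {aM : M ⊗ H ⟶ M} {cM : M ⟶ M ⊗ H} {aN : N ⊗ H ⟶ N} {cN : N ⟶ N ⊗ H} :
    tensorActR (doubleComul fin) (smashActR aM (dualActionR fin.dual cM))
        (smashActR aN (dualActionR fin.dual cN)) =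
      smashActR (tensorActR Δ[H] aM aN) (dualActionR fin.dual (tensorCoactR μ[H] cM cN)) := by
  rw [doubleComul, tensorActR_smashActR, dualActionR_tensorCoactR, dualComul_eq]

omit [Transparent H] in
variable (fin) in
theorem smashActR_unit :
    smashActR ((λ_ H).hom ≫ ε[H]) (dualActionR fin.dual (η[H] ≫ (λ_ H).inv)) =
      (λ_ (double fin)).hom ≫ doubleCounit fin := by
  have h : η[H] ≫ antipodeInv H = η[H] := by
    have := ins_antipodeInv (H := H) (𝟙_ C)
    calc
      _ = 𝟙 _ ⊗≫ (ins η[H] (𝟙_ C) ≫ antipodeInv H ▷ 𝟙_ C) ⊗≫ 𝟙 _ := by rw [ins]; monoidal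
      _ = _ := by rw [this, ins]; monoidal
  have e : dualActionR fin.dual (η[H] ≫ (λ_ H).inv) = (λ_ fin.dual).hom ≫ dualCounit fin := by
    have h' := braiding_naturality_left η[H] fin.dual
    have e' : (ε_ H fin.dual : fin.dual ⊗ H ⟶ 𝟙_ C) = fin.ev := rfl
    rw [dualActionR_eq]
    calc
      _ = 𝟙 _ ⊗≫ (η[H] ≫ antipodeInv H) ▷ fin.dual ≫ (β_ H fin.dual).hom ≫ fin.ev := by
        rw [e']; monoidal
      _ = 𝟙 _ ⊗≫ fin.dual ◁ η[H] ≫ fin.ev := by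
        rw [h, reassoc_of% h', braiding_tensorUnit_left]; monoidal
      _ = _ := by rw [dualCounit]; monoidal
  rw [e, smashActR, doubleCounit, MonoidalCategory.tensorHom_def]
  monoidal

end RightDoubleActions

section RightBraiding

open MonoidalOpposite

variable {C : Type u} [Category.{v} C] [MonoidalCategory C] [BraidedCategory C]
variable {H M M' N N' P : C}

/-- The morphism `m ⊗ n ↦ n₀ ⊗ m n₁`. -/
def braidMapR (a : M ⊗ H ⟶ M) (c : N ⟶ N ⊗ H) : M ⊗ N ⟶ N ⊗ M :=
  M ◁ c ≫ (α_ M N H).inv ≫ (β_ M N).hom ▷ H ≫ (α_ N M H).hom ≫ N ◁ a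

theorem unmop_braidMap (a : M ⊗ H ⟶ M) (c : N ⟶ N ⊗ H) :
    (braidMap (H := mop H) (X := mop N) (N := mop M) c.mop a.mop).unmop = braidMapR a c :=
  rfl

theorem braidMapR_natural_right {c : N ⟶ N ⊗ H} {c' : N' ⟶ N' ⊗ H} {f : N ⟶ N'}
    (h : c ≫ f ▷ H = f ≫ c') (a : M ⊗ H ⟶ M) :
    M ◁ f ≫ braidMapR a c' = braidMapR a c ≫ f ▷ M :=
  congrArg Quiver.Hom.unmop (braidMap_natural_left (H := mop H) (X := mop N) (X' := mop N')
    (N := mop M) (c := c.mop) (c' := c'.mop) (f := f.mop) (Quiver.Hom.unmop_inj h) a.mop)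

theorem braidMapR_natural_left (c : N ⟶ N ⊗ H) {a : M ⊗ H ⟶ M} {a' : M' ⊗ H ⟶ M'} {g : M ⟶ M'}
    (h : a ≫ g = g ▷ H ≫ a') : g ▷ N ≫ braidMapR a' c = braidMapR a c ≫ N ◁ g :=
  congrArg Quiver.Hom.unmop (braidMap_natural_right (H := mop H) (X := mop N) (N := mop M)
    (P := mop M') c.mop (a := a.mop) (a' := a'.mop) (g := g.mop) (Quiver.Hom.unmop_inj h))

theorem colinear_of_braidMapR_mul [MonObj H] {c : N ⟶ N ⊗ H} {c' : N' ⟶ N' ⊗ H} {f : N ⟶ N'}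
    (h : H ◁ f ≫ braidMapR μ[H] c' = braidMapR μ[H] c ≫ f ▷ H) : c ≫ f ▷ H = f ≫ c' :=
  congrArg Quiver.Hom.unmop (colinear_of_braidMap_mul (H := mop H) (X := mop N) (X' := mop N')
    (c := c.mop) (c' := c'.mop) (f := f.mop) (Quiver.Hom.unmop_inj h))

section Hopf

variable [HopfObj H]

theorem braidMapR_tensor_left {c : N ⟶ N ⊗ H} (aM : M ⊗ H ⟶ M) (aP : P ⊗ H ⟶ P)
    (h : c ≫ N ◁ Δ[H] = c ≫ c ▷ H ≫ (α_ N H H).hom) :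
    braidMapR (tensorActR Δ[H] aM aP) c = (α_ M P N).hom ≫ M ◁ braidMapR aP c ≫
      (α_ M N P).inv ≫ braidMapR aM c ▷ P ≫ (α_ N M P).hom := by
  have h' := braidMap_tensor_right (H := mop H) (X := mop N) (N := mop P) (P := mop M)
    (c := c.mop) aP.mop aM.mop (Quiver.Hom.unmop_inj h)
  rw [← unmop_braidMap, ← tensorAct_mop]
  exact congrArg Quiver.Hom.unmop h'

theorem braidMapR_tensor_right (cN : N ⟶ N ⊗ H) (cP : P ⟶ P ⊗ H) {a : M ⊗ H ⟶ M}
    (h : M ◁ μ[H] ≫ a = (α_ M H H).inv ≫ a ▷ H ≫ a) :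
    braidMapR a (tensorCoactR μ[H] cN cP) = (α_ M N P).inv ≫ braidMapR a cN ▷ P ≫
      (α_ N M P).hom ≫ N ◁ braidMapR a cP ≫ (α_ N P M).inv := by
  have h' := braidMap_tensor_left (H := mop H) (X := mop P) (Y := mop N) (N := mop M)
    cP.mop cN.mop (a := a.mop) (Quiver.Hom.unmop_inj h)
  rw [← unmop_braidMap, ← tensorCoact_mop]
  exact congrArg Quiver.Hom.unmop h'

theorem braidMapR_unit_right {a : M ⊗ H ⟶ M} (h : M ◁ η[H] ≫ a = (ρ_ M).hom) :
    braidMapR a (η[H] ≫ (λ_ H).inv) = (ρ_ M).hom ≫ (λ_ M).inv :=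
  congrArg Quiver.Hom.unmop (braidMap_unit_left (H := mop H) (N := mop M) (a := a.mop)
    (Quiver.Hom.unmop_inj h))

theorem braidMapR_linear {aN : N ⊗ H ⟶ N} {c : N ⟶ N ⊗ H} {a : M ⊗ H ⟶ M}
    (hN : IsRightYD aN c) (h : M ◁ μ[H] ≫ a = (α_ M H H).inv ≫ a ▷ H ≫ a) :
    tensorActR Δ[H] a aN ≫ braidMapR a c = braidMapR a c ▷ H ≫ tensorActR Δ[H] aN a := by
  have h' := braidMap_linear (H := mop H) (X := mop N) (N := mop M) (aX := aN.mop) (c := c.mop)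
    (a := a.mop) (isLeftYD_mop_iff.2 hN).yd (Quiver.Hom.unmop_inj h)
  have e₁ := tensorAct_mop Δ[H] a aN
  have e₂ := tensorAct_mop Δ[H] aN a
  have h'' := (congrArg (· ≫ _) e₁.symm).trans (h'.trans (congrArg (_ ≫ ·) e₂))
  exact congrArg Quiver.Hom.unmop h''

theorem braidMapR_colinear {c : N ⟶ N ⊗ H} {aM : M ⊗ H ⟶ M} {cM : M ⟶ M ⊗ H}
    (hM : IsRightYD aM cM) (h : c ≫ N ◁ Δ[H] = c ≫ c ▷ H ≫ (α_ N H H).hom) :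
    tensorCoactR μ[H] cM c ≫ braidMapR aM c ▷ H = braidMapR aM c ≫ tensorCoactR μ[H] c cM := by
  have h' := braidMap_colinear (H := mop H) (X := mop N) (Y := mop M) (c := c.mop) (aY := aM.mop)
    (cY := cM.mop) (isLeftYD_mop_iff.2 hM).yd (Quiver.Hom.unmop_inj h)
  have e₁ := tensorCoact_mop cM c
  have e₂ := tensorCoact_mop c cM
  have h'' := (congrArg (· ≫ _) e₁.symm).trans (h'.trans (congrArg (_ ≫ ·) e₂))
  exact congrArg Quiver.Hom.unmop h''

variable [IsIso (HopfObj.antipode (X := H))] [Transparent H]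

/-- The braiding of a right module `M` with a right-right Yetter-Drinfeld module `N`. -/
noncomputable def braidIsoR {aN : N ⊗ H ⟶ N} {c : N ⟶ N ⊗ H} (hN : IsRightYD aN c)
    {a : M ⊗ H ⟶ M} (h₁ : M ◁ η[H] ≫ a = (ρ_ M).hom)
    (h₂ : M ◁ μ[H] ≫ a = (α_ M H H).inv ≫ a ▷ H ≫ a) : M ⊗ N ≅ N ⊗ M :=
  let e := braidIso (H := mop H) (X := mop N) (N := mop M) (a := a.mop) (isLeftYD_mop_iff.2 hN)
    (Quiver.Hom.unmop_inj h₁) (Quiver.Hom.unmop_inj h₂)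
  { hom := braidMapR a c
    inv := e.inv.unmop
    hom_inv_id := congrArg Quiver.Hom.unmop e.hom_inv_id
    inv_hom_id := congrArg Quiver.Hom.unmop e.inv_hom_id }

/-- The inverse of the braiding is the action of the universal R-matrix, in terms of the actions of
`H` and of its dual. -/
theorem braidIsoR_inv {B : C} [ExactPairing H B] {aN : N ⊗ H ⟶ N} {c : N ⟶ N ⊗ H}
    (hN : IsRightYD aN c) {a : M ⊗ H ⟶ M} (h₁ : M ◁ η[H] ≫ a = (ρ_ M).hom)
    (h₂ : M ◁ μ[H] ≫ a = (α_ M H H).inv ≫ a ▷ H ≫ a) :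
    (braidIsoR hN h₁ h₂).inv =
      (ρ_ (N ⊗ M)).inv ≫ (N ⊗ M) ◁ (ExactPairing.coevaluation H B ≫ (β_ B H).inv) ≫
        tensorμ N M B H ≫ (dualActionR B c ⊗ₘ a) ≫ (β_ M N).inv := by
  have h := congrArg Quiver.Hom.unmop
    (twist_eq (H := mop H) (B := mop B) (X := mop N) (N := mop M) c.mop a.mop)
  refine h.symm.trans ?_
  have e : (coevT (mop H) (mop B) (mop M ⊗ mop N)).unmop = (ρ_ (N ⊗ M)).inv ≫
      (N ⊗ M) ◁ (ExactPairing.coevaluation H B ≫ (β_ B H).inv) ≫ (α_ (N ⊗ M) B H).inv := by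
    simp only [coevT, cup, unmop_comp]
    rfl
  have e' : (cross (mop B) (mop M) (mop N)).unmop =
      (α_ N M B).hom ≫ N ◁ (β_ M B).hom ≫ (α_ N B M).inv := by
    simp only [cross, unmop_comp]
    rfl
  have e'' : (fuse a.mop (mop N)).unmop = (α_ N M H).hom ≫ N ◁ a := rfl
  change (coevT (mop H) (mop B) (mop M ⊗ mop N)).unmop ≫
    (cross (mop B) (mop M) (mop N)).unmop ▷ H ≫ (dualActionR B c ▷ M) ▷ H ≫
      (fuse a.mop (mop N)).unmop ≫ (β_ M N).inv = _
  rw [e, e', e'', tensorμ, MonoidalCategory.tensorHom_def]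
  monoidal

end Hopf

end RightBraiding

/-! ### Right Yetter-Drinfeld modules and the right center -/

noncomputable section RightCategories

variable {C : Type u} [Category.{v} C] [MonoidalCategory C] [BraidedCategory C]

instance {A : C} [MonObj A] : (RMod.forget A).Faithful where
  map_injective h := RMod.Hom.ext h

theorem RightYD.hom_ext {H : C} [BimonObj H] {M N : RightYD H} {f g : M ⟶ N}
    (h : f.hom.hom = g.hom.hom) : f = g :=
  RightYD.Hom.ext (RMod.Hom.ext h)

instance {H : C} [BimonObj H] : (RightYD.forgetToRMod H ⋙ RMod.forget H).Faithful where
  map_injective h := RightYD.hom_ext h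

omit [BraidedCategory C] in
theorem RMod.ext_act {A : C} [MonObj A] {M N : RMod C A} (hX : M.X = N.X)
    (h : HEq M.act N.act) : M = N := by
  obtain ⟨X, aX, _, _⟩ := M
  obtain ⟨Y, aY, _, _⟩ := N
  obtain rfl : X = Y := hX
  obtain rfl : aX = aY := eq_of_heq h
  rfl

theorem RightYD.ext_coact {H : C} [BimonObj H] {M N : RightYD H} (h : M.toRMod = N.toRMod)
    (h' : HEq M.coact N.coact) : M = N := by
  obtain ⟨X, a, _, _⟩ := M
  obtain ⟨Y, b, _, _⟩ := N
  obtain rfl : X = Y := h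
  obtain rfl : a = b := eq_of_heq h'
  rfl

variable {H : C} [HopfObj H]

theorem RightYD.isRightYD (M : RightYD H) : IsRightYD M.toRMod.act M.coact :=
  ⟨M.toRMod.act_one, M.toRMod.act_mul, M.coact_counit, M.coact_coassoc, M.yd⟩

variable [Transparent H] [IsIso (HopfObj.antipode (X := H))]

namespace RightYD

/-- The braiding of a module with a Yetter-Drinfeld module. -/
def braidModIso (M : RMod C H) (N : RightYD H) : M ⊗ N.toRMod ≅ N.toRMod ⊗ M :=
  RMod.isoMk (M := M ⊗ N.toRMod) (N := N.toRMod ⊗ M)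
    (braidIsoR N.isRightYD M.act_one M.act_mul) (braidMapR_linear N.isRightYD M.act_mul)

/-- The half-braiding of the underlying module of a Yetter-Drinfeld module. -/
def halfBraiding (N : RightYD H) : RightHalfBraiding N.toRMod where
  β U := braidModIso U N
  monoidal _ _ := RMod.Hom.ext (braidMapR_tensor_left _ _ N.coact_coassoc)
  naturality f := RMod.Hom.ext (braidMapR_natural_left _ f.act_hom)

/-- The braiding of the category of Yetter-Drinfeld modules. -/
instance : BraidedCategory (RightYD H) where
  braiding M N := isoMk (M := M ⊗ N) (N := N ⊗ M) (braidModIso M.toRMod N)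
    (braidMapR_colinear M.isRightYD N.coact_coassoc)
  braiding_naturality_right M _ _ f := hom_ext (braidMapR_natural_right f.coact_hom M.toRMod.act)
  braiding_naturality_left f N := hom_ext (braidMapR_natural_left N.coact f.hom.act_hom)
  hexagon_forward M N P := hom_ext (by
    change (α_ M.toRMod.X N.toRMod.X P.toRMod.X).hom ≫
      braidMapR M.toRMod.act (tensorCoactR μ[H] N.coact P.coact) ≫
        (α_ N.toRMod.X P.toRMod.X M.toRMod.X).hom =
      braidMapR M.toRMod.act N.coact ▷ P.toRMod.X ≫ (α_ _ _ _).hom ≫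
        N.toRMod.X ◁ braidMapR M.toRMod.act P.coact
    rw [braidMapR_tensor_right _ _ M.toRMod.act_mul]
    simp)
  hexagon_reverse M N P := hom_ext (by
    change (α_ M.toRMod.X N.toRMod.X P.toRMod.X).inv ≫
      braidMapR (tensorActR Δ[H] M.toRMod.act N.toRMod.act) P.coact ≫
        (α_ P.toRMod.X M.toRMod.X N.toRMod.X).inv =
      M.toRMod.X ◁ braidMapR N.toRMod.act P.coact ≫ (α_ _ _ _).inv ≫
        braidMapR M.toRMod.act P.coact ▷ N.toRMod.X
    rw [braidMapR_tensor_left _ _ P.coact_coassoc]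
    simp)

/-- The functor from Yetter-Drinfeld modules to the right center of the category of right
modules. -/
def toCenter : RightYD H ⥤ RightCenter (RMod C H) where
  obj M := ⟨M.toRMod, M.halfBraiding⟩
  map f := ⟨f.hom, fun U => RMod.Hom.ext (braidMapR_natural_right f.coact_hom U.act)⟩

variable (H) in
/-- The regular right module. -/
abbrev regular : RMod C H := ⟨H, μ[H], MonObj.mul_one H, by simp⟩

/-- A linear morphism that is compatible with the half-braidings is colinear: it suffices to look at
the half-braidings with the regular module. -/
theorem coact_hom_of_comm {M N : RightYD H} (f : M.toRMod ⟶ N.toRMod)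
    (h : regular H ◁ f ≫ (N.halfBraiding.β (regular H)).hom =
      (M.halfBraiding.β (regular H)).hom ≫ f ▷ regular H) :
    M.coact ≫ f.hom ▷ H = f.hom ≫ N.coact :=
  colinear_of_braidMapR_mul (congrArg RMod.Hom.hom h)

instance : (toCenter (H := H)).Full where
  map_surjective f := ⟨⟨f.hom, coact_hom_of_comm f.hom (f.comm _)⟩, rfl⟩

instance : (toCenter (H := H)).Faithful where
  map_injective h := Hom.ext (congrArg RightCenter.Hom.hom h)

theorem toCenter_injective : Function.Injective (toCenter (H := H)).obj := by
  intro M N h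
  obtain ⟨X, c, _, _, _⟩ := M
  obtain ⟨Y, c', _, _, _⟩ := N
  obtain ⟨h₁, h₂⟩ := RightCenter.mk.inj h
  change X = Y at h₁
  subst h₁
  have h₃ := congrArg (fun t : RightHalfBraiding X => (t.β (regular H)).hom) (eq_of_heq h₂)
  refine ext_coact rfl (heq_of_eq ?_)
  -- As the half-braidings agree, the identity is colinear, so the coactions are equal.
  have : c ≫ 𝟙 X.X ▷ H = 𝟙 X.X ≫ c' :=
    coact_hom_of_comm (M := ⟨X, c, ‹_›, ‹_›, ‹_›⟩) (N := ⟨X, c', ‹_›, ‹_›, ‹_›⟩) (𝟙 X) (by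
      rw [id_whiskerRight, MonoidalCategory.whiskerLeft_id, Category.id_comp, Category.comp_id]
      exact h₃.symm)
  rw [id_whiskerRight, Category.id_comp, Category.comp_id] at this
  exact this

/-- The functor to the right center is strictly monoidal on underlying objects. -/
def toCenterCoreMonoidal : (toCenter (H := H)).CoreMonoidal where
  εIso := RightCenter.isoMk (X := 𝟙_ (RightCenter (RMod C H)))
    (Y := (toCenter (H := H)).obj (𝟙_ (RightYD H))) (Iso.refl (𝟙_ (RMod C H))) fun U =>
      RMod.Hom.ext (by
    change U.X ◁ 𝟙 (𝟙_ C) ≫ braidMapR U.act (η[H] ≫ (λ_ H).inv) =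
      ((ρ_ U.X).hom ≫ (λ_ U.X).inv) ≫ 𝟙 (𝟙_ C) ▷ U.X
    rw [braidMapR_unit_right U.act_one]
    simp)
  μIso M N := RightCenter.isoMk
    (X := (toCenter (H := H)).obj M ⊗ (toCenter (H := H)).obj N)
    (Y := (toCenter (H := H)).obj (M ⊗ N)) (Iso.refl (M.toRMod ⊗ N.toRMod)) fun U =>
      RMod.Hom.ext (by
    change U.X ◁ 𝟙 (M.toRMod.X ⊗ N.toRMod.X) ≫
        braidMapR U.act (tensorCoactR μ[H] M.coact N.coact) =
      ((α_ _ _ _).inv ≫ braidMapR U.act M.coact ▷ N.toRMod.X ≫ (α_ _ _ _).hom ≫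
        M.toRMod.X ◁ braidMapR U.act N.coact ≫ (α_ _ _ _).inv) ≫
          𝟙 (M.toRMod.X ⊗ N.toRMod.X) ▷ U.X
    rw [braidMapR_tensor_right _ _ U.act_mul]
    simp)
  μIso_hom_natural_left f N := by
    refine RightCenter.Hom.ext ?_
    change f.hom ▷ N.toRMod ≫ 𝟙 _ = 𝟙 _ ≫ f.hom ▷ N.toRMod
    rw [Category.id_comp, Category.comp_id]
  μIso_hom_natural_right M f := by
    refine RightCenter.Hom.ext ?_
    change M.toRMod ◁ f.hom ≫ 𝟙 _ = 𝟙 _ ≫ M.toRMod ◁ f.hom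
    rw [Category.id_comp, Category.comp_id]
  associativity M N P := RightCenter.Hom.ext (by
    change 𝟙 (M.toRMod ⊗ N.toRMod) ▷ P.toRMod ≫ 𝟙 ((M.toRMod ⊗ N.toRMod) ⊗ P.toRMod) ≫
        (α_ M.toRMod N.toRMod P.toRMod).hom =
      (α_ M.toRMod N.toRMod P.toRMod).hom ≫ M.toRMod ◁ 𝟙 (N.toRMod ⊗ P.toRMod) ≫
        𝟙 (M.toRMod ⊗ N.toRMod ⊗ P.toRMod)
    simp)
  left_unitality M := RightCenter.Hom.ext (by
    change (λ_ M.toRMod).hom = 𝟙 (𝟙_ (RMod C H)) ▷ M.toRMod ≫ 𝟙 _ ≫ (λ_ M.toRMod).hom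
    simp)
  right_unitality M := RightCenter.Hom.ext (by
    change (ρ_ M.toRMod).hom = M.toRMod ◁ 𝟙 (𝟙_ (RMod C H)) ≫ 𝟙 _ ≫ (ρ_ M.toRMod).hom
    simp)

instance : (toCenter (H := H)).Braided where
  __ := toCenterCoreMonoidal.toMonoidal
  braided M N := by
    refine RightCenter.Hom.ext ?_
    change 𝟙 (M.toRMod ⊗ N.toRMod) ≫ (braidModIso M.toRMod N).hom =
      (braidModIso M.toRMod N).hom ≫ 𝟙 (N.toRMod ⊗ M.toRMod)
    rw [Category.id_comp, Category.comp_id]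

end RightYD

end RightCategories

/-! ### Right modules over the double -/

noncomputable section RightDoubleModules

variable {C : Type u} [Category.{v} C] [MonoidalCategory C] [BraidedCategory C]
variable {H : C} [HopfObj H] [Transparent H] [IsIso (HopfObj.antipode (X := H))] (fin : FiniteObj H)

omit [Transparent H] in
theorem RightYD.doubleAct_eq (M : RightYD H) :
    M.doubleAct fin = smashActR M.toRMod.act (dualActionR fin.dual M.coact) := by
  have e : (β_ H fin.dual).hom ≫ (ε_ H fin.dual : fin.dual ⊗ H ⟶ 𝟙_ C) = fin.ev' := rfl
  rw [RightYD.doubleAct, smashActR, dualActionR_eq, e, antipodeInv]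
  monoidal

/-- The right module over the double given by a Yetter-Drinfeld module. -/
def RightYD.toDoubleMod : RightYD H ⥤ RMod C (double fin) where
  obj M := ⟨M.toRMod.X, M.doubleAct fin,
    by rw [M.doubleAct_eq]; exact M.isRightYD.double.1,
    by rw [M.doubleAct_eq]; exact M.isRightYD.double.2⟩
  map {M N} f := ⟨f.hom.hom, by
    change M.doubleAct fin ≫ f.hom.hom = f.hom.hom ▷ double fin ≫ N.doubleAct fin
    rw [M.doubleAct_eq, N.doubleAct_eq]
    exact smashActR_comp f.hom.act_hom ((dualActionR_comp_iff _ _ _).2 f.coact_hom)⟩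

theorem isRightYD_of_rmod (M : RMod C (double fin)) :
    IsRightYD (M.X ◁ inclH fin ≫ M.act) (coactionOfR H (M.X ◁ inclB fin ≫ M.act)) ∧
      smashActR (M.X ◁ inclH fin ≫ M.act) (M.X ◁ inclB fin ≫ M.act) = M.act :=
  isRightYD_of_double M.act_one M.act_mul

/-- The Yetter-Drinfeld module given by a right module over the double. -/
def RightYD.ofDoubleMod : RMod C (double fin) ⥤ RightYD H where
  obj M :=
    { toRMod := (RMod.comap (inclH fin)).obj M
      coact := coactionOfR H (M.X ◁ inclB fin ≫ M.act)
      coact_counit := (isRightYD_of_rmod fin M).1.counit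
      coact_coassoc := (isRightYD_of_rmod fin M).1.coassoc
      yd := (isRightYD_of_rmod fin M).1.yd }
  map {M N} f := ⟨(RMod.comap (inclH fin)).map f, by
    refine (dualActionR_comp_iff (B := fin.dual) _ _ _).1 ?_
    rw [dualActionR_coactionOfR, dualActionR_coactionOfR]
    change (M.X ◁ inclB fin ≫ M.act) ≫ f.hom = f.hom ▷ fin.dual ≫ N.X ◁ inclB fin ≫ N.act
    rw [Category.assoc, f.act_hom, whisker_exchange_assoc]⟩

theorem RightYD.toDoubleMod_comp_ofDoubleMod :
    RightYD.toDoubleMod fin ⋙ RightYD.ofDoubleMod fin = 𝟭 (RightYD H) := by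
  refine functor_eq_of_faithful (RightYD.forgetToRMod H ⋙ RMod.forget H) (fun M => ?_)
    fun _ => HEq.rfl
  have h := M.isRightYD
  obtain ⟨⟨h₁, h₂⟩, ⟨h₃, h₄⟩, h₅⟩ := (isRightYD_iff (B := fin.dual) _ _).1 h
  rw [← dualOne_eq] at h₃
  refine RightYD.ext_coact (RMod.ext_act rfl (heq_of_eq ?_)) (heq_of_eq ?_)
  · change M.toRMod.X ◁ inclH fin ≫ M.doubleAct fin = M.toRMod.act
    rw [M.doubleAct_eq, inclH_smashActR h₃]
  · change coactionOfR H (M.toRMod.X ◁ inclB fin ≫ M.doubleAct fin) = M.coact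
    rw [M.doubleAct_eq, inclB_smashActR h₁, coactionOfR_dualActionR]

theorem RightYD.ofDoubleMod_comp_toDoubleMod :
    RightYD.ofDoubleMod fin ⋙ RightYD.toDoubleMod fin = 𝟭 (RMod C (double fin)) := by
  refine functor_eq_of_faithful (RMod.forget (double fin)) (fun M => ?_) fun _ => HEq.rfl
  refine RMod.ext_act rfl (heq_of_eq ?_)
  change ((RightYD.ofDoubleMod fin).obj M).doubleAct fin = M.act
  rw [RightYD.doubleAct_eq]
  change smashActR (M.X ◁ inclH fin ≫ M.act)
    (dualActionR fin.dual (coactionOfR H (M.X ◁ inclB fin ≫ M.act))) = M.act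
  rw [dualActionR_coactionOfR, (isRightYD_of_rmod fin M).2]

/-- The functor from Yetter-Drinfeld modules to right modules over the double is strictly monoidal
on underlying objects. -/
def RightYD.toDoubleModCoreMonoidal : (RightYD.toDoubleMod fin).CoreMonoidal where
  εIso := RMod.isoMk (M := 𝟙_ (RMod C (double fin)))
    (N := (RightYD.toDoubleMod fin).obj (𝟙_ (RightYD H))) (Iso.refl (𝟙_ C)) (by
      change ((λ_ (double fin)).hom ≫ doubleCounit fin) ≫ 𝟙 (𝟙_ C) =
        𝟙 (𝟙_ C) ▷ double fin ≫ (𝟙_ (RightYD H)).doubleAct fin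
      rw [RightYD.doubleAct_eq, Category.comp_id, id_whiskerRight, Category.id_comp]
      exact (smashActR_unit fin).symm)
  μIso M N := RMod.isoMk (M := (RightYD.toDoubleMod fin).obj M ⊗ (RightYD.toDoubleMod fin).obj N)
    (N := (RightYD.toDoubleMod fin).obj (M ⊗ N)) (Iso.refl (M.toRMod.X ⊗ N.toRMod.X)) (by
      change tensorActR (doubleComul fin) (M.doubleAct fin) (N.doubleAct fin) ≫ 𝟙 _ =
        𝟙 _ ▷ double fin ≫ (M ⊗ N).doubleAct fin
      rw [M.doubleAct_eq, N.doubleAct_eq, (M ⊗ N).doubleAct_eq, tensorActR_double,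
        Category.comp_id, id_whiskerRight, Category.id_comp]
      rfl)
  μIso_hom_natural_left {M M'} f N := RMod.Hom.ext (by
    change f.hom.hom ▷ N.toRMod.X ≫ 𝟙 _ = 𝟙 _ ≫ f.hom.hom ▷ N.toRMod.X
    rw [Category.id_comp, Category.comp_id])
  μIso_hom_natural_right M f := RMod.Hom.ext (by
    change M.toRMod.X ◁ f.hom.hom ≫ 𝟙 _ = 𝟙 _ ≫ M.toRMod.X ◁ f.hom.hom
    rw [Category.id_comp, Category.comp_id])
  associativity M N P := RMod.Hom.ext (by
    change 𝟙 (M.toRMod.X ⊗ N.toRMod.X) ▷ P.toRMod.X ≫ 𝟙 _ ≫ (α_ _ _ _).hom =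
      (α_ _ _ _).hom ≫ M.toRMod.X ◁ 𝟙 (N.toRMod.X ⊗ P.toRMod.X) ≫ 𝟙 _
    simp)
  left_unitality M := RMod.Hom.ext (by
    change (λ_ M.toRMod.X).hom = 𝟙 (𝟙_ C) ▷ M.toRMod.X ≫ 𝟙 _ ≫ (λ_ M.toRMod.X).hom
    simp)
  right_unitality M := RMod.Hom.ext (by
    change (ρ_ M.toRMod.X).hom = M.toRMod.X ◁ 𝟙 (𝟙_ C) ≫ 𝟙 _ ≫ (ρ_ M.toRMod.X).hom
    simp)

/-- The tensor product of right modules over the double has the diagonal action of `H` and the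
codiagonal coaction. -/
theorem inclH_doubleR (M N : RMod C (double fin)) :
    (M.X ⊗ N.X) ◁ inclH fin ≫ (M ⊗ N).act =
      tensorActR Δ[H] (M.X ◁ inclH fin ≫ M.act) (N.X ◁ inclH fin ≫ N.act) ∧
    coactionOfR H ((M.X ⊗ N.X) ◁ inclB fin ≫ (M ⊗ N).act) =
      tensorCoactR μ[H] (coactionOfR H (M.X ◁ inclB fin ≫ M.act))
        (coactionOfR H (N.X ◁ inclB fin ≫ N.act)) := by
  obtain ⟨hM, eM⟩ := isRightYD_of_rmod fin M
  obtain ⟨hN, eN⟩ := isRightYD_of_rmod fin N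
  have h := hM.tensor hN
  obtain ⟨⟨h₁, h₂⟩, ⟨h₃, h₄⟩, h₅⟩ := (isRightYD_iff (B := fin.dual) _ _).1 h
  rw [← dualOne_eq] at h₃
  have e : (M ⊗ N).act = tensorActR (doubleComul fin) M.act N.act := rfl
  rw [← eM, ← eN, ← dualActionR_coactionOfR (H := H) (M.X ◁ inclB fin ≫ M.act),
    ← dualActionR_coactionOfR (H := H) (N.X ◁ inclB fin ≫ N.act), tensorActR_double] at e
  rw [e, inclH_smashActR h₃, inclB_smashActR h₁, coactionOfR_dualActionR]
  exact ⟨rfl, rfl⟩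

theorem inclH_doubleR_unit :
    𝟙_ C ◁ inclH fin ≫ (𝟙_ (RMod C (double fin))).act = (λ_ H).hom ≫ ε[H] ∧
      coactionOfR H (𝟙_ C ◁ inclB fin ≫ (𝟙_ (RMod C (double fin))).act) =
        η[H] ≫ (λ_ H).inv := by
  obtain ⟨⟨h₁, h₂⟩, ⟨h₃, h₄⟩, h₅⟩ :=
    (isRightYD_iff (B := fin.dual) _ _).1 (isRightYD_unit (H := H))
  rw [← dualOne_eq] at h₃
  have e : (𝟙_ (RMod C (double fin))).act = (λ_ (double fin)).hom ≫ doubleCounit fin := rfl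
  rw [← smashActR_unit] at e
  rw [e, inclH_smashActR h₃, inclB_smashActR h₁, coactionOfR_dualActionR]
  exact ⟨rfl, rfl⟩

/-- The functor from right modules over the double to Yetter-Drinfeld modules is strictly monoidal
on underlying objects. -/
def RightYD.ofDoubleModCoreMonoidal : (RightYD.ofDoubleMod fin).CoreMonoidal where
  εIso := RightYD.isoMk (M := 𝟙_ (RightYD H)) (N := (RightYD.ofDoubleMod fin).obj (𝟙_ _))
    (RMod.isoMk (M := 𝟙_ (RMod C H)) (N := (RMod.comap (inclH fin)).obj (𝟙_ _)) (Iso.refl (𝟙_ C))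
      (by
      change ((λ_ H).hom ≫ ε[H]) ≫ 𝟙 (𝟙_ C) =
        𝟙 (𝟙_ C) ▷ H ≫ 𝟙_ C ◁ inclH fin ≫ (𝟙_ (RMod C (double fin))).act
      rw [(inclH_doubleR_unit fin).1]
      simp))
    (by
      change (η[H] ≫ (λ_ H).inv) ≫ 𝟙 (𝟙_ C) ▷ H =
        𝟙 (𝟙_ C) ≫ coactionOfR H (𝟙_ C ◁ inclB fin ≫ (𝟙_ (RMod C (double fin))).act)
      rw [(inclH_doubleR_unit fin).2]
      simp)
  μIso M N := RightYD.isoMk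
    (M := (RightYD.ofDoubleMod fin).obj M ⊗ (RightYD.ofDoubleMod fin).obj N)
    (N := (RightYD.ofDoubleMod fin).obj (M ⊗ N))
    (RMod.isoMk (M := (RMod.comap (inclH fin)).obj M ⊗ (RMod.comap (inclH fin)).obj N)
      (N := (RMod.comap (inclH fin)).obj (M ⊗ N)) (Iso.refl (M.X ⊗ N.X)) (by
      change tensorActR Δ[H] (M.X ◁ inclH fin ≫ M.act) (N.X ◁ inclH fin ≫ N.act) ≫
          𝟙 (M.X ⊗ N.X) = 𝟙 (M.X ⊗ N.X) ▷ H ≫ (M.X ⊗ N.X) ◁ inclH fin ≫ (M ⊗ N).act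
      rw [(inclH_doubleR fin M N).1]
      simp))
    (by
      change tensorCoactR μ[H] (coactionOfR H (M.X ◁ inclB fin ≫ M.act))
        (coactionOfR H (N.X ◁ inclB fin ≫ N.act)) ≫ 𝟙 (M.X ⊗ N.X) ▷ H =
          𝟙 (M.X ⊗ N.X) ≫ coactionOfR H ((M.X ⊗ N.X) ◁ inclB fin ≫ (M ⊗ N).act)
      rw [(inclH_doubleR fin M N).2]
      simp)
  μIso_hom_natural_left {M M'} f N := RightYD.hom_ext (by
    change f.hom ▷ N.X ≫ 𝟙 _ = 𝟙 _ ≫ f.hom ▷ N.X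
    rw [Category.id_comp, Category.comp_id])
  μIso_hom_natural_right M f := RightYD.hom_ext (by
    change M.X ◁ f.hom ≫ 𝟙 _ = 𝟙 _ ≫ M.X ◁ f.hom
    rw [Category.id_comp, Category.comp_id])
  associativity M N P := RightYD.hom_ext (by
    change 𝟙 (M.X ⊗ N.X) ▷ P.X ≫ 𝟙 _ ≫ (α_ _ _ _).hom =
      (α_ _ _ _).hom ≫ M.X ◁ 𝟙 (N.X ⊗ P.X) ≫ 𝟙 _
    simp)
  left_unitality M := RightYD.hom_ext (by
    change (λ_ M.X).hom = 𝟙 (𝟙_ C) ▷ M.X ≫ 𝟙 _ ≫ (λ_ M.X).hom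
    simp)
  right_unitality M := RightYD.hom_ext (by
    change (ρ_ M.X).hom = M.X ◁ 𝟙 (𝟙_ C) ≫ 𝟙 _ ≫ (ρ_ M.X).hom
    simp)

theorem ract_tensor (M N : RMod C (double fin)) :
    (M ⊗ N).act = smashActR
      (tensorActR Δ[H] (M.X ◁ inclH fin ≫ M.act) (N.X ◁ inclH fin ≫ N.act))
      (dualActionR fin.dual (tensorCoactR μ[H] (coactionOfR H (M.X ◁ inclB fin ≫ M.act))
        (coactionOfR H (N.X ◁ inclB fin ≫ N.act)))) := by
  rw [← (inclH_doubleR fin M N).1, ← (inclH_doubleR fin M N).2, dualActionR_coactionOfR]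
  exact (isRightYD_of_rmod fin (M ⊗ N)).2.symm

/-- The braiding of right modules over the double: the braiding of the corresponding Yetter-Drinfeld
modules, which is linear over the double since it is linear and colinear over `H`. -/
def doubleBraidIsoR (M N : RMod C (double fin)) : M ⊗ N ≅ N ⊗ M :=
  RMod.isoMk (M := M ⊗ N) (N := N ⊗ M)
    (braidIsoR (isRightYD_of_rmod fin N).1 (isRightYD_of_rmod fin M).1.one
      (isRightYD_of_rmod fin M).1.mul) (by
    rw [ract_tensor, ract_tensor]
    exact smashActR_comp (braidMapR_linear (isRightYD_of_rmod fin N).1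
      (isRightYD_of_rmod fin M).1.mul)
      ((dualActionR_comp_iff _ _ _).2 (braidMapR_colinear (isRightYD_of_rmod fin M).1
        (isRightYD_of_rmod fin N).1.coassoc)))

instance : (RightYD.ofDoubleMod fin).Faithful where
  map_injective h := RMod.Hom.ext (congrArg (fun t => t.hom.hom) h)

/-- The braiding of the category of right modules over the double. -/
instance : BraidedCategory (RMod C (double fin)) :=
  letI := (RightYD.ofDoubleModCoreMonoidal fin).toMonoidal
  .ofFaithful (RightYD.ofDoubleMod fin) (doubleBraidIsoR fin) fun _ _ => RightYD.hom_ext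
    ((Category.id_comp _).trans (Category.comp_id _).symm)

instance : (RightYD.ofDoubleMod fin).Braided where
  __ := (RightYD.ofDoubleModCoreMonoidal fin).toMonoidal
  braided _ _ := RightYD.hom_ext
    ((Category.id_comp _).trans (Category.comp_id _).symm)

theorem doubleBraidIsoR_toDoubleMod (M N : RightYD H) :
    (doubleBraidIsoR fin ((RightYD.toDoubleMod fin).obj M)
      ((RightYD.toDoubleMod fin).obj N)).hom.hom = RightYD.braid M.toRMod N := by
  obtain ⟨⟨h₁, h₂⟩, ⟨h₃, h₄⟩, h₅⟩ := (isRightYD_iff (B := fin.dual) _ _).1 M.isRightYD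
  obtain ⟨⟨k₁, k₂⟩, ⟨k₃, k₄⟩, k₅⟩ := (isRightYD_iff (B := fin.dual) _ _).1 N.isRightYD
  rw [← dualOne_eq] at h₃ k₃
  change braidMapR (M.toRMod.X ◁ inclH fin ≫ M.doubleAct fin)
    (coactionOfR H (N.toRMod.X ◁ inclB fin ≫ N.doubleAct fin)) =
      braidMapR M.toRMod.act N.coact
  rw [M.doubleAct_eq, N.doubleAct_eq, inclB_smashActR k₁, inclH_smashActR h₃,
    coactionOfR_dualActionR]

instance : (RightYD.toDoubleMod fin).Braided where
  __ := (RightYD.toDoubleModCoreMonoidal fin).toMonoidal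
  braided M N := RMod.Hom.ext ((Category.id_comp _).trans
    ((doubleBraidIsoR_toDoubleMod fin M N).symm.trans (Category.comp_id _).symm))

/-- The inverse of the braiding is the action of the universal R-matrix `∑ (hⁱ ⊗ 1) ⊗ (ε ⊗ hᵢ)`,
followed by the inverse braiding of the base category. -/
theorem doubleBraidIsoR_inv (M N : RMod C (double fin)) :
    (doubleBraidIsoR fin M N).inv.hom = twistR fin N.act M.act := by
  refine (braidIsoR_inv (B := fin.dual) (isRightYD_of_rmod fin N).1
    (isRightYD_of_rmod fin M).1.one (isRightYD_of_rmod fin M).1.mul).trans ?_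
  have e : (η_ H fin.dual : 𝟙_ C ⟶ H ⊗ fin.dual) ≫ (β_ fin.dual H).inv = fin.coev' := rfl
  rw [dualActionR_coactionOfR, e, twistR, MonoidalCategory.whiskerLeft_comp, Category.assoc,
    tensorμ_natural_right_assoc, tensorHom_comp_tensorHom_assoc]

/-- Right-right Yetter-Drinfeld modules and right modules over the double form isomorphic braided
monoidal categories. -/
def RightYD.doubleModIso : BraidedIso (RightYD H) (RMod C (double fin)) where
  functor := RightYD.toDoubleMod fin
  inverse := RightYD.ofDoubleMod fin
  functor_inverse := RightYD.toDoubleMod_comp_ofDoubleMod fin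
  inverse_functor := RightYD.ofDoubleMod_comp_toDoubleMod fin
  braided := inferInstance
  braided_inverse := inferInstance

instance : (RightYD.ofDoubleMod fin).Full where
  map_surjective {M N} f := by
    refine ⟨⟨f.hom.hom, ?_⟩, rfl⟩
    rw [← (isRightYD_of_rmod fin M).2, ← (isRightYD_of_rmod fin N).2,
      ← dualActionR_coactionOfR (H := H) (M.X ◁ inclB fin ≫ M.act),
      ← dualActionR_coactionOfR (H := H) (N.X ◁ inclB fin ≫ N.act)]
    exact smashActR_comp f.hom.act_hom ((dualActionR_comp_iff _ _ _).2 f.coact_hom)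

theorem RightYD.ofDoubleMod_injective : Function.Injective (RightYD.ofDoubleMod fin).obj :=
  fun M N h => by
    have e (M) := CategoryTheory.Functor.congr_obj (RightYD.ofDoubleMod_comp_toDoubleMod fin) M
    exact (e M).symm.trans ((congrArg (RightYD.toDoubleMod fin).obj h).trans (e N))

/-- The embedding of the category of right modules over the double into the right center of the
category of right modules over `H`. -/
def doubleRModEmbedding : BraidedEmbedding (RMod C (double fin)) (RightCenter (RMod C H)) where
  functor := RightYD.ofDoubleMod fin ⋙ RightYD.toCenter
  braided := inferInstance
  full := inferInstance
  faithful := inferInstance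
  injective_obj := RightYD.toCenter_injective.comp (RightYD.ofDoubleMod_injective fin)

/-- The right-handed half of the theorem: the isomorphism and the embedding of braided monoidal
categories, with the formulas that describe them. -/
theorem exists_right_double_iso :
    ∃ (_ : BraidedCategory (RightYD H)) (_ : BraidedCategory (RMod C (double fin)))
      (F : BraidedIso (RightYD H) (RMod C (double fin)))
      (J : BraidedEmbedding (RMod C (double fin)) (RightCenter (RMod C H)))
      (h₁ : ∀ X : RightYD H, X.toRMod.X ◁ η[double fin] ≫ X.doubleAct fin = (ρ_ _).hom)
      (h₂ : ∀ X : RightYD H, X.toRMod.X ◁ μ[double fin] ≫ X.doubleAct fin =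
        (α_ _ _ _).inv ≫ X.doubleAct fin ▷ double fin ≫ X.doubleAct fin)
      (c : ∀ X : RightYD H, RightHalfBraiding X.toRMod),
      (∀ X Y : RightYD H, (β_ X Y).hom.hom.hom = RightYD.braid X.toRMod Y) ∧
      (∀ M N : RMod C (double fin), (β_ M N).inv.hom = twistR fin N.act M.act) ∧
      (∀ X, F.functor.obj X = ⟨X.toRMod.X, X.doubleAct fin, h₁ X, h₂ X⟩) ∧
      F.functor ⋙ RMod.comap (inclH fin) = RightYD.forgetToRMod H ∧
      (∀ X Y, ((c X).β Y).hom.hom = RightYD.braid Y X) ∧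
      (∀ X, J.functor.obj (F.functor.obj X) = ⟨X.toRMod, c X⟩) ∧
      J.functor ⋙ RightCenter.forget (RMod C H) = RMod.comap (inclH fin) := by
  refine ⟨inferInstance, inferInstance, RightYD.doubleModIso fin, doubleRModEmbedding fin,
    fun X => ((RightYD.toDoubleMod fin).obj X).act_one,
    fun X => ((RightYD.toDoubleMod fin).obj X).act_mul, fun X => X.halfBraiding,
    fun _ _ => rfl, doubleBraidIsoR_inv fin, fun _ => rfl, ?_, fun _ _ => rfl, fun X => ?_, rfl⟩
  · exact congrArg (· ⋙ RightYD.forgetToRMod H) (RightYD.toDoubleMod_comp_ofDoubleMod fin)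
  · exact congrArg RightYD.toCenter.obj
      (CategoryTheory.Functor.congr_obj (RightYD.toDoubleMod_comp_ofDoubleMod fin) X)

end RightDoubleModules

end BraidedHopf

theorem mainTheorem4 {C : Type u} [Category.{v} C] [MonoidalCategory C] [BraidedCategory C]
    (H : C) [HopfObj H] [IsIso (HopfObj.antipode (X := H))] (fin : FiniteObj H)
    (hH : H ∈ mugerCenter C) :
    ∃ D : BimonObj (double fin),
      D.mul = doubleMul fin ∧ D.one = doubleOne fin ∧
      D.comul = doubleComul fin ∧ D.counit = doubleCounit fin ∧
      ∃ _ : IsMonHom (inclH fin),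
        (∃ (_ : BraidedCategory (LeftYD H)) (_ : BraidedCategory (Mod C (double fin)))
          (F : BraidedIso (LeftYD H) (Mod C (double fin)))
          (J : BraidedEmbedding (Mod C (double fin)) (Center (Mod C H)))
          (h₁ : ∀ X : LeftYD H, η[double fin] ▷ X.toMod.X ≫ X.doubleAct fin = (λ_ _).hom)
          (h₂ : ∀ X : LeftYD H, μ[double fin] ▷ X.toMod.X ≫ X.doubleAct fin =
            (α_ _ _ _).hom ≫ double fin ◁ X.doubleAct fin ≫ X.doubleAct fin)
          (c : ∀ X : LeftYD H, HalfBraiding X.toMod),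
          (∀ X Y : LeftYD H, (β_ X Y).hom.hom.hom = X.braid Y.toMod) ∧
          (∀ M N : Mod C (double fin), (β_ M N).inv.hom = twistL fin (lact N) (lact M)) ∧
          (∀ X, F.functor.obj X = lmk X.toMod.X (X.doubleAct fin) (h₁ X) (h₂ X)) ∧
          F.functor ⋙ Mod.comap (inclH fin) = LeftYD.forgetToMod H ∧
          (∀ X Y, ((c X).β Y).hom.hom = X.braid Y) ∧
          (∀ X, J.functor.obj (F.functor.obj X) = ⟨X.toMod, c X⟩) ∧
          J.functor ⋙ Center.forget (Mod C H) = Mod.comap (inclH fin)) ∧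
        (∃ (_ : BraidedCategory (RightYD H)) (_ : BraidedCategory (RMod C (double fin)))
          (F : BraidedIso (RightYD H) (RMod C (double fin)))
          (J : BraidedEmbedding (RMod C (double fin)) (RightCenter (RMod C H)))
          (h₁ : ∀ X : RightYD H, X.toRMod.X ◁ η[double fin] ≫ X.doubleAct fin = (ρ_ _).hom)
          (h₂ : ∀ X : RightYD H, X.toRMod.X ◁ μ[double fin] ≫ X.doubleAct fin =
            (α_ _ _ _).inv ≫ X.doubleAct fin ▷ double fin ≫ X.doubleAct fin)
          (c : ∀ X : RightYD H, RightHalfBraiding X.toRMod),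
          (∀ X Y : RightYD H, (β_ X Y).hom.hom.hom = RightYD.braid X.toRMod Y) ∧
          (∀ M N : RMod C (double fin), (β_ M N).inv.hom = twistR fin N.act M.act) ∧
          (∀ X, F.functor.obj X = ⟨X.toRMod.X, X.doubleAct fin, h₁ X, h₂ X⟩) ∧
          F.functor ⋙ RMod.comap (inclH fin) = RightYD.forgetToRMod H ∧
          (∀ X Y, ((c X).β Y).hom.hom = RightYD.braid Y X) ∧
          (∀ X, J.functor.obj (F.functor.obj X) = ⟨X.toRMod, c X⟩) ∧
          J.functor ⋙ RightCenter.forget (RMod C H) = RMod.comap (inclH fin)) := by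
  have : Transparent H := ⟨hH⟩
  exact ⟨doubleBimonObj fin, rfl, rfl, rfl, rfl, inferInstance, exists_left_double_iso fin,
    exists_right_double_iso fin⟩
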